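/- **Setting.** Let $n\ge 2$ be an integer, $m=n-1$, $\gamma>1$, $\mu>0$, $\lambda+\frac2n\mu\ge0$, $\kappa>0$, $\beta=2\mu+\lambda$, $p(v,e)=(\gamma-1)e/v$, $\psi(\zeta)=\zeta-1-\log\zeta$, $G(\zeta)=1-\zeta+\zeta\log\zeta$, $\sigma(t)=\min\{1,t\}$; let $\psi_-^{-1}:[0,\infty)\to(0,1]$ be the left branch of the inverse of $\psi$. *Cauchy data.* Let $C_*>0$ and let $\rho_0,u_0,e_0$ be measurable on $[0,\infty)$ with $e_0\ge C_*^{-1}$, $C_*^{-1}\le\rho_0\le C_*$ and $$\int_0^\infty\Big(\rho_0\big(\tfrac12u_0^2+\psi(e_0)\big)+(\gamma-1)G(\rho_0)+|(\rho_0-1,u_0^2,e_0-1)|^2\Big)r^m\,dr\le C_* .$$ *Approximate data.* Let $a\in(0,1)$ and $k\in\{1,2,\dots\}$. Extend $\rho_0,e_0$ evenly and $u_0$ oddly to $\hat\rho_0,\hat e_0,\hat u_0$ on $\mathbb R$. Let $j\ge 0$ be a smooth mollifier with $\int j=1$ and support in $[-\frac a2,\frac a2]$. Let $\chi,\bar\chi:\mathbb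 R\to[0,1]$ be smooth with $\chi=0$ on $(-\infty,1]$, $\chi=1$ on $[2,\infty)$, and $\bar\chi=1$ on $(-\infty,0]$, $\bar\chi=0$ on $[1,\infty)$, $|\bar\chi'|\le2$. Put, with $\chi_a(r)=\chi(r/a)$, $$\rho_a^0=(\hat\rho_0*j-1)\chi_a+1,\qquad u_a^0=(\hat u_0*j)\chi_a,\qquad e_a^0=(\hat e_0*j-1)\chi_a+1 .$$ Define $R_a:[0,\infty)\to[a,\infty)$ by $\int_a^{R_a(x)}\rho_a^0(s)s^m\,ds=x$, and set $\varphi(r)=\bar\chi\big(\frac{2r-R_a(k)}{R_a(k)}\big)$. The Lagrangian initial data are the following functions, evaluated at $r=R_a(x)$: $$v^0=\big((\rho_a^0-1)\varphi+1\big)^{-1},\qquad u^0=u_a^0\varphi,\qquad e^0=(e_a^0-1)\varphi+1 .$$ *The $(a,k)$-approximate problem.* Let $T>0$. A classical solution on $[0,k]\times[0,T]$ is a triple $(v,u,e)$ with $v,e>0$ such that $v,D_xv,D_tv$ and $u,D_xu,D_x^2u,D_tu$ and $e,D_xe,D_x^2e,D_te$ are continuous on $[0,k]\times[0,T]$ and,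 with $r(x,t)=\big(a^n+n\int_0^xv(y,t)\,dy\big)^{1/n}$, $$D_tv=D_x(r^mu),\qquad D_tu+r^mD_xp(v,e)=\beta r^mD_x\Big(\frac{D_x(r^mu)}v\Big),$$ $$D_te+p(v,e)D_x(r^mu)=\beta\frac{|D_x(r^mu)|^2}v-2m\mu D_x(r^{m-1}u^2)+\kappa D_x\Big(\frac{r^{2m}D_xe}v\Big),$$ $u=D_xe=0$ at $x=0$ and $x=k$, and $(v,u,e)(\cdot,0)=(v^0,u^0,e^0)$ on $[0,k]$. **Theorem (a-priori estimates).** There are constants larger than $1$, namely $C_0$ depending only on $(\gamma,\mu,\lambda,\kappa,n,C_*)$ and $C(T)$, $C(a)=C(a,T)$, $C(\varepsilon)=C(\varepsilon,T)$ depending otherwise only on $(\gamma,\mu,\lambda,\kappa,n,C_*)$ (in particular, all of them are independent of $k$, and $C_0$, $C(T)$, $C(\varepsilon)$ are independent of $a$), such that for all Cauchy data, mollifiers and cut-off functions as above, all $a\in(0,1)$, $k\ge1$, $T>0$, every classical solution $(v,u,e)$ of the $(a,k)$-approximate problem on $[0,k]\times[0,T]$ satisfies the following. (i) Entropy estimate: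 $$\sup_{t\in[0,T]}\int_0^k\Big(\tfrac12u^2+\psi(e)+(\gamma-1)\psi(v)\Big)dx+\kappa\int_0^T\!\!\int_0^k\frac{r^{2m}|D_xe|^2}{ve^2}\,dx\,dt$$ $$+\int_0^T\!\!\int_0^k\Big\{\Big(\lambda+\frac{2\mu}n\Big)\frac{|D_x(r^mu)|^2}{ve}+2m\mu\frac ve\Big(\frac{D_x(r^mu)}{v\sqrt n}-\sqrt n\frac ur\Big)^2\Big\}dx\,dt\le C_0 .$$ (ii) For every $\varepsilon\ge0$ and all $(x,t)\in[\varepsilon,k]\times[0,T]$: $\underline v(\varepsilon,t,a)\le v(x,t)\le\overline v(\varepsilon,t,a)$, where $$\overline v=C_0(1+t)^2f\exp\big\{C_0tf+C_0(1+t)hf\exp\{C_0tf\}\big\},\qquad \underline v=C_0^{-1}(1+t)^{-1}f^{-1}\exp\{-C_0tf^2\}\,\Gamma$$ with $h(z,a)=\big(a^n+nz\,\psi_-^{-1}(C_0/z)\big)^{-2m/n}$ (so $h(0,a)=a^{-2m}$), $f(z,a)=\exp\{C_0h(z,a)\}$, $\Gamma(z,t,a)=\exp\{-\frac{mC_0t}\beta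 h(z,a)^{n/(2m)}\}$. Moreover $C(T)^{-1}\le v\le C(T)$ on $[1,k]\times[0,T]$; for every $\varepsilon>0$, $C(\varepsilon)^{-1}\le v\le C(\varepsilon)$ on $[\varepsilon,k]\times[0,T]$; and $C(a)^{-1}\le v\le C(a)$ on $[0,k]\times[0,T]$. (iii) For $y\in[0,1]$ let $$\mathcal L_y=\sup_{t\in[0,T]}\int_y^k\big|\big(v-1,u^2,e-1,\sqrt\sigma\,r^mD_xu,\sigma r^mD_xe\big)\big|^2dx+\int_0^T\!\!\int_y^k\big|\big(r^mD_xu,r^mD_xe,r^muD_xu,\sqrt\sigma D_tu,\sigma D_te\big)\big|^2dx\,dt .$$ Then $\mathcal L_0\le C(a)$ and, on $[0,k]\times[0,T]$, $$C(a)^{-1}\le v\le C(a),\qquad \sigma^{1/4}|u|\le C(a),\qquad e\ge C(a)^{-1},\qquad \sigma^{1/2}e\le C(a).$$ For every $\varepsilon\in(0,1]$, $\mathcal L_\varepsilon\le C(\varepsilon)$ and, on $[\varepsilon,k]\times[0,T]$, $$C(\varepsilon)^{-1}\le v\le C(\varepsilon),\qquad \sigma^{1/4}|u|+\sigma^{1/2}e\le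 C(\varepsilon).$$ -/

import Mathlib

open Set MeasureTheory
open scoped ENNReal ContDiff

noncomputable section

namespace SphNS

/-- Space dimension `n ≥ 2`, adiabatic exponent `γ > 1`, shear viscosity `μ`, second viscosity
`lam` (with nonnegative bulk viscosity) and heat conduction coefficient `κ`. -/
structure FluidParams where
  n : ℕ
  γ : ℝ
  μ : ℝ
  lam : ℝ
  κ : ℝ
  two_le_n : 2 ≤ n
  one_lt_γ : 1 < γ
  μ_pos : 0 < μ
  bulk_nonneg : 0 ≤ lam + 2 / (n : ℝ) * μ
  κ_pos : 0 < κ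

/-- `m = n - 1`. -/
def FluidParams.m (P : FluidParams) : ℕ := P.n - 1

/-- `β = 2μ + λ`. -/
def FluidParams.β (P : FluidParams) : ℝ := 2 * P.μ + P.lam

/-- `ψ(ζ) = ζ - 1 - log ζ` (used for `ζ > 0` only). -/
def psi (ζ : ℝ) : ℝ := ζ - 1 - Real.log ζ

/-- `G(ζ) = 1 - ζ + ζ log ζ` (used for `ζ > 0` only). -/
def entG (ζ : ℝ) : ℝ := 1 - ζ + ζ * Real.log ζ

/-- The left branch `[0,∞) → (0,1]` of the inverse of `ψ`: the point `s ∈ (0,1]` with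
`ψ(s) = y`. -/
def psiInvLeft (y : ℝ) : ℝ := Function.invFunOn psi (Ioc 0 1) y

/-- `σ(t) = min {1, t}`. -/
def sigma (t : ℝ) : ℝ := min 1 t

/-! ### The initial data -/

/-- Radial Cauchy data on `[0,∞)` with bound `Cstar`. -/
structure AdmissibleData (P : FluidParams) (Cstar : ℝ) (ρ₀ u₀ e₀ : ℝ → ℝ) : Prop where
  meas_ρ : AEMeasurable ρ₀ (volume.restrict (Ici 0))
  meas_u : AEMeasurable u₀ (volume.restrict (Ici 0))
  meas_e : AEMeasurable e₀ (volume.restrict (Ici 0))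
  e_lower : ∀ r, 0 ≤ r → Cstar⁻¹ ≤ e₀ r
  ρ_lower : ∀ r, 0 ≤ r → Cstar⁻¹ ≤ ρ₀ r
  ρ_upper : ∀ r, 0 ≤ r → ρ₀ r ≤ Cstar
  energy : ∫⁻ r in Ici (0 : ℝ), ENNReal.ofReal
      ((ρ₀ r * (1 / 2 * (u₀ r) ^ 2 + psi (e₀ r)) + (P.γ - 1) * entG (ρ₀ r)
        + ((ρ₀ r - 1) ^ 2 + ((u₀ r) ^ 2) ^ 2 + (e₀ r - 1) ^ 2)) * r ^ P.m)
      ≤ ENNReal.ofReal Cstar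

/-- A smooth nonnegative mollifier of mass one supported in `[-δ, δ]`. -/
structure IsMollifier (δ : ℝ) (j : ℝ → ℝ) : Prop where
  smooth : ContDiff ℝ ∞ j
  nonneg : ∀ ζ, 0 ≤ j ζ
  supp : tsupport j ⊆ Icc (-δ) δ
  mass : ∫ ζ, j ζ = 1

/-- The smooth cut-off used near the origin: `0` on `ζ ≤ 1`, `1` on `ζ ≥ 2`. -/
structure IsInnerCutoff (χ : ℝ → ℝ) : Prop where
  smooth : ContDiff ℝ ∞ χ
  range : ∀ ζ, χ ζ ∈ Icc (0 : ℝ) 1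
  eq_zero : ∀ ζ, ζ ≤ 1 → χ ζ = 0
  eq_one : ∀ ζ, 2 ≤ ζ → χ ζ = 1

/-- The smooth cut-off used in the far field: `1` on `ζ ≤ 0`, `0` on `ζ ≥ 1`, slope at
most `2`. -/
structure IsOuterCutoff (χ : ℝ → ℝ) : Prop where
  smooth : ContDiff ℝ ∞ χ
  range : ∀ ζ, χ ζ ∈ Icc (0 : ℝ) 1
  eq_one : ∀ ζ, ζ ≤ 0 → χ ζ = 1
  eq_zero : ∀ ζ, 1 ≤ ζ → χ ζ = 0
  slope : ∀ ζ, |deriv χ ζ| ≤ 2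

/-- Even extension of a function on `[0,∞)`. -/
def evenExt (f : ℝ → ℝ) (ζ : ℝ) : ℝ := if 0 ≤ ζ then f ζ else f (-ζ)

/-- Odd extension of a function on `[0,∞)`. -/
def oddExt (f : ℝ → ℝ) (ζ : ℝ) : ℝ := if 0 ≤ ζ then f ζ else -f (-ζ)

/-- The convolution `f ∗ j`. -/
def mollify (j f : ℝ → ℝ) (r : ℝ) : ℝ := ∫ ζ, f (r - ζ) * j ζ

/-- `ρ_a^0` (and, with `e₀` in place of `ρ₀`, also `e_a^0`):
`((f̂ ∗ j) - 1) χ(r/a) + 1`. -/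
def extData (a : ℝ) (j χ f : ℝ → ℝ) (r : ℝ) : ℝ :=
  (mollify j (evenExt f) r - 1) * χ (r / a) + 1

/-- `u_a^0 = (û ∗ j) χ(r/a)`. -/
def extVel (a : ℝ) (j χ u₀ : ℝ → ℝ) (r : ℝ) : ℝ :=
  mollify j (oddExt u₀) r * χ (r / a)

/-- The initial particle path `x ↦ R(x)`: the point `R ∈ [a,∞)` with
`∫_a^R ρ(s) s^m ds = x`. -/
def initPath (m : ℕ) (a : ℝ) (ρ : ℝ → ℝ) (x : ℝ) : ℝ :=
  Function.invFunOn (fun r => ∫ s in a..r, ρ s * s ^ m) (Ici a) x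

/-- The far-field cut-off `χ((2r - R)/R)`. -/
def farCutoff (χ : ℝ → ℝ) (R r : ℝ) : ℝ := χ ((2 * r - R) / R)

/-- All the ingredients of the approximate initial data: the Cauchy data, the mollifier and
the two cut-off functions. -/
structure DataTuple where
  ρ₀ : ℝ → ℝ
  u₀ : ℝ → ℝ
  e₀ : ℝ → ℝ
  j : ℝ → ℝ
  χin : ℝ → ℝ
  χout : ℝ → ℝ

/-- Admissibility of the ingredients for the inner radius `a`. -/
structure DataTuple.Admissible (D : DataTuple) (P : FluidParams) (Cstar a : ℝ) : Prop where
  cauchy : AdmissibleData P Cstar D.ρ₀ D.u₀ D.e₀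
  mollifier : IsMollifier (a / 2) D.j
  inner : IsInnerCutoff D.χin
  outer : IsOuterCutoff D.χout

/-- `r̃_a^0`. -/
def DataTuple.path (D : DataTuple) (P : FluidParams) (a : ℝ) : ℝ → ℝ :=
  initPath P.m a (extData a D.j D.χin D.ρ₀)

/-- `φ_{a,k}^0`. -/
def DataTuple.phi (D : DataTuple) (P : FluidParams) (a : ℝ) (k : ℕ) (r : ℝ) : ℝ :=
  farCutoff D.χout (D.path P a k) r

/-- Initial specific volume in Lagrangian coordinates, `1 / ρ_{a,k}^0(r̃_a^0(x))`. -/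
def DataTuple.vInit (D : DataTuple) (P : FluidParams) (a : ℝ) (k : ℕ) (x : ℝ) : ℝ :=
  ((extData a D.j D.χin D.ρ₀ (D.path P a x) - 1) * D.phi P a k (D.path P a x) + 1)⁻¹

/-- Initial velocity in Lagrangian coordinates. -/
def DataTuple.uInit (D : DataTuple) (P : FluidParams) (a : ℝ) (k : ℕ) (x : ℝ) : ℝ :=
  extVel a D.j D.χin D.u₀ (D.path P a x) * D.phi P a k (D.path P a x)

/-- Initial internal energy in Lagrangian coordinates. -/
def DataTuple.eInit (D : DataTuple) (P : FluidParams) (a : ℝ) (k : ℕ) (x : ℝ) : ℝ :=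
  (extData a D.j D.χin D.e₀ (D.path P a x) - 1) * D.phi P a k (D.path P a x) + 1

/-! ### The Lagrangian initial-boundary value problem -/

/-- Space derivative on `[0,L]` (one-sided at the end points). -/
def Dx (L : ℝ) (f : ℝ → ℝ → ℝ) (x t : ℝ) : ℝ := derivWithin (fun y => f y t) (Icc 0 L) x

/-- Time derivative on `[0,T]` (one-sided at the end points). -/
def Dt (T : ℝ) (f : ℝ → ℝ → ℝ) (x t : ℝ) : ℝ := derivWithin (fun s => f x s) (Icc 0 T) t

/-- `f`, `Dx f`, `Dt f` exist and are continuous on `[0,L] × [0,T]`. -/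
structure IsC11 (L T : ℝ) (f : ℝ → ℝ → ℝ) : Prop where
  cont : ContinuousOn (fun q : ℝ × ℝ => f q.1 q.2) (Icc 0 L ×ˢ Icc 0 T)
  diff_x : ∀ t ∈ Icc (0 : ℝ) T, DifferentiableOn ℝ (fun y => f y t) (Icc 0 L)
  diff_t : ∀ x ∈ Icc (0 : ℝ) L, DifferentiableOn ℝ (fun s => f x s) (Icc 0 T)
  cont_x : ContinuousOn (fun q : ℝ × ℝ => Dx L f q.1 q.2) (Icc 0 L ×ˢ Icc 0 T)
  cont_t : ContinuousOn (fun q : ℝ × ℝ => Dt T f q.1 q.2) (Icc 0 L ×ˢ Icc 0 T)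

/-- `f`, `Dx f`, `Dx (Dx f)`, `Dt f` exist and are continuous on `[0,L] × [0,T]`. -/
structure IsC21 (L T : ℝ) (f : ℝ → ℝ → ℝ) : Prop extends IsC11 L T f where
  diff_xx : ∀ t ∈ Icc (0 : ℝ) T, DifferentiableOn ℝ (fun y => Dx L f y t) (Icc 0 L)
  cont_xx : ContinuousOn (fun q : ℝ × ℝ => Dx L (Dx L f) q.1 q.2) (Icc 0 L ×ˢ Icc 0 T)

/-- `r(x,t) = (a^n + n ∫_0^x v(y,t) dy)^{1/n}`. -/
def radius (P : FluidParams) (a : ℝ) (v : ℝ → ℝ → ℝ) (x t : ℝ) : ℝ :=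
  (a ^ P.n + P.n * ∫ y in (0 : ℝ)..x, v y t) ^ (1 / (P.n : ℝ))

/-- `r^m u`. -/
def flux (P : FluidParams) (a : ℝ) (v u : ℝ → ℝ → ℝ) (x t : ℝ) : ℝ :=
  radius P a v x t ^ P.m * u x t

/-- The pressure `p(v,e) = (γ-1) e / v` along `(v,e)`. -/
def pressure (P : FluidParams) (v e : ℝ → ℝ → ℝ) (x t : ℝ) : ℝ :=
  (P.γ - 1) * e x t / v x t

/-- The right-hand side of the energy equation,
`β |Dx(r^m u)|²/v - 2mμ Dx(r^{m-1}u²) + κ Dx(r^{2m} Dx e / v)`. -/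
def heatSource (P : FluidParams) (a L : ℝ) (v u e : ℝ → ℝ → ℝ) (x t : ℝ) : ℝ :=
  P.β * (Dx L (flux P a v u) x t) ^ 2 / v x t
    - 2 * P.m * P.μ * Dx L (fun y s => radius P a v y s ^ (P.m - 1) * (u y s) ^ 2) x t
    + P.κ * Dx L (fun y s => radius P a v y s ^ (2 * P.m) * Dx L e y s / v y s) x t

/-- Classical solutions on `[0,L] × [0,T]` of the Lagrangian problem with inner radius `a` and
initial data `(v₀,u₀,e₀)`. -/
structure IsClassicalSolution (P : FluidParams) (a L T : ℝ) (v₀ u₀ e₀ : ℝ → ℝ)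
    (v u e : ℝ → ℝ → ℝ) : Prop where
  reg_v : IsC11 L T v
  reg_u : IsC21 L T u
  reg_e : IsC21 L T e
  v_pos : ∀ x ∈ Icc (0 : ℝ) L, ∀ t ∈ Icc (0 : ℝ) T, 0 < v x t
  e_pos : ∀ x ∈ Icc (0 : ℝ) L, ∀ t ∈ Icc (0 : ℝ) T, 0 < e x t
  mass : ∀ x ∈ Icc (0 : ℝ) L, ∀ t ∈ Icc (0 : ℝ) T,
    Dt T v x t - Dx L (flux P a v u) x t = 0
  momentum : ∀ x ∈ Icc (0 : ℝ) L, ∀ t ∈ Icc (0 : ℝ) T,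
    Dt T u x t + radius P a v x t ^ P.m * Dx L (pressure P v e) x t
      = P.β * radius P a v x t ^ P.m
          * Dx L (fun y s => Dx L (flux P a v u) y s / v y s) x t
  energy : ∀ x ∈ Icc (0 : ℝ) L, ∀ t ∈ Icc (0 : ℝ) T,
    Dt T e x t + pressure P v e x t * Dx L (flux P a v u) x t = heatSource P a L v u e x t
  bdry_u : ∀ t ∈ Icc (0 : ℝ) T, u 0 t = 0 ∧ u L t = 0
  bdry_e : ∀ t ∈ Icc (0 : ℝ) T, Dx L e 0 t = 0 ∧ Dx L e L t = 0
  init : ∀ x ∈ Icc (0 : ℝ) L, v x 0 = v₀ x ∧ u x 0 = u₀ x ∧ e x 0 = e₀ x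

/-! ### The quantities that are estimated -/

/-- The left-hand side of the entropy estimate (all integrands are nonnegative). -/
def entropyFunctional (P : FluidParams) (a L T : ℝ) (v u e : ℝ → ℝ → ℝ) : ℝ≥0∞ :=
  (⨆ t ∈ Icc (0 : ℝ) T, ∫⁻ x in Icc 0 L, ENNReal.ofReal
      (1 / 2 * (u x t) ^ 2 + psi (e x t) + (P.γ - 1) * psi (v x t)))
  + ENNReal.ofReal P.κ * (∫⁻ t in Icc 0 T, ∫⁻ x in Icc 0 L, ENNReal.ofReal
      (radius P a v x t ^ (2 * P.m) * (Dx L e x t) ^ 2 / (v x t * (e x t) ^ 2)))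
  + ∫⁻ t in Icc 0 T, ∫⁻ x in Icc 0 L, ENNReal.ofReal
      ((P.lam + 2 * P.μ / P.n) * ((Dx L (flux P a v u) x t) ^ 2 / (v x t * e x t))
        + 2 * P.m * P.μ * (v x t / e x t)
          * (Dx L (flux P a v u) x t / (v x t * √(P.n : ℝ))
              - √(P.n : ℝ) * (u x t / radius P a v x t)) ^ 2)

/-- The functional `𝓛_y[v,u,e](T)` on `[y,L] × [0,T]`. -/
def regFunctional (P : FluidParams) (a L T y : ℝ) (v u e : ℝ → ℝ → ℝ) : ℝ≥0∞ :=
  (⨆ t ∈ Icc (0 : ℝ) T, ∫⁻ x in Icc y L, ENNReal.ofReal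
      ((v x t - 1) ^ 2 + ((u x t) ^ 2) ^ 2 + (e x t - 1) ^ 2
        + (√(sigma t) * radius P a v x t ^ P.m * Dx L u x t) ^ 2
        + (sigma t * radius P a v x t ^ P.m * Dx L e x t) ^ 2))
  + ∫⁻ t in Icc 0 T, ∫⁻ x in Icc y L, ENNReal.ofReal
      ((radius P a v x t ^ P.m * Dx L u x t) ^ 2
        + (radius P a v x t ^ P.m * Dx L e x t) ^ 2
        + (radius P a v x t ^ P.m * u x t * Dx L u x t) ^ 2
        + (√(sigma t) * Dt T u x t) ^ 2
        + (sigma t * Dt T e x t) ^ 2)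

/-- `h(z,a) = (a^n + n z ψ_-^{-1}(C₀/z))^{-2m/n}`; at `z = 0` it is `a^{-2m}`. -/
def hFun (P : FluidParams) (C₀ z a : ℝ) : ℝ :=
  (a ^ P.n + P.n * z * psiInvLeft (C₀ / z)) ^ (-(2 * (P.m : ℝ)) / (P.n : ℝ))

/-- `f(z,a) = exp(C₀ h(z,a))`. -/
def fFun (P : FluidParams) (C₀ z a : ℝ) : ℝ := Real.exp (C₀ * hFun P C₀ z a)

/-- `Γ(z,t,a) = exp(-(m C₀ t / β) h(z,a)^{n/(2m)})`. -/
def GammaFun (P : FluidParams) (C₀ z t a : ℝ) : ℝ :=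
  Real.exp (-(P.m * C₀ * t / P.β) * hFun P C₀ z a ^ ((P.n : ℝ) / (2 * (P.m : ℝ))))

/-- The explicit upper bound for the specific volume. -/
def vUpper (P : FluidParams) (C₀ z t a : ℝ) : ℝ :=
  C₀ * (1 + t) ^ 2 * fFun P C₀ z a
    * Real.exp (C₀ * t * fFun P C₀ z a
        + C₀ * (1 + t) * hFun P C₀ z a * fFun P C₀ z a * Real.exp (C₀ * t * fFun P C₀ z a))

/-- The explicit lower bound for the specific volume. -/
def vLower (P : FluidParams) (C₀ z t a : ℝ) : ℝ :=
  C₀⁻¹ * (1 + t)⁻¹ * (fFun P C₀ z a)⁻¹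
    * Real.exp (-(t * C₀ * fFun P C₀ z a ^ 2)) * GammaFun P C₀ z t a

end SphNS

end

/-!
Why the theorem is true. On its rectangle a classical solution is a `Flow`
(`IsClassicalSolution.exists_flow`): the momentum and the energy equation say that the effective
viscous flux `F = β Dₓ(rᵐ u)/v - (p - (γ - 1))` and the heat flux `H = κ r²ᵐ Dₓe/v` have the space
derivatives `Dₜu/rᵐ` and `Dₜe + p Dₓ(rᵐ u) - Q`, where `Q` is the viscous dissipation. Every
estimate is an identity for these two fluxes followed by Gronwall's inequality
(`gronwall_dissipation`), so no derivative is needed that a classical solution does not have.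

*Entropy.* The entropy production is the loss of entropy (`entropy_balance`). The initial entropy
is bounded independently of `a` and `k` (`exists_basic`): away from the ball of radius `a`
mollification does not increase weighted moments by more than a constant
(`IsMollifier.lintegral_mollify_le`, a consequence of Jensen's inequality), and `x = ∫ ρ sᵐ ds`
converts them into integrals over `x` (`lintegral_initPath_le`).

*Specific volume.* Integrating `Dₜ log v` gives `v = X (1 + ((γ - 1)/β) ∫ e/X ds)` (`v_eq`). On an
interval of length `1/2` the momentum equation, integrated in space and time, shows that `X` is up
to bounded factors the product of a function of time and the initial specific volume
(`viscLog_sub_le`). The function of time is controlled by the averages of `v`, which the entropy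
bounds from above and below, and of `e`, which it bounds from above; the supremum of `e` is
controlled by the heat production (`exists_v_bounds_segment`). The constants involve only lower
bounds for `r`; Jensen's inequality for `ψ` yields these in the form of the function `h`
(`Basic.hBase_le`).

*Energy estimates.* On `[y,L]`, with `v` bounded above and below and `r` bounded below
(`Bounded`), the equations are tested successively with `u`, `u³` and the total energy, with a
cut-off in `x` that vanishes near `y` (`exists_velocity_energy_le`, `exists_total_energy_le`).
Then `t ∫ v F²` is estimated, with dissipation `t (Dₜu)²` (`exists_secondOrder`), and `t² ∫ H
Dₓe`, with dissipation `t² (Dₜe)²` (`exists_thirdOrder`); the weights in time remove the need for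
regular initial data. Three nested cut-offs lead to constants that do not see `a`
(`exists_regular_of_pos`). For fixed `a` the boundary conditions make the cut-off superfluous, and
`y = 0` is allowed (`exists_regular_zero`).

*Temperature from below.* A minimum principle bounds `e` from below as long as the supremum of the
compression rate `Dₓ(rᵐ u)/v` is integrable in time (`le_e_of_work_le`). This holds because `|F|`
is bounded by `t^(-1/2)` plus the densities of the energy estimates (`exists_abs_F_le`).
-/

namespace SphNS

/-! ### Tools from real analysis -/

theorem continuous_intervalIntegral_param {f : ℝ → ℝ → ℝ}
    (hf : Continuous fun q : ℝ × ℝ => f q.1 q.2) (y L : ℝ) :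
    Continuous fun t => ∫ x in y..L, f x t := by
  refine intervalIntegral.continuous_parametric_intervalIntegral_of_continuous'
    (f := fun t x => f x t) ?_ y L
  exact hf.comp continuous_swap

theorem integral_mono_of_continuous {f g : ℝ → ℝ} {a b : ℝ} (hab : a ≤ b) (hf : Continuous f)
    (hg : Continuous g) (h : ∀ x ∈ Icc a b, f x ≤ g x) :
    ∫ x in a..b, f x ≤ ∫ x in a..b, g x :=
  intervalIntegral.integral_mono_on hab (hf.intervalIntegrable _ _) (hg.intervalIntegrable _ _) h

theorem integral_le_integral_of_subinterval {f : ℝ → ℝ} {a b c d : ℝ} (hca : c ≤ a) (hab : a ≤ b)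
    (hbd : b ≤ d) (hf : Continuous f) (h : ∀ x ∈ Icc c d, 0 ≤ f x) :
    ∫ x in a..b, f x ≤ ∫ x in c..d, f x := by
  refine intervalIntegral.integral_mono_interval hca hab hbd ?_ (hf.intervalIntegrable _ _)
  refine (ae_restrict_iff' measurableSet_Ioc).2 (Filter.Eventually.of_forall fun x hx => ?_)
  exact h x ⟨hx.1.le, hx.2⟩

theorem integral_add_of_continuous {f g : ℝ → ℝ} {a b : ℝ} (hf : Continuous f)
    (hg : Continuous g) :
    ∫ x in a..b, (f x + g x) = (∫ x in a..b, f x) + ∫ x in a..b, g x :=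
  intervalIntegral.integral_add (hf.intervalIntegrable _ _) (hg.intervalIntegrable _ _)

theorem integral_nonneg_of_continuous {f : ℝ → ℝ} {a b : ℝ} (hab : a ≤ b)
    (h : ∀ x ∈ Icc a b, 0 ≤ f x) : 0 ≤ ∫ x in a..b, f x :=
  intervalIntegral.integral_nonneg hab h

theorem hasDerivAt_primitive {g : ℝ → ℝ} (hg : Continuous g) (a t : ℝ) :
    HasDerivAt (fun s => ∫ x in a..s, g x) (g t) t :=
  intervalIntegral.integral_hasDerivAt_right (hg.intervalIntegrable _ _)
    (hg.stronglyMeasurableAtFilter _ _) hg.continuousAt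

/-- A function of class `C¹` on an open interval that vanishes at both ends, or more generally has
equal end values, has a derivative of integral zero. -/
theorem integral_deriv_eq_zero {S S' : ℝ → ℝ} {y L : ℝ} (hyL : y ≤ L) (hS : Continuous S)
    (hS' : Continuous S') (hd : ∀ x ∈ Ioo y L, HasDerivAt S (S' x) x) (h : S y = S L) :
    ∫ x in y..L, S' x = 0 := by
  rw [intervalIntegral.integral_eq_sub_of_hasDerivAt_of_le hyL hS.continuousOn hd
    (hS'.intervalIntegrable _ _), h, sub_self]

/-- Gronwall's inequality with a variable rate `g`, a source `b` and a dissipation `D`. -/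
theorem gronwall_dissipation {T : ℝ} {J J' D g b : ℝ → ℝ}
    (hJ : ContinuousOn J (Icc 0 T)) (hJ' : ∀ t ∈ Ioo 0 T, HasDerivAt J (J' t) t)
    (hD : Continuous D) (hg : Continuous g) (hb : Continuous b)
    (D0 : ∀ t ∈ Icc 0 T, 0 ≤ D t) (g0 : ∀ t ∈ Icc 0 T, 0 ≤ g t) (b0 : ∀ t ∈ Icc 0 T, 0 ≤ b t)
    (h : ∀ t ∈ Ioo 0 T, J' t ≤ -D t + g t * J t + b t) :
    ∀ t ∈ Icc 0 T, J t + ∫ s in (0 : ℝ)..t, D s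
      ≤ (J 0 + ∫ s in (0 : ℝ)..T, b s) * Real.exp (∫ s in (0 : ℝ)..t, g s) := by
  intro t ht
  have hT : 0 ≤ T := ht.1.trans ht.2
  set B := ∫ s in (0 : ℝ)..T, b s with hB
  let Y : ℝ → ℝ := fun t => J t + (∫ s in (0 : ℝ)..t, D s) - (∫ s in (0 : ℝ)..t, b s) + B
  let E : ℝ → ℝ := fun t => Real.exp (-∫ s in (0 : ℝ)..t, g s)
  have hYd : ∀ s ∈ Ioo 0 T, HasDerivAt Y (J' s + D s - b s) s := fun s hs =>
    (((hJ' s hs).add (hasDerivAt_primitive hD 0 s)).sub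
      (hasDerivAt_primitive hb 0 s)).add_const B
  have hEd : ∀ s, HasDerivAt E (E s * (-g s)) s := fun s =>
    ((hasDerivAt_primitive hg 0 s).neg).exp
  have hprim : ∀ {f : ℝ → ℝ}, Continuous f → Continuous fun t => ∫ s in (0 : ℝ)..t, f s :=
    fun hf => continuous_iff_continuousAt.2 fun s => (hasDerivAt_primitive hf 0 s).continuousAt
  have hYc : ContinuousOn Y (Icc 0 T) :=
    ((hJ.add (hprim hD).continuousOn).sub (hprim hb).continuousOn).add continuousOn_const
  have hEc : Continuous E := continuous_iff_continuousAt.2 fun s => (hEd s).continuousAt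
  have hanti : AntitoneOn (fun s => Y s * E s) (Icc 0 T) := by
    refine antitoneOn_of_deriv_nonpos (convex_Icc 0 T) (hYc.mul hEc.continuousOn) ?_ ?_
    · intro s hs
      rw [interior_Icc] at hs
      exact ((hYd s hs).mul (hEd s)).differentiableAt.differentiableWithinAt
    · intro s hs
      rw [interior_Icc] at hs
      have hs' : s ∈ Icc 0 T := ⟨hs.1.le, hs.2.le⟩
      rw [show deriv (fun s => Y s * E s) s = _ from ((hYd s hs).mul (hEd s)).deriv]
      have hE0 : 0 < E s := Real.exp_pos _
      have h1 : 0 ≤ ∫ r in (0 : ℝ)..s, D r :=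
        integral_nonneg_of_continuous hs'.1 fun r hr => D0 r ⟨hr.1, hr.2.trans hs'.2⟩
      have h2 : ∫ r in (0 : ℝ)..s, b r ≤ B :=
        integral_le_integral_of_subinterval le_rfl hs'.1 hs'.2 hb b0
      have h3 := h s hs
      have h4 : g s * J s ≤ g s * Y s := by
        refine mul_le_mul_of_nonneg_left ?_ (g0 s hs')
        simp only [Y]; linarith
      nlinarith [mul_nonneg hE0.le (by linarith : 0 ≤ g s * Y s - (J' s + D s - b s))]
  have h0 := hanti ⟨le_rfl, hT⟩ ht ht.1
  simp only [Y, E, intervalIntegral.integral_same, neg_zero, Real.exp_zero, mul_one, add_zero,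
    sub_zero] at h0
  have h2 : ∫ r in (0 : ℝ)..t, b r ≤ B :=
    integral_le_integral_of_subinterval le_rfl ht.1 ht.2 hb b0
  rw [Real.exp_neg, ← div_eq_mul_inv, div_le_iff₀ (Real.exp_pos _)] at h0
  linarith

theorem gronwall_integral {T A : ℝ} {φ g : ℝ → ℝ} (hφ : Continuous φ) (hg : Continuous g)
    (g0 : ∀ t ∈ Icc 0 T, 0 ≤ g t)
    (h : ∀ t ∈ Icc 0 T, φ t ≤ A + ∫ s in (0 : ℝ)..t, g s * φ s) :
    ∀ t ∈ Icc 0 T, φ t ≤ A * Real.exp (∫ s in (0 : ℝ)..t, g s) := by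
  intro t ht
  have hgφ : Continuous fun s => g s * φ s := hg.mul hφ
  have hd : ∀ s, HasDerivAt (fun t => A + ∫ s in (0 : ℝ)..t, g s * φ s) (g s * φ s) s := fun s =>
    (hasDerivAt_primitive hgφ 0 s).const_add A
  have := gronwall_dissipation (T := T) (D := fun _ => 0) (b := fun _ => 0) (g := g)
    (fun s _ => (hd s).continuousAt.continuousWithinAt) (fun s _ => hd s)
    continuous_const hg continuous_const (fun _ _ => le_rfl) g0 (fun _ _ => le_rfl)
    (fun s hs => by
      have hs' : s ∈ Icc 0 T := ⟨hs.1.le, hs.2.le⟩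
      have := mul_le_mul_of_nonneg_left (h s hs') (g0 s hs')
      linarith) t ht
  simp only [intervalIntegral.integral_same, add_zero, intervalIntegral.integral_zero] at this
  exact (h t ht).trans this

theorem sq_integral_mul_le {f g : ℝ → ℝ} {a b : ℝ} (hab : a ≤ b) (hf : Continuous f)
    (hg : Continuous g) :
    (∫ x in a..b, f x * g x) ^ 2 ≤ (∫ x in a..b, f x ^ 2) * ∫ x in a..b, g x ^ 2 := by
  have key : ∀ c : ℝ, 0 ≤ (∫ x in a..b, g x ^ 2) * (c * c)
      + (2 * ∫ x in a..b, f x * g x) * c + ∫ x in a..b, f x ^ 2 := by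
    intro c
    have h0 : 0 ≤ ∫ x in a..b, (f x + c * g x) ^ 2 :=
      integral_nonneg_of_continuous hab fun x _ => sq_nonneg _
    have h1 : ∫ x in a..b, (f x + c * g x) ^ 2
        = (∫ x in a..b, f x ^ 2) + (∫ x in a..b, 2 * c * (f x * g x))
          + ∫ x in a..b, c ^ 2 * g x ^ 2 := by
      rw [← intervalIntegral.integral_add, ← intervalIntegral.integral_add]
      · congr 1; ext x; ring
      all_goals exact Continuous.intervalIntegrable (by fun_prop) _ _
    rw [h1, intervalIntegral.integral_const_mul, intervalIntegral.integral_const_mul] at h0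
    linarith
  have := discrim_le_zero key
  rw [discrim] at this
  nlinarith

theorem sq_integral_le {f : ℝ → ℝ} {a b : ℝ} (hab : a ≤ b) (hf : Continuous f) :
    (∫ x in a..b, f x) ^ 2 ≤ (b - a) * ∫ x in a..b, f x ^ 2 := by
  have := sq_integral_mul_le hab (f := fun _ => (1 : ℝ)) continuous_const hf
  simpa using this

/-- Every point of an interval of length at least `1/2` lies in a subinterval of length `1/2`. -/
theorem exists_half_interval {y L x : ℝ} (hyL : y + 1 / 2 ≤ L) (hx : x ∈ Icc y L) :
    ∃ c, y ≤ c ∧ c + 1 / 2 ≤ L ∧ x ∈ Icc c (c + 1 / 2) := by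
  rcases le_total x (L - 1 / 2) with h | h
  · exact ⟨x, hx.1, by linarith, le_rfl, by linarith⟩
  · exact ⟨L - 1 / 2, by linarith, by linarith, h, by linarith [hx.2]⟩

/-- On an interval of length `1/2` a function is bounded by its average and the integral of its
derivative. -/
theorem abs_le_integral_add_integral_deriv {f f' : ℝ → ℝ} {c : ℝ} (hf : Continuous f)
    (hf' : Continuous f') (hd : ∀ x ∈ Ioo c (c + 1 / 2), HasDerivAt f (f' x) x) {x : ℝ}
    (hx : x ∈ Icc c (c + 1 / 2)) :
    |f x| ≤ 2 * (∫ z in c..c + 1 / 2, |f z|) + ∫ z in c..c + 1 / 2, |f' z| := by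
  set I := ∫ z in c..c + 1 / 2, |f' z| with hI
  have h1 : ∀ z ∈ Icc c (c + 1 / 2), |f x| ≤ |f z| + I := by
    have aux : ∀ p ∈ Icc c (c + 1 / 2), ∀ q ∈ Icc c (c + 1 / 2), p ≤ q → |f q - f p| ≤ I := by
      intro p hp q hq hpq
      rw [← intervalIntegral.integral_eq_sub_of_hasDerivAt_of_le hpq hf.continuousOn
        (fun z hz => hd z ⟨hp.1.trans_lt hz.1, hz.2.trans_le hq.2⟩) (hf'.intervalIntegrable _ _)]
      refine (intervalIntegral.abs_integral_le_integral_abs hpq).trans ?_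
      exact integral_le_integral_of_subinterval hp.1 hpq hq.2 hf'.abs fun _ _ => abs_nonneg _
    intro z hz
    rcases le_total x z with h | h
    · have := aux x hx z hz h
      rw [abs_sub_comm] at this
      linarith [abs_sub_abs_le_abs_sub (f x) (f z)]
    · have := aux z hz x hx h
      linarith [abs_sub_abs_le_abs_sub (f x) (f z)]
  have h2 := integral_mono_of_continuous (by linarith : c ≤ c + 1 / 2)
    (continuous_const (y := |f x|)) (g := fun z => |f z| + I) (by fun_prop) h1
  rw [integral_add_of_continuous hf.abs continuous_const] at h2
  simp only [intervalIntegral.integral_const, smul_eq_mul] at h2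
  linarith

/-- The one-dimensional Sobolev inequality, with a constant that does not depend on the interval
as long as its length is at least `1/2`. -/
theorem sq_le_integral_sq_add_sq_deriv {f f' : ℝ → ℝ} {y L : ℝ} (hyL : y + 1 / 2 ≤ L)
    (hf : Continuous f) (hf' : Continuous f') (hd : ∀ x ∈ Ioo y L, HasDerivAt f (f' x) x) {x : ℝ}
    (hx : x ∈ Icc y L) :
    f x ^ 2 ≤ 4 * ∫ z in y..L, (f z ^ 2 + f' z ^ 2) := by
  obtain ⟨c, hyc, hcL, hxc⟩ := exists_half_interval hyL hx
  have h1 := abs_le_integral_add_integral_deriv hf hf'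
    (fun z hz => hd z ⟨hyc.trans_lt hz.1, hz.2.trans_le hcL⟩) hxc
  have hc : c ≤ c + 1 / 2 := by linarith
  have h2 := sq_integral_le hc hf.abs
  have h3 := sq_integral_le hc hf'.abs
  simp only [sq_abs] at h2 h3
  have h4 : (∫ z in c..c + 1 / 2, f z ^ 2) + (∫ z in c..c + 1 / 2, f' z ^ 2)
      ≤ ∫ z in y..L, (f z ^ 2 + f' z ^ 2) := by
    rw [← integral_add_of_continuous (by fun_prop) (by fun_prop)]
    exact integral_le_integral_of_subinterval hyc hc hcL (by fun_prop) fun z _ => by positivity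
  have h5 : 0 ≤ ∫ z in c..c + 1 / 2, f' z ^ 2 :=
    integral_nonneg_of_continuous hc fun z _ => sq_nonneg _
  have h6 : f x ^ 2 ≤ (2 * (∫ z in c..c + 1 / 2, |f z|) + ∫ z in c..c + 1 / 2, |f' z|) ^ 2 := by
    rw [← sq_abs (f x)]
    exact pow_le_pow_left₀ (abs_nonneg _) h1 2
  nlinarith [sq_nonneg (2 * (∫ z in c..c + 1 / 2, |f z|) - ∫ z in c..c + 1 / 2, |f' z|)]

/-- The difference quotient of a function with continuous derivative `bt`, written as an average of
the derivative. It is jointly continuous, so that parametric integrals can be differentiated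
without a domination argument. -/
theorem integral_deriv_segment {b bt : ℝ → ℝ} {T t t₀ : ℝ} (hbt : Continuous bt)
    (hd : ∀ s ∈ Ioo 0 T, HasDerivAt b (bt s) s) (ht : t ∈ Ioo 0 T) (ht₀ : t₀ ∈ Ioo 0 T) :
    b t - b t₀ = (t - t₀) * ∫ s in (0 : ℝ)..1, bt (t₀ + s * (t - t₀)) := by
  have hmem : ∀ s ∈ uIcc (0 : ℝ) 1, t₀ + s * (t - t₀) ∈ Ioo 0 T := by
    intro s hs
    rw [uIcc_of_le zero_le_one] at hs
    have := (convex_Ioo (0 : ℝ) T) ht₀ ht (sub_nonneg.2 hs.2) hs.1 (by ring)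
    simp only [smul_eq_mul] at this
    convert this using 1; ring
  have h1 : ∀ s ∈ uIcc (0 : ℝ) 1, HasDerivAt (fun s => b (t₀ + s * (t - t₀)))
      (bt (t₀ + s * (t - t₀)) * (t - t₀)) s := by
    intro s hs
    have hin : HasDerivAt (fun s : ℝ => t₀ + s * (t - t₀)) (t - t₀) s := by
      simpa using ((hasDerivAt_id s).mul_const (t - t₀)).const_add t₀
    exact (hd _ (hmem s hs)).comp s hin
  have h2 := intervalIntegral.integral_eq_sub_of_hasDerivAt h1
    (Continuous.intervalIntegrable (by fun_prop) _ _)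
  rw [intervalIntegral.integral_mul_const] at h2
  simp only [one_mul, zero_mul, add_zero, add_sub_cancel] at h2
  linarith

theorem hasDerivAt_integral_mul_sub {a b bt : ℝ → ℝ → ℝ} {y L T t₀ : ℝ} (hyL : y ≤ L)
    (ha : Continuous fun q : ℝ × ℝ => a q.1 q.2)
    (hbt : Continuous fun q : ℝ × ℝ => bt q.1 q.2)
    (hd : ∀ x ∈ Icc y L, ∀ t ∈ Ioo 0 T, HasDerivAt (fun s => b x s) (bt x t) t)
    (ht₀ : t₀ ∈ Ioo 0 T) :
    HasDerivAt (fun t => ∫ x in y..L, a x t * (b x t - b x t₀))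
      (∫ x in y..L, a x t₀ * bt x t₀) t₀ := by
  let c : ℝ → ℝ → ℝ := fun x t => ∫ s in (0 : ℝ)..1, bt x (t₀ + s * (t - t₀))
  have hc : Continuous fun q : ℝ × ℝ => c q.1 q.2 := by
    refine intervalIntegral.continuous_parametric_intervalIntegral_of_continuous'
      (f := fun (q : ℝ × ℝ) s => bt q.1 (t₀ + s * (q.2 - t₀))) ?_ 0 1
    exact hbt.comp (f := fun z : (ℝ × ℝ) × ℝ => (z.1.1, t₀ + z.2 * (z.1.2 - t₀))) (by fun_prop)
  let Φ : ℝ → ℝ := fun t => ∫ x in y..L, a x t * c x t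
  have hΦ : Continuous Φ := continuous_intervalIntegral_param (f := fun x t => a x t * c x t)
    (ha.mul hc) y L
  have hΦ₀ : Φ t₀ = ∫ x in y..L, a x t₀ * bt x t₀ := by
    simp [Φ, c]
  have hev : (fun t => ∫ x in y..L, a x t * (b x t - b x t₀))
      =ᶠ[nhds t₀] fun t => (t - t₀) * Φ t := by
    filter_upwards [Ioo_mem_nhds ht₀.1 ht₀.2] with t ht
    simp only [Φ]
    rw [← intervalIntegral.integral_const_mul]
    refine intervalIntegral.integral_congr fun x hx => ?_
    rw [uIcc_of_le hyL] at hx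
    have hbx : Continuous fun s => bt x s := hbt.comp (f := fun s : ℝ => (x, s)) (by fun_prop)
    have := integral_deriv_segment hbx (hd x hx) ht ht₀
    simp only [c, this]; ring
  refine HasDerivAt.congr_of_eventuallyEq ?_ hev
  rw [← hΦ₀, hasDerivAt_iff_tendsto_slope]
  refine (hΦ.tendsto t₀).mono_left nhdsWithin_le_nhds |>.congr' ?_
  filter_upwards [self_mem_nhdsWithin] with t ht
  have ht' : t - t₀ ≠ 0 := sub_ne_zero.2 ht
  rw [slope_def_field]
  field_simp
  ring

/-- Differentiation under the integral sign. -/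
theorem hasDerivAt_integral_param {b bt : ℝ → ℝ → ℝ} {y L T t₀ : ℝ} (hyL : y ≤ L)
    (hb : Continuous fun q : ℝ × ℝ => b q.1 q.2)
    (hbt : Continuous fun q : ℝ × ℝ => bt q.1 q.2)
    (hd : ∀ x ∈ Icc y L, ∀ t ∈ Ioo 0 T, HasDerivAt (fun s => b x s) (bt x t) t)
    (ht₀ : t₀ ∈ Ioo 0 T) :
    HasDerivAt (fun t => ∫ x in y..L, b x t) (∫ x in y..L, bt x t₀) t₀ := by
  have h := hasDerivAt_integral_mul_sub (a := fun _ _ => (1 : ℝ)) hyL continuous_const hbt hd ht₀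
  simp only [one_mul] at h
  have h2 := h.add_const (∫ x in y..L, b x t₀)
  have hs : ∀ t, Continuous fun x => b x t := fun t =>
    hb.comp (f := fun x : ℝ => (x, t)) (by fun_prop)
  refine h2.congr_of_eventuallyEq (Filter.Eventually.of_forall fun t => ?_)
  simp only
  rw [← integral_add_of_continuous (f := fun x => b x t - b x t₀) ((hs t).sub (hs t₀)) (hs t₀)]
  simp

/-- The time derivative of `½ ∫ w g²` for `g = Pₓ + q`, when the flux `S = w g` is differentiable
in space but the mixed derivative of `P` need not exist: by the identity
`w'g'² - wg² = (S' + S)(g' - g) + (w' - w) g g'` for the values at two times, the space derivative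
can be moved to `S` before the difference quotient is formed. -/
theorem hasDerivAt_integral_weighted_sq {p pt q qt w wt g S Sx : ℝ → ℝ → ℝ} {y L T t₀ : ℝ}
    (hyL : y ≤ L)
    (hp : Continuous fun z : ℝ × ℝ => p z.1 z.2) (hpt : Continuous fun z : ℝ × ℝ => pt z.1 z.2)
    (hq : Continuous fun z : ℝ × ℝ => q z.1 z.2) (hqt : Continuous fun z : ℝ × ℝ => qt z.1 z.2)
    (hw : Continuous fun z : ℝ × ℝ => w z.1 z.2) (hwt : Continuous fun z : ℝ × ℝ => wt z.1 z.2)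
    (hg : Continuous fun z : ℝ × ℝ => g z.1 z.2) (hSx : Continuous fun z : ℝ × ℝ => Sx z.1 z.2)
    (hSw : ∀ x t, S x t = w x t * g x t)
    (dpx : ∀ x ∈ Ioo y L, ∀ t, HasDerivAt (fun z => p z t) (g x t - q x t) x)
    (dS : ∀ x ∈ Ioo y L, ∀ t, HasDerivAt (fun z => S z t) (Sx x t) x)
    (dpt : ∀ x ∈ Icc y L, ∀ t ∈ Ioo 0 T, HasDerivAt (fun s => p x s) (pt x t) t)
    (dqt : ∀ x ∈ Icc y L, ∀ t ∈ Ioo 0 T, HasDerivAt (fun s => q x s) (qt x t) t)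
    (dwt : ∀ x ∈ Icc y L, ∀ t ∈ Ioo 0 T, HasDerivAt (fun s => w x s) (wt x t) t)
    (bdy : ∀ t s, (S y t + S y s) * (p y t - p y s) = 0)
    (bdL : ∀ t s, (S L t + S L s) * (p L t - p L s) = 0)
    (ht₀ : t₀ ∈ Ioo 0 T) :
    HasDerivAt (fun t => ∫ x in y..L, 1 / 2 * (w x t * g x t ^ 2))
      (∫ x in y..L, (-(Sx x t₀ * pt x t₀) + S x t₀ * qt x t₀ + 1 / 2 * (wt x t₀ * g x t₀ ^ 2)))
      t₀ := by
  have hS : Continuous fun z : ℝ × ℝ => S z.1 z.2 := by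
    simp only [hSw]; exact hw.mul hg
  have sl : ∀ {f : ℝ → ℝ → ℝ}, (Continuous fun z : ℝ × ℝ => f z.1 z.2) → ∀ t,
      Continuous fun x => f x t := fun hf t => hf.comp (f := fun x : ℝ => (x, t)) (by fun_prop)
  have sl₀ : ∀ {f : ℝ → ℝ → ℝ}, (Continuous fun z : ℝ × ℝ => f z.1 z.2) →
      Continuous fun z : ℝ × ℝ => f z.1 t₀ :=
    fun hf => hf.comp (f := fun z : ℝ × ℝ => (z.1, t₀)) (by fun_prop)
  have cA : Continuous fun z : ℝ × ℝ => -(1 / 2) * (Sx z.1 z.2 + Sx z.1 t₀) :=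
    continuous_const.mul (hSx.add (sl₀ hSx))
  have cB : Continuous fun z : ℝ × ℝ => 1 / 2 * (S z.1 z.2 + S z.1 t₀) :=
    continuous_const.mul (hS.add (sl₀ hS))
  have cC : Continuous fun z : ℝ × ℝ => 1 / 2 * (g z.1 z.2 * g z.1 t₀) :=
    continuous_const.mul (hg.mul (sl₀ hg))
  have sA := sl (f := fun x s => -(1 / 2) * (Sx x s + Sx x t₀)) cA
  have sB := sl (f := fun x s => 1 / 2 * (S x s + S x t₀)) cB
  have sC := sl (f := fun x s => 1 / 2 * (g x s * g x t₀)) cC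
  have dA := hasDerivAt_integral_mul_sub (a := fun x t => -(1 / 2) * (Sx x t + Sx x t₀)) hyL cA hpt
    dpt ht₀
  have dB := hasDerivAt_integral_mul_sub (a := fun x t => 1 / 2 * (S x t + S x t₀)) hyL cB hqt
    dqt ht₀
  have dC := hasDerivAt_integral_mul_sub (a := fun x t => 1 / 2 * (g x t * g x t₀)) hyL cC hwt
    dwt ht₀
  have dsum := ((dA.add dB).add dC).add_const (∫ x in y..L, 1 / 2 * (w x t₀ * g x t₀ ^ 2))
  have hval : (∫ x in y..L, -(1 / 2) * (Sx x t₀ + Sx x t₀) * pt x t₀)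
      + (∫ x in y..L, 1 / 2 * (S x t₀ + S x t₀) * qt x t₀)
      + (∫ x in y..L, 1 / 2 * (g x t₀ * g x t₀) * wt x t₀)
      = ∫ x in y..L, (-(Sx x t₀ * pt x t₀) + S x t₀ * qt x t₀
          + 1 / 2 * (wt x t₀ * g x t₀ ^ 2)) := by
    have i1 := (sA t₀).mul (sl hpt t₀)
    have i2 := (sB t₀).mul (sl hqt t₀)
    have i3 := (sC t₀).mul (sl hwt t₀)
    have hsum3 := integral_add_of_continuous (a := y) (b := L) (i1.add i2) i3
    have hsum2 := integral_add_of_continuous (a := y) (b := L) i1 i2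
    simp only [Pi.add_apply, Pi.mul_apply] at hsum2 hsum3
    rw [← hsum2, ← hsum3]
    congr 1; ext x; ring
  rw [hval] at dsum
  refine dsum.congr_of_eventuallyEq (Filter.Eventually.of_forall fun t => ?_)
  have i1 := (sA t).mul ((sl hp t).sub (sl hp t₀))
  have i2 := (sB t).mul ((sl hq t).sub (sl hq t₀))
  have i3 := (sC t).mul ((sl hw t).sub (sl hw t₀))
  have i4 : Continuous fun x => 1 / 2 * (w x t₀ * g x t₀ ^ 2) :=
    continuous_const.mul ((sl hw t₀).mul ((sl hg t₀).pow 2))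
  -- the total derivative that moves the space derivative from `p` to `S`
  have i5 : Continuous fun x => 1 / 2 * ((Sx x t + Sx x t₀) * (p x t - p x t₀)
      + (S x t + S x t₀) * ((g x t - q x t) - (g x t₀ - q x t₀))) :=
    continuous_const.mul ((((sl hSx t).add (sl hSx t₀)).mul ((sl hp t).sub (sl hp t₀))).add
      (((sl hS t).add (sl hS t₀)).mul
        (((sl hg t).sub (sl hq t)).sub ((sl hg t₀).sub (sl hq t₀)))))
  have hz := integral_deriv_eq_zero
    (S := fun x => 1 / 2 * ((S x t + S x t₀) * (p x t - p x t₀))) hyL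
    (continuous_const.mul (((sl hS t).add (sl hS t₀)).mul ((sl hp t).sub (sl hp t₀)))) i5
    (fun x hx => ((((dS x hx t).add (dS x hx t₀)).mul
      ((dpx x hx t).sub (dpx x hx t₀))).const_mul (1 / 2)))
    (by simp only [bdy t t₀, bdL t t₀])
  have hsum := integral_add_of_continuous (a := y) (b := L)
    (((i1.add i2).add i3).add i4) i5
  rw [hz, add_zero] at hsum
  have hsum4 := integral_add_of_continuous (a := y) (b := L) ((i1.add i2).add i3) i4
  have hsum3 := integral_add_of_continuous (a := y) (b := L) (i1.add i2) i3
  have hsum2 := integral_add_of_continuous (a := y) (b := L) i1 i2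
  simp only [Pi.add_apply, Pi.mul_apply, Pi.sub_apply] at hsum hsum2 hsum3 hsum4 ⊢
  rw [← hsum2, ← hsum3, ← hsum4, ← hsum]
  congr 1; ext x
  simp only [hSw]
  ring

end SphNS

namespace SphNS

/-! ### The flow and its derived quantities -/

theorem FluidParams.n_eq (P : FluidParams) : P.n = P.m + 1 := by
  have := P.two_le_n; unfold FluidParams.m; omega

theorem FluidParams.one_le_m (P : FluidParams) : 1 ≤ P.m := by
  have := P.two_le_n; unfold FluidParams.m; omega

theorem FluidParams.n_cast (P : FluidParams) : (P.n : ℝ) = P.m + 1 := by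
  rw [P.n_eq]; push_cast; ring

theorem FluidParams.one_le_m_cast (P : FluidParams) : (1 : ℝ) ≤ P.m := by
  exact_mod_cast P.one_le_m

theorem FluidParams.n_pos (P : FluidParams) : (0 : ℝ) < P.n := by
  rw [P.n_cast]; positivity

theorem FluidParams.β_pos (P : FluidParams) : 0 < P.β := by
  have h := P.bulk_nonneg
  have hμ := P.μ_pos
  have hm := P.one_le_m_cast
  rw [P.n_cast] at h
  have h2 : 2 / ((P.m : ℝ) + 1) ≤ 1 := by rw [div_le_one (by linarith)]; linarith
  unfold FluidParams.β
  nlinarith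

theorem FluidParams.γ_sub_pos (P : FluidParams) : 0 < P.γ - 1 := sub_pos.2 P.one_lt_γ

/-- A solution of the Lagrangian problem on `[0,L] × [0,T]` in the form in which it is estimated.
All functions are continuous on the whole plane (in the application they are extended constantly
along the coordinate directions), `W` stands for `Dₓ(rᵐ u) = Dₜ v`, and the momentum and the energy
equation are recorded as formulas for the space derivatives of the effective viscous flux and of the
heat flux. Second space derivatives do not occur. -/
structure Flow (P : FluidParams) (L T : ℝ) where
  r : ℝ → ℝ → ℝ
  v : ℝ → ℝ → ℝ
  u : ℝ → ℝ → ℝ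
  e : ℝ → ℝ → ℝ
  W : ℝ → ℝ → ℝ
  ux : ℝ → ℝ → ℝ
  ex : ℝ → ℝ → ℝ
  ut : ℝ → ℝ → ℝ
  et : ℝ → ℝ → ℝ
  one_le_L : 1 ≤ L
  T_pos : 0 < T
  r_pos : ∀ x t, 0 < r x t
  v_pos : ∀ x t, 0 < v x t
  e_pos : ∀ x t, 0 < e x t
  cr : Continuous fun q : ℝ × ℝ => r q.1 q.2
  cv : Continuous fun q : ℝ × ℝ => v q.1 q.2
  cu : Continuous fun q : ℝ × ℝ => u q.1 q.2
  ce : Continuous fun q : ℝ × ℝ => e q.1 q.2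
  cW : Continuous fun q : ℝ × ℝ => W q.1 q.2
  cux : Continuous fun q : ℝ × ℝ => ux q.1 q.2
  cex : Continuous fun q : ℝ × ℝ => ex q.1 q.2
  cut : Continuous fun q : ℝ × ℝ => ut q.1 q.2
  cet : Continuous fun q : ℝ × ℝ => et q.1 q.2
  W_eq : ∀ x t, W x t = r x t ^ P.m * ux x t + P.m * v x t * (u x t / r x t)
  r_dx : ∀ x ∈ Ioo 0 L, ∀ t, HasDerivAt (fun z => r z t) (v x t / r x t ^ P.m) x
  u_dx : ∀ x ∈ Ioo 0 L, ∀ t, HasDerivAt (fun z => u z t) (ux x t) x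
  e_dx : ∀ x ∈ Ioo 0 L, ∀ t, HasDerivAt (fun z => e z t) (ex x t) x
  r_dt : ∀ x, ∀ t ∈ Ioo 0 T, HasDerivAt (fun s => r x s) (u x t) t
  v_dt : ∀ x, ∀ t ∈ Ioo 0 T, HasDerivAt (fun s => v x s) (W x t) t
  u_dt : ∀ x, ∀ t ∈ Ioo 0 T, HasDerivAt (fun s => u x s) (ut x t) t
  e_dt : ∀ x, ∀ t ∈ Ioo 0 T, HasDerivAt (fun s => e x s) (et x t) t
  F_dx' : ∀ x ∈ Ioo 0 L, ∀ t, HasDerivAt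
    (fun z => P.β * W z t / v z t - (P.γ - 1) * (e z t - v z t) / v z t)
    (ut x t / r x t ^ P.m) x
  H_dx' : ∀ x ∈ Ioo 0 L, ∀ t, HasDerivAt
    (fun z => P.κ * r z t ^ (2 * P.m) * ex z t / v z t)
    (et x t + (P.γ - 1) * e x t / v x t * W x t
      - (P.β * W x t ^ 2 / v x t - 4 * P.m * P.μ * (u x t / r x t) * W x t
          + 2 * P.m * P.μ * P.n * v x t * (u x t / r x t) ^ 2)) x
  u_left : ∀ t, u 0 t = 0
  u_right : ∀ t, u L t = 0
  ex_left : ∀ t, ex 0 t = 0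
  ex_right : ∀ t, ex L t = 0

namespace Flow

variable {P : FluidParams} {L T : ℝ} (S : Flow P L T)

theorem L_pos (S : Flow P L T) : 0 < L := lt_of_lt_of_le one_pos S.one_le_L

section Continuity

variable {X : Type*} [TopologicalSpace X] {f g : X → ℝ}

@[fun_prop] theorem continuous_r (hf : Continuous f) (hg : Continuous g) :
    Continuous fun z => S.r (f z) (g z) := S.cr.comp (hf.prodMk hg)
@[fun_prop] theorem continuous_v (hf : Continuous f) (hg : Continuous g) :
    Continuous fun z => S.v (f z) (g z) := S.cv.comp (hf.prodMk hg)
@[fun_prop] theorem continuous_u (hf : Continuous f) (hg : Continuous g) :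
    Continuous fun z => S.u (f z) (g z) := S.cu.comp (hf.prodMk hg)
@[fun_prop] theorem continuous_e (hf : Continuous f) (hg : Continuous g) :
    Continuous fun z => S.e (f z) (g z) := S.ce.comp (hf.prodMk hg)
@[fun_prop] theorem continuous_W (hf : Continuous f) (hg : Continuous g) :
    Continuous fun z => S.W (f z) (g z) := S.cW.comp (hf.prodMk hg)
@[fun_prop] theorem continuous_ux (hf : Continuous f) (hg : Continuous g) :
    Continuous fun z => S.ux (f z) (g z) := S.cux.comp (hf.prodMk hg)
@[fun_prop] theorem continuous_ex (hf : Continuous f) (hg : Continuous g) :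
    Continuous fun z => S.ex (f z) (g z) := S.cex.comp (hf.prodMk hg)
@[fun_prop] theorem continuous_ut (hf : Continuous f) (hg : Continuous g) :
    Continuous fun z => S.ut (f z) (g z) := S.cut.comp (hf.prodMk hg)
@[fun_prop] theorem continuous_et (hf : Continuous f) (hg : Continuous g) :
    Continuous fun z => S.et (f z) (g z) := S.cet.comp (hf.prodMk hg)

end Continuity

/-- `u / r`. -/
noncomputable def b (x t : ℝ) : ℝ := S.u x t / S.r x t

/-- `rᵐ`. -/
noncomputable def rm (x t : ℝ) : ℝ := S.r x t ^ P.m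

/-- The area-weighted velocity gradient `rᵐ Dₓu`. -/
noncomputable def A (x t : ℝ) : ℝ := S.rm x t * S.ux x t

/-- The area-weighted temperature gradient `rᵐ Dₓe`. -/
noncomputable def B (x t : ℝ) : ℝ := S.rm x t * S.ex x t

/-- The deviation `p - (γ - 1)` of the pressure from its value at infinity. -/
noncomputable def π (x t : ℝ) : ℝ := (P.γ - 1) * (S.e x t - S.v x t) / S.v x t

/-- The pressure. -/
noncomputable def p (x t : ℝ) : ℝ := (P.γ - 1) * S.e x t / S.v x t

/-- The effective viscous flux `β Dₓ(rᵐ u)/v - (p - (γ - 1))`. -/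
noncomputable def F (x t : ℝ) : ℝ := P.β * S.W x t / S.v x t - S.π x t

/-- The heat flux `κ r²ᵐ Dₓe / v`. -/
noncomputable def H (x t : ℝ) : ℝ := P.κ * S.r x t ^ (2 * P.m) * S.ex x t / S.v x t

/-- The viscous dissipation. -/
noncomputable def Q (x t : ℝ) : ℝ := P.β * S.W x t ^ 2 / S.v x t - 4 * P.m * P.μ * S.b x t * S.W x t
  + 2 * P.m * P.μ * P.n * S.v x t * S.b x t ^ 2

section Continuity

variable {X : Type*} [TopologicalSpace X] {f g : X → ℝ}

@[fun_prop] theorem continuous_div_v {h : X → ℝ} (hh : Continuous h) (hf : Continuous f)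
    (hg : Continuous g) : Continuous fun z => h z / S.v (f z) (g z) :=
  hh.div (S.continuous_v hf hg) fun _ => (S.v_pos _ _).ne'
@[fun_prop] theorem continuous_div_e {h : X → ℝ} (hh : Continuous h) (hf : Continuous f)
    (hg : Continuous g) : Continuous fun z => h z / S.e (f z) (g z) :=
  hh.div (S.continuous_e hf hg) fun _ => (S.e_pos _ _).ne'
@[fun_prop] theorem continuous_b (hf : Continuous f) (hg : Continuous g) :
    Continuous fun z => S.b (f z) (g z) :=
  (S.continuous_u hf hg).div (S.continuous_r hf hg) fun _ => (S.r_pos _ _).ne'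
@[fun_prop] theorem continuous_rm (hf : Continuous f) (hg : Continuous g) :
    Continuous fun z => S.rm (f z) (g z) := by
  unfold rm; fun_prop
theorem rm_pos (x t : ℝ) : 0 < S.rm x t := pow_pos (S.r_pos x t) _
@[fun_prop] theorem continuous_div_rm {h : X → ℝ} (hh : Continuous h) (hf : Continuous f)
    (hg : Continuous g) : Continuous fun z => h z / S.rm (f z) (g z) :=
  hh.div (S.continuous_rm hf hg) fun _ => (S.rm_pos _ _).ne'
@[fun_prop] theorem continuous_A (hf : Continuous f) (hg : Continuous g) :
    Continuous fun z => S.A (f z) (g z) := by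
  unfold A; fun_prop
@[fun_prop] theorem continuous_B (hf : Continuous f) (hg : Continuous g) :
    Continuous fun z => S.B (f z) (g z) := by
  unfold B; fun_prop
@[fun_prop] theorem continuous_π (hf : Continuous f) (hg : Continuous g) :
    Continuous fun z => S.π (f z) (g z) :=
  S.continuous_div_v (by fun_prop) hf hg
@[fun_prop] theorem continuous_p (hf : Continuous f) (hg : Continuous g) :
    Continuous fun z => S.p (f z) (g z) :=
  S.continuous_div_v (by fun_prop) hf hg
@[fun_prop] theorem continuous_F (hf : Continuous f) (hg : Continuous g) :
    Continuous fun z => S.F (f z) (g z) :=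
  (S.continuous_div_v (by fun_prop) hf hg).sub (S.continuous_π hf hg)
@[fun_prop] theorem continuous_H (hf : Continuous f) (hg : Continuous g) :
    Continuous fun z => S.H (f z) (g z) :=
  S.continuous_div_v (by fun_prop) hf hg
@[fun_prop] theorem continuous_Q (hf : Continuous f) (hg : Continuous g) :
    Continuous fun z => S.Q (f z) (g z) := by
  have h := S.continuous_div_v (h := fun z => P.β * S.W (f z) (g z) ^ 2) (by fun_prop) hf hg
  unfold Q; fun_prop
@[fun_prop] theorem continuous_psi_e (hf : Continuous f) (hg : Continuous g) :
    Continuous fun z => psi (S.e (f z) (g z)) :=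
  ((S.continuous_e hf hg).sub continuous_const).sub
    ((S.continuous_e hf hg).log fun _ => (S.e_pos _ _).ne')
@[fun_prop] theorem continuous_psi_v (hf : Continuous f) (hg : Continuous g) :
    Continuous fun z => psi (S.v (f z) (g z)) :=
  ((S.continuous_v hf hg).sub continuous_const).sub
    ((S.continuous_v hf hg).log fun _ => (S.v_pos _ _).ne')

end Continuity

theorem W_eq_A (x t : ℝ) : S.W x t = S.A x t + P.m * S.v x t * S.b x t := S.W_eq x t

theorem H_eq (x t : ℝ) : S.H x t = P.κ * S.rm x t * S.B x t / S.v x t := by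
  unfold H B rm; ring

theorem W_eq_F (x t : ℝ) : S.W x t = S.v x t * (S.F x t + S.π x t) / P.β := by
  have h1 := (S.v_pos x t).ne'
  have h2 := P.β_pos.ne'
  unfold F; field_simp; ring

theorem p_eq (x t : ℝ) : S.p x t = S.π x t + (P.γ - 1) := by
  have h1 := (S.v_pos x t).ne'
  unfold p π; field_simp; ring

/-- The dissipation as a sum of squares. -/
theorem Q_eq (x t : ℝ) : S.Q x t = (P.lam + 2 * P.μ / P.n) * (S.W x t ^ 2 / S.v x t)
    + 2 * P.m * P.μ * S.v x t * (S.W x t / (S.v x t * √(P.n : ℝ))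
        - √(P.n : ℝ) * S.b x t) ^ 2 := by
  have h1 := (S.v_pos x t).ne'
  have h2 : √(P.n : ℝ) ^ 2 = P.n := Real.sq_sqrt P.n_pos.le
  have h3 : √(P.n : ℝ) ≠ 0 := (Real.sqrt_pos.2 P.n_pos).ne'
  have h4 : (S.W x t / (S.v x t * √(P.n : ℝ)) - √(P.n : ℝ) * S.b x t) ^ 2
      = S.W x t ^ 2 / (S.v x t ^ 2 * P.n) - 2 * (S.W x t / S.v x t) * S.b x t
        + P.n * S.b x t ^ 2 := by
    have : S.W x t / (S.v x t * √(P.n : ℝ)) * √(P.n : ℝ) = S.W x t / S.v x t := by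
      field_simp
    rw [sub_sq, div_pow, mul_pow, mul_pow, h2]
    linear_combination (-2 * S.b x t) * this
  have h5 := P.n_pos.ne'
  rw [h4]; unfold Q FluidParams.β
  field_simp
  rw [P.n_cast]
  ring

/-- The dissipation controls the deviation of the velocity gradient from that of a dilation, even
when the bulk viscosity vanishes. -/
theorem Q_ge (x t : ℝ) : 2 * P.m * P.μ / (P.n * S.v x t) * (S.A x t - S.v x t * S.b x t) ^ 2
    ≤ S.Q x t := by
  have h1 := S.v_pos x t
  have h5 := P.n_pos
  have hb := P.bulk_nonneg
  have : S.Q x t - 2 * P.m * P.μ / (P.n * S.v x t) * (S.A x t - S.v x t * S.b x t) ^ 2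
      = (P.lam + 2 / P.n * P.μ) * (S.W x t ^ 2 / S.v x t) := by
    unfold Q FluidParams.β
    rw [W_eq_A, P.n_cast]
    have : (P.m : ℝ) + 1 ≠ 0 := by positivity
    field_simp
    ring
  have h6 : 0 ≤ (P.lam + 2 / P.n * P.μ) * (S.W x t ^ 2 / S.v x t) := by positivity
  linarith

theorem Q_nonneg (x t : ℝ) : 0 ≤ S.Q x t := by
  have h1 := S.v_pos x t
  have := P.n_pos
  have := P.μ_pos
  exact le_trans (by positivity) (S.Q_ge x t)

theorem rm_dx {x : ℝ} (hx : x ∈ Ioo 0 L) (t : ℝ) :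
    HasDerivAt (fun z => S.rm z t) (P.m * S.v x t / S.r x t) x := by
  have h := (S.r_dx x hx t).pow P.m
  refine h.congr_deriv ?_
  have h0 := (S.r_pos x t).ne'
  obtain ⟨k, hk⟩ : ∃ k, P.m = k + 1 := ⟨P.m - 1, by have := P.one_le_m; omega⟩
  rw [hk]
  simp only [Nat.add_sub_cancel, pow_succ]
  field_simp

theorem U_dx {x : ℝ} (hx : x ∈ Ioo 0 L) (t : ℝ) :
    HasDerivAt (fun z => S.rm z t * S.u z t) (S.W x t) x := by
  refine ((S.rm_dx hx t).mul (S.u_dx x hx t)).congr_deriv ?_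
  rw [W_eq_A]; unfold A b rm; ring

theorem U_dt (x : ℝ) {t : ℝ} (ht : t ∈ Ioo 0 T) :
    HasDerivAt (fun s => S.rm x s * S.u x s)
      (S.rm x t * (S.ut x t + P.m * S.b x t * S.u x t)) t := by
  have h := ((S.r_dt x t ht).pow P.m).mul (S.u_dt x t ht)
  refine h.congr_deriv ?_
  have h0 := (S.r_pos x t).ne'
  obtain ⟨k, hk⟩ : ∃ k, P.m = k + 1 := ⟨P.m - 1, by have := P.one_le_m; omega⟩
  unfold rm b
  rw [hk]
  simp only [Nat.add_sub_cancel, pow_succ, Pi.pow_apply]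
  field_simp
  ring

theorem F_dx {x : ℝ} (hx : x ∈ Ioo 0 L) (t : ℝ) :
    HasDerivAt (fun z => S.F z t) (S.ut x t / S.rm x t) x := S.F_dx' x hx t

theorem H_dx {x : ℝ} (hx : x ∈ Ioo 0 L) (t : ℝ) :
    HasDerivAt (fun z => S.H z t) (S.et x t + S.p x t * S.W x t - S.Q x t) x := S.H_dx' x hx t

theorem H_left (t : ℝ) : S.H 0 t = 0 := by simp [H, S.ex_left]
theorem H_right (t : ℝ) : S.H L t = 0 := by simp [H, S.ex_right]

end Flow

end SphNS

namespace SphNS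

/-! ### Classical solutions as flows -/

/-- The projection of the line onto `[0,L]`. -/
noncomputable def clampTo (L x : ℝ) : ℝ := max 0 (min L x)

/-- The extension of a function from `[0,L] × [0,T]` to the plane that is constant along the
coordinate directions outside of the rectangle. -/
noncomputable def extendRect (L T : ℝ) (f : ℝ → ℝ → ℝ) (x t : ℝ) : ℝ :=
  f (clampTo L x) (clampTo T t)

theorem clampTo_mem {L : ℝ} (hL : 0 ≤ L) (x : ℝ) : clampTo L x ∈ Icc 0 L :=
  ⟨le_max_left _ _, max_le hL (min_le_left _ _)⟩

theorem clampTo_eq {L x : ℝ} (hx : x ∈ Icc 0 L) : clampTo L x = x := by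
  unfold clampTo; rw [min_eq_right hx.2, max_eq_right hx.1]

theorem continuous_clampTo (L : ℝ) : Continuous (clampTo L) := by
  unfold clampTo; fun_prop

theorem extendRect_eq {L T x t : ℝ} {f : ℝ → ℝ → ℝ} (hx : x ∈ Icc 0 L) (ht : t ∈ Icc 0 T) :
    extendRect L T f x t = f x t := by
  unfold extendRect; rw [clampTo_eq hx, clampTo_eq ht]

theorem continuous_extendRect {L T : ℝ} (hL : 0 ≤ L) (hT : 0 ≤ T) {f : ℝ → ℝ → ℝ}
    (hf : ContinuousOn (fun q : ℝ × ℝ => f q.1 q.2) (Icc 0 L ×ˢ Icc 0 T)) :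
    Continuous fun q : ℝ × ℝ => extendRect L T f q.1 q.2 :=
  hf.comp_continuous (f := fun q : ℝ × ℝ => (clampTo L q.1, clampTo T q.2))
    (((continuous_clampTo L).comp continuous_fst).prodMk
      ((continuous_clampTo T).comp continuous_snd))
    fun _ => ⟨clampTo_mem hL _, clampTo_mem hT _⟩

theorem hasDerivAt_of_differentiableOn_Icc {f : ℝ → ℝ} {L x : ℝ}
    (hf : DifferentiableOn ℝ f (Icc 0 L)) (hx : x ∈ Ioo 0 L) :
    HasDerivAt f (derivWithin f (Icc 0 L) x) x :=
  ((hf x ⟨hx.1.le, hx.2.le⟩).hasDerivWithinAt).hasDerivAt (Icc_mem_nhds hx.1 hx.2)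

theorem hasDerivAt_extendRect_x {L T : ℝ} {f : ℝ → ℝ → ℝ} {x t d : ℝ}
    (hf : HasDerivAt (fun z => f z (clampTo T t)) d x) (hx : x ∈ Ioo 0 L) :
    HasDerivAt (fun z => extendRect L T f z t) d x := by
  refine hf.congr_of_eventuallyEq ?_
  filter_upwards [Ioo_mem_nhds hx.1 hx.2] with z hz
  unfold extendRect
  rw [clampTo_eq ⟨hz.1.le, hz.2.le⟩]

theorem hasDerivAt_extendRect_t {L T : ℝ} {f : ℝ → ℝ → ℝ} {x t d : ℝ}
    (hf : HasDerivAt (fun s => f (clampTo L x) s) d t) (ht : t ∈ Ioo 0 T) :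
    HasDerivAt (fun s => extendRect L T f x s) d t := by
  refine hf.congr_of_eventuallyEq ?_
  filter_upwards [Ioo_mem_nhds ht.1 ht.2] with s hs
  unfold extendRect
  rw [clampTo_eq ⟨hs.1.le, hs.2.le⟩]

/-- The derivative of an `n`-th root, `n = m + 1`. -/
theorem hasDerivWithinAt_nthRoot (P : FluidParams) {f : ℝ → ℝ} {f' x : ℝ} {s : Set ℝ}
    (hf : HasDerivWithinAt f f' s x) (hpos : 0 < f x) :
    HasDerivWithinAt (fun z => f z ^ (1 / (P.n : ℝ)))
      (f' / (P.n * (f x ^ (1 / (P.n : ℝ))) ^ P.m)) s x := by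
  refine (hf.rpow_const (Or.inl hpos.ne')).congr_deriv ?_
  have hn := P.n_pos
  have h1 : (f x ^ (1 / (P.n : ℝ))) ^ P.m = f x ^ (-(1 / (P.n : ℝ) - 1)) := by
    rw [← Real.rpow_natCast, ← Real.rpow_mul hpos.le]
    congr 1
    rw [P.n_cast]
    have : (P.m : ℝ) + 1 ≠ 0 := by positivity
    field_simp; ring
  rw [h1, Real.rpow_neg hpos.le]
  have h2 : f x ^ (1 / (P.n : ℝ) - 1) ≠ 0 := (Real.rpow_pos_of_pos hpos _).ne'
  field_simp

theorem radius_pow (P : FluidParams) {a : ℝ} {v : ℝ → ℝ → ℝ} {x t : ℝ}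
    (h : 0 ≤ a ^ P.n + P.n * ∫ y in (0 : ℝ)..x, v y t) :
    radius P a v x t ^ P.n = a ^ P.n + P.n * ∫ y in (0 : ℝ)..x, v y t := by
  unfold radius
  rw [← Real.rpow_natCast, ← Real.rpow_mul h, one_div, inv_mul_cancel₀ P.n_pos.ne', Real.rpow_one]

section Construction

variable {P : FluidParams} {a L T : ℝ} {v₀ u₀ e₀ : ℝ → ℝ} {v u e : ℝ → ℝ → ℝ}

theorem IsClassicalSolution.continuous_v (h : IsClassicalSolution P a L T v₀ u₀ e₀ v u e)
    (hL : 0 ≤ L) (hT : 0 ≤ T) : Continuous fun q : ℝ × ℝ => extendRect L T v q.1 q.2 :=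
  continuous_extendRect hL hT h.reg_v.cont

theorem radius_eq_extendRect {x t : ℝ} (hx : x ∈ Icc 0 L) (ht : t ∈ Icc 0 T) :
    radius P a v x t = radius P a (extendRect L T v) x t := by
  unfold radius
  congr 3
  refine intervalIntegral.integral_congr fun y hy => ?_
  rw [uIcc_of_le hx.1] at hy
  rw [extendRect_eq ⟨hy.1, hy.2.trans hx.2⟩ ht]

theorem IsClassicalSolution.base_pos (h : IsClassicalSolution P a L T v₀ u₀ e₀ v u e)
    (ha : 0 < a) (hL : 0 ≤ L) (hT : 0 ≤ T) {x : ℝ} (hx : 0 ≤ x) (t : ℝ) :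
    0 < a ^ P.n + P.n * ∫ y in (0 : ℝ)..x, extendRect L T v y t := by
  have : 0 ≤ ∫ y in (0 : ℝ)..x, extendRect L T v y t :=
    integral_nonneg_of_continuous hx fun y _ =>
      (h.v_pos _ (clampTo_mem hL y) _ (clampTo_mem hT t)).le
  have := P.n_pos
  positivity

theorem IsClassicalSolution.radius_pos (h : IsClassicalSolution P a L T v₀ u₀ e₀ v u e)
    (ha : 0 < a) {x t : ℝ} (hx : x ∈ Icc 0 L) (ht : t ∈ Icc 0 T) : 0 < radius P a v x t := by
  rw [radius_eq_extendRect hx ht]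
  exact Real.rpow_pos_of_pos
    (h.base_pos ha (hx.1.trans hx.2) (ht.1.trans ht.2) hx.1 t) _

theorem IsClassicalSolution.continuousOn_radius
    (h : IsClassicalSolution P a L T v₀ u₀ e₀ v u e) (ha : 0 < a) (hL : 0 ≤ L) (hT : 0 ≤ T) :
    ContinuousOn (fun q : ℝ × ℝ => radius P a v q.1 q.2) (Icc 0 L ×ˢ Icc 0 T) := by
  have hc : Continuous fun q : ℝ × ℝ => ∫ y in (0 : ℝ)..q.1, extendRect L T v y q.2 :=
    intervalIntegral.continuous_parametric_intervalIntegral_of_continuous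
      (f := fun (q : ℝ × ℝ) y => extendRect L T v y q.2)
      ((h.continuous_v hL hT).comp (f := fun z : (ℝ × ℝ) × ℝ => (z.2, z.1.2)) (by fun_prop))
      continuous_fst
  have h2 : ContinuousOn (fun q : ℝ × ℝ => radius P a (extendRect L T v) q.1 q.2)
      (Icc 0 L ×ˢ Icc 0 T) := by
    unfold radius
    exact ContinuousOn.rpow_const
      (continuous_const.add (continuous_const.mul hc)).continuousOn fun q hq =>
      Or.inl (h.base_pos ha hL hT hq.1.1 q.2).ne'
  exact h2.congr fun q hq => radius_eq_extendRect hq.1 hq.2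

theorem IsClassicalSolution.radius_dx (h : IsClassicalSolution P a L T v₀ u₀ e₀ v u e)
    (ha : 0 < a) {x t : ℝ} (hx : x ∈ Icc 0 L) (ht : t ∈ Icc 0 T) :
    HasDerivWithinAt (fun z => radius P a v z t) (v x t / radius P a v x t ^ P.m)
      (Icc 0 L) x := by
  have hL := hx.1.trans hx.2
  have hT := ht.1.trans ht.2
  have hv : Continuous fun y => extendRect L T v y t :=
    (h.continuous_v hL hT).comp (f := fun y : ℝ => (y, t)) (by fun_prop)
  have h1 : HasDerivWithinAt (fun z => a ^ P.n + P.n * ∫ y in (0 : ℝ)..z, extendRect L T v y t)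
      (P.n * extendRect L T v x t) (Icc 0 L) x :=
    (((hasDerivAt_primitive hv 0 x).const_mul _).const_add _).hasDerivWithinAt
  have h2 := hasDerivWithinAt_nthRoot P h1 (h.base_pos ha hL hT hx.1 t)
  have h3 := h2.congr (f₁ := fun z => radius P a v z t)
    (fun z hz => radius_eq_extendRect hz ht) (radius_eq_extendRect hx ht)
  refine h3.congr_deriv ?_
  rw [extendRect_eq hx ht, radius_eq_extendRect hx ht]
  have := P.n_pos.ne'
  unfold radius
  field_simp

/-- The derivative of a power of the radius times a function of the position. -/
theorem IsClassicalSolution.radius_pow_mul_dx (h : IsClassicalSolution P a L T v₀ u₀ e₀ v u e)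
    (ha : 0 < a) {x t : ℝ} (hx : x ∈ Icc 0 L) (ht : t ∈ Icc 0 T) (i : ℕ) {g : ℝ → ℝ} {g' : ℝ}
    (hg : HasDerivWithinAt g g' (Icc 0 L) x) :
    HasDerivWithinAt (fun z => radius P a v z t ^ i * g z)
      (radius P a v x t ^ i * g' + i * radius P a v x t ^ i / radius P a v x t
        * (v x t / radius P a v x t ^ P.m) * g x) (Icc 0 L) x := by
  refine (((h.radius_dx ha hx ht).pow i).mul hg).congr_deriv ?_
  have h0 := (h.radius_pos ha hx ht).ne'
  rcases i with _ | i
  · simp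
  · simp only [Nat.add_sub_cancel, Pi.pow_apply, pow_succ]
    field_simp
    ring

theorem IsClassicalSolution.u_dx (h : IsClassicalSolution P a L T v₀ u₀ e₀ v u e) {x t : ℝ}
    (hx : x ∈ Icc 0 L) (ht : t ∈ Icc 0 T) :
    HasDerivWithinAt (fun z => u z t) (Dx L u x t) (Icc 0 L) x :=
  (h.reg_u.diff_x t ht x hx).hasDerivWithinAt

theorem IsClassicalSolution.flux_dx (h : IsClassicalSolution P a L T v₀ u₀ e₀ v u e)
    (ha : 0 < a) {x t : ℝ} (hx : x ∈ Icc 0 L) (ht : t ∈ Icc 0 T) :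
    HasDerivWithinAt (fun z => flux P a v u z t)
      (radius P a v x t ^ P.m * Dx L u x t + P.m * v x t * (u x t / radius P a v x t))
      (Icc 0 L) x := by
  refine (h.radius_pow_mul_dx ha hx ht P.m (h.u_dx hx ht)).congr_deriv ?_
  have h0 := (h.radius_pos ha hx ht).ne'
  field_simp

theorem IsClassicalSolution.Dx_flux (h : IsClassicalSolution P a L T v₀ u₀ e₀ v u e)
    (ha : 0 < a) (hL : 0 < L) {x t : ℝ} (hx : x ∈ Icc 0 L) (ht : t ∈ Icc 0 T) :
    Dx L (flux P a v u) x t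
      = radius P a v x t ^ P.m * Dx L u x t + P.m * v x t * (u x t / radius P a v x t) :=
  (h.flux_dx ha hx ht).derivWithin (uniqueDiffOn_Icc hL x hx)

theorem IsClassicalSolution.Dt_v (h : IsClassicalSolution P a L T v₀ u₀ e₀ v u e) {x t : ℝ}
    (hx : x ∈ Icc 0 L) (ht : t ∈ Icc 0 T) : Dt T v x t = Dx L (flux P a v u) x t :=
  sub_eq_zero.1 (h.mass x hx t ht)

theorem IsClassicalSolution.differentiableOn_radius
    (h : IsClassicalSolution P a L T v₀ u₀ e₀ v u e) (ha : 0 < a) {t : ℝ} (ht : t ∈ Icc 0 T) :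
    DifferentiableOn ℝ (fun z => radius P a v z t) (Icc 0 L) :=
  fun _ hx => (h.radius_dx ha hx ht).differentiableWithinAt

theorem IsClassicalSolution.differentiableOn_W
    (h : IsClassicalSolution P a L T v₀ u₀ e₀ v u e) (ha : 0 < a) (hL : 0 < L) {t : ℝ}
    (ht : t ∈ Icc 0 T) : DifferentiableOn ℝ (fun z => Dx L (flux P a v u) z t) (Icc 0 L) := by
  have hr := h.differentiableOn_radius ha ht
  have h1 : DifferentiableOn ℝ (fun z => radius P a v z t ^ P.m * Dx L u z t
      + P.m * v z t * (u z t / radius P a v z t)) (Icc 0 L) :=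
    ((hr.pow _).mul (h.reg_u.diff_xx t ht)).add
      (((h.reg_v.diff_x t ht).const_mul _).mul ((h.reg_u.diff_x t ht).div hr
        fun z hz => (h.radius_pos ha hz ht).ne'))
  exact h1.congr fun z hz => h.Dx_flux ha hL hz ht

/-- The radius moves with the fluid velocity. -/
theorem IsClassicalSolution.radius_dt (h : IsClassicalSolution P a L T v₀ u₀ e₀ v u e)
    (ha : 0 < a) (hL : 0 < L) {x t : ℝ} (hx : x ∈ Icc 0 L) (ht : t ∈ Ioo 0 T) :
    HasDerivAt (fun s => radius P a v x s) (u x t) t := by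
  have ht' : t ∈ Icc 0 T := ⟨ht.1.le, ht.2.le⟩
  have hT : 0 ≤ T := ht'.1.trans ht'.2
  have hWc : Continuous fun q : ℝ × ℝ => extendRect L T (Dt T v) q.1 q.2 :=
    continuous_extendRect hL.le hT h.reg_v.cont_t
  have h1 := hasDerivAt_integral_param (b := extendRect L T v)
    (bt := extendRect L T (Dt T v)) hx.1 (h.continuous_v hL.le hT) hWc
    (fun y hy s hs => hasDerivAt_extendRect_t
      (by
        have := hasDerivAt_of_differentiableOn_Icc
          (h.reg_v.diff_t (clampTo L y) (clampTo_mem hL.le y)) hs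
        simpa only [extendRect, Dt, clampTo_eq (show s ∈ Icc 0 T from ⟨hs.1.le, hs.2.le⟩)]
          using this) hs) ht
  have h2 : ∫ y in (0 : ℝ)..x, extendRect L T (Dt T v) y t = flux P a v u x t := by
    have hWt : Continuous fun y => extendRect L T (Dt T v) y t :=
      hWc.comp (f := fun y : ℝ => (y, t)) (by fun_prop)
    have hfc : ContinuousOn (fun z => flux P a v u z t) (Icc 0 x) := fun z hz =>
      ((h.flux_dx ha ⟨hz.1, hz.2.trans hx.2⟩ ht').continuousWithinAt).mono
        (Icc_subset_Icc_right hx.2)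
    rw [intervalIntegral.integral_eq_sub_of_hasDerivAt_of_le hx.1 hfc (fun z hz => ?_)
      (hWt.intervalIntegrable _ _)]
    · simp [flux, (h.bdry_u t ht').1]
    · have hz' : z ∈ Icc 0 L := ⟨hz.1.le, hz.2.le.trans hx.2⟩
      rw [extendRect_eq hz' ht', h.Dt_v hz' ht', h.Dx_flux ha hL hz' ht']
      exact (h.flux_dx ha hz' ht').hasDerivAt (Icc_mem_nhds hz.1 (hz.2.trans_le hx.2))
  rw [h2] at h1
  have h3 := hasDerivWithinAt_nthRoot P (s := univ)
    ((h1.const_mul (P.n : ℝ)).const_add (a ^ P.n)).hasDerivWithinAt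
    (h.base_pos ha hL.le hT hx.1 t)
  rw [hasDerivWithinAt_univ] at h3
  have h4 := h3.congr_of_eventuallyEq (f₁ := fun s => radius P a v x s) (by
    filter_upwards [Ioo_mem_nhds ht.1 ht.2] with s hs
    exact radius_eq_extendRect hx ⟨hs.1.le, hs.2.le⟩)
  refine h4.congr_deriv ?_
  have h5 := (h.radius_pos ha hx ht').ne'
  have h6 := P.n_pos.ne'
  change P.n * flux P a v u x t / (P.n * radius P a (extendRect L T v) x t ^ P.m) = _
  rw [← radius_eq_extendRect hx ht', flux]
  field_simp

theorem IsClassicalSolution.flux_F_dx (h : IsClassicalSolution P a L T v₀ u₀ e₀ v u e)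
    (ha : 0 < a) (hL : 0 < L) {x t : ℝ} (hx : x ∈ Ioo 0 L) (ht : t ∈ Icc 0 T) :
    HasDerivAt (fun z => P.β * Dx L (flux P a v u) z t / v z t
      - (P.γ - 1) * (e z t - v z t) / v z t)
      (Dt T u x t / radius P a v x t ^ P.m) x := by
  have hx' : x ∈ Icc 0 L := ⟨hx.1.le, hx.2.le⟩
  have hv0 : ∀ z ∈ Icc 0 L, v z t ≠ 0 := fun z hz => (h.v_pos z hz t ht).ne'
  have d1 : HasDerivAt (fun z => Dx L (flux P a v u) z t / v z t) _ x :=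
    hasDerivAt_of_differentiableOn_Icc
      ((h.differentiableOn_W ha hL ht).div (h.reg_v.diff_x t ht) hv0) hx
  have d2 : HasDerivAt (fun z => pressure P v e z t) _ x :=
    hasDerivAt_of_differentiableOn_Icc
      (((h.reg_e.diff_x t ht).const_mul (P.γ - 1)).div (h.reg_v.diff_x t ht) hv0) hx
  have hm := h.momentum x hx' t ht
  have hr := (h.radius_pos ha hx' ht).ne'
  have d3 := (((d1.const_mul P.β).sub d2).add_const (P.γ - 1))
  refine (d3.congr_of_eventuallyEq ?_).congr_deriv ?_
  · filter_upwards [Ioo_mem_nhds hx.1 hx.2] with z hz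
    have := hv0 z ⟨hz.1.le, hz.2.le⟩
    simp only [pressure, Pi.sub_apply]
    field_simp
    ring
  · rw [eq_div_iff (pow_ne_zero _ hr)]
    change (P.β * Dx L (fun y s => Dx L (flux P a v u) y s / v y s) x t
      - Dx L (pressure P v e) x t) * _ = _
    linear_combination -hm

theorem IsClassicalSolution.flux_H_dx (h : IsClassicalSolution P a L T v₀ u₀ e₀ v u e)
    (ha : 0 < a) (hL : 0 < L) {x t : ℝ} (hx : x ∈ Ioo 0 L) (ht : t ∈ Icc 0 T) :
    HasDerivAt (fun z => P.κ * radius P a v z t ^ (2 * P.m) * Dx L e z t / v z t)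
      (Dt T e x t + (P.γ - 1) * e x t / v x t * Dx L (flux P a v u) x t
      - (P.β * Dx L (flux P a v u) x t ^ 2 / v x t
          - 4 * P.m * P.μ * (u x t / radius P a v x t) * Dx L (flux P a v u) x t
          + 2 * P.m * P.μ * P.n * v x t * (u x t / radius P a v x t) ^ 2)) x := by
  have hx' : x ∈ Icc 0 L := ⟨hx.1.le, hx.2.le⟩
  have hv0 : ∀ z ∈ Icc 0 L, v z t ≠ 0 := fun z hz => (h.v_pos z hz t ht).ne'
  have d1 : HasDerivAt (fun z => radius P a v z t ^ (2 * P.m) * Dx L e z t / v z t) _ x :=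
    hasDerivAt_of_differentiableOn_Icc
      ((((h.differentiableOn_radius ha ht).pow _).mul (h.reg_e.diff_xx t ht)).div
        (h.reg_v.diff_x t ht) hv0) hx
  have d2 : Dx L (fun y s => radius P a v y s ^ (P.m - 1) * (u y s) ^ 2) x t
      = 2 * (u x t / radius P a v x t) * Dx L (flux P a v u) x t
        - P.n * v x t * (u x t / radius P a v x t) ^ 2 := by
    have := (h.radius_pow_mul_dx ha hx' ht (P.m - 1) ((h.u_dx hx' ht).pow 2)).derivWithin
      (uniqueDiffOn_Icc hL x hx')
    refine this.trans ?_
    rw [h.Dx_flux ha hL hx' ht]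
    obtain ⟨k, hk⟩ : ∃ k, P.m = k + 1 := ⟨P.m - 1, by have := P.one_le_m; omega⟩
    have h0 := (h.radius_pos ha hx' ht).ne'
    rw [P.n_cast, hk]
    simp only [Nat.add_sub_cancel, pow_succ, Pi.pow_apply]
    push_cast
    field_simp
    ring
  have he := h.energy x hx' t ht
  unfold heatSource at he
  rw [d2] at he
  refine ((d1.const_mul P.κ).congr_of_eventuallyEq
    (Filter.Eventually.of_forall fun z => ?_)).congr_deriv ?_
  · simp only; ring
  · change P.κ * Dx L (fun y s => radius P a v y s ^ (2 * P.m) * Dx L e y s / v y s) x t = _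
    unfold pressure at he
    linear_combination -he

/-- Every classical solution agrees on its rectangle with a flow. -/
theorem IsClassicalSolution.exists_flow (h : IsClassicalSolution P a L T v₀ u₀ e₀ v u e)
    (ha : 0 < a) (hL : 1 ≤ L) (hT : 0 < T) :
    ∃ S : Flow P L T, ∀ x ∈ Icc 0 L, ∀ t ∈ Icc 0 T,
      S.r x t = radius P a v x t ∧ S.v x t = v x t ∧ S.u x t = u x t ∧ S.e x t = e x t ∧
      S.W x t = Dx L (flux P a v u) x t ∧ S.ux x t = Dx L u x t ∧ S.ex x t = Dx L e x t ∧
      S.ut x t = Dt T u x t ∧ S.et x t = Dt T e x t := by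
  have hL0 : 0 < L := lt_of_lt_of_le one_pos hL
  have cx := fun x => clampTo_mem hL0.le x
  have ct := fun t => clampTo_mem hT.le t
  have cxo : ∀ {x}, x ∈ Ioo 0 L → clampTo L x = x := fun hx => clampTo_eq ⟨hx.1.le, hx.2.le⟩
  have cto : ∀ {t}, t ∈ Ioo 0 T → clampTo T t = t := fun ht => clampTo_eq ⟨ht.1.le, ht.2.le⟩
  have c0 : clampTo L 0 = 0 := clampTo_eq ⟨le_rfl, hL0.le⟩
  have cL : clampTo L L = L := clampTo_eq ⟨hL0.le, le_rfl⟩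
  have dt : ∀ {f : ℝ → ℝ → ℝ}, (∀ x ∈ Icc (0 : ℝ) L,
      DifferentiableOn ℝ (fun s => f x s) (Icc 0 T)) → ∀ x, ∀ t ∈ Ioo 0 T,
      HasDerivAt (fun s => extendRect L T f x s) (extendRect L T (Dt T f) x t) t := by
    intro f hf x t ht
    refine hasDerivAt_extendRect_t ?_ ht
    have := hasDerivAt_of_differentiableOn_Icc (hf (clampTo L x) (cx x)) ht
    simpa only [extendRect, Dt, cto ht] using this
  have dx : ∀ {f : ℝ → ℝ → ℝ}, (∀ t ∈ Icc (0 : ℝ) T,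
      DifferentiableOn ℝ (fun y => f y t) (Icc 0 L)) → ∀ x ∈ Ioo 0 L, ∀ t,
      HasDerivAt (fun z => extendRect L T f z t) (extendRect L T (Dx L f) x t) x := by
    intro f hf x hx t
    refine hasDerivAt_extendRect_x ?_ hx
    have := hasDerivAt_of_differentiableOn_Icc (hf (clampTo T t) (ct t)) hx
    simpa only [extendRect, Dx, cxo hx] using this
  refine ⟨{
    r := extendRect L T (radius P a v)
    v := extendRect L T v
    u := extendRect L T u
    e := extendRect L T e
    W := extendRect L T (Dt T v)
    ux := extendRect L T (Dx L u)
    ex := extendRect L T (Dx L e)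
    ut := extendRect L T (Dt T u)
    et := extendRect L T (Dt T e)
    one_le_L := hL
    T_pos := hT
    r_pos := fun x t => h.radius_pos ha (cx x) (ct t)
    v_pos := fun x t => h.v_pos _ (cx x) _ (ct t)
    e_pos := fun x t => h.e_pos _ (cx x) _ (ct t)
    cr := continuous_extendRect hL0.le hT.le (h.continuousOn_radius ha hL0.le hT.le)
    cv := continuous_extendRect hL0.le hT.le h.reg_v.cont
    cu := continuous_extendRect hL0.le hT.le h.reg_u.cont
    ce := continuous_extendRect hL0.le hT.le h.reg_e.cont
    cW := continuous_extendRect hL0.le hT.le h.reg_v.cont_t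
    cux := continuous_extendRect hL0.le hT.le h.reg_u.cont_x
    cex := continuous_extendRect hL0.le hT.le h.reg_e.cont_x
    cut := continuous_extendRect hL0.le hT.le h.reg_u.cont_t
    cet := continuous_extendRect hL0.le hT.le h.reg_e.cont_t
    W_eq := fun x t => (h.Dt_v (cx x) (ct t)).trans (h.Dx_flux ha hL0 (cx x) (ct t))
    r_dx := ?_
    u_dx := dx h.reg_u.diff_x
    e_dx := dx h.reg_e.diff_x
    r_dt := ?_
    v_dt := dt h.reg_v.diff_t
    u_dt := dt h.reg_u.diff_t
    e_dt := dt h.reg_e.diff_t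
    F_dx' := ?_
    H_dx' := ?_
    u_left := fun t => by simp only [extendRect, c0]; exact (h.bdry_u _ (ct t)).1
    u_right := fun t => by simp only [extendRect, cL]; exact (h.bdry_u _ (ct t)).2
    ex_left := fun t => by simp only [extendRect, c0]; exact (h.bdry_e _ (ct t)).1
    ex_right := fun t => by simp only [extendRect, cL]; exact (h.bdry_e _ (ct t)).2 }, ?_⟩
  · intro x hx t
    refine hasDerivAt_extendRect_x ?_ hx
    simp only [extendRect, cxo hx]
    exact (h.radius_dx ha ⟨hx.1.le, hx.2.le⟩ (ct t)).hasDerivAt (Icc_mem_nhds hx.1 hx.2)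
  · intro x t ht
    refine hasDerivAt_extendRect_t ?_ ht
    simp only [extendRect, cto ht]
    exact h.radius_dt ha hL0 (cx x) ht
  · intro x hx t
    refine ((h.flux_F_dx ha hL0 hx (ct t)).congr_of_eventuallyEq ?_).congr_deriv ?_
    · filter_upwards [Ioo_mem_nhds hx.1 hx.2] with z hz
      simp only [extendRect]
      rw [h.Dt_v (cx z) (ct t), cxo hz]
    · simp only [extendRect, cxo hx]
  · intro x hx t
    refine ((h.flux_H_dx ha hL0 hx (ct t)).congr_of_eventuallyEq ?_).congr_deriv ?_
    · filter_upwards [Ioo_mem_nhds hx.1 hx.2] with z hz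
      simp only [extendRect, cxo hz]
    · simp only [extendRect]
      rw [h.Dt_v (cx x) (ct t), cxo hx]
  · intro x hx t ht
    dsimp only
    exact ⟨extendRect_eq hx ht, extendRect_eq hx ht, extendRect_eq hx ht, extendRect_eq hx ht,
      (extendRect_eq hx ht).trans (h.Dt_v hx ht), extendRect_eq hx ht, extendRect_eq hx ht,
      extendRect_eq hx ht, extendRect_eq hx ht⟩

end Construction

end SphNS

namespace SphNS

/-! ### The entropy balance -/

namespace Flow

variable {P : FluidParams} {L T : ℝ} (S : Flow P L T)

/-- The entropy functional at time `t`. -/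
noncomputable def entropy (t : ℝ) : ℝ :=
  ∫ x in (0 : ℝ)..L, (1 / 2 * S.u x t ^ 2 + psi (S.e x t) + (P.γ - 1) * psi (S.v x t))

/-- The viscous part of the entropy production. -/
noncomputable def viscProd (t : ℝ) : ℝ := ∫ x in (0 : ℝ)..L, S.Q x t / S.e x t

/-- The heat conduction part of the entropy production, without the factor `κ`. -/
noncomputable def heatProd (t : ℝ) : ℝ :=
  ∫ x in (0 : ℝ)..L, S.B x t ^ 2 / (S.v x t * S.e x t ^ 2)

@[fun_prop] theorem continuous_div_ve {X : Type*} [TopologicalSpace X] {f g h : X → ℝ}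
    (hh : Continuous h) (hf : Continuous f) (hg : Continuous g) :
    Continuous fun z => h z / (S.v (f z) (g z) * S.e (f z) (g z) ^ 2) :=
  hh.div ((S.continuous_v hf hg).mul ((S.continuous_e hf hg).pow 2)) fun _ =>
    (mul_pos (S.v_pos _ _) (pow_pos (S.e_pos _ _) 2)).ne'

theorem continuous_entropy : Continuous S.entropy :=
  continuous_intervalIntegral_param (by fun_prop) 0 L

theorem continuous_viscProd : Continuous S.viscProd :=
  continuous_intervalIntegral_param (by fun_prop) 0 L

theorem continuous_heatProd : Continuous S.heatProd :=
  continuous_intervalIntegral_param (by fun_prop) 0 L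

theorem viscProd_nonneg (t : ℝ) : 0 ≤ S.viscProd t :=
  integral_nonneg_of_continuous S.L_pos.le fun x _ => div_nonneg (S.Q_nonneg x t) (S.e_pos x t).le

theorem heatProd_nonneg (t : ℝ) : 0 ≤ S.heatProd t :=
  integral_nonneg_of_continuous S.L_pos.le fun x _ => by
    have := S.v_pos x t
    positivity

theorem b_dx {x : ℝ} (hx : x ∈ Ioo 0 L) (t : ℝ) :
    HasDerivAt (fun z => S.b z t)
      ((S.W x t - P.n * S.v x t * S.b x t) / (S.rm x t * S.r x t)) x := by
  refine ((S.u_dx x hx t).div (S.r_dx x hx t) (S.r_pos x t).ne').congr_deriv ?_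
  have h0 := (S.r_pos x t).ne'
  rw [S.W_eq_A, P.n_cast]
  unfold A b rm
  field_simp
  ring

theorem Ub_dx {x : ℝ} (hx : x ∈ Ioo 0 L) (t : ℝ) :
    HasDerivAt (fun z => S.rm z t * S.u z t * S.b z t)
      (2 * S.b x t * S.W x t - P.n * S.v x t * S.b x t ^ 2) x := by
  refine ((S.U_dx hx t).mul (S.b_dx hx t)).congr_deriv ?_
  have h0 := (S.r_pos x t).ne'
  have h1 := (S.rm_pos x t).ne'
  rw [show S.u x t = S.b x t * S.r x t by unfold b; field_simp]
  field_simp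
  ring

theorem hasDerivAt_psi {f : ℝ → ℝ} {f' t : ℝ} (hf : HasDerivAt f f' t) (h0 : 0 < f t) :
    HasDerivAt (fun s => psi (f s)) ((1 - 1 / f t) * f') t := by
  refine ((hf.sub_const 1).sub (hf.log h0.ne')).congr_deriv ?_
  ring

/-- The entropy balance. The time derivative of the entropy density plus the entropy production is the
space derivative of `rᵐ u F + (1 - 1/e) H - 2mμ rᵐ u²/r`, and this flux vanishes at both boundary
points because `u` and `Dₓe` do. -/
theorem entropy_balance {t : ℝ} (ht : t ∈ Icc 0 T) :
    S.entropy t + ∫ s in (0 : ℝ)..t, (S.viscProd s + P.κ * S.heatProd s) ≤ S.entropy 0 := by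
  have hκ := P.κ_pos
  have hder : ∀ s ∈ Ioo 0 T, HasDerivAt S.entropy (-(S.viscProd s + P.κ * S.heatProd s)) s := by
    intro s hs
    have h1 := hasDerivAt_integral_param
      (b := fun x t => 1 / 2 * S.u x t ^ 2 + psi (S.e x t) + (P.γ - 1) * psi (S.v x t))
      (bt := fun x t => S.u x t * S.ut x t + (1 - 1 / S.e x t) * S.et x t
        + (P.γ - 1) * ((1 - 1 / S.v x t) * S.W x t)) S.L_pos.le (by fun_prop) (by fun_prop)
      (fun x _ τ hτ => by
        refine (((((S.u_dt x τ hτ).pow 2).const_mul (1 / 2)).add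
          (hasDerivAt_psi (S.e_dt x τ hτ) (S.e_pos x τ))).add
          ((hasDerivAt_psi (S.v_dt x τ hτ) (S.v_pos x τ)).const_mul (P.γ - 1))).congr_deriv ?_
        simp only [Nat.cast_ofNat, Nat.add_one_sub_one, pow_one]
        ring) hs
    refine h1.congr_deriv ?_
    have hz := integral_deriv_eq_zero (y := 0) (L := L)
      (S := fun x => S.rm x s * S.u x s * S.F x s + (1 - 1 / S.e x s) * S.H x s
        - 2 * P.m * P.μ * (S.rm x s * S.u x s * S.b x s))
      (S' := fun x => (S.u x s * S.ut x s + (1 - 1 / S.e x s) * S.et x s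
        + (P.γ - 1) * ((1 - 1 / S.v x s) * S.W x s)) + (S.Q x s / S.e x s
          + P.κ * (S.B x s ^ 2 / (S.v x s * S.e x s ^ 2))))
      S.L_pos.le (by fun_prop) (by fun_prop) (fun x hx => by
        have e0 := (S.e_pos x s).ne'
        have hinv := ((S.e_dx x hx s).inv e0).const_sub 1
        refine ((((S.U_dx hx s).mul (S.F_dx hx s)).add (hinv.mul (S.H_dx hx s))).sub
          ((S.Ub_dx hx s).const_mul (2 * P.m * P.μ))).congr_deriv ?_ |>.congr_of_eventuallyEq ?_
        · have v0 := (S.v_pos x s).ne'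
          have r0 := (S.rm_pos x s).ne'
          simp only [Pi.inv_apply]
          rw [S.H_eq]
          unfold F π p Q B
          field_simp
          ring
        · refine Filter.Eventually.of_forall fun z => ?_
          simp [one_div])
      (by simp [S.u_left, S.u_right, S.H_left, S.H_right])
    have i1 : Continuous fun x => S.u x s * S.ut x s + (1 - 1 / S.e x s) * S.et x s
        + (P.γ - 1) * ((1 - 1 / S.v x s) * S.W x s) := by fun_prop
    have i2 : Continuous fun x => S.Q x s / S.e x s := by fun_prop
    have i3 : Continuous fun x => P.κ * (S.B x s ^ 2 / (S.v x s * S.e x s ^ 2)) := by fun_prop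
    have i23 : Continuous fun x => S.Q x s / S.e x s
        + P.κ * (S.B x s ^ 2 / (S.v x s * S.e x s ^ 2)) := i2.add i3
    rw [integral_add_of_continuous i1 i23, integral_add_of_continuous i2 i3,
      intervalIntegral.integral_const_mul] at hz
    unfold viscProd heatProd
    linarith
  have h := gronwall_dissipation (g := fun _ => 0) (b := fun _ => 0)
    S.continuous_entropy.continuousOn hder
    (S.continuous_viscProd.add (S.continuous_heatProd.const_smul P.κ)) continuous_const
    continuous_const (fun s _ => add_nonneg (S.viscProd_nonneg s)
      (mul_nonneg hκ.le (S.heatProd_nonneg s))) (fun _ _ => le_rfl) (fun _ _ => le_rfl)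
    (fun s _ => by simp) t ht
  simpa using h

theorem psi_nonneg {x : ℝ} (hx : 0 < x) : 0 ≤ psi x := by
  unfold psi; linarith [Real.log_le_sub_one_of_pos hx]

theorem entropy_density_nonneg (x t : ℝ) :
    0 ≤ 1 / 2 * S.u x t ^ 2 + psi (S.e x t) + (P.γ - 1) * psi (S.v x t) := by
  have h1 := psi_nonneg (S.e_pos x t)
  have h2 := psi_nonneg (S.v_pos x t)
  have h3 := P.γ_sub_pos
  positivity

theorem entropy_nonneg (t : ℝ) : 0 ≤ S.entropy t :=
  integral_nonneg_of_continuous S.L_pos.le fun x _ => S.entropy_density_nonneg x t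

theorem entropy_le {t : ℝ} (ht : t ∈ Icc 0 T) : S.entropy t ≤ S.entropy 0 := by
  have h := S.entropy_balance ht
  have : 0 ≤ ∫ s in (0 : ℝ)..t, (S.viscProd s + P.κ * S.heatProd s) :=
    integral_nonneg_of_continuous ht.1 fun s _ => add_nonneg (S.viscProd_nonneg s)
      (mul_nonneg P.κ_pos.le (S.heatProd_nonneg s))
  linarith

theorem integral_viscProd_le {t : ℝ} (ht : t ∈ Icc 0 T) :
    ∫ s in (0 : ℝ)..t, S.viscProd s ≤ S.entropy 0 := by
  have h := S.entropy_balance ht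
  have h2 : ∫ s in (0 : ℝ)..t, S.viscProd s
      ≤ ∫ s in (0 : ℝ)..t, (S.viscProd s + P.κ * S.heatProd s) :=
    integral_mono_of_continuous ht.1 S.continuous_viscProd
      (S.continuous_viscProd.add (S.continuous_heatProd.const_smul P.κ)) fun s _ =>
      le_add_of_nonneg_right (mul_nonneg P.κ_pos.le (S.heatProd_nonneg s))
  linarith [S.entropy_nonneg t]

theorem integral_heatProd_le {t : ℝ} (ht : t ∈ Icc 0 T) :
    P.κ * ∫ s in (0 : ℝ)..t, S.heatProd s ≤ S.entropy 0 := by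
  have h := S.entropy_balance ht
  have h2 : P.κ * ∫ s in (0 : ℝ)..t, S.heatProd s
      ≤ ∫ s in (0 : ℝ)..t, (S.viscProd s + P.κ * S.heatProd s) := by
    rw [← intervalIntegral.integral_const_mul]
    exact integral_mono_of_continuous ht.1 (S.continuous_heatProd.const_smul P.κ)
      (S.continuous_viscProd.add (S.continuous_heatProd.const_smul P.κ)) fun s _ =>
      le_add_of_nonneg_left (S.viscProd_nonneg s)
  linarith [S.entropy_nonneg t]

end Flow

end SphNS

namespace SphNS

/-! ### Pointwise bounds by the entropy production -/

/-- From `log z = 2 log √z ≤ 2 (√z - 1)`. -/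
theorem sq_sqrt_sub_one_le_psi {z : ℝ} (hz : 0 < z) : (√z - 1) ^ 2 ≤ psi z := by
  have h1 : Real.log z = 2 * Real.log √z := by
    rw [Real.log_sqrt hz.le]; ring
  have h2 := Real.log_le_sub_one_of_pos (Real.sqrt_pos.2 hz)
  have h3 := Real.sq_sqrt hz.le
  unfold psi
  nlinarith

theorem le_two_mul_psi_add_two {z : ℝ} (hz : 0 < z) : z ≤ 2 * psi z + 2 := by
  have h := sq_sqrt_sub_one_le_psi hz
  have h3 := Real.sq_sqrt hz.le
  nlinarith [sq_nonneg (√z - 2)]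

theorem sq_sub_one_le_psi {z : ℝ} (hz : 0 < z) : (z - 1) ^ 2 ≤ 2 * (1 + z) * psi z := by
  have h := sq_sqrt_sub_one_le_psi hz
  have h3 := Real.sq_sqrt hz.le
  have h4 : (z - 1) ^ 2 = (√z + 1) ^ 2 * (√z - 1) ^ 2 := by
    rw [← mul_pow]; congr 1; nlinarith
  rw [h4]
  have h5 : (√z + 1) ^ 2 ≤ 2 * (1 + z) := by nlinarith [sq_nonneg (√z - 1)]
  exact mul_le_mul h5 h (sq_nonneg _) (by linarith)

theorem psi_le_sq_sub_one_div {z : ℝ} (hz : 0 < z) : psi z ≤ (z - 1) ^ 2 / z := by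
  have h := Real.log_le_sub_one_of_pos (inv_pos.2 hz)
  rw [Real.log_inv] at h
  have : (z - 1) ^ 2 / z = z - 1 + (z⁻¹ - 1) := by field_simp; ring
  rw [this]; unfold psi; linarith

namespace Flow

variable {P : FluidParams} {L T : ℝ} (S : Flow P L T)

theorem integral_le_entropy {f : ℝ → ℝ} {c d : ℝ} {t : ℝ} (ht : t ∈ Icc 0 T) (hc : 0 ≤ c)
    (hcd : c ≤ d) (hd : d ≤ L) (hf : Continuous f)
    (h : ∀ x ∈ Icc c d, f x
      ≤ 1 / 2 * S.u x t ^ 2 + psi (S.e x t) + (P.γ - 1) * psi (S.v x t)) :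
    ∫ x in c..d, f x ≤ S.entropy 0 := by
  refine le_trans ?_ (S.entropy_le ht)
  refine (integral_mono_of_continuous hcd hf (by fun_prop) h).trans ?_
  exact integral_le_integral_of_subinterval hc hcd hd (by fun_prop)
    fun x _ => S.entropy_density_nonneg x t

theorem integral_u_sq_le {c d t : ℝ} (ht : t ∈ Icc 0 T) (hc : 0 ≤ c) (hcd : c ≤ d)
    (hd : d ≤ L) : ∫ x in c..d, S.u x t ^ 2 ≤ 2 * S.entropy 0 := by
  have h := S.integral_le_entropy (f := fun x => 1 / 2 * S.u x t ^ 2) ht hc hcd hd (by fun_prop)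
    fun x _ => by
      have h1 := psi_nonneg (S.e_pos x t)
      have h2 := psi_nonneg (S.v_pos x t)
      have h3 := mul_nonneg P.γ_sub_pos.le h2
      linarith
  rw [intervalIntegral.integral_const_mul] at h
  linarith

theorem integral_psi_e_le {c d t : ℝ} (ht : t ∈ Icc 0 T) (hc : 0 ≤ c) (hcd : c ≤ d)
    (hd : d ≤ L) : ∫ x in c..d, psi (S.e x t) ≤ S.entropy 0 :=
  S.integral_le_entropy ht hc hcd hd (by fun_prop) fun x _ => by
    have h2 := psi_nonneg (S.v_pos x t)
    have h3 := mul_nonneg P.γ_sub_pos.le h2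
    have := sq_nonneg (S.u x t)
    linarith

theorem integral_psi_v_le {c d t : ℝ} (ht : t ∈ Icc 0 T) (hc : 0 ≤ c) (hcd : c ≤ d)
    (hd : d ≤ L) : (P.γ - 1) * ∫ x in c..d, psi (S.v x t) ≤ S.entropy 0 := by
  rw [← intervalIntegral.integral_const_mul]
  exact S.integral_le_entropy ht hc hcd hd (by fun_prop) fun x _ => by
    have h1 := psi_nonneg (S.e_pos x t)
    have := sq_nonneg (S.u x t)
    linarith

theorem integral_e_le {c d t : ℝ} (ht : t ∈ Icc 0 T) (hc : 0 ≤ c) (hcd : c ≤ d)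
    (hd : d ≤ L) : ∫ x in c..d, S.e x t ≤ 2 * S.entropy 0 + 2 * (d - c) := by
  have h := integral_mono_of_continuous (f := fun x => S.e x t)
    (g := fun x => 2 * psi (S.e x t) + 2) hcd (by fun_prop) (by fun_prop)
    fun x _ => le_two_mul_psi_add_two (S.e_pos x t)
  rw [integral_add_of_continuous (by fun_prop) (by fun_prop),
    intervalIntegral.integral_const_mul, intervalIntegral.integral_const, smul_eq_mul] at h
  linarith [S.integral_psi_e_le ht hc hcd hd]

theorem integral_v_le {c d t : ℝ} (ht : t ∈ Icc 0 T) (hc : 0 ≤ c) (hcd : c ≤ d)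
    (hd : d ≤ L) : ∫ x in c..d, S.v x t ≤ 2 * (S.entropy 0 / (P.γ - 1)) + 2 * (d - c) := by
  have h := integral_mono_of_continuous (f := fun x => S.v x t)
    (g := fun x => 2 * psi (S.v x t) + 2) hcd (by fun_prop) (by fun_prop)
    fun x _ => le_two_mul_psi_add_two (S.v_pos x t)
  rw [integral_add_of_continuous (by fun_prop) (by fun_prop),
    intervalIntegral.integral_const_mul, intervalIntegral.integral_const, smul_eq_mul] at h
  have h2 : ∫ x in c..d, psi (S.v x t) ≤ S.entropy 0 / (P.γ - 1) := by
    rw [le_div_iff₀ P.γ_sub_pos, mul_comm]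
    exact S.integral_psi_v_le ht hc hcd hd
  linarith

/-- The temperature on an interval of length `1/2` is bounded by the heat production, because the
latter contains the square of the derivative of `2 √e` divided by `e`. -/
theorem e_le {c t M : ℝ} (ht : t ∈ Icc 0 T) (hc : 0 ≤ c) (hcL : c + 1 / 2 ≤ L) (hM0 : 0 ≤ M)
    (hM : ∀ x ∈ Icc c (c + 1 / 2), S.v x t ≤ M * S.rm x t ^ 2) {x : ℝ}
    (hx : x ∈ Icc c (c + 1 / 2)) :
    S.e x t ≤ (2 * S.entropy 0 + 1) * (4 + M * S.heatProd t) := by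
  have hcd : c ≤ c + 1 / 2 := by linarith
  have cs : Continuous fun z => √(S.e z t) := Real.continuous_sqrt.comp (by fun_prop)
  have s0 : ∀ z, 0 < √(S.e z t) := fun z => Real.sqrt_pos.2 (S.e_pos z t)
  have cd : Continuous fun z => S.ex z t / (2 * √(S.e z t)) :=
    Continuous.div (by fun_prop) (continuous_const.mul cs) fun z => by have := s0 z; positivity
  have h1 := abs_le_integral_add_integral_deriv cs cd (fun z hz =>
    (S.e_dx z ⟨hc.trans_lt hz.1, hz.2.trans_le hcL⟩ t).sqrt (S.e_pos z t).ne') hx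
  have hsq : ∀ z, √(S.e z t) ^ 2 = S.e z t := fun z => Real.sq_sqrt (S.e_pos z t).le
  have hE : ∫ z in c..c + 1 / 2, S.e z t ≤ 2 * S.entropy 0 + 1 := by
    have := S.integral_e_le ht hc hcd hcL
    linarith
  have h2 : (∫ z in c..c + 1 / 2, |√(S.e z t)|) ^ 2 ≤ 1 / 2 * (2 * S.entropy 0 + 1) := by
    have := sq_integral_le hcd cs.abs
    simp only [sq_abs, hsq] at this
    linarith
  have h3 : (∫ z in c..c + 1 / 2, |S.ex z t / (2 * √(S.e z t))|) ^ 2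
      ≤ (1 / 4 * (M * S.heatProd t)) * (2 * S.entropy 0 + 1) := by
    have c1 : Continuous fun z => |S.ex z t| / (2 * S.e z t) :=
      Continuous.div (by fun_prop) (by fun_prop) fun z => by have := S.e_pos z t; positivity
    have hcs := sq_integral_mul_le hcd c1 cs
    simp only [hsq] at hcs
    have heq : ∀ z, |S.ex z t / (2 * √(S.e z t))|
        = |S.ex z t| / (2 * S.e z t) * √(S.e z t) := by
      intro z
      rw [abs_div, abs_of_pos (mul_pos two_pos (s0 z))]
      nth_rw 2 [← hsq z]
      have := (s0 z).ne'
      field_simp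
    simp only [heq]
    refine hcs.trans (mul_le_mul ?_ hE (integral_nonneg_of_continuous hcd
      fun z _ => (S.e_pos z t).le) ?_)
    · have : ∫ z in c..c + 1 / 2, (|S.ex z t| / (2 * S.e z t)) ^ 2
          ≤ ∫ z in c..c + 1 / 2, 1 / 4 * (M * (S.B z t ^ 2 / (S.v z t * S.e z t ^ 2))) := by
        refine integral_mono_of_continuous hcd (c1.pow 2) (by fun_prop) fun z hz => ?_
        have hv := S.v_pos z t
        have he := S.e_pos z t
        rw [div_pow, sq_abs]
        have h5 : S.ex z t ^ 2 / (2 * S.e z t) ^ 2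
            = 1 / 4 * (S.v z t * (S.ex z t ^ 2 / (S.v z t * S.e z t ^ 2))) := by field_simp; ring
        have h6 : M * (S.B z t ^ 2 / (S.v z t * S.e z t ^ 2))
            = M * S.rm z t ^ 2 * (S.ex z t ^ 2 / (S.v z t * S.e z t ^ 2)) := by unfold B; ring
        rw [h5, h6]
        have := mul_le_mul_of_nonneg_right (hM z hz)
          (by positivity : 0 ≤ S.ex z t ^ 2 / (S.v z t * S.e z t ^ 2))
        linarith
      refine this.trans ?_
      rw [intervalIntegral.integral_const_mul, intervalIntegral.integral_const_mul]
      have := integral_le_integral_of_subinterval (f := fun z => S.B z t ^ 2 /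
        (S.v z t * S.e z t ^ 2)) hc hcd hcL (by fun_prop) fun z _ => by
          have := S.v_pos z t
          positivity
      have := mul_le_mul_of_nonneg_left this hM0
      unfold heatProd
      linarith
    · have := mul_nonneg hM0 (S.heatProd_nonneg t)
      linarith
  rw [← hsq x]
  have h4 : √(S.e x t) ^ 2 ≤ (2 * (∫ z in c..c + 1 / 2, |√(S.e z t)|)
      + ∫ z in c..c + 1 / 2, |S.ex z t / (2 * √(S.e z t))|) ^ 2 := by
    rw [← sq_abs √(S.e x t)]
    exact pow_le_pow_left₀ (abs_nonneg _) h1 2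
  have := mul_nonneg (mul_nonneg hM0 (S.heatProd_nonneg t))
    (by linarith [S.entropy_nonneg 0] : 0 ≤ 2 * S.entropy 0 + 1)
  nlinarith [sq_nonneg (2 * (∫ z in c..c + 1 / 2, |√(S.e z t)|)
    - ∫ z in c..c + 1 / 2, |S.ex z t / (2 * √(S.e z t))|)]

/-- The setting of the energy estimates: on `[y,L]` the specific volume is bounded above and below,
the radius is bounded below, and also above on the part with `x ≤ 1`; the entropy and the fourth and
second order norms of the initial data are bounded. -/
structure Bounded (S : Flow P L T) (K y : ℝ) : Prop where
  one_le_K : 1 ≤ K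
  T_le : T ≤ K
  y_nonneg : 0 ≤ y
  y_le : y + 1 / 2 ≤ L
  v_lower : ∀ x ∈ Icc y L, ∀ t ∈ Icc 0 T, K⁻¹ ≤ S.v x t
  v_upper : ∀ x ∈ Icc y L, ∀ t ∈ Icc 0 T, S.v x t ≤ K
  r_lower : ∀ x ∈ Icc y L, ∀ t ∈ Icc 0 T, K⁻¹ ≤ S.r x t
  r_upper : ∀ x ∈ Icc y L, x ≤ 1 → ∀ t ∈ Icc 0 T, S.r x t ≤ K
  ent : S.entropy 0 ≤ K
  init : ∫ x in (0 : ℝ)..L, (S.u x 0 ^ 4 + (S.e x 0 - 1) ^ 2) ≤ K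

section

variable {S} {K y : ℝ}

theorem Bounded.mono (h : S.Bounded K y) {y' : ℝ} (hy : y ≤ y') (hy' : y' + 1 / 2 ≤ L) :
    S.Bounded K y' where
  one_le_K := h.one_le_K
  T_le := h.T_le
  y_nonneg := h.y_nonneg.trans hy
  y_le := hy'
  v_lower := fun x hx => h.v_lower x ⟨hy.trans hx.1, hx.2⟩
  v_upper := fun x hx => h.v_upper x ⟨hy.trans hx.1, hx.2⟩
  r_lower := fun x hx => h.r_lower x ⟨hy.trans hx.1, hx.2⟩
  r_upper := fun x hx => h.r_upper x ⟨hy.trans hx.1, hx.2⟩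
  ent := h.ent
  init := h.init

theorem Bounded.K_pos (h : S.Bounded K y) : 0 < K := lt_of_lt_of_le one_pos h.one_le_K

theorem Bounded.y_le_L (h : S.Bounded K y) : y ≤ L := by linarith [h.y_le]

theorem Bounded.rm_lower (h : S.Bounded K y) {x t : ℝ} (hx : x ∈ Icc y L) (ht : t ∈ Icc 0 T) :
    1 ≤ K ^ P.m * S.rm x t := by
  have h1 := h.r_lower x hx t ht
  have h2 := h.K_pos
  rw [rm, ← mul_pow]
  refine one_le_pow₀ ?_
  rwa [inv_le_iff_one_le_mul₀' h2] at h1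

theorem Bounded.abs_b_le (h : S.Bounded K y) {x t : ℝ} (hx : x ∈ Icc y L) (ht : t ∈ Icc 0 T) :
    |S.b x t| ≤ K * |S.u x t| := by
  have h1 := h.r_lower x hx t ht
  have h2 := h.K_pos
  rw [inv_le_iff_one_le_mul₀' h2] at h1
  have h3 := S.r_pos x t
  rw [b, abs_div, abs_of_pos h3, div_le_iff₀ h3]
  nlinarith [abs_nonneg (S.u x t), mul_le_mul_of_nonneg_left h1 (abs_nonneg (S.u x t))]

/-- The form of `e_le` in the setting of `Bounded`. -/
theorem Bounded.e_le_heatProd (h : S.Bounded K y) {x t : ℝ} (hx : x ∈ Icc y L)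
    (ht : t ∈ Icc 0 T) :
    S.e x t ≤ (2 * K + 1) * (4 + K * (K ^ P.m) ^ 2) * (1 + S.heatProd t) := by
  obtain ⟨c, hyc, hcL, hxc⟩ := exists_half_interval h.y_le hx
  have hK := h.K_pos
  have h1 := S.e_le ht (h.y_nonneg.trans hyc) hcL (M := K * (K ^ P.m) ^ 2) (by positivity)
    (fun z hz => by
      have hz' : z ∈ Icc y L := ⟨hyc.trans hz.1, hz.2.trans hcL⟩
      have h2 := h.rm_lower hz' ht
      have h3 := h.v_upper z hz' t ht
      have h4 : 1 ≤ (K ^ P.m * S.rm z t) ^ 2 := one_le_pow₀ h2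
      nlinarith) hxc
  refine h1.trans ?_
  have hV := S.heatProd_nonneg t
  have h5 : 2 * S.entropy 0 + 1 ≤ 2 * K + 1 := by linarith [h.ent]
  have h6 : 0 ≤ K * (K ^ P.m) ^ 2 := by positivity
  rw [mul_assoc (2 * K + 1)]
  refine mul_le_mul h5 ?_ (by positivity) (by positivity)
  nlinarith

/-- The velocity is bounded by the viscous entropy production: the latter controls
`rᵐ Dₓu - v u/r`. -/
theorem exists_u_sq_le (P : FluidParams) (K : ℝ) : ∃ C, 0 ≤ C ∧ ∀ (L T : ℝ) (S : Flow P L T)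
    (y : ℝ), S.Bounded K y → ∀ x ∈ Icc y L, ∀ t ∈ Icc 0 T,
    S.u x t ^ 2 ≤ C * (1 + S.viscProd t) := by
  let k₁ := 2 + K ^ P.m * K ^ 2
  let k₂ := K ^ P.m
  let k₃ := P.n * K / (2 * P.m * P.μ) * (2 * K + 1)
  have hμ := P.μ_pos
  have hm : (0 : ℝ) < P.m := lt_of_lt_of_le one_pos P.one_le_m_cast
  have hn := P.n_pos
  refine ⟨2 * k₁ ^ 2 * |K| + 2 * k₂ ^ 2 * |k₃|, by positivity, ?_⟩
  intro L T S y h x hx t ht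
  have hK := h.K_pos
  obtain ⟨c, hyc, hcL, hxc⟩ := exists_half_interval h.y_le hx
  have hcd : c ≤ c + 1 / 2 := by linarith
  have hc := h.y_nonneg.trans hyc
  have h1 := abs_le_integral_add_integral_deriv (f := fun z => S.u z t) (f' := fun z => S.ux z t)
    (by fun_prop) (by fun_prop)
    (fun z hz => S.u_dx z ⟨hc.trans_lt hz.1, hz.2.trans_le hcL⟩ t) hxc
  have hux : ∫ z in c..c + 1 / 2, |S.ux z t|
      ≤ k₂ * (∫ z in c..c + 1 / 2, |S.A z t - S.v z t * S.b z t|)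
        + k₂ * K ^ 2 * ∫ z in c..c + 1 / 2, |S.u z t| := by
    rw [← intervalIntegral.integral_const_mul, ← intervalIntegral.integral_const_mul,
      ← integral_add_of_continuous (by fun_prop) (by fun_prop)]
    refine integral_mono_of_continuous hcd (by fun_prop) (by fun_prop) fun z hz => ?_
    have hz' : z ∈ Icc y L := ⟨hyc.trans hz.1, hz.2.trans hcL⟩
    have e1 : |S.ux z t| ≤ k₂ * |S.A z t| := by
      have := mul_le_mul_of_nonneg_right (h.rm_lower hz' ht) (abs_nonneg (S.ux z t))
      rw [A, abs_mul, abs_of_pos (S.rm_pos z t)]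
      simp only [k₂]; linarith
    have e2 : |S.A z t| ≤ |S.A z t - S.v z t * S.b z t| + K ^ 2 * |S.u z t| := by
      have e3 : |S.v z t * S.b z t| ≤ K ^ 2 * |S.u z t| := by
        rw [abs_mul, abs_of_pos (S.v_pos z t), sq, mul_assoc]
        exact mul_le_mul (h.v_upper z hz' t ht) (h.abs_b_le hz' ht) (abs_nonneg _) hK.le
      have := abs_sub_abs_le_abs_sub (S.A z t) (S.v z t * S.b z t)
      linarith
    have : 0 ≤ k₂ := by positivity
    nlinarith [mul_le_mul_of_nonneg_left e2 this]
  have hu : (∫ z in c..c + 1 / 2, |S.u z t|) ^ 2 ≤ K := by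
    have := sq_integral_le hcd (f := fun z => |S.u z t|) (by fun_prop)
    simp only [sq_abs] at this
    linarith [S.integral_u_sq_le ht hc hcd hcL, h.ent]
  have hA : (∫ z in c..c + 1 / 2, |S.A z t - S.v z t * S.b z t|) ^ 2 ≤ k₃ * S.viscProd t := by
    have cs : Continuous fun z => √(S.e z t) := Real.continuous_sqrt.comp (by fun_prop)
    have s0 : ∀ z, 0 < √(S.e z t) := fun z => Real.sqrt_pos.2 (S.e_pos z t)
    have hsq : ∀ z, √(S.e z t) ^ 2 = S.e z t := fun z => Real.sq_sqrt (S.e_pos z t).le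
    have c1 : Continuous fun z => |S.A z t - S.v z t * S.b z t| / √(S.e z t) :=
      Continuous.div (by fun_prop) cs fun z => (s0 z).ne'
    have hcs := sq_integral_mul_le hcd c1 cs
    simp only [hsq, div_mul_cancel₀ _ (s0 _).ne', div_pow, sq_abs] at hcs
    refine hcs.trans ?_
    have i1 : ∫ z in c..c + 1 / 2, (S.A z t - S.v z t * S.b z t) ^ 2 / S.e z t
        ≤ P.n * K / (2 * P.m * P.μ) * S.viscProd t := by
      have : ∫ z in c..c + 1 / 2, (S.A z t - S.v z t * S.b z t) ^ 2 / S.e z t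
          ≤ ∫ z in c..c + 1 / 2, P.n * K / (2 * P.m * P.μ) * (S.Q z t / S.e z t) := by
        refine integral_mono_of_continuous hcd (by fun_prop) (by fun_prop) fun z hz => ?_
        have hz' : z ∈ Icc y L := ⟨hyc.trans hz.1, hz.2.trans hcL⟩
        have he := S.e_pos z t
        rw [← mul_div_assoc]
        refine div_le_div_of_nonneg_right ?_ he.le
        have hv := S.v_pos z t
        have hQ := S.Q_ge z t
        rw [div_mul_eq_mul_div, div_le_iff₀ (by positivity)] at hQ
        have := mul_le_mul_of_nonneg_left (h.v_upper z hz' t ht)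
          (mul_nonneg hn.le (S.Q_nonneg z t))
        rw [div_mul_eq_mul_div, le_div_iff₀ (by positivity)]
        linarith
      refine this.trans ?_
      rw [intervalIntegral.integral_const_mul]
      refine mul_le_mul_of_nonneg_left ?_ (by positivity)
      exact integral_le_integral_of_subinterval hc hcd hcL (by fun_prop)
        fun z _ => div_nonneg (S.Q_nonneg z t) (S.e_pos z t).le
    have i2 : ∫ z in c..c + 1 / 2, S.e z t ≤ 2 * K + 1 := by
      have := S.integral_e_le ht hc hcd hcL
      linarith [h.ent]
    have := mul_le_mul i1 i2 (integral_nonneg_of_continuous hcd fun z _ => (S.e_pos z t).le)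
      (mul_nonneg (by positivity) (S.viscProd_nonneg t))
    refine this.trans_eq ?_
    simp only [k₃]; ring
  have hV := S.viscProd_nonneg t
  have hk₃ : k₃ ≤ |k₃| := le_abs_self _
  have hKa : K ≤ |K| := le_abs_self _
  set I₁ := ∫ z in c..c + 1 / 2, |S.u z t|
  set I₂ := ∫ z in c..c + 1 / 2, |S.A z t - S.v z t * S.b z t|
  have h7 : |S.u x t| ≤ k₁ * I₁ + k₂ * I₂ := by
    simp only [k₁]
    simp only [k₂] at hux ⊢
    linarith
  have h8 : S.u x t ^ 2 ≤ (k₁ * I₁ + k₂ * I₂) ^ 2 := by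
    rw [← sq_abs]; exact pow_le_pow_left₀ (abs_nonneg _) h7 2
  have h9 : (k₁ * I₁ + k₂ * I₂) ^ 2 ≤ 2 * k₁ ^ 2 * I₁ ^ 2 + 2 * k₂ ^ 2 * I₂ ^ 2 := by
    nlinarith [sq_nonneg (k₁ * I₁ - k₂ * I₂)]
  have h10 : 2 * k₁ ^ 2 * I₁ ^ 2 ≤ 2 * k₁ ^ 2 * |K| :=
    mul_le_mul_of_nonneg_left (hu.trans hKa) (by positivity)
  have h11 : 2 * k₂ ^ 2 * I₂ ^ 2 ≤ 2 * k₂ ^ 2 * (|k₃| * S.viscProd t) :=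
    mul_le_mul_of_nonneg_left (hA.trans (mul_le_mul_of_nonneg_right hk₃ hV)) (by positivity)
  have h12 : 0 ≤ 2 * k₁ ^ 2 * |K| * S.viscProd t := by positivity
  have h13 : 0 ≤ 2 * k₂ ^ 2 * |k₃| := by positivity
  nlinarith

end

end Flow

end SphNS

namespace SphNS

/-! ### Energy estimates of first order -/

/-- A space cut-off `η` for the estimates on `[y,L]`, with derivative `η'`: it equals one on
`[y',L]` and is constant for `x ≥ 1`. It vanishes at `y`, unless `y = 0`, where the boundary
conditions make the cut-off superfluous. -/
structure IsWeight (K L y y' : ℝ) (η η' : ℝ → ℝ) : Prop where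
  cont : Continuous η
  cont' : Continuous η'
  deriv : ∀ x, HasDerivAt η (η' x) x
  nonneg : ∀ x, 0 ≤ η x
  le_one : ∀ x, η x ≤ 1
  left : y = 0 ∨ η y = 0
  eq_one : ∀ x ∈ Icc y' L, η x = 1
  bound : ∀ x, |η' x| ≤ K
  far : ∀ x, 1 < x → η' x = 0
  le : y ≤ y'
  le' : y' + 1 / 2 ≤ L

/-- Integration by parts, in the form in which the terms are exchanged under the integral. -/
theorem integral_eq_of_flux {f g Z : ℝ → ℝ} {y L : ℝ} (hyL : y ≤ L) (hf : Continuous f)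
    (hg : Continuous g) (hZ : Continuous Z) (hd : ∀ x ∈ Ioo y L, HasDerivAt Z (f x - g x) x)
    (h : Z y = Z L) : ∫ x in y..L, f x = ∫ x in y..L, g x := by
  have := integral_deriv_eq_zero hyL hZ (hf.sub hg) hd h
  simp only [Pi.sub_apply] at this
  rw [intervalIntegral.integral_sub (hf.intervalIntegrable _ _) (hg.intervalIntegrable _ _)] at this
  linarith

/-- The coercivity of all fluxes below: a product of two affine functions of `X` with positive
leading coefficients is bounded below by `X²` up to the squares of the lower order terms. -/
theorem neg_mul_le_of_coercive {c₀ c₁ c d X Y₁ Y₂ : ℝ} (h0 : 0 < c₀) (hc : c₀ ≤ c)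
    (hc' : c ≤ c₁) (hd : 1 ≤ d) (hd' : d ≤ 3) :
    -((d * X + Y₁) * (c * X + Y₂))
      ≤ -(c₀ / 2) * X ^ 2 + (1 + c₁ + 3 / c₀) * (Y₁ ^ 2 + Y₂ ^ 2) := by
  have hcp : 0 < c := h0.trans_le hc
  have h1 : -(d * (X * Y₂)) ≤ d * c / 4 * X ^ 2 + d / c * Y₂ ^ 2 := by
    have : d * c / 4 * X ^ 2 + d / c * Y₂ ^ 2 + d * (X * Y₂)
        = d / c * (c / 2 * X + Y₂) ^ 2 := by field_simp; ring
    have : 0 ≤ d / c * (c / 2 * X + Y₂) ^ 2 := by positivity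
    linarith
  have h2 : -(c * (X * Y₁)) ≤ c / 4 * X ^ 2 + c * Y₁ ^ 2 := by
    have : 0 ≤ c * (X / 2 + Y₁) ^ 2 := by positivity
    nlinarith
  have h3 : -(Y₁ * Y₂) ≤ 1 / 2 * Y₁ ^ 2 + 1 / 2 * Y₂ ^ 2 := by
    nlinarith [sq_nonneg (Y₁ + Y₂)]
  have h4 : d / c ≤ 3 / c₀ := div_le_div₀ (by norm_num) hd' h0 hc
  have h5 : d / c * Y₂ ^ 2 ≤ 3 / c₀ * Y₂ ^ 2 := mul_le_mul_of_nonneg_right h4 (sq_nonneg _)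
  have h6 : c * Y₁ ^ 2 ≤ c₁ * Y₁ ^ 2 := mul_le_mul_of_nonneg_right hc' (sq_nonneg _)
  have h7 : 0 ≤ 3 / c₀ * Y₁ ^ 2 := by positivity
  have h8 : 0 ≤ c₁ * Y₂ ^ 2 := mul_nonneg (hcp.le.trans hc') (sq_nonneg _)
  have h9 : c₀ / 2 * X ^ 2 ≤ (d * c - d * c / 4 - c / 4) * X ^ 2 := by
    refine mul_le_mul_of_nonneg_right ?_ (sq_nonneg _)
    nlinarith
  nlinarith [sq_nonneg Y₁, sq_nonneg Y₂]

namespace Flow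

variable {P : FluidParams} {L T : ℝ} {S : Flow P L T} {K y y' : ℝ} {η η' : ℝ → ℝ}

section Pointwise

variable (h : S.Bounded K y) {x t : ℝ} (hx : x ∈ Icc y L) (ht : t ∈ Icc 0 T)

include h hx ht

theorem Bounded.inv_v_le : (S.v x t)⁻¹ ≤ K := by
  rw [inv_le_comm₀ (S.v_pos x t) h.K_pos]; exact h.v_lower x hx t ht

theorem Bounded.sq_cut_le (hη : IsWeight K L y y' η η') :
    (η' x * S.rm x t) ^ 2 ≤ (K * K ^ P.m) ^ 2 := by
  have hK := h.K_pos
  refine sq_le_sq' ?_ ?_ <;> rcases le_or_gt x 1 with h1 | h1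
  · have h2 : S.rm x t ≤ K ^ P.m := pow_le_pow_left₀ (S.r_pos x t).le (h.r_upper x hx h1 t ht) _
    have := mul_le_mul (hη.bound x) h2 (S.rm_pos x t).le hK.le
    rw [← abs_of_pos (S.rm_pos x t), ← abs_mul] at this
    exact (abs_le.1 this).1
  · rw [hη.far x h1, zero_mul]; simp only [Left.neg_nonpos_iff]; positivity
  · have h2 : S.rm x t ≤ K ^ P.m := pow_le_pow_left₀ (S.r_pos x t).le (h.r_upper x hx h1 t ht) _
    have := mul_le_mul (hη.bound x) h2 (S.rm_pos x t).le hK.le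
    rw [← abs_of_pos (S.rm_pos x t), ← abs_mul] at this
    exact (abs_le.1 this).2
  · rw [hη.far x h1, zero_mul]; positivity

theorem Bounded.b_sq_le : S.b x t ^ 2 ≤ K ^ 2 * S.u x t ^ 2 := by
  have := pow_le_pow_left₀ (abs_nonneg _) (h.abs_b_le hx ht) 2
  rwa [sq_abs, mul_pow, sq_abs] at this

theorem Bounded.v_sq_le : S.v x t ^ 2 ≤ K ^ 2 :=
  pow_le_pow_left₀ (S.v_pos x t).le (h.v_upper x hx t ht) 2

theorem Bounded.v_sub_sq_le : (S.v x t - 1) ^ 2 ≤ K ^ 2 := by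
  have h1 := S.v_pos x t
  have h2 := h.v_upper x hx t ht
  have h3 := h.one_le_K
  nlinarith

theorem Bounded.π_sq_le : S.π x t ^ 2
    ≤ 2 * (P.γ - 1) ^ 2 * K ^ 2 * ((S.e x t - 1) ^ 2 + (S.v x t - 1) ^ 2) := by
  have h1 := h.inv_v_le hx ht
  have h2 := inv_pos.2 (S.v_pos x t)
  have h3 : (S.v x t)⁻¹ ^ 2 ≤ K ^ 2 := pow_le_pow_left₀ h2.le h1 2
  have h4 : S.π x t = (P.γ - 1) * ((S.e x t - 1) - (S.v x t - 1)) * (S.v x t)⁻¹ := by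
    unfold π; ring
  rw [h4, mul_pow, mul_pow]
  have h5 : ((S.e x t - 1) - (S.v x t - 1)) ^ 2
      ≤ 2 * ((S.e x t - 1) ^ 2 + (S.v x t - 1) ^ 2) := by
    nlinarith [sq_nonneg ((S.e x t - 1) + (S.v x t - 1))]
  have h6 := mul_le_mul h5 h3 (sq_nonneg _) (by positivity)
  have := mul_le_mul_of_nonneg_left h6 (sq_nonneg (P.γ - 1))
  linarith

theorem Bounded.p_sq_le : S.p x t ^ 2 ≤ 2 * (P.γ - 1) ^ 2 * K ^ 2 * (1 + (S.e x t - 1) ^ 2) := by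
  have h1 := h.inv_v_le hx ht
  have h2 := inv_pos.2 (S.v_pos x t)
  have h3 : (S.v x t)⁻¹ ^ 2 ≤ K ^ 2 := pow_le_pow_left₀ h2.le h1 2
  have h4 : S.p x t = (P.γ - 1) * (1 + (S.e x t - 1)) * (S.v x t)⁻¹ := by
    unfold p; ring
  rw [h4, mul_pow, mul_pow]
  have h5 : (1 + (S.e x t - 1)) ^ 2 ≤ 2 * (1 + (S.e x t - 1) ^ 2) := by
    nlinarith [sq_nonneg (1 - (S.e x t - 1))]
  have h6 := mul_le_mul h5 h3 (sq_nonneg _) (by positivity)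
  have := mul_le_mul_of_nonneg_left h6 (sq_nonneg (P.γ - 1))
  linarith

theorem Bounded.div_v_lower {c : ℝ} (hc : 0 ≤ c) : c / K ≤ c / S.v x t :=
  div_le_div_of_nonneg_left hc (S.v_pos x t) (h.v_upper x hx t ht)

theorem Bounded.div_v_upper {c : ℝ} (hc : 0 ≤ c) : c / S.v x t ≤ c * K := by
  rw [div_eq_mul_inv]
  exact mul_le_mul_of_nonneg_left (h.inv_v_le hx ht) hc

theorem Bounded.vb_sq_le : S.v x t ^ 2 * S.b x t ^ 2 ≤ K ^ 4 * S.u x t ^ 2 := by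
  have := mul_le_mul (h.v_sq_le hx ht) (h.b_sq_le hx ht) (sq_nonneg _) (sq_nonneg K)
  linarith

/-- The part of the effective viscous flux without the velocity gradient. -/
theorem Bounded.flux_lower_order_sq_le : (P.β * P.m * S.b x t - S.π x t) ^ 2
    ≤ (2 * P.β ^ 2 * P.m ^ 2 * K ^ 2 + 4 * (P.γ - 1) ^ 2 * K ^ 2)
      * (S.u x t ^ 2 + (S.e x t - 1) ^ 2 + (S.v x t - 1) ^ 2) := by
  have f1 := h.b_sq_le hx ht
  have f3 := h.π_sq_le hx ht
  have a1 := mul_le_mul_of_nonneg_left f1 (by positivity : 0 ≤ 2 * P.β ^ 2 * (P.m : ℝ) ^ 2)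
  have a2 : 0 ≤ 2 * P.β ^ 2 * P.m ^ 2 * K ^ 2
    * ((S.e x t - 1) ^ 2 + (S.v x t - 1) ^ 2) := by positivity
  have a3 : 0 ≤ 4 * (P.γ - 1) ^ 2 * K ^ 2 * S.u x t ^ 2 := by positivity
  have a4 : (P.β * P.m * S.b x t - S.π x t) ^ 2
      ≤ 2 * P.β ^ 2 * P.m ^ 2 * S.b x t ^ 2 + 2 * S.π x t ^ 2 := by
    linarith [sq_nonneg (P.β * P.m * S.b x t + S.π x t)]
  linarith

theorem Bounded.velocity_lower_order_sq_le (hη : IsWeight K L y y' η η') :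
    (η x * (P.m * S.v x t * S.b x t) + 2 * (η' x * S.rm x t) * S.u x t) ^ 2
      ≤ (2 * (P.m : ℝ) ^ 2 * K ^ 4 + 8 * (K * K ^ P.m) ^ 2) * S.u x t ^ 2 := by
  have f4 := h.sq_cut_le hx ht hη
  have f5 : η x ^ 2 ≤ 1 := pow_le_one₀ (hη.nonneg x) (hη.le_one x)
  have a1 : η x ^ 2 * (S.v x t ^ 2 * S.b x t ^ 2) ≤ K ^ 4 * S.u x t ^ 2 :=
    (mul_le_of_le_one_left (by positivity) f5).trans (h.vb_sq_le hx ht)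
  have a2 := mul_le_mul_of_nonneg_right f4 (sq_nonneg (S.u x t))
  have a3 := mul_le_mul_of_nonneg_left a1 (sq_nonneg (P.m : ℝ))
  have a4 : (η x * (P.m * S.v x t * S.b x t) + 2 * (η' x * S.rm x t) * S.u x t) ^ 2
      ≤ 2 * (P.m ^ 2 * (η x ^ 2 * (S.v x t ^ 2 * S.b x t ^ 2)))
        + 8 * ((η' x * S.rm x t) ^ 2 * S.u x t ^ 2) := by
    linarith [sq_nonneg (η x * (P.m * S.v x t * S.b x t) - 2 * (η' x * S.rm x t) * S.u x t)]
  linarith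

end Pointwise

theorem integral_one_add_production_le (h : S.Bounded K y) :
    ∫ s in (0 : ℝ)..T, (1 + S.viscProd s + S.heatProd s) ≤ 2 * K + K / P.κ := by
  have cV1 := S.continuous_viscProd
  have cV2 := S.continuous_heatProd
  have hT : T ∈ Icc 0 T := ⟨S.T_pos.le, le_rfl⟩
  rw [integral_add_of_continuous (by fun_prop) (by fun_prop),
    integral_add_of_continuous (by fun_prop) (by fun_prop)]
  have i1 := (S.integral_viscProd_le hT).trans h.ent
  have i2 := (S.integral_heatProd_le hT).trans h.ent
  rw [mul_comm, ← le_div_iff₀ P.κ_pos] at i2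
  simp only [intervalIntegral.integral_const, smul_eq_mul]
  linarith [h.T_le]

theorem IsWeight_flux_left {Z : ℝ} (hη : IsWeight K L y y' η η') (h : y = 0 → Z = 0) :
    η y * Z = 0 := by
  rcases hη.left with h1 | h1
  · rw [h h1, mul_zero]
  · rw [h1, zero_mul]

/-- The lower order terms are integrable in time by the entropy balance. -/
theorem exists_lower_order_le (P : FluidParams) (K : ℝ) : ∃ C, 0 ≤ C ∧
    ∀ (L T : ℝ) (S : Flow P L T) (y : ℝ), S.Bounded K y → ∀ t ∈ Icc 0 T,
    ∫ x in y..L, (S.u x t ^ 4 + S.u x t ^ 2 + (S.e x t - 1) ^ 2 + (S.v x t - 1) ^ 2)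
      ≤ C * (1 + S.viscProd t + S.heatProd t) := by
  obtain ⟨Cu, hCu0, hCu⟩ := exists_u_sq_le P K
  let Ce := (2 * K + 1) * (4 + K * (K ^ P.m) ^ 2)
  have hγ := P.γ_sub_pos
  refine ⟨2 * |K| * (Cu + 1) + 2 * (1 + |Ce|) * |K| + 2 * (1 + |K|) * (|K| / (P.γ - 1)),
    by positivity, ?_⟩
  intro L T S y h t ht
  have hK := h.K_pos
  have hyL := h.y_le_L
  have hV1 := S.viscProd_nonneg t
  have hV2 := S.heatProd_nonneg t
  have hCe : 0 ≤ Ce := by positivity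
  have h1 : ∫ x in y..L, (S.u x t ^ 4 + S.u x t ^ 2 + (S.e x t - 1) ^ 2 + (S.v x t - 1) ^ 2)
      ≤ ∫ x in y..L, ((Cu * (1 + S.viscProd t) + 1) * S.u x t ^ 2
        + (2 * (1 + Ce * (1 + S.heatProd t)) * psi (S.e x t)
          + 2 * (1 + K) * psi (S.v x t))) := by
    refine integral_mono_of_continuous hyL (by fun_prop) (by fun_prop) fun x hx => ?_
    have e1 := mul_le_mul_of_nonneg_right (hCu L T S y h x hx t ht) (sq_nonneg (S.u x t))
    have e2 := sq_sub_one_le_psi (S.e_pos x t)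
    have e3 := sq_sub_one_le_psi (S.v_pos x t)
    have e4 := mul_le_mul_of_nonneg_right (h.e_le_heatProd hx ht) (psi_nonneg (S.e_pos x t))
    have e5 := mul_le_mul_of_nonneg_right (h.v_upper x hx t ht) (psi_nonneg (S.v_pos x t))
    simp only [Ce]
    nlinarith
  refine h1.trans ?_
  rw [integral_add_of_continuous (by fun_prop) (by fun_prop),
    integral_add_of_continuous (by fun_prop) (by fun_prop),
    intervalIntegral.integral_const_mul, intervalIntegral.integral_const_mul,
    intervalIntegral.integral_const_mul]
  have i1 := (S.integral_u_sq_le ht h.y_nonneg hyL le_rfl).trans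
    (mul_le_mul_of_nonneg_left h.ent zero_le_two)
  have i2 := (S.integral_psi_e_le ht h.y_nonneg hyL le_rfl).trans h.ent
  have i3 := (S.integral_psi_v_le ht h.y_nonneg hyL le_rfl).trans h.ent
  rw [mul_comm, ← le_div_iff₀ hγ] at i3
  rw [abs_of_pos hK, abs_of_nonneg hCe]
  have j1 := mul_le_mul_of_nonneg_left i1
    (by positivity : 0 ≤ Cu * (1 + S.viscProd t) + 1)
  have j2 := mul_le_mul_of_nonneg_left i2
    (by positivity : 0 ≤ 2 * (1 + Ce * (1 + S.heatProd t)))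
  have j3 := mul_le_mul_of_nonneg_left i3 (by positivity : 0 ≤ 2 * (1 + K))
  have k1 : (Cu * (1 + S.viscProd t) + 1) * (2 * K)
      ≤ 2 * K * (Cu + 1) * (1 + S.viscProd t + S.heatProd t) := by
    have : Cu * (1 + S.viscProd t) + 1 ≤ (Cu + 1) * (1 + S.viscProd t + S.heatProd t) := by
      nlinarith [mul_nonneg hCu0 hV2]
    nlinarith [mul_le_mul_of_nonneg_left this (by positivity : 0 ≤ 2 * K)]
  have k2 : 2 * (1 + Ce * (1 + S.heatProd t)) * K
      ≤ 2 * (1 + Ce) * K * (1 + S.viscProd t + S.heatProd t) := by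
    have : 1 + Ce * (1 + S.heatProd t) ≤ (1 + Ce) * (1 + S.viscProd t + S.heatProd t) := by
      nlinarith [mul_nonneg hCe hV1]
    nlinarith [mul_le_mul_of_nonneg_left this (by positivity : 0 ≤ 2 * K)]
  have k3 : 2 * (1 + K) * (K / (P.γ - 1))
      ≤ 2 * (1 + K) * (K / (P.γ - 1)) * (1 + S.viscProd t + S.heatProd t) :=
    le_mul_of_one_le_right (by positivity) (by linarith)
  linarith

theorem Bounded.velocity_flux_le (h : S.Bounded K y) (hη : IsWeight K L y y' η η') {x t : ℝ}
    (hx : x ∈ Icc y L) (ht : t ∈ Icc 0 T) :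
    -((1 * (η x * S.A x t) + (η x * (P.m * S.v x t * S.b x t)
          + 2 * (η' x * S.rm x t) * S.u x t))
        * (P.β / S.v x t * (η x * S.A x t) + η x * (P.β * P.m * S.b x t - S.π x t)))
      ≤ -(P.β / K / 2) * (η x ^ 2 * S.A x t ^ 2)
        + (1 + P.β * K + 3 / (P.β / K)) * ((2 * (P.m : ℝ) ^ 2 * K ^ 4 + 8 * (K * K ^ P.m) ^ 2)
            + (2 * P.β ^ 2 * P.m ^ 2 * K ^ 2 + 4 * (P.γ - 1) ^ 2 * K ^ 2))
          * (S.u x t ^ 4 + S.u x t ^ 2 + (S.e x t - 1) ^ 2 + (S.v x t - 1) ^ 2) := by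
  have hK := h.K_pos
  have hβ := P.β_pos
  have hq := neg_mul_le_of_coercive (c := P.β / S.v x t) (d := 1)
    (X := η x * S.A x t) (Y₁ := η x * (P.m * S.v x t * S.b x t)
        + 2 * (η' x * S.rm x t) * S.u x t)
    (Y₂ := η x * (P.β * P.m * S.b x t - S.π x t)) (by positivity : 0 < P.β / K)
    (h.div_v_lower hx ht hβ.le) (h.div_v_upper hx ht hβ.le) le_rfl (by norm_num)
  refine hq.trans ?_
  have f5 : η x ^ 2 ≤ 1 := pow_le_one₀ (hη.nonneg x) (hη.le_one x)
  have g1 := h.velocity_lower_order_sq_le hx ht hη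
  have g2 : (η x * (P.β * P.m * S.b x t - S.π x t)) ^ 2 ≤ _ :=
    ((mul_pow _ _ 2).trans_le (mul_le_of_le_one_left (sq_nonneg _) f5)).trans
      (h.flux_lower_order_sq_le hx ht)
  set Cy₁ := 2 * (P.m : ℝ) ^ 2 * K ^ 4 + 8 * (K * K ^ P.m) ^ 2
  set Cy₂ := 2 * P.β ^ 2 * P.m ^ 2 * K ^ 2 + 4 * (P.γ - 1) ^ 2 * K ^ 2
  have c1 : 0 ≤ Cy₁ := by positivity
  have c2 : 0 ≤ Cy₂ := by positivity
  have g4 : Cy₁ * S.u x t ^ 2 + Cy₂ * (S.u x t ^ 2 + (S.e x t - 1) ^ 2 + (S.v x t - 1) ^ 2)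
      ≤ (Cy₁ + Cy₂) * (S.u x t ^ 4 + S.u x t ^ 2 + (S.e x t - 1) ^ 2
        + (S.v x t - 1) ^ 2) := by
    have : 0 ≤ Cy₁ * (S.u x t ^ 4 + (S.e x t - 1) ^ 2 + (S.v x t - 1) ^ 2) := by positivity
    have : 0 ≤ Cy₂ * S.u x t ^ 4 := by positivity
    linarith
  have g5 := mul_le_mul_of_nonneg_left ((add_le_add g1 g2).trans g4)
    (by positivity : 0 ≤ 1 + P.β * K + 3 / (P.β / K))
  rw [mul_pow]
  linarith

/-- The energy estimate for the velocity. -/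
theorem exists_velocity_energy_le (P : FluidParams) (K : ℝ) : ∃ C, 0 ≤ C ∧
    ∀ (L T : ℝ) (S : Flow P L T) (y y' : ℝ) (η η' : ℝ → ℝ), S.Bounded K y →
    IsWeight K L y y' η η' → ∀ t ∈ Icc 0 T,
    ∫ s in (0 : ℝ)..t, ∫ x in y..L, η x ^ 2 * S.A x s ^ 2 ≤ C := by
  obtain ⟨Cl, hCl0, hCl⟩ := exists_lower_order_le P K
  have hβ := P.β_pos
  have hκ := P.κ_pos
  let Cp := (1 + P.β * K + 3 / (P.β / K)) * ((2 * (P.m : ℝ) ^ 2 * K ^ 4 + 8 * (K * K ^ P.m) ^ 2)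
    + (2 * P.β ^ 2 * P.m ^ 2 * K ^ 2 + 4 * (P.γ - 1) ^ 2 * K ^ 2))
  let M := (K + Cp * Cl * (2 * K + K / P.κ)) / (P.β / K / 2)
  refine ⟨|M|, abs_nonneg _, ?_⟩
  intro L T S y y' η η' h hη t ht
  have hK := h.K_pos
  have hK1 := h.one_le_K
  have hyL := h.y_le_L
  have cη := hη.cont
  have cη' := hη.cont'
  have hCp : 0 ≤ Cp := by positivity
  let J : ℝ → ℝ := fun s => ∫ x in y..L, η x ^ 2 * (1 / 2 * S.u x s ^ 2)
  let D : ℝ → ℝ := fun s => P.β / K / 2 * ∫ x in y..L, η x ^ 2 * S.A x s ^ 2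
  let bb : ℝ → ℝ := fun s => Cp * (Cl * (1 + S.viscProd s + S.heatProd s))
  have cV1 := S.continuous_viscProd
  have cV2 := S.continuous_heatProd
  have cD : Continuous D := continuous_const.mul
    (continuous_intervalIntegral_param (f := fun x s => η x ^ 2 * S.A x s ^ 2) (by fun_prop) y L)
  have hder : ∀ s ∈ Ioo 0 T, HasDerivAt J (∫ x in y..L,
      -((1 * (η x * S.A x s) + (η x * (P.m * S.v x s * S.b x s)
          + 2 * (η' x * S.rm x s) * S.u x s))
        * (P.β / S.v x s * (η x * S.A x s) + η x * (P.β * P.m * S.b x s - S.π x s)))) s := by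
    intro s hs
    refine (hasDerivAt_integral_param (bt := fun x s => η x ^ 2 * (S.u x s * S.ut x s)) hyL
      (by fun_prop) (by fun_prop) (fun x _ τ hτ => by
        refine ((((S.u_dt x τ hτ).pow 2).const_mul (1 / 2)).const_mul (η x ^ 2)).congr_deriv ?_
        simp only [Nat.cast_ofNat, Nat.add_one_sub_one, pow_one]; ring) hs).congr_deriv ?_
    refine integral_eq_of_flux (Z := fun x => η x * (η x * (S.rm x s * S.u x s * S.F x s))) hyL
      (by fun_prop) (by fun_prop) (by fun_prop) (fun x hx => ?_) ?_
    · have hx0 : x ∈ Ioo 0 L := ⟨h.y_nonneg.trans_lt hx.1, hx.2⟩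
      refine ((hη.deriv x).mul ((hη.deriv x).mul
        ((S.U_dx hx0 s).mul (S.F_dx hx0 s)))).congr_deriv ?_
      have v0 := (S.v_pos x s).ne'
      have r0 := (S.rm_pos x s).ne'
      simp only [Pi.mul_apply]
      unfold F
      rw [S.W_eq_A]
      field_simp
      ring
    · rw [IsWeight_flux_left hη (fun h0 => by simp [h0, S.u_left])]
      simp [S.u_right]
  have hmain := gronwall_dissipation (J := J) (D := D) (g := fun _ => 0) (b := bb) (T := T)
    (continuous_intervalIntegral_param (by fun_prop) y L).continuousOn hder cD continuous_const
    (by fun_prop)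
    (fun s _ => mul_nonneg (by positivity) (integral_nonneg_of_continuous hyL fun x _ => by
      positivity))
    (fun _ _ => le_rfl)
    (fun s _ => by
      have := S.viscProd_nonneg s
      have := S.heatProd_nonneg s
      positivity)
    (fun s hs => by
      have hs' : s ∈ Icc 0 T := ⟨hs.1.le, hs.2.le⟩
      have hb := mul_le_mul_of_nonneg_left (hCl L T S y h s hs') hCp
      have hpt : ∫ x in y..L,
          -((1 * (η x * S.A x s) + (η x * (P.m * S.v x s * S.b x s)
              + 2 * (η' x * S.rm x s) * S.u x s))
            * (P.β / S.v x s * (η x * S.A x s) + η x * (P.β * P.m * S.b x s - S.π x s)))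
          ≤ ∫ x in y..L, (-(P.β / K / 2) * (η x ^ 2 * S.A x s ^ 2)
            + Cp * (S.u x s ^ 4 + S.u x s ^ 2 + (S.e x s - 1) ^ 2 + (S.v x s - 1) ^ 2)) := by
        exact integral_mono_of_continuous hyL (by fun_prop) (by fun_prop) fun x hx =>
          h.velocity_flux_le hη hx hs'
      rw [integral_add_of_continuous (by fun_prop) (by fun_prop),
        intervalIntegral.integral_const_mul, intervalIntegral.integral_const_mul] at hpt
      simp only [D, bb]
      linarith) t ht
  have hJ0 : 0 ≤ J t := integral_nonneg_of_continuous hyL fun x _ => by positivity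
  have hJi : J 0 ≤ K := by
    have h0 : (0 : ℝ) ∈ Icc 0 T := ⟨le_rfl, S.T_pos.le⟩
    refine le_trans ?_ h.ent
    refine S.integral_le_entropy h0 h.y_nonneg hyL le_rfl (by fun_prop) fun x _ => ?_
    have f5 : η x ^ 2 ≤ 1 := pow_le_one₀ (hη.nonneg x) (hη.le_one x)
    have h1 := psi_nonneg (S.e_pos x 0)
    have h2 := mul_nonneg P.γ_sub_pos.le (psi_nonneg (S.v_pos x 0))
    have := mul_le_of_le_one_left (by positivity : 0 ≤ 1 / 2 * S.u x 0 ^ 2) f5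
    linarith
  have hbb : ∫ s in (0 : ℝ)..T, bb s ≤ Cp * Cl * (2 * K + K / P.κ) := by
    simp only [bb]
    rw [intervalIntegral.integral_const_mul, intervalIntegral.integral_const_mul]
    exact (mul_le_mul_of_nonneg_left (mul_le_mul_of_nonneg_left
      (integral_one_add_production_le h) hCl0) hCp).trans_eq (by ring)
  simp only [intervalIntegral.integral_const, smul_zero, Real.exp_zero, mul_one] at hmain
  simp only [D] at hmain
  rw [intervalIntegral.integral_const_mul] at hmain
  refine le_trans ?_ (le_abs_self M)
  simp only [M]
  rw [le_div_iff₀ (by positivity)]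
  linarith

end Flow

end SphNS

namespace SphNS
namespace Flow

variable {P : FluidParams} {L T : ℝ} {S : Flow P L T} {K y y' : ℝ} {η η' : ℝ → ℝ}

/-! ### Energy estimates for the square of the velocity and for the temperature -/

/-- The total energy per unit mass, measured from its value at infinity. -/
noncomputable def w (S : Flow P L T) (x t : ℝ) : ℝ := 1 / 2 * S.u x t ^ 2 + (S.e x t - 1)

/-- The flux of the total energy, divided by `rᵐ`. -/
noncomputable def z (S : Flow P L T) (x t : ℝ) : ℝ :=
  P.κ / S.v x t * S.B x t + P.β / S.v x t * (S.u x t * S.A x t)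
    + S.u x t * ((P.β * P.m - 2 * P.m * P.μ) * S.b x t - S.p x t)

@[fun_prop] theorem continuous_w (S : Flow P L T) {X : Type*} [TopologicalSpace X] {f g : X → ℝ}
    (hf : Continuous f) (hg : Continuous g) : Continuous fun q => S.w (f q) (g q) := by
  unfold w; fun_prop

@[fun_prop] theorem continuous_z (S : Flow P L T) {X : Type*} [TopologicalSpace X] {f g : X → ℝ}
    (hf : Continuous f) (hg : Continuous g) : Continuous fun q => S.z (f q) (g q) := by
  unfold z; fun_prop

theorem w_dx (S : Flow P L T) {x : ℝ} (hx : x ∈ Ioo 0 L) (t : ℝ) :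
    HasDerivAt (fun q => S.w q t) ((S.u x t * S.A x t + S.B x t) / S.rm x t) x := by
  refine ((((S.u_dx x hx t).pow 2).const_mul (1 / 2)).add
    ((S.e_dx x hx t).sub_const 1)).congr_deriv ?_
  have := (S.rm_pos x t).ne'
  unfold A B
  simp only [Nat.cast_ofNat, Nat.add_one_sub_one, pow_one]
  field_simp

theorem w_dt (S : Flow P L T) (x : ℝ) {t : ℝ} (ht : t ∈ Ioo 0 T) :
    HasDerivAt (fun s => S.w x s) (S.u x t * S.ut x t + S.et x t) t := by
  refine ((((S.u_dt x t ht).pow 2).const_mul (1 / 2)).add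
    ((S.e_dt x t ht).sub_const 1)).congr_deriv ?_
  simp only [Nat.cast_ofNat, Nat.add_one_sub_one, pow_one]
  ring

/-- Conservation of the total energy. -/
theorem rm_z_dx (S : Flow P L T) {x : ℝ} (hx : x ∈ Ioo 0 L) (t : ℝ) :
    HasDerivAt (fun q => S.rm q t * S.z q t) (S.u x t * S.ut x t + S.et x t) x := by
  have h1 := (((S.U_dx hx t).mul (S.F_dx hx t)).add (S.H_dx hx t)).sub
    (((S.U_dx hx t).const_mul (P.γ - 1)).add ((S.Ub_dx hx t).const_mul (2 * P.m * P.μ)))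
  refine (h1.congr_deriv ?_).congr_of_eventuallyEq (Filter.Eventually.of_forall fun q => ?_)
  · have v0 := (S.v_pos x t).ne'
    have r0 := (S.rm_pos x t).ne'
    unfold F Q π p
    field_simp
    ring
  · have v0 := (S.v_pos q t).ne'
    simp only [Pi.sub_apply, Pi.add_apply, Pi.mul_apply]
    rw [S.H_eq]
    unfold z F π p
    rw [S.W_eq_A]
    field_simp
    ring

/-- The flux in the momentum equation tested with `η² u³`. It is coercive in `u rᵐ Dₓu`; the last
term `η² u² (e - 1)²` is of the order of the energy only after `u²` has been bounded pointwise. -/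
theorem Bounded.quartic_flux_le (h : S.Bounded K y) (hη : IsWeight K L y y' η η') {x t : ℝ}
    (hx : x ∈ Icc y L) (ht : t ∈ Icc 0 T) :
    -((3 * (η x * S.u x t * S.A x t) + S.u x t * (η x * (P.m * S.v x t * S.b x t)
          + 2 * (η' x * S.rm x t) * S.u x t))
        * (P.β / S.v x t * (η x * S.u x t * S.A x t)
          + η x * S.u x t * (P.β * P.m * S.b x t - S.π x t)))
      ≤ -(P.β / K / 2) * (η x ^ 2 * (S.u x t ^ 2 * S.A x t ^ 2))
        + (1 + P.β * K + 3 / (P.β / K)) * ((2 * (P.m : ℝ) ^ 2 * K ^ 4 + 8 * (K * K ^ P.m) ^ 2)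
            + (2 * P.β ^ 2 * P.m ^ 2 * K ^ 2 + 4 * (P.γ - 1) ^ 2 * K ^ 2) * (1 + K ^ 2))
          * (S.u x t ^ 4 + S.u x t ^ 2 + η x ^ 2 * (S.u x t ^ 2 * (S.e x t - 1) ^ 2)) := by
  have hK := h.K_pos
  have hβ := P.β_pos
  have hq := neg_mul_le_of_coercive (c := P.β / S.v x t) (d := 3)
    (X := η x * S.u x t * S.A x t) (Y₁ := S.u x t * (η x * (P.m * S.v x t * S.b x t)
        + 2 * (η' x * S.rm x t) * S.u x t))
    (Y₂ := η x * S.u x t * (P.β * P.m * S.b x t - S.π x t)) (by positivity : 0 < P.β / K)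
    (h.div_v_lower hx ht hβ.le) (h.div_v_upper hx ht hβ.le) (by norm_num) le_rfl
  refine hq.trans ?_
  have f5 : η x ^ 2 ≤ 1 := pow_le_one₀ (hη.nonneg x) (hη.le_one x)
  have f6 := h.v_sub_sq_le hx ht
  have g1 := mul_le_mul_of_nonneg_left (h.velocity_lower_order_sq_le hx ht hη)
    (sq_nonneg (S.u x t))
  have g2 := mul_le_mul_of_nonneg_left (h.flux_lower_order_sq_le hx ht)
    (by positivity : 0 ≤ η x ^ 2 * S.u x t ^ 2)
  set Cy₁ := 2 * (P.m : ℝ) ^ 2 * K ^ 4 + 8 * (K * K ^ P.m) ^ 2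
  set Cy₂ := 2 * P.β ^ 2 * P.m ^ 2 * K ^ 2 + 4 * (P.γ - 1) ^ 2 * K ^ 2
  have c1 : 0 ≤ Cy₁ := by positivity
  have c2 : 0 ≤ Cy₂ := by positivity
  have g3 : η x ^ 2 * S.u x t ^ 2 * (S.u x t ^ 2 + (S.e x t - 1) ^ 2 + (S.v x t - 1) ^ 2)
      ≤ (1 + K ^ 2) * (S.u x t ^ 4 + S.u x t ^ 2
        + η x ^ 2 * (S.u x t ^ 2 * (S.e x t - 1) ^ 2)) := by
    have a1 : η x ^ 2 * S.u x t ^ 4 ≤ S.u x t ^ 4 := mul_le_of_le_one_left (by positivity) f5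
    have a2 : η x ^ 2 * (S.u x t ^ 2 * (S.v x t - 1) ^ 2) ≤ S.u x t ^ 2 * (S.v x t - 1) ^ 2 :=
      mul_le_of_le_one_left (by positivity) f5
    have a3 := mul_le_mul_of_nonneg_left f6 (sq_nonneg (S.u x t))
    have a4 : 0 ≤ K ^ 2 * (S.u x t ^ 4 + η x ^ 2 * (S.u x t ^ 2 * (S.e x t - 1) ^ 2)) := by
      positivity
    have a5 := sq_nonneg (S.u x t)
    linarith
  have g4 : Cy₁ * S.u x t ^ 4 ≤ Cy₁ * (S.u x t ^ 4 + S.u x t ^ 2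
      + η x ^ 2 * (S.u x t ^ 2 * (S.e x t - 1) ^ 2)) := by
    refine mul_le_mul_of_nonneg_left ?_ c1
    have : 0 ≤ S.u x t ^ 2 + η x ^ 2 * (S.u x t ^ 2 * (S.e x t - 1) ^ 2) := by positivity
    linarith
  have g5 := mul_le_mul_of_nonneg_left g3 c2
  have g6 : (S.u x t * (η x * (P.m * S.v x t * S.b x t)
        + 2 * (η' x * S.rm x t) * S.u x t)) ^ 2
      + (η x * S.u x t * (P.β * P.m * S.b x t - S.π x t)) ^ 2
      ≤ (Cy₁ + Cy₂ * (1 + K ^ 2)) * (S.u x t ^ 4 + S.u x t ^ 2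
        + η x ^ 2 * (S.u x t ^ 2 * (S.e x t - 1) ^ 2)) := by
    rw [mul_pow, mul_pow, mul_pow]
    linarith
  have g7 := mul_le_mul_of_nonneg_left g6 (by positivity : 0 ≤ 1 + P.β * K + 3 / (P.β / K))
  have g8 : (η x * S.u x t * S.A x t) ^ 2 = η x ^ 2 * (S.u x t ^ 2 * S.A x t ^ 2) := by ring
  rw [g8]
  linarith

/-- The flux of the total energy tested with `η² w`. It is coercive in `rᵐ Dₓe`, up to the term
`η² u² (rᵐ Dₓu)²`, which only the estimate for `u⁴` controls. -/
theorem Bounded.energy_flux_le (h : S.Bounded K y) (hη : IsWeight K L y y' η η') {x t : ℝ}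
    (hx : x ∈ Icc y L) (ht : t ∈ Icc 0 T) :
    -((2 * (η' x * S.rm x t) * S.w x t + η x * (S.u x t * S.A x t + S.B x t))
        * (η x * S.z x t))
      ≤ -(P.κ / K / 2) * (η x ^ 2 * S.B x t ^ 2)
        + (1 + P.κ * K + 3 / (P.κ / K)) * (2 + 2 * (P.β * K) ^ 2)
          * (η x ^ 2 * (S.u x t ^ 2 * S.A x t ^ 2))
        + (1 + P.κ * K + 3 / (P.κ / K)) * (16 * (K * K ^ P.m) ^ 2
            + 4 * (P.β * P.m - 2 * P.m * P.μ) ^ 2 * K ^ 2 + 8 * (P.γ - 1) ^ 2 * K ^ 2)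
          * (S.u x t ^ 4 + S.u x t ^ 2 + (S.e x t - 1) ^ 2
            + η x ^ 2 * (S.u x t ^ 2 * (S.e x t - 1) ^ 2)) := by
  have hK := h.K_pos
  have hκ := P.κ_pos
  have hβ := P.β_pos
  have hq := neg_mul_le_of_coercive (c := P.κ / S.v x t) (d := 1) (X := η x * S.B x t)
    (Y₁ := 2 * (η' x * S.rm x t) * S.w x t + η x * (S.u x t * S.A x t))
    (Y₂ := P.β / S.v x t * (η x * (S.u x t * S.A x t))
      + η x * S.u x t * ((P.β * P.m - 2 * P.m * P.μ) * S.b x t - S.p x t))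
    (by positivity : 0 < P.κ / K) (h.div_v_lower hx ht hκ.le) (h.div_v_upper hx ht hκ.le)
    le_rfl (by norm_num)
  have heq : -((2 * (η' x * S.rm x t) * S.w x t + η x * (S.u x t * S.A x t + S.B x t))
        * (η x * S.z x t))
      = -((1 * (η x * S.B x t) + (2 * (η' x * S.rm x t) * S.w x t + η x * (S.u x t * S.A x t)))
        * (P.κ / S.v x t * (η x * S.B x t) + (P.β / S.v x t * (η x * (S.u x t * S.A x t))
      + η x * S.u x t * ((P.β * P.m - 2 * P.m * P.μ) * S.b x t - S.p x t)))) := by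
    unfold z; ring
  rw [heq]
  refine hq.trans ?_
  have f5 : η x ^ 2 ≤ 1 := pow_le_one₀ (hη.nonneg x) (hη.le_one x)
  have g0 : (η x * (S.u x t * S.A x t)) ^ 2 = η x ^ 2 * (S.u x t ^ 2 * S.A x t ^ 2) := by ring
  -- the cut-off term
  have g1 : (2 * (η' x * S.rm x t) * S.w x t + η x * (S.u x t * S.A x t)) ^ 2
      ≤ 2 * (η x ^ 2 * (S.u x t ^ 2 * S.A x t ^ 2))
        + 16 * (K * K ^ P.m) ^ 2 * (S.u x t ^ 4 + (S.e x t - 1) ^ 2) := by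
    have a1 : S.w x t ^ 2 ≤ 2 * (S.u x t ^ 4 + (S.e x t - 1) ^ 2) := by
      unfold w
      have : 0 ≤ S.u x t ^ 4 := by positivity
      have := sq_nonneg (1 / 2 * S.u x t ^ 2 - (S.e x t - 1))
      linarith
    have a2 := mul_le_mul (h.sq_cut_le hx ht hη) a1 (sq_nonneg _) (by positivity)
    have := sq_nonneg (2 * (η' x * S.rm x t) * S.w x t - η x * (S.u x t * S.A x t))
    linarith
  have g2 : (P.β / S.v x t * (η x * (S.u x t * S.A x t))
      + η x * S.u x t * ((P.β * P.m - 2 * P.m * P.μ) * S.b x t - S.p x t)) ^ 2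
      ≤ 2 * (P.β * K) ^ 2 * (η x ^ 2 * (S.u x t ^ 2 * S.A x t ^ 2))
        + (4 * (P.β * P.m - 2 * P.m * P.μ) ^ 2 * K ^ 2 + 8 * (P.γ - 1) ^ 2 * K ^ 2)
          * (S.u x t ^ 4 + S.u x t ^ 2 + η x ^ 2 * (S.u x t ^ 2 * (S.e x t - 1) ^ 2)) := by
    have a1 : (P.β / S.v x t) ^ 2 ≤ (P.β * K) ^ 2 :=
      pow_le_pow_left₀ (div_nonneg hβ.le (S.v_pos x t).le) (h.div_v_upper hx ht hβ.le) 2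
    have a2 := mul_le_mul_of_nonneg_right a1
      (by positivity : 0 ≤ η x ^ 2 * (S.u x t ^ 2 * S.A x t ^ 2))
    have a3 : ((P.β * P.m - 2 * P.m * P.μ) * S.b x t - S.p x t) ^ 2
        ≤ 2 * (P.β * P.m - 2 * P.m * P.μ) ^ 2 * K ^ 2 * S.u x t ^ 2
          + 4 * (P.γ - 1) ^ 2 * K ^ 2 * (1 + (S.e x t - 1) ^ 2) := by
      have b1 := mul_le_mul_of_nonneg_left (h.b_sq_le hx ht)
        (by positivity : 0 ≤ 2 * (P.β * P.m - 2 * P.m * P.μ) ^ 2)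
      have b2 := h.p_sq_le hx ht
      have := sq_nonneg ((P.β * P.m - 2 * P.m * P.μ) * S.b x t + S.p x t)
      linarith
    have a4 := mul_le_mul_of_nonneg_left a3 (by positivity : 0 ≤ η x ^ 2 * S.u x t ^ 2)
    have a5 : η x ^ 2 * S.u x t ^ 4 ≤ S.u x t ^ 4 := mul_le_of_le_one_left (by positivity) f5
    have a6 : η x ^ 2 * S.u x t ^ 2 ≤ S.u x t ^ 2 := mul_le_of_le_one_left (by positivity) f5
    have a7 := mul_le_mul_of_nonneg_left a5
      (by positivity : 0 ≤ 2 * (P.β * P.m - 2 * P.m * P.μ) ^ 2 * K ^ 2)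
    have a8 := mul_le_mul_of_nonneg_left a6 (by positivity : 0 ≤ 4 * (P.γ - 1) ^ 2 * K ^ 2)
    have a9 : 0 ≤ 4 * (P.β * P.m - 2 * P.m * P.μ) ^ 2 * K ^ 2
      * (S.u x t ^ 2 + η x ^ 2 * (S.u x t ^ 2 * (S.e x t - 1) ^ 2)) := by positivity
    have a10 : 0 ≤ 8 * (P.γ - 1) ^ 2 * K ^ 2 * S.u x t ^ 4 := by positivity
    have := sq_nonneg (P.β / S.v x t * (η x * (S.u x t * S.A x t))
      - η x * S.u x t * ((P.β * P.m - 2 * P.m * P.μ) * S.b x t - S.p x t))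
    linarith
  have g3 := mul_le_mul_of_nonneg_left (add_le_add g1 g2)
    (by positivity : 0 ≤ 1 + P.κ * K + 3 / (P.κ / K))
  have g4 : 0 ≤ (1 + P.κ * K + 3 / (P.κ / K)) * (16 * (K * K ^ P.m) ^ 2
      * (S.u x t ^ 2 + η x ^ 2 * (S.u x t ^ 2 * (S.e x t - 1) ^ 2))
      + (4 * (P.β * P.m - 2 * P.m * P.μ) ^ 2 * K ^ 2 + 8 * (P.γ - 1) ^ 2 * K ^ 2)
        * (S.e x t - 1) ^ 2) := by positivity
  rw [mul_pow (η x) (S.B x t)]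
  linarith

end Flow

end SphNS

namespace SphNS
namespace Flow

variable {P : FluidParams} {L T : ℝ} {S : Flow P L T} {K y y' : ℝ} {η η' : ℝ → ℝ}

/-- The evolution of `∫ η² (l u⁴/4 + w²/2)`. The boundary terms vanish at the right end by the
boundary conditions, and at the left end by these or by the cut-off. -/
theorem hasDerivAt_energy (h : S.Bounded K y) (hη : IsWeight K L y y' η η') (l : ℝ) {s : ℝ}
    (hs : s ∈ Ioo 0 T) :
    HasDerivAt (fun s => ∫ x in y..L, η x ^ 2 * (l / 4 * S.u x s ^ 4 + 1 / 2 * S.w x s ^ 2))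
      (∫ x in y..L,
        (l * -((3 * (η x * S.u x s * S.A x s) + S.u x s * (η x * (P.m * S.v x s * S.b x s)
            + 2 * (η' x * S.rm x s) * S.u x s))
          * (P.β / S.v x s * (η x * S.u x s * S.A x s)
            + η x * S.u x s * (P.β * P.m * S.b x s - S.π x s)))
        + -((2 * (η' x * S.rm x s) * S.w x s + η x * (S.u x s * S.A x s + S.B x s))
          * (η x * S.z x s)))) s := by
  have cη := hη.cont
  have cη' := hη.cont'
  refine (hasDerivAt_integral_param
    (bt := fun x s => η x ^ 2 * (l * (S.u x s ^ 3 * S.ut x s)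
      + S.w x s * (S.u x s * S.ut x s + S.et x s))) h.y_le_L
    (by fun_prop) (by fun_prop) (fun x _ τ hτ => by
      refine (((((S.u_dt x τ hτ).pow 4).const_mul (l / 4)).add
        (((S.w_dt x hτ).pow 2).const_mul (1 / 2))).const_mul (η x ^ 2)).congr_deriv ?_
      simp only [Nat.cast_ofNat, Nat.add_one_sub_one, pow_one]; ring) hs).congr_deriv ?_
  refine integral_eq_of_flux (Z := fun x => η x * (η x * (l * (S.rm x s * S.u x s *
      (S.u x s ^ 2 * S.F x s)) + S.w x s * (S.rm x s * S.z x s)))) h.y_le_L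
    (by fun_prop) (by fun_prop) (by fun_prop) (fun x hx => ?_) ?_
  · have hx0 : x ∈ Ioo 0 L := ⟨h.y_nonneg.trans_lt hx.1, hx.2⟩
    refine ((hη.deriv x).mul ((hη.deriv x).mul
      ((((S.U_dx hx0 s).mul (((S.u_dx x hx0 s).pow 2).mul (S.F_dx hx0 s))).const_mul l).add
        ((S.w_dx hx0 s).mul (S.rm_z_dx hx0 s))))).congr_deriv ?_
    have v0 := (S.v_pos x s).ne'
    have r0 := (S.rm_pos x s).ne'
    simp only [Pi.mul_apply, Pi.add_apply, Pi.pow_apply]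
    unfold F
    rw [S.W_eq_A]
    unfold A
    simp only [Nat.cast_ofNat, Nat.add_one_sub_one, pow_one]
    field_simp
    ring
  · have hB0 : S.B 0 s = 0 := by simp [B, S.ex_left]
    have hBL : S.B L s = 0 := by simp [B, S.ex_right]
    rw [IsWeight_flux_left hη (fun h0 => by simp [h0, S.u_left, z, hB0])]
    simp [S.u_right, z, hBL]

/-- The energy estimate for `u⁴` and the total energy. With a large factor `l` the dissipation of
`l u⁴/4` absorbs the mixed term of `w²/2`. The product `u² (e - 1)²` is treated by Gronwall's
inequality: the supremum of `u²` is bounded by the viscous entropy production, which is integrable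
in time. -/
theorem exists_total_energy_le (P : FluidParams) (K : ℝ) : ∃ C, 0 ≤ C ∧
    ∀ (L T : ℝ) (S : Flow P L T) (y y' : ℝ) (η η' : ℝ → ℝ), S.Bounded K y →
    IsWeight K L y y' η η' → ∀ t ∈ Icc 0 T,
    (∫ x in y..L, η x ^ 2 * (S.u x t ^ 4 + (S.e x t - 1) ^ 2) ≤ C) ∧
    ∫ s in (0 : ℝ)..t, ∫ x in y..L, η x ^ 2 * (S.u x s ^ 2 * S.A x s ^ 2 + S.B x s ^ 2) ≤ C := by
  obtain ⟨Cl, hCl0, hCl⟩ := exists_lower_order_le P K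
  obtain ⟨Cu, hCu0, hCu⟩ := exists_u_sq_le P K
  have hβ := P.β_pos
  have hκ := P.κ_pos
  obtain ⟨Ca, hCa⟩ : ∃ C, C = (1 + P.β * K + 3 / (P.β / K))
    * ((2 * (P.m : ℝ) ^ 2 * K ^ 4 + 8 * (K * K ^ P.m) ^ 2)
      + (2 * P.β ^ 2 * P.m ^ 2 * K ^ 2 + 4 * (P.γ - 1) ^ 2 * K ^ 2) * (1 + K ^ 2)) := ⟨_, rfl⟩
  obtain ⟨Cx, hCx⟩ : ∃ C, C = (1 + P.κ * K + 3 / (P.κ / K)) * (2 + 2 * (P.β * K) ^ 2) := ⟨_, rfl⟩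
  obtain ⟨Cb, hCb⟩ : ∃ C, C = (1 + P.κ * K + 3 / (P.κ / K)) * (16 * (K * K ^ P.m) ^ 2
    + 4 * (P.β * P.m - 2 * P.m * P.μ) ^ 2 * K ^ 2 + 8 * (P.γ - 1) ^ 2 * K ^ 2) := ⟨_, rfl⟩
  -- the weight of the quartic part absorbs the mixed term of the total energy
  obtain ⟨l, hl⟩ : ∃ l, l = 1 + (Cx + 1) / (P.β / K / 2) := ⟨_, rfl⟩
  obtain ⟨Cs, hCs⟩ : ∃ C, C = l * Ca + Cb := ⟨_, rfl⟩
  obtain ⟨d, hd⟩ : ∃ d, d = min 1 (P.κ / K / 2) := ⟨_, rfl⟩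
  let M := ((l + 1) * K + Cs * Cl * (2 * K + K / P.κ)) * Real.exp (4 * Cs * Cu * (2 * K))
  refine ⟨|6 * M| + |M / d|, by positivity, ?_⟩
  intro L T S y y' η η' h hη t ht
  have hK := h.K_pos
  have hyL := h.y_le_L
  have cη := hη.cont
  have hCa0 : 0 ≤ Ca := by rw [hCa]; positivity
  have hCx0 : 0 ≤ Cx := by rw [hCx]; positivity
  have hCb0 : 0 ≤ Cb := by rw [hCb]; positivity
  have hl1 : 1 ≤ l := by rw [hl]; exact le_add_of_nonneg_right (by positivity)
  have hCs0 : 0 ≤ Cs := by rw [hCs]; positivity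
  have hd0 : 0 < d := by rw [hd]; exact lt_min one_pos (by positivity)
  have hlb : Cx + 1 ≤ l * (P.β / K / 2) := by
    rw [hl, add_mul, div_mul_cancel₀ _ (by positivity)]
    have : 0 < P.β / K / 2 := by positivity
    linarith
  have cV1 := S.continuous_viscProd
  have cV2 := S.continuous_heatProd
  let J : ℝ → ℝ := fun s => ∫ x in y..L, η x ^ 2 * (l / 4 * S.u x s ^ 4 + 1 / 2 * S.w x s ^ 2)
  let D : ℝ → ℝ := fun s =>
    d * ∫ x in y..L, η x ^ 2 * (S.u x s ^ 2 * S.A x s ^ 2 + S.B x s ^ 2)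
  let g : ℝ → ℝ := fun s => 4 * Cs * Cu * (1 + S.viscProd s)
  let bb : ℝ → ℝ := fun s => Cs * (Cl * (1 + S.viscProd s + S.heatProd s))
  have cD : Continuous D := continuous_const.mul (continuous_intervalIntegral_param
    (f := fun x s => η x ^ 2 * (S.u x s ^ 2 * S.A x s ^ 2 + S.B x s ^ 2)) (by fun_prop) y L)
  have hθ : ∀ x s, S.u x s ^ 4 + (S.e x s - 1) ^ 2
      ≤ 6 * (l / 4 * S.u x s ^ 4 + 1 / 2 * S.w x s ^ 2) := by
    intro x s
    have a1 : (S.e x s - 1) ^ 2 ≤ 2 * S.w x s ^ 2 + 1 / 2 * S.u x s ^ 4 := by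
      have : S.e x s - 1 = S.w x s - 1 / 2 * S.u x s ^ 2 := by unfold w; ring
      rw [this]
      linarith [sq_nonneg (S.w x s + 1 / 2 * S.u x s ^ 2)]
    have a2 : 0 ≤ S.u x s ^ 4 := by positivity
    have a3 := mul_le_mul_of_nonneg_right hl1 a2
    have a4 := sq_nonneg (S.w x s)
    linarith
  have hmain := gronwall_dissipation (J := J) (D := D) (g := g) (b := bb) (T := T)
    (continuous_intervalIntegral_param (by fun_prop) y L).continuousOn
    (fun s hs => hasDerivAt_energy h hη l hs) cD (by fun_prop) (by fun_prop)
    (fun s _ => mul_nonneg hd0.le (integral_nonneg_of_continuous hyL fun x _ => by positivity))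
    (fun s _ => by
      have := S.viscProd_nonneg s
      positivity)
    (fun s _ => by
      have := S.viscProd_nonneg s
      have := S.heatProd_nonneg s
      positivity)
    (fun s hs => by
      have hs' : s ∈ Icc 0 T := ⟨hs.1.le, hs.2.le⟩
      have hb := mul_le_mul_of_nonneg_left (hCl L T S y h s hs') hCs0
      have cη' := hη.cont'
      have hV := S.viscProd_nonneg s
      have hpt := integral_mono_of_continuous (f := fun x =>
        (l * -((3 * (η x * S.u x s * S.A x s) + S.u x s * (η x * (P.m * S.v x s * S.b x s)
            + 2 * (η' x * S.rm x s) * S.u x s))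
          * (P.β / S.v x s * (η x * S.u x s * S.A x s)
            + η x * S.u x s * (P.β * P.m * S.b x s - S.π x s)))
        + -((2 * (η' x * S.rm x s) * S.w x s + η x * (S.u x s * S.A x s + S.B x s))
          * (η x * S.z x s))))
        (g := fun x => (-d) * (η x ^ 2 * (S.u x s ^ 2 * S.A x s ^ 2 + S.B x s ^ 2))
          + (Cs * (S.u x s ^ 4 + S.u x s ^ 2 + (S.e x s - 1) ^ 2 + (S.v x s - 1) ^ 2)
            + g s * (η x ^ 2 * (l / 4 * S.u x s ^ 4 + 1 / 2 * S.w x s ^ 2))))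
        hyL (by fun_prop) (by fun_prop) fun x hx => by
          have q1 := mul_le_mul_of_nonneg_left (h.quartic_flux_le hη hx hs') (by linarith : 0 ≤ l)
          have q2 := h.energy_flux_le hη hx hs'
          rw [← hCa] at q1
          rw [← hCx, ← hCb] at q2
          have e1 : 0 ≤ η x ^ 2 * (S.u x s ^ 2 * S.A x s ^ 2) := by positivity
          have e2 : 0 ≤ η x ^ 2 * S.B x s ^ 2 := by positivity
          have e3 := mul_le_mul_of_nonneg_right hlb e1
          have e4 := mul_le_mul_of_nonneg_right ((hd.trans_le (min_le_left _ _))) e1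
          have e5 := mul_le_mul_of_nonneg_right ((hd.trans_le (min_le_right _ _))) e2
          have e6 : η x ^ 2 * (S.u x s ^ 2 * (S.e x s - 1) ^ 2)
              ≤ 4 * Cu * (1 + S.viscProd s)
                * (η x ^ 2 * (l / 4 * S.u x s ^ 4 + 1 / 2 * S.w x s ^ 2)) := by
            have b1 := hCu L T S y h x hx s hs'
            have b2 : (S.e x s - 1) ^ 2 ≤ 4 * (l / 4 * S.u x s ^ 4 + 1 / 2 * S.w x s ^ 2) := by
              have a1 : (S.e x s - 1) ^ 2 ≤ 2 * S.w x s ^ 2 + 1 / 2 * S.u x s ^ 4 := by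
                have : S.e x s - 1 = S.w x s - 1 / 2 * S.u x s ^ 2 := by unfold w; ring
                rw [this]
                linarith [sq_nonneg (S.w x s + 1 / 2 * S.u x s ^ 2)]
              have a2 : 0 ≤ S.u x s ^ 4 := by positivity
              have a3 := mul_le_mul_of_nonneg_right hl1 a2
              linarith
            have b3 := mul_le_mul b1 b2 (sq_nonneg _) (by positivity)
            have b4 := mul_le_mul_of_nonneg_left b3 (sq_nonneg (η x))
            linarith
          have e7 := mul_le_mul_of_nonneg_left e6 hCs0
          have e8 : 0 ≤ Cs * (S.v x s - 1) ^ 2 := by positivity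
          have e9 : 0 ≤ l * Ca * (S.e x s - 1) ^ 2 := by positivity
          have e10 : Cs * (S.u x s ^ 4 + S.u x s ^ 2
              + η x ^ 2 * (S.u x s ^ 2 * (S.e x s - 1) ^ 2) + (S.e x s - 1) ^ 2)
              = (l * Ca + Cb) * (S.u x s ^ 4 + S.u x s ^ 2
              + η x ^ 2 * (S.u x s ^ 2 * (S.e x s - 1) ^ 2) + (S.e x s - 1) ^ 2) := by rw [hCs]
          simp only [g]
          linarith
      refine hpt.trans ?_
      rw [integral_add_of_continuous (by fun_prop) (by fun_prop),
        integral_add_of_continuous (by fun_prop) (by fun_prop),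
        intervalIntegral.integral_const_mul, intervalIntegral.integral_const_mul,
        intervalIntegral.integral_const_mul]
      simp only [D, bb, J]
      linarith) t ht
  have hJi : J 0 ≤ (l + 1) * K := by
    have h1 : J 0 ≤ ∫ x in y..L, (l + 1) * (S.u x 0 ^ 4 + (S.e x 0 - 1) ^ 2) := by
      refine integral_mono_of_continuous hyL (by fun_prop) (by fun_prop) fun x _ => ?_
      have f5 : η x ^ 2 ≤ 1 := pow_le_one₀ (hη.nonneg x) (hη.le_one x)
      have a0 : 0 ≤ l / 4 * S.u x 0 ^ 4 + 1 / 2 * S.w x 0 ^ 2 := by positivity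
      refine (mul_le_of_le_one_left a0 f5).trans ?_
      have a1 : S.w x 0 ^ 2 ≤ 2 * (S.u x 0 ^ 4 + (S.e x 0 - 1) ^ 2) := by
        unfold w
        have : 0 ≤ S.u x 0 ^ 4 := by positivity
        have := sq_nonneg (1 / 2 * S.u x 0 ^ 2 - (S.e x 0 - 1))
        linarith
      have a2 : 0 ≤ l * S.u x 0 ^ 4 := by positivity
      have a3 : 0 ≤ l * (S.e x 0 - 1) ^ 2 := by positivity
      linarith
    rw [intervalIntegral.integral_const_mul] at h1
    refine h1.trans (mul_le_mul_of_nonneg_left ?_ (by linarith))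
    exact (integral_le_integral_of_subinterval h.y_nonneg hyL le_rfl (by fun_prop)
      fun x _ => by positivity).trans h.init
  have hbb : ∫ s in (0 : ℝ)..T, bb s ≤ Cs * Cl * (2 * K + K / P.κ) := by
    simp only [bb]
    rw [intervalIntegral.integral_const_mul, intervalIntegral.integral_const_mul]
    exact (mul_le_mul_of_nonneg_left (mul_le_mul_of_nonneg_left
      (integral_one_add_production_le h) hCl0) hCs0).trans_eq (by ring)
  have hgg : ∫ s in (0 : ℝ)..t, g s ≤ 4 * Cs * Cu * (2 * K) := by
    simp only [g]
    rw [intervalIntegral.integral_const_mul]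
    refine mul_le_mul_of_nonneg_left ?_ (by positivity)
    rw [integral_add_of_continuous (by fun_prop) (by fun_prop)]
    simp only [intervalIntegral.integral_const, smul_eq_mul]
    linarith [(S.integral_viscProd_le ht).trans h.ent, h.T_le, ht.2]
  have hM : (J 0 + ∫ s in (0 : ℝ)..T, bb s) * Real.exp (∫ s in (0 : ℝ)..t, g s) ≤ M :=
    mul_le_mul (add_le_add hJi hbb) (Real.exp_le_exp.2 hgg) (Real.exp_pos _).le
      (by positivity)
  have hJ0 : 0 ≤ J t := integral_nonneg_of_continuous hyL fun x _ => by positivity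
  have hD0 : 0 ≤ ∫ s in (0 : ℝ)..t, D s := integral_nonneg_of_continuous ht.1 fun s _ =>
    mul_nonneg hd0.le (integral_nonneg_of_continuous hyL fun x _ => by positivity)
  constructor
  · have h1 : ∫ x in y..L, η x ^ 2 * (S.u x t ^ 4 + (S.e x t - 1) ^ 2) ≤ 6 * J t := by
      simp only [J]
      rw [← intervalIntegral.integral_const_mul]
      refine integral_mono_of_continuous hyL (by fun_prop) (by fun_prop) fun x _ => ?_
      have := mul_le_mul_of_nonneg_left (hθ x t) (sq_nonneg (η x))
      linarith
    have h2 := le_abs_self (6 * M)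
    have h3 := abs_nonneg (M / d)
    linarith
  · simp only [D] at hmain hD0
    rw [intervalIntegral.integral_const_mul] at hmain
    have h2 := le_abs_self (M / d)
    have h3 := abs_nonneg (6 * M)
    refine le_trans ?_ (le_add_of_nonneg_of_le h3 h2)
    rw [le_div_iff₀ hd0]
    linarith

/-- The first order estimates on the region where the weight is one. -/
theorem exists_first_order_le (P : FluidParams) (K : ℝ) : ∃ C, 0 ≤ C ∧
    ∀ (L T : ℝ) (S : Flow P L T) (y y' : ℝ) (η η' : ℝ → ℝ), S.Bounded K y →
    IsWeight K L y y' η η' →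
    (∀ t ∈ Icc 0 T, ∫ x in y'..L, (S.u x t ^ 4 + (S.e x t - 1) ^ 2 + (S.v x t - 1) ^ 2) ≤ C) ∧
    ∫ s in (0 : ℝ)..T, ∫ x in y'..L,
      (S.A x s ^ 2 + S.B x s ^ 2 + S.u x s ^ 2 * S.A x s ^ 2) ≤ C := by
  obtain ⟨C₁, hC₁0, hC₁⟩ := exists_velocity_energy_le P K
  obtain ⟨C₂, hC₂0, hC₂⟩ := exists_total_energy_le P K
  have hγ := P.γ_sub_pos
  refine ⟨C₁ + C₂ + |2 * (1 + K) * (K / (P.γ - 1))|, by positivity, ?_⟩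
  intro L T S y y' η η' h hη
  have hK := h.K_pos
  have cη := hη.cont
  have hy'L : y' ≤ L := by linarith [hη.le']
  have hT : T ∈ Icc 0 T := ⟨S.T_pos.le, le_rfl⟩
  have restrict : ∀ {f : ℝ → ℝ}, Continuous f → (∀ x, 0 ≤ f x) →
      ∫ x in y'..L, f x ≤ ∫ x in y..L, η x ^ 2 * f x := by
    intro f hf f0
    have h1 : ∫ x in y'..L, f x = ∫ x in y'..L, η x ^ 2 * f x := by
      refine intervalIntegral.integral_congr fun x hx => ?_
      rw [uIcc_of_le hy'L] at hx
      simp [hη.eq_one x hx]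
    rw [h1]
    exact integral_le_integral_of_subinterval hη.le hy'L le_rfl (by fun_prop)
      fun x _ => mul_nonneg (sq_nonneg _) (f0 x)
  have hM := le_abs_self (2 * (1 + K) * (K / (P.γ - 1)))
  constructor
  · intro t ht
    rw [integral_add_of_continuous (by fun_prop) (by fun_prop)]
    have h1 := (restrict (f := fun x => S.u x t ^ 4 + (S.e x t - 1) ^ 2) (by fun_prop)
      fun x => by positivity).trans (hC₂ L T S y y' η η' h hη t ht).1
    have h2 : ∫ x in y'..L, (S.v x t - 1) ^ 2 ≤ 2 * (1 + K) * (K / (P.γ - 1)) := by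
      have i1 : ∫ x in y'..L, (S.v x t - 1) ^ 2
          ≤ ∫ x in y'..L, 2 * (1 + K) * psi (S.v x t) := by
        refine integral_mono_of_continuous hy'L (by fun_prop) (by fun_prop) fun x hx => ?_
        have e3 := sq_sub_one_le_psi (S.v_pos x t)
        have e5 := mul_le_mul_of_nonneg_right (h.v_upper x ⟨hη.le.trans hx.1, hx.2⟩ t ht)
          (psi_nonneg (S.v_pos x t))
        linarith
      rw [intervalIntegral.integral_const_mul] at i1
      refine i1.trans (mul_le_mul_of_nonneg_left ?_ (by positivity))
      rw [le_div_iff₀ hγ, mul_comm]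
      exact (S.integral_psi_v_le ht (h.y_nonneg.trans hη.le) hy'L le_rfl).trans h.ent
    linarith
  · have h1 : ∫ s in (0 : ℝ)..T, ∫ x in y'..L,
        (S.A x s ^ 2 + S.B x s ^ 2 + S.u x s ^ 2 * S.A x s ^ 2)
        ≤ ∫ s in (0 : ℝ)..T, ((∫ x in y..L, η x ^ 2 * S.A x s ^ 2)
          + ∫ x in y..L, η x ^ 2 * (S.u x s ^ 2 * S.A x s ^ 2 + S.B x s ^ 2)) := by
      refine integral_mono_of_continuous S.T_pos.le
        (continuous_intervalIntegral_param (by fun_prop) _ _)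
        ((continuous_intervalIntegral_param (by fun_prop) _ _).add
          (continuous_intervalIntegral_param (by fun_prop) _ _)) fun s _ => ?_
      have e1 := restrict (f := fun x => S.A x s ^ 2) (by fun_prop) fun x => by positivity
      have e2 := restrict (f := fun x => S.u x s ^ 2 * S.A x s ^ 2 + S.B x s ^ 2) (by fun_prop)
        fun x => by positivity
      have e3 : ∫ x in y'..L, (S.A x s ^ 2 + S.B x s ^ 2 + S.u x s ^ 2 * S.A x s ^ 2)
          = (∫ x in y'..L, S.A x s ^ 2)
            + ∫ x in y'..L, (S.u x s ^ 2 * S.A x s ^ 2 + S.B x s ^ 2) := by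
        rw [← integral_add_of_continuous (by fun_prop) (by fun_prop)]
        congr 1; ext x; ring
      rw [e3]
      exact add_le_add e1 e2
    rw [integral_add_of_continuous (continuous_intervalIntegral_param (by fun_prop) _ _)
      (continuous_intervalIntegral_param (by fun_prop) _ _)] at h1
    have h3 := abs_nonneg (2 * (1 + K) * (K / (P.γ - 1)))
    linarith [hC₁ L T S y y' η η' h hη T hT, (hC₂ L T S y y' η η' h hη T hT).2]

end Flow

end SphNS

namespace SphNS
namespace Flow

variable {P : FluidParams} {L T : ℝ} {S : Flow P L T} {K y y' : ℝ} {η η' : ℝ → ℝ}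

/-! ### The effective viscous flux -/

/-- The sum of the squares whose space-time integrals are controlled by the first order
estimates. -/
noncomputable def low (S : Flow P L T) (x t : ℝ) : ℝ :=
  S.A x t ^ 2 + S.B x t ^ 2 + S.u x t ^ 4 + S.u x t ^ 2 + (S.e x t - 1) ^ 2 + (S.v x t - 1) ^ 2

@[fun_prop] theorem continuous_low (S : Flow P L T) {X : Type*} [TopologicalSpace X] {f g : X → ℝ}
    (hf : Continuous f) (hg : Continuous g) : Continuous fun q => S.low (f q) (g q) := by
  unfold low; fun_prop

theorem low_nonneg (S : Flow P L T) (x t : ℝ) : 0 ≤ S.low x t := by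
  unfold low; positivity

/-- The first order estimates on `[y,L]`. -/
structure FirstOrder (S : Flow P L T) (C y : ℝ) : Prop where
  nonneg : 0 ≤ C
  sup : ∀ t ∈ Icc 0 T, ∫ x in y..L, (S.u x t ^ 4 + (S.e x t - 1) ^ 2 + (S.v x t - 1) ^ 2) ≤ C
  int : ∫ s in (0 : ℝ)..T, ∫ x in y..L,
      (S.A x s ^ 2 + S.B x s ^ 2 + S.u x s ^ 2 * S.A x s ^ 2) ≤ C

theorem exists_integral_low_le (P : FluidParams) (K C₁ : ℝ) : ∃ C, 0 ≤ C ∧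
    ∀ (L T : ℝ) (S : Flow P L T) (y : ℝ), S.Bounded K y → S.FirstOrder C₁ y →
    ∫ s in (0 : ℝ)..T, ∫ x in y..L, S.low x s ≤ C := by
  obtain ⟨Cl, hCl0, hCl⟩ := exists_lower_order_le P K
  have hκ := P.κ_pos
  refine ⟨|C₁| + Cl * |2 * K + K / P.κ|, by positivity, ?_⟩
  intro L T S y h h1
  have cV1 := S.continuous_viscProd
  have cV2 := S.continuous_heatProd
  have hyL := h.y_le_L
  have i1 : ∫ s in (0 : ℝ)..T, ∫ x in y..L, S.low x s
      ≤ ∫ s in (0 : ℝ)..T, ((∫ x in y..L,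
        (S.A x s ^ 2 + S.B x s ^ 2 + S.u x s ^ 2 * S.A x s ^ 2))
        + Cl * (1 + S.viscProd s + S.heatProd s)) := by
    refine integral_mono_of_continuous S.T_pos.le
      (continuous_intervalIntegral_param (by fun_prop) _ _)
      ((continuous_intervalIntegral_param (by fun_prop) _ _).add (by fun_prop)) fun s hs => ?_
    refine le_trans ?_ (add_le_add le_rfl (hCl L T S y h s hs))
    rw [← integral_add_of_continuous (by fun_prop) (by fun_prop)]
    refine integral_mono_of_continuous hyL (by fun_prop) (by fun_prop) fun x _ => ?_
    have : 0 ≤ S.u x s ^ 2 * S.A x s ^ 2 := by positivity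
    unfold low
    linarith
  refine i1.trans ?_
  rw [integral_add_of_continuous (continuous_intervalIntegral_param (by fun_prop) _ _)
    (by fun_prop), intervalIntegral.integral_const_mul]
  exact add_le_add (h1.int.trans (le_abs_self _)) (mul_le_mul_of_nonneg_left
    ((integral_one_add_production_le h).trans (le_abs_self _)) hCl0)

theorem F_eq (S : Flow P L T) (x t : ℝ) :
    S.F x t = P.β / S.v x t * S.A x t + (P.β * P.m * S.b x t - S.π x t) := by
  have := (S.v_pos x t).ne'
  unfold F
  rw [S.W_eq_A]
  field_simp
  ring

section Pointwise

variable (h : S.Bounded K y) {x t : ℝ} (hx : x ∈ Icc y L) (ht : t ∈ Icc 0 T)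

include h hx ht

theorem Bounded.F_sq_le : S.F x t ^ 2 ≤ (2 * (P.β * K) ^ 2
    + 2 * (2 * P.β ^ 2 * P.m ^ 2 * K ^ 2 + 4 * (P.γ - 1) ^ 2 * K ^ 2)) * S.low x t := by
  have hβ := P.β_pos
  have a1 : (P.β / S.v x t) ^ 2 ≤ (P.β * K) ^ 2 :=
    pow_le_pow_left₀ (div_nonneg hβ.le (S.v_pos x t).le) (h.div_v_upper hx ht hβ.le) 2
  have a2 := mul_le_mul_of_nonneg_right a1 (sq_nonneg (S.A x t))
  have a3 := h.flux_lower_order_sq_le hx ht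
  have a4 : S.F x t ^ 2 ≤ 2 * ((P.β / S.v x t) ^ 2 * S.A x t ^ 2)
      + 2 * (P.β * P.m * S.b x t - S.π x t) ^ 2 := by
    rw [S.F_eq]
    linarith [sq_nonneg (P.β / S.v x t * S.A x t - (P.β * P.m * S.b x t - S.π x t))]
  set Cy := 2 * P.β ^ 2 * (P.m : ℝ) ^ 2 * K ^ 2 + 4 * (P.γ - 1) ^ 2 * K ^ 2
  have a5 : 0 ≤ (P.β * K) ^ 2 * (S.B x t ^ 2 + S.u x t ^ 4 + S.u x t ^ 2 + (S.e x t - 1) ^ 2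
      + (S.v x t - 1) ^ 2) := by positivity
  have a6 : 0 ≤ Cy * (S.A x t ^ 2 + S.B x t ^ 2 + S.u x t ^ 4) := by positivity
  unfold low
  linarith

/-- `W` as a function of the effective viscous flux. -/
theorem Bounded.W_sq_le : S.W x t ^ 2 ≤ 2 * (K / P.β) ^ 2 * (S.F x t ^ 2 + S.π x t ^ 2) := by
  have hβ := P.β_pos
  have h1 : S.W x t = S.v x t / P.β * (S.F x t + S.π x t) := by rw [S.W_eq_F]; ring
  have h2 : (S.v x t / P.β) ^ 2 ≤ (K / P.β) ^ 2 :=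
    pow_le_pow_left₀ (div_nonneg (S.v_pos x t).le hβ.le)
      (div_le_div_of_nonneg_right (h.v_upper x hx t ht) hβ.le) 2
  rw [h1, mul_pow]
  have h3 : (S.F x t + S.π x t) ^ 2 ≤ 2 * (S.F x t ^ 2 + S.π x t ^ 2) := by
    linarith [sq_nonneg (S.F x t - S.π x t)]
  have := mul_le_mul h2 h3 (sq_nonneg _) (sq_nonneg _)
  linarith

theorem Bounded.Q_le : S.Q x t ≤ (P.β * K + 2 * P.m * P.μ) * S.W x t ^ 2
    + (2 * P.m * P.μ + 2 * P.m * P.μ * P.n * K) * S.b x t ^ 2 := by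
  have hβ := P.β_pos
  have hμ := P.μ_pos
  have hn := P.n_pos
  have a1 := mul_le_mul_of_nonneg_right (h.div_v_upper hx ht hβ.le) (sq_nonneg (S.W x t))
  have a2 := mul_le_mul_of_nonneg_left (h.v_upper x hx t ht)
    (by positivity : 0 ≤ 2 * P.m * P.μ * P.n * S.b x t ^ 2)
  have a3 : 0 ≤ 2 * P.m * P.μ * (S.b x t + S.W x t) ^ 2 := by positivity
  have a4 : P.β * S.W x t ^ 2 / S.v x t = P.β / S.v x t * S.W x t ^ 2 := by ring
  unfold Q
  rw [a4]
  linarith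

end Pointwise

/-- A product estimate for the terms of third order, in terms of real numbers. -/
theorem cubic_le {F W p b Q c q₁ q₂ G : ℝ} (c0 : 0 ≤ c) (q₁0 : 0 ≤ q₁) (q₂0 : 0 ≤ q₂)
    (G0 : 0 ≤ G) (hWc : |W| ≤ c * (|F| + |p|)) (hW : W ^ 2 ≤ 2 * c ^ 2 * (F ^ 2 + p ^ 2))
    (hQ : Q ≤ q₁ * W ^ 2 + q₂ * b ^ 2) (hQ0 : 0 ≤ Q) :
    G * F * (W + (p + G) * W - Q) - 1 / 2 * W * F ^ 2
      ≤ (2 * G * c + 2 * G * q₁ * c ^ 2 + c) * (|F| * (F ^ 2 + p ^ 2))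
        + (2 * G * c + 2 * G ^ 2 * c + G * q₂) * (F ^ 2 + p ^ 2 + b ^ 4) := by
  have F2 : |F| ^ 2 = F ^ 2 := sq_abs F
  have p2 : |p| ^ 2 = p ^ 2 := sq_abs p
  have f0 := abs_nonneg F
  have p0 := abs_nonneg p
  have hfp : |F| * |p| ≤ 1 / 2 * (F ^ 2 + p ^ 2) := by
    linarith [sq_nonneg (|F| - |p|)]
  -- `|F W|` is of second order
  have hFW : |F| * |W| ≤ c * (2 * (F ^ 2 + p ^ 2)) := by
    have := mul_le_mul_of_nonneg_left hWc f0
    have e : |F| * (c * (|F| + |p|)) = c * (|F| ^ 2 + |F| * |p|) := by ring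
    rw [e, F2] at this
    refine this.trans (mul_le_mul_of_nonneg_left ?_ c0)
    linarith [sq_nonneg F, sq_nonneg p]
  have t1 : F * W ≤ |F| * |W| := by rw [← abs_mul]; exact le_abs_self _
  have t2 : F * (p * W) ≤ |F| * (c * (2 * (F ^ 2 + p ^ 2))) := by
    have e : F * (p * W) ≤ |F| * (|p| * |W|) := by
      rw [← abs_mul, ← abs_mul]; exact le_abs_self _
    refine e.trans (mul_le_mul_of_nonneg_left ?_ f0)
    have := mul_le_mul_of_nonneg_left hWc p0
    have e : |p| * (c * (|F| + |p|)) = c * (|F| * |p| + |p| ^ 2) := by ring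
    rw [e, p2] at this
    refine this.trans (mul_le_mul_of_nonneg_left ?_ c0)
    linarith [sq_nonneg F, sq_nonneg p]
  have t3 : -(F * Q) ≤ |F| * (q₁ * (2 * c ^ 2 * (F ^ 2 + p ^ 2))) + q₂ * (F ^ 2 + b ^ 4) := by
    have e1 : -(F * Q) ≤ |F| * Q := by
      have := mul_le_mul_of_nonneg_right (neg_abs_le F) hQ0
      linarith
    have e2 := mul_le_mul_of_nonneg_left hQ f0
    have e3 := mul_le_mul_of_nonneg_left (mul_le_mul_of_nonneg_left hW q₁0) f0
    have e4 : |F| * b ^ 2 ≤ F ^ 2 + b ^ 4 := by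
      rw [← F2]
      nlinarith [sq_nonneg (|F| - b ^ 2), sq_nonneg (|F|), sq_nonneg (b ^ 2)]
    have e5 := mul_le_mul_of_nonneg_left e4 q₂0
    linarith
  have t4 : -(1 / 2 * W * F ^ 2) ≤ |F| * (c * (F ^ 2 + p ^ 2)) := by
    have e1 : -(1 / 2 * W * F ^ 2) ≤ 1 / 2 * (|F| * (|F| * |W|)) := by
      have := mul_le_mul_of_nonneg_right (neg_abs_le W) (sq_nonneg F)
      have e : |F| * (|F| * |W|) = |W| * F ^ 2 := by rw [← F2]; ring
      rw [e]; linarith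
    have := mul_le_mul_of_nonneg_left hFW f0
    linarith
  have s1 : 0 ≤ F ^ 2 + p ^ 2 := by positivity
  have r1 := mul_le_mul_of_nonneg_left (t1.trans hFW) G0
  have r2 := mul_le_mul_of_nonneg_left (t1.trans hFW) (sq_nonneg G)
  have r3 := mul_le_mul_of_nonneg_left t2 G0
  have r4 := mul_le_mul_of_nonneg_left t3 G0
  have r5 : 0 ≤ (2 * G * c + 2 * G ^ 2 * c) * b ^ 4 := by positivity
  have r6 : 0 ≤ G * q₂ * p ^ 2 := by positivity
  linarith

/-- A bound for the terms of third order in the equation of the effective viscous flux. -/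
theorem exists_cubic_le (P : FluidParams) (K : ℝ) : ∃ C, 0 ≤ C ∧
    ∀ (L T : ℝ) (S : Flow P L T) (y : ℝ), S.Bounded K y → ∀ x ∈ Icc y L, ∀ t ∈ Icc 0 T,
    (P.γ - 1) * S.F x t * (S.W x t + S.p x t * S.W x t - S.Q x t) - 1 / 2 * S.W x t * S.F x t ^ 2
      ≤ C * (|S.F x t| * (S.F x t ^ 2 + ((S.e x t - 1) ^ 2 + (S.v x t - 1) ^ 2)) + S.low x t) := by
  have hβ := P.β_pos
  have hμ := P.μ_pos
  have hn := P.n_pos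
  have hγ := P.γ_sub_pos
  obtain ⟨c, hc⟩ : ∃ c, c = |K| / P.β := ⟨_, rfl⟩
  obtain ⟨q₁, hq₁⟩ : ∃ c, c = P.β * |K| + 2 * P.m * P.μ := ⟨_, rfl⟩
  obtain ⟨q₂, hq₂⟩ : ∃ c, c = 2 * P.m * P.μ + 2 * P.m * P.μ * P.n * |K| := ⟨_, rfl⟩
  obtain ⟨G, hG⟩ : ∃ G, G = P.γ - 1 := ⟨_, rfl⟩
  obtain ⟨Cπ, hCπ⟩ : ∃ C, C = 2 * (P.γ - 1) ^ 2 * K ^ 2 := ⟨_, rfl⟩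
  obtain ⟨CF, hCF⟩ : ∃ C, C = (2 * (P.β * K) ^ 2
    + 2 * (2 * P.β ^ 2 * P.m ^ 2 * K ^ 2 + 4 * (P.γ - 1) ^ 2 * K ^ 2)) := ⟨_, rfl⟩
  have c0 : 0 ≤ c := by rw [hc]; positivity
  have q₁0 : 0 ≤ q₁ := by rw [hq₁]; positivity
  have q₂0 : 0 ≤ q₂ := by rw [hq₂]; positivity
  have Cπ0 : 0 ≤ Cπ := by rw [hCπ]; positivity
  have CF0 : 0 ≤ CF := by rw [hCF]; positivity
  have G0 : 0 < G := hG ▸ hγ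
  -- the coefficients of `|F| (F² + π²)`, of `F² + π²` and of `b⁴`
  obtain ⟨k₁, hk₁⟩ : ∃ k, k = 2 * G * c + 2 * G * q₁ * c ^ 2 + c := ⟨_, rfl⟩
  obtain ⟨k₂, hk₂⟩ : ∃ k, k = 2 * G * c + 2 * G ^ 2 * c + G * q₂ := ⟨_, rfl⟩
  have k₁0 : 0 ≤ k₁ := by rw [hk₁]; positivity
  have k₂0 : 0 ≤ k₂ := by rw [hk₂]; positivity
  refine ⟨k₁ * (1 + Cπ) + k₂ * (CF + Cπ + K ^ 4), by positivity, ?_⟩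
  intro L T S y h x hx t ht
  have hK := h.K_pos
  have hQ := h.Q_le hx ht
  have hW := h.W_sq_le hx ht
  have hF := h.F_sq_le hx ht
  have hπ := h.π_sq_le hx ht
  have hb := h.b_sq_le hx ht
  have hlow := S.low_nonneg x t
  have hlow1 : S.u x t ^ 4 ≤ S.low x t := by
    have : 0 ≤ S.A x t ^ 2 + S.B x t ^ 2 + S.u x t ^ 2 + (S.e x t - 1) ^ 2
      + (S.v x t - 1) ^ 2 := by positivity
    unfold low; linarith
  have hlow2 : (S.e x t - 1) ^ 2 + (S.v x t - 1) ^ 2 ≤ S.low x t := by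
    have : 0 ≤ S.A x t ^ 2 + S.B x t ^ 2 + S.u x t ^ 4 + S.u x t ^ 2 := by positivity
    unfold low; linarith
  rw [← hCF] at hF
  rw [← hCπ] at hπ
  rw [S.p_eq]
  have hb4 : S.b x t ^ 4 ≤ K ^ 4 * S.u x t ^ 4 := by
    have := pow_le_pow_left₀ (sq_nonneg _) hb 2
    calc S.b x t ^ 4 = (S.b x t ^ 2) ^ 2 := by ring
      _ ≤ _ := this
      _ = _ := by ring
  have hKa : |K| = K := abs_of_pos hK
  rw [hKa] at hc hq₁ hq₂
  rw [← hq₁, ← hq₂] at hQ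
  rw [← hc] at hW
  have hWc : |S.W x t| ≤ c * (|S.F x t| + |S.π x t|) := by
    have e1 : S.W x t = S.v x t / P.β * (S.F x t + S.π x t) := by rw [S.W_eq_F]; ring
    rw [e1, abs_mul, abs_of_pos (div_pos (S.v_pos x t) hβ), hc]
    exact mul_le_mul (div_le_div_of_nonneg_right (h.v_upper x hx t ht) hβ.le) (abs_add_le _ _)
      (abs_nonneg _) (by positivity)
  have hN := cubic_le c0 q₁0 q₂0 G0.le hWc hW hQ (S.Q_nonneg x t)
  rw [← hk₁, ← hk₂] at hN
  rw [← hG]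
  generalize S.F x t = F at *
  generalize S.W x t = W at *
  generalize S.π x t = p at *
  generalize S.b x t = b at *
  generalize S.Q x t = Q at *
  have f0 := abs_nonneg F
  clear hW hQ hWc hc hq₁ hq₂ hk₁ hk₂ hb
  refine hN.trans ?_
  have u1 : |F| * (F ^ 2 + p ^ 2)
      ≤ (1 + Cπ) * (|F| * (F ^ 2 + ((S.e x t - 1) ^ 2 + (S.v x t - 1) ^ 2))) := by
    have e1 : F ^ 2 + p ^ 2 ≤ (1 + Cπ) * (F ^ 2 + ((S.e x t - 1) ^ 2 + (S.v x t - 1) ^ 2)) := by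
      have : 0 ≤ Cπ * F ^ 2 := by positivity
      nlinarith [sq_nonneg (S.e x t - 1), sq_nonneg (S.v x t - 1)]
    have := mul_le_mul_of_nonneg_left e1 f0
    linarith
  have u2 : F ^ 2 + p ^ 2 + b ^ 4 ≤ (CF + Cπ + K ^ 4) * S.low x t := by
    have e1 := mul_le_mul_of_nonneg_left hlow2 Cπ0
    have e2 := mul_le_mul_of_nonneg_left hlow1 (by positivity : 0 ≤ K ^ 4)
    linarith
  have v1 := mul_le_mul_of_nonneg_left u1 k₁0
  have v2 := mul_le_mul_of_nonneg_left u2 k₂0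
  have v3 : 0 ≤ k₁ * (1 + Cπ) * S.low x t := by positivity
  have v4 : 0 ≤ k₂ * (CF + Cπ + K ^ 4)
      * (|F| * (F ^ 2 + ((S.e x t - 1) ^ 2 + (S.v x t - 1) ^ 2))) := by positivity
  linarith

/-- The evolution of the weighted norm of the effective viscous flux. By
definition `vF` is the space derivative of `β rᵐ u` plus a function of class `C¹` in time, so that
the differentiation in time succeeds although `Dₓu` need not be differentiable in time. The time
derivative of the temperature is eliminated by means of the heat flux. -/
theorem hasDerivAt_effectiveFlux (h : S.Bounded K y) (hη : IsWeight K L y y' η η') {s : ℝ}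
    (hs : s ∈ Ioo 0 T) :
    HasDerivAt (fun s => ∫ x in y..L, 1 / 2 * (η x ^ 2 * S.v x s * S.F x s ^ 2))
      (∫ x in y..L,
        (-((1 * (η x * S.ut x s) + 2 * (η' x * S.rm x s) * S.F x s)
          * (P.β * (η x * S.ut x s) + η x * (P.β * P.m * (S.b x s * S.u x s)
            - (P.γ - 1) * (P.κ / S.v x s * S.B x s))))
        + η x ^ 2 * ((P.γ - 1) * S.F x s * (S.W x s + S.p x s * S.W x s - S.Q x s)
          - 1 / 2 * S.W x s * S.F x s ^ 2))) s := by
  have cη := hη.cont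
  have cη' := hη.cont'
  have hvF : ∀ x t, P.β * S.W x t - (P.γ - 1) * (S.e x t - S.v x t) = S.v x t * S.F x t := by
    intro x t
    have := (S.v_pos x t).ne'
    unfold F π; field_simp
  have hfun : (fun s => ∫ x in y..L, 1 / 2 * (η x ^ 2 * S.v x s * S.F x s ^ 2))
      = fun s => ∫ x in y..L, 1 / 2 * (η x ^ 2 / S.v x s
        * (P.β * S.W x s - (P.γ - 1) * (S.e x s - S.v x s)) ^ 2) := by
    funext s
    congr 1; funext x
    have := (S.v_pos x s).ne'
    rw [hvF]; field_simp
  rw [hfun]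
  refine (hasDerivAt_integral_weighted_sq
    (p := fun x t => P.β * (S.rm x t * S.u x t))
    (pt := fun x t => P.β * (S.rm x t * (S.ut x t + P.m * S.b x t * S.u x t)))
    (q := fun x t => -((P.γ - 1) * (S.e x t - S.v x t)))
    (qt := fun x t => -((P.γ - 1) * (S.et x t - S.W x t)))
    (w := fun x t => η x ^ 2 / S.v x t)
    (wt := fun x t => -(η x ^ 2 * S.W x t / S.v x t / S.v x t))
    (g := fun x t => P.β * S.W x t - (P.γ - 1) * (S.e x t - S.v x t))
    (S := fun x t => η x ^ 2 * S.F x t)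
    (Sx := fun x t => 2 * η x * η' x * S.F x t + η x ^ 2 * (S.ut x t / S.rm x t))
    h.y_le_L (by fun_prop) (by fun_prop) (by fun_prop) (by fun_prop) (by fun_prop) (by fun_prop)
    (by fun_prop) (by fun_prop) (fun x t => by
      have := (S.v_pos x t).ne'
      rw [hvF]; field_simp) (fun x hx t => ?_) (fun x hx t => ?_) (fun x _ t ht => ?_)
    (fun x _ t ht => ?_) (fun x _ t ht => ?_) (fun t τ => ?_) (fun t τ => ?_) hs).congr_deriv ?_
  · have hx0 : x ∈ Ioo 0 L := ⟨h.y_nonneg.trans_lt hx.1, hx.2⟩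
    refine ((S.U_dx hx0 t).const_mul P.β).congr_deriv ?_
    ring
  · have hx0 : x ∈ Ioo 0 L := ⟨h.y_nonneg.trans_lt hx.1, hx.2⟩
    refine (((hη.deriv x).pow 2).mul (S.F_dx hx0 t)).congr_deriv ?_
    simp
  · exact (S.U_dt x ht).const_mul P.β
  · exact (((S.e_dt x t ht).sub (S.v_dt x t ht)).const_mul (P.γ - 1)).neg
  · have v0 := (S.v_pos x t).ne'
    refine ((hasDerivAt_const t (η x ^ 2)).div (S.v_dt x t ht) v0).congr_deriv ?_
    field_simp
    ring
  · rcases hη.left with h0 | h0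
    · simp [h0, S.u_left]
    · simp [h0]
  · simp [S.u_right]
  · refine integral_eq_of_flux (Z := fun x => η x * (η x * (-(P.γ - 1) * (S.F x s * S.H x s))))
      h.y_le_L (by fun_prop) (by fun_prop) (by fun_prop) (fun x hx => ?_) ?_
    · have hx0 : x ∈ Ioo 0 L := ⟨h.y_nonneg.trans_lt hx.1, hx.2⟩
      refine ((hη.deriv x).mul ((hη.deriv x).mul
        (((S.F_dx hx0 s).mul (S.H_dx hx0 s)).const_mul (-(P.γ - 1))))).congr_deriv ?_
      have v0 := (S.v_pos x s).ne'
      have r0 := (S.rm_pos x s).ne'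
      simp only [Pi.mul_apply]
      rw [hvF, S.H_eq]
      field_simp
      ring
    · rw [IsWeight_flux_left hη (fun h0 => by simp [h0, S.H_left])]
      simp [S.H_right]

end Flow

end SphNS

namespace SphNS
namespace Flow

variable {P : FluidParams} {L T : ℝ} {S : Flow P L T} {K y y' : ℝ} {η η' : ℝ → ℝ}

/-- The cut-off is one on `[y',L]`. -/
theorem _root_.SphNS.IsWeight.integral_le (hη : IsWeight K L y y' η η') {f : ℝ → ℝ}
    (hf : Continuous f) (f0 : ∀ x, 0 ≤ f x) :
    ∫ x in y'..L, f x ≤ ∫ x in y..L, η x ^ 2 * f x := by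
  have cη := hη.cont
  have hy'L : y' ≤ L := by linarith [hη.le']
  have h1 : ∫ x in y'..L, f x = ∫ x in y'..L, η x ^ 2 * f x := by
    refine intervalIntegral.integral_congr fun x hx => ?_
    rw [uIcc_of_le hy'L] at hx
    simp [hη.eq_one x hx]
  rw [h1]
  exact integral_le_integral_of_subinterval hη.le hy'L le_rfl (by fun_prop)
    fun x _ => mul_nonneg (sq_nonneg _) (f0 x)

theorem _root_.SphNS.IsWeight.sq_le_one (hη : IsWeight K L y y' η η') (x : ℝ) : η x ^ 2 ≤ 1 :=
  pow_le_one₀ (hη.nonneg x) (hη.le_one x)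

theorem Bounded.inv_rm_sq_le (h : S.Bounded K y) {x t : ℝ} (hx : x ∈ Icc y L) (ht : t ∈ Icc 0 T) :
    1 / S.rm x t ^ 2 ≤ (K ^ P.m) ^ 2 := by
  have h0 := S.rm_pos x t
  have h1 : (K ^ P.m)⁻¹ ≤ S.rm x t := by
    rw [← inv_pow]
    exact pow_le_pow_left₀ (inv_pos.2 h.K_pos).le (h.r_lower x hx t ht) _
  have h2 : 1 / S.rm x t ≤ K ^ P.m := by
    rw [one_div]; exact (inv_le_comm₀ (pow_pos h.K_pos _) h0).1 h1
  calc 1 / S.rm x t ^ 2 = (1 / S.rm x t) ^ 2 := by rw [div_pow, one_pow]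
    _ ≤ _ := pow_le_pow_left₀ (by positivity) h2 2

/-- The supremum of the weighted effective viscous flux. -/
theorem exists_weighted_F_sq_le (P : FluidParams) (K : ℝ) : ∃ C, 0 ≤ C ∧
    ∀ (L T : ℝ) (S : Flow P L T) (y y' : ℝ) (η η' : ℝ → ℝ), S.Bounded K y →
    IsWeight K L y y' η η' → ∀ x ∈ Icc y L, ∀ t ∈ Icc 0 T,
    (η x * S.F x t) ^ 2
      ≤ C * ((∫ x in y..L, S.low x t) + ∫ x in y..L, η x ^ 2 * S.ut x t ^ 2) := by
  obtain ⟨CF, hCF⟩ : ∃ C, C = (2 * (P.β * K) ^ 2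
    + 2 * (2 * P.β ^ 2 * P.m ^ 2 * K ^ 2 + 4 * (P.γ - 1) ^ 2 * K ^ 2)) := ⟨_, rfl⟩
  have CF0 : 0 ≤ CF := by rw [hCF]; positivity
  refine ⟨4 * (CF + 2 * K ^ 2 * CF + 2 * (K ^ P.m) ^ 2), by positivity, ?_⟩
  intro L T S y y' η η' h hη x hx t ht
  have cη := hη.cont
  have cη' := hη.cont'
  have h1 := sq_le_integral_sq_add_sq_deriv (f := fun x => η x * S.F x t)
    (f' := fun x => η' x * S.F x t + η x * (S.ut x t / S.rm x t)) h.y_le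
    (by fun_prop) (by fun_prop) (fun z hz => (hη.deriv z).mul
      (S.F_dx ⟨h.y_nonneg.trans_lt hz.1, hz.2⟩ t)) hx
  refine h1.trans ?_
  rw [mul_assoc]
  refine mul_le_mul_of_nonneg_left ?_ (by norm_num)
  rw [← integral_add_of_continuous (by fun_prop) (by fun_prop),
    ← intervalIntegral.integral_const_mul]
  refine integral_mono_of_continuous h.y_le_L (by fun_prop) (by fun_prop) fun z hz => ?_
  have hF := h.F_sq_le hz ht
  rw [← hCF] at hF
  have e1 : (η z * S.F z t) ^ 2 ≤ CF * S.low z t := by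
    rw [mul_pow]
    exact (mul_le_of_le_one_left (sq_nonneg _) (hη.sq_le_one z)).trans hF
  have e2 : (η' z * S.F z t) ^ 2 ≤ K ^ 2 * (CF * S.low z t) := by
    rw [mul_pow]
    refine mul_le_mul ?_ hF (sq_nonneg _) (sq_nonneg _)
    rw [← sq_abs]
    exact pow_le_pow_left₀ (abs_nonneg _) (hη.bound z) 2
  have e3 : (η z * (S.ut z t / S.rm z t)) ^ 2 ≤ (K ^ P.m) ^ 2 * (η z ^ 2 * S.ut z t ^ 2) := by
    have := mul_le_mul_of_nonneg_right (h.inv_rm_sq_le hz ht)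
      (by positivity : 0 ≤ η z ^ 2 * S.ut z t ^ 2)
    refine le_trans (le_of_eq ?_) this
    rw [mul_pow, div_pow]; ring
  have e4 : (η' z * S.F z t + η z * (S.ut z t / S.rm z t)) ^ 2
      ≤ 2 * (η' z * S.F z t) ^ 2 + 2 * (η z * (S.ut z t / S.rm z t)) ^ 2 := by
    linarith [sq_nonneg (η' z * S.F z t - η z * (S.ut z t / S.rm z t))]
  have e5 : 0 ≤ (CF + 2 * K ^ 2 * CF) * (η z ^ 2 * S.ut z t ^ 2) := by positivity
  have e6 : 0 ≤ 2 * (K ^ P.m) ^ 2 * S.low z t := mul_nonneg (by positivity) (S.low_nonneg _ _)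
  linarith

/-- A pointwise bound for the integrand in `hasDerivAt_effectiveFlux`: the acceleration is dissipated,
the squares of first order are collected in `low`, and the cubic terms carry a factor `|η F|`. -/
theorem exists_effectiveFlux_pointwise_le (P : FluidParams) (K : ℝ) : ∃ C, 0 ≤ C ∧
    ∀ (L T : ℝ) (S : Flow P L T) (y y' : ℝ) (η η' : ℝ → ℝ), S.Bounded K y →
    IsWeight K L y y' η η' → ∀ x ∈ Icc y L, ∀ t ∈ Icc 0 T,
    -((1 * (η x * S.ut x t) + 2 * (η' x * S.rm x t) * S.F x t)
          * (P.β * (η x * S.ut x t) + η x * (P.β * P.m * (S.b x t * S.u x t)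
            - (P.γ - 1) * (P.κ / S.v x t * S.B x t))))
        + η x ^ 2 * ((P.γ - 1) * S.F x t * (S.W x t + S.p x t * S.W x t - S.Q x t)
          - 1 / 2 * S.W x t * S.F x t ^ 2)
      ≤ -(P.β / 2) * (η x ^ 2 * S.ut x t ^ 2) + C * S.low x t
        + C * (|η x * S.F x t| * |S.F x t|) * |η x * S.F x t|
        + C * (|η x * S.F x t| * ((S.e x t - 1) ^ 2 + (S.v x t - 1) ^ 2)) := by
  obtain ⟨Cc, hCc0, hCc⟩ := exists_cubic_le P K
  have hβ := P.β_pos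
  have hκ := P.κ_pos
  obtain ⟨CF, hCF⟩ : ∃ C, C = (2 * (P.β * K) ^ 2
    + 2 * (2 * P.β ^ 2 * P.m ^ 2 * K ^ 2 + 4 * (P.γ - 1) ^ 2 * K ^ 2)) := ⟨_, rfl⟩
  have CF0 : 0 ≤ CF := by rw [hCF]; positivity
  obtain ⟨c1, hc1⟩ : ∃ C, C = 1 + P.β + 3 / P.β := ⟨_, rfl⟩
  have c10 : 0 ≤ c1 := by rw [hc1]; positivity
  obtain ⟨c2, hc2⟩ : ∃ C, C = 4 * (K * K ^ P.m) ^ 2 * CF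
    + (2 * (P.β * P.m) ^ 2 * K ^ 2 + 2 * (P.γ - 1) ^ 2 * (P.κ * K) ^ 2) := ⟨_, rfl⟩
  have c20 : 0 ≤ c2 := by rw [hc2]; positivity
  refine ⟨Cc + c1 * c2, by positivity, ?_⟩
  intro L T S y y' η η' h hη x hx t ht
  have hF := h.F_sq_le hx ht
  rw [← hCF] at hF
  have hl0 := S.low_nonneg x t
  have y1 : (2 * (η' x * S.rm x t) * S.F x t) ^ 2 ≤ 4 * (K * K ^ P.m) ^ 2 * CF * S.low x t := by
    have := mul_le_mul (h.sq_cut_le hx ht hη) hF (sq_nonneg _) (sq_nonneg _)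
    calc _ = 4 * ((η' x * S.rm x t) ^ 2 * S.F x t ^ 2) := by ring
      _ ≤ 4 * _ := mul_le_mul_of_nonneg_left this (by norm_num)
      _ = _ := by ring
  have y2 : (η x * (P.β * P.m * (S.b x t * S.u x t)
      - (P.γ - 1) * (P.κ / S.v x t * S.B x t))) ^ 2
      ≤ (2 * (P.β * P.m) ^ 2 * K ^ 2 + 2 * (P.γ - 1) ^ 2 * (P.κ * K) ^ 2) * S.low x t := by
    rw [mul_pow]
    refine (mul_le_of_le_one_left (sq_nonneg _) (hη.sq_le_one x)).trans ?_
    have i1 : (S.b x t * S.u x t) ^ 2 ≤ K ^ 2 * S.u x t ^ 4 := by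
      have := mul_le_mul_of_nonneg_right (h.b_sq_le hx ht) (sq_nonneg (S.u x t))
      linarith
    have i2 : (P.κ / S.v x t) ^ 2 * S.B x t ^ 2 ≤ (P.κ * K) ^ 2 * S.B x t ^ 2 :=
      mul_le_mul_of_nonneg_right (pow_le_pow_left₀ (div_nonneg hκ.le (S.v_pos x t).le)
        (h.div_v_upper hx ht hκ.le) 2) (sq_nonneg _)
    have i3 := mul_le_mul_of_nonneg_left i1 (sq_nonneg (P.β * P.m))
    have i4 := mul_le_mul_of_nonneg_left i2 (sq_nonneg (P.γ - 1))
    have i5 := sq_nonneg (P.β * P.m * (S.b x t * S.u x t)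
      + (P.γ - 1) * (P.κ / S.v x t * S.B x t))
    have i6 : 0 ≤ 2 * (P.β * P.m) ^ 2 * K ^ 2 * (S.A x t ^ 2 + S.B x t ^ 2 + S.u x t ^ 2
      + (S.e x t - 1) ^ 2 + (S.v x t - 1) ^ 2) := by positivity
    have i7 : 0 ≤ 2 * (P.γ - 1) ^ 2 * (P.κ * K) ^ 2 * (S.A x t ^ 2 + S.u x t ^ 4 + S.u x t ^ 2
      + (S.e x t - 1) ^ 2 + (S.v x t - 1) ^ 2) := by positivity
    unfold low
    clear hF hCF hc1 hc2 y1 hl0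
    linarith
  have hco := neg_mul_le_of_coercive (d := 1) (X := η x * S.ut x t)
    (Y₁ := 2 * (η' x * S.rm x t) * S.F x t) (Y₂ := η x * (P.β * P.m * (S.b x t * S.u x t)
      - (P.γ - 1) * (P.κ / S.v x t * S.B x t))) hβ le_rfl le_rfl le_rfl (by norm_num)
  rw [← hc1] at hco
  have hcub := mul_le_mul_of_nonneg_left (hCc L T S y h x hx t ht) (sq_nonneg (η x))
  have hy := mul_le_mul_of_nonneg_left (add_le_add y1 y2) c10
  have hηa : |η x * S.F x t| = η x * |S.F x t| := by rw [abs_mul, abs_of_nonneg (hη.nonneg x)]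
  have z1 : η x ^ 2 * (Cc * S.low x t) ≤ Cc * S.low x t :=
    mul_le_of_le_one_left (by positivity) (hη.sq_le_one x)
  have z2 : (η x) ^ 2 * (|S.F x t| * ((S.e x t - 1) ^ 2 + (S.v x t - 1) ^ 2))
      ≤ |η x * S.F x t| * ((S.e x t - 1) ^ 2 + (S.v x t - 1) ^ 2) := by
    rw [hηa, ← mul_assoc]
    refine mul_le_mul_of_nonneg_right (mul_le_mul_of_nonneg_right ?_ (abs_nonneg _)) (by positivity)
    rw [sq]; exact mul_le_of_le_one_left (hη.nonneg x) (hη.le_one x)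
  have z3 : η x ^ 2 * (|S.F x t| * S.F x t ^ 2)
      = (|η x * S.F x t| * |S.F x t|) * |η x * S.F x t| := by
    rw [hηa, ← sq_abs (S.F x t)]; ring
  have z4 := mul_le_mul_of_nonneg_left z2 hCc0
  have z5 : 0 ≤ c1 * c2 * ((|η x * S.F x t| * |S.F x t|) * |η x * S.F x t|) := by positivity
  have z6 : 0 ≤ c1 * c2 * (|η x * S.F x t| * ((S.e x t - 1) ^ 2 + (S.v x t - 1) ^ 2)) := by
    positivity
  have z7 : c1 * (4 * (K * K ^ P.m) ^ 2 * CF * S.low x t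
    + (2 * (P.β * P.m) ^ 2 * K ^ 2 + 2 * (P.γ - 1) ^ 2 * (P.κ * K) ^ 2) * S.low x t)
    = c1 * c2 * S.low x t := by rw [hc2]; ring
  have z8 : η x ^ 2 * (Cc * (|S.F x t| * (S.F x t ^ 2 + ((S.e x t - 1) ^ 2 + (S.v x t - 1) ^ 2))
      + S.low x t)) = Cc * (η x ^ 2 * (|S.F x t| * S.F x t ^ 2))
      + Cc * ((η x) ^ 2 * (|S.F x t| * ((S.e x t - 1) ^ 2 + (S.v x t - 1) ^ 2)))
      + η x ^ 2 * (Cc * S.low x t) := by ring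
  rw [z8, z3] at hcub
  rw [z7] at hy
  rw [mul_pow (η x) (S.ut x t)] at hco
  clear hF hCF hc1 hc2 y1 y2 z2 z3 z7 z8 hηa
  linarith

/-- The differential inequality for `½ ∫ η² v F²`. In the cubic terms `|η F|` is replaced by its
supremum, which `exists_weighted_F_sq_le` bounds by the dissipation; a small part of the latter
suffices by Young's inequality. -/
theorem exists_effectiveFlux_deriv_le (P : FluidParams) (K C₁ : ℝ) : ∃ C, 0 ≤ C ∧
    ∀ (L T : ℝ) (S : Flow P L T) (y y' : ℝ) (η η' : ℝ → ℝ), S.Bounded K y → S.FirstOrder C₁ y →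
    IsWeight K L y y' η η' → ∀ s ∈ Icc 0 T,
    (∫ x in y..L,
        (-((1 * (η x * S.ut x s) + 2 * (η' x * S.rm x s) * S.F x s)
          * (P.β * (η x * S.ut x s) + η x * (P.β * P.m * (S.b x s * S.u x s)
            - (P.γ - 1) * (P.κ / S.v x s * S.B x s))))
        + η x ^ 2 * ((P.γ - 1) * S.F x s * (S.W x s + S.p x s * S.W x s - S.Q x s)
          - 1 / 2 * S.W x s * S.F x s ^ 2)))
      ≤ -(P.β / 4) * (∫ x in y..L, η x ^ 2 * S.ut x s ^ 2) + C * (1 + ∫ x in y..L, S.low x s)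
        + C * (∫ x in y..L, S.low x s)
          * ∫ x in y..L, 1 / 2 * (η x ^ 2 * S.v x s * S.F x s ^ 2) := by
  obtain ⟨Cp, hCp0, hCp⟩ := exists_effectiveFlux_pointwise_le P K
  obtain ⟨CR, hCR0, hCR⟩ := exists_weighted_F_sq_le P K
  have hβ := P.β_pos
  obtain ⟨CF, hCF⟩ : ∃ C, C = (2 * (P.β * K) ^ 2
    + 2 * (2 * P.β ^ 2 * P.m ^ 2 * K ^ 2 + 4 * (P.γ - 1) ^ 2 * K ^ 2)) := ⟨_, rfl⟩
  have CF0 : 0 ≤ CF := by rw [hCF]; positivity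
  -- with this choice the supremum of the flux is absorbed by the dissipation
  obtain ⟨δ, hδ⟩ : ∃ δ, δ = P.β / (8 * (Cp * CR + 1)) := ⟨_, rfl⟩
  have δ0 : 0 < δ := by rw [hδ]; positivity
  have hδ' : 2 * (Cp * (δ * CR)) ≤ P.β / 4 := by
    rw [hδ, show 2 * (Cp * (P.β / (8 * (Cp * CR + 1)) * CR))
      = P.β / 4 * ((Cp * CR) / (Cp * CR + 1)) by field_simp; ring]
    refine mul_le_of_le_one_right (by positivity) ?_
    rw [div_le_one (by positivity)]; linarith
  obtain ⟨ρ, hρ⟩ : ∃ ρ, ρ = Cp / (4 * δ) := ⟨_, rfl⟩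
  have ρ0 : 0 ≤ ρ := by rw [hρ]; positivity
  refine ⟨Cp + P.β / 4 + ρ * (2 * |K| * CF) + ρ * C₁ ^ 2, by positivity, ?_⟩
  intro L T S y y' η η' h h1 hη s hs
  have hK := h.K_pos
  have hyL := h.y_le_L
  have cη := hη.cont
  have cη' := hη.cont'
  obtain ⟨ℓ, hℓ⟩ : ∃ ℓ, ℓ = ∫ x in y..L, S.low x s := ⟨_, rfl⟩
  obtain ⟨N, hN⟩ : ∃ N, N = ∫ x in y..L, η x ^ 2 * S.ut x s ^ 2 := ⟨_, rfl⟩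
  obtain ⟨J, hJ⟩ : ∃ J, J = ∫ x in y..L, 1 / 2 * (η x ^ 2 * S.v x s * S.F x s ^ 2) := ⟨_, rfl⟩
  obtain ⟨Y, hY⟩ : ∃ Y, Y = ∫ x in y..L, |η x * S.F x s| * |S.F x s| := ⟨_, rfl⟩
  have ℓ0 : 0 ≤ ℓ := hℓ ▸ integral_nonneg_of_continuous hyL fun x _ => S.low_nonneg x s
  have N0 : 0 ≤ N := hN ▸ integral_nonneg_of_continuous hyL fun x _ => by positivity
  have J0 : 0 ≤ J := hJ ▸ integral_nonneg_of_continuous hyL fun x _ => by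
    have := S.v_pos x s
    positivity
  -- `R` bounds the supremum of `|η F|`
  obtain ⟨R, hR⟩ : ∃ R, R = √(CR * (ℓ + N)) := ⟨_, rfl⟩
  have R0 : 0 ≤ R := hR ▸ Real.sqrt_nonneg _
  have R2 : R ^ 2 = CR * (ℓ + N) := by rw [hR]; exact Real.sq_sqrt (by positivity)
  have hRx : ∀ x ∈ Icc y L, |η x * S.F x s| ≤ R := by
    intro x hx
    rw [hR]
    refine Real.abs_le_sqrt ?_
    rw [hℓ, hN]
    exact hCR L T S y y' η η' h hη x hx s hs
  -- the Cauchy–Schwarz inequality, one factor with and one without the cut-off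
  have hY2 : Y ^ 2 ≤ 2 * K * J * (CF * ℓ) := by
    rw [hY]
    refine (sq_integral_mul_le hyL (by fun_prop) (by fun_prop)).trans ?_
    refine mul_le_mul ?_ ?_ (integral_nonneg_of_continuous hyL fun x _ => by positivity)
      (by positivity)
    · rw [hJ, ← intervalIntegral.integral_const_mul]
      refine integral_mono_of_continuous hyL (by fun_prop) (by fun_prop) fun x hx => ?_
      have i1 : 1 ≤ K * S.v x s := by
        have := mul_le_mul_of_nonneg_left (h.v_lower x hx s hs) hK.le
        rwa [mul_inv_cancel₀ hK.ne'] at this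
      have := mul_le_mul_of_nonneg_right i1 (by positivity : 0 ≤ η x ^ 2 * S.F x s ^ 2)
      rw [sq_abs]
      linarith
    · rw [hℓ, ← intervalIntegral.integral_const_mul]
      refine integral_mono_of_continuous hyL (by fun_prop) (by fun_prop) fun x hx => ?_
      rw [sq_abs, hCF]
      exact h.F_sq_le hx hs
  have hτ : ∫ x in y..L, ((S.e x s - 1) ^ 2 + (S.v x s - 1) ^ 2) ≤ C₁ := by
    refine le_trans ?_ (h1.sup s hs)
    refine integral_mono_of_continuous hyL (by fun_prop) (by fun_prop) fun x hx => ?_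
    have : 0 ≤ S.u x s ^ 4 := by positivity
    linarith
  have hpt : (∫ x in y..L,
        (-((1 * (η x * S.ut x s) + 2 * (η' x * S.rm x s) * S.F x s)
          * (P.β * (η x * S.ut x s) + η x * (P.β * P.m * (S.b x s * S.u x s)
            - (P.γ - 1) * (P.κ / S.v x s * S.B x s))))
        + η x ^ 2 * ((P.γ - 1) * S.F x s * (S.W x s + S.p x s * S.W x s - S.Q x s)
          - 1 / 2 * S.W x s * S.F x s ^ 2)))
      ≤ ∫ x in y..L, (-(P.β / 2) * (η x ^ 2 * S.ut x s ^ 2) + Cp * S.low x s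
        + Cp * R * (|η x * S.F x s| * |S.F x s|)
        + Cp * R * ((S.e x s - 1) ^ 2 + (S.v x s - 1) ^ 2)) := by
    refine integral_mono_of_continuous hyL (by fun_prop) (by fun_prop) fun x hx => ?_
    have e := hCp L T S y y' η η' h hη x hx s hs
    have e1 := mul_le_mul_of_nonneg_left (hRx x hx)
      (by positivity : 0 ≤ Cp * (|η x * S.F x s| * |S.F x s|))
    have e2 := mul_le_mul_of_nonneg_left (mul_le_mul_of_nonneg_right (hRx x hx)
      (by positivity : 0 ≤ (S.e x s - 1) ^ 2 + (S.v x s - 1) ^ 2)) hCp0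
    linarith
  refine hpt.trans ?_
  rw [integral_add_of_continuous (by fun_prop) (by fun_prop),
    integral_add_of_continuous (by fun_prop) (by fun_prop),
    integral_add_of_continuous (by fun_prop) (by fun_prop),
    intervalIntegral.integral_const_mul, intervalIntegral.integral_const_mul,
    intervalIntegral.integral_const_mul, intervalIntegral.integral_const_mul,
    ← hℓ, ← hN, ← hJ, ← hY]
  have young : ∀ Z, Cp * R * Z ≤ Cp * (δ * R ^ 2) + ρ * Z ^ 2 := by
    intro Z
    have e : δ * R ^ 2 + Z ^ 2 / (4 * δ) - R * Z = δ * (R - Z / (2 * δ)) ^ 2 := by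
      field_simp; ring
    have e0 : 0 ≤ δ * (R - Z / (2 * δ)) ^ 2 := by positivity
    have e1 := mul_le_mul_of_nonneg_left (by linarith : R * Z ≤ δ * R ^ 2 + Z ^ 2 / (4 * δ)) hCp0
    have e2 : ρ * Z ^ 2 = Cp * (Z ^ 2 / (4 * δ)) := by rw [hρ]; ring
    rw [e2]; linarith
  have y1 := young Y
  have y2 := young C₁
  have y3 := mul_le_mul_of_nonneg_left hτ (mul_nonneg hCp0 R0)
  have y4 := mul_le_mul_of_nonneg_left hY2 ρ0
  rw [R2] at y1 y2
  have y5 := mul_le_mul_of_nonneg_right hδ' (add_nonneg ℓ0 N0)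
  have hKa : |K| = K := abs_of_pos hK
  rw [hKa]
  have t1 : 0 ≤ (Cp + P.β / 4 + ρ * C₁ ^ 2) * (ℓ * J) := by positivity
  have t2 : 0 ≤ ρ * (2 * K * CF) * (1 + ℓ) := by positivity
  have t3 : 0 ≤ ρ * C₁ ^ 2 * ℓ := by positivity
  have t4 : 0 ≤ Cp + P.β / 4 := by positivity
  clear hℓ hN hJ hY hR hRx hpt hCF hδ hρ hδ' hY2 hτ young hCp hCR
  linarith

/-- The second order estimates for the velocity, in the form of bounds for the effective viscous
flux and the acceleration. -/
structure SecondOrder (S : Flow P L T) (C y : ℝ) : Prop where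
  nonneg : 0 ≤ C
  sup : ∀ t ∈ Icc 0 T, t * ∫ x in y..L, S.F x t ^ 2 ≤ C
  int : ∫ s in (0 : ℝ)..T, s * ∫ x in y..L, S.ut x s ^ 2 ≤ C

/-- The weight `t` removes the initial value of `½ ∫ η² v F²`. Its derivative produces the unweighted
integral, which is bounded by `∫ low` and therefore integrable in time; the same function is the
rate in Gronwall's inequality. -/
theorem exists_secondOrder (P : FluidParams) (K C₁ : ℝ) : ∃ C, 0 ≤ C ∧
    ∀ (L T : ℝ) (S : Flow P L T) (y y' : ℝ) (η η' : ℝ → ℝ), S.Bounded K y → S.FirstOrder C₁ y →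
    IsWeight K L y y' η η' → S.SecondOrder C y' := by
  obtain ⟨Cd, hCd0, hCd⟩ := exists_effectiveFlux_deriv_le P K C₁
  obtain ⟨Cl, hCl0, hCl⟩ := exists_integral_low_le P K C₁
  have hβ := P.β_pos
  obtain ⟨CF, hCF⟩ : ∃ C, C = (2 * (P.β * K) ^ 2
    + 2 * (2 * P.β ^ 2 * P.m ^ 2 * K ^ 2 + 4 * (P.γ - 1) ^ 2 * K ^ 2)) := ⟨_, rfl⟩
  have CF0 : 0 ≤ CF := by rw [hCF]; positivity
  obtain ⟨M, hM⟩ : ∃ M, M = (|K| * Cd * (|K| + Cl) + |K| * CF * Cl) * Real.exp (Cd * Cl) :=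
    ⟨_, rfl⟩
  have M0 : 0 ≤ M := by rw [hM]; positivity
  refine ⟨2 * |K| * M + M / (P.β / 4), by positivity, ?_⟩
  intro L T S y y' η η' h h1 hη
  have hK := h.K_pos
  have hKa : |K| = K := abs_of_pos hK
  rw [hKa] at hM ⊢
  have hyL := h.y_le_L
  have hT := S.T_pos
  have cη := hη.cont
  have cη' := hη.cont'
  let J : ℝ → ℝ := fun s => ∫ x in y..L, 1 / 2 * (η x ^ 2 * S.v x s * S.F x s ^ 2)
  let ℓ : ℝ → ℝ := fun s => ∫ x in y..L, S.low x s
  let N : ℝ → ℝ := fun s => ∫ x in y..L, η x ^ 2 * S.ut x s ^ 2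
  have cJ : Continuous J := continuous_intervalIntegral_param
    (f := fun x s => 1 / 2 * (η x ^ 2 * S.v x s * S.F x s ^ 2)) (by fun_prop) y L
  have cℓ : Continuous ℓ := continuous_intervalIntegral_param
    (f := fun x s => S.low x s) (by fun_prop) y L
  have cN : Continuous N := continuous_intervalIntegral_param
    (f := fun x s => η x ^ 2 * S.ut x s ^ 2) (by fun_prop) y L
  have ℓ0 : ∀ s, 0 ≤ ℓ s := fun s => integral_nonneg_of_continuous hyL fun x _ => S.low_nonneg x s
  have N0 : ∀ s, 0 ≤ N s := fun s => integral_nonneg_of_continuous hyL fun x _ => by positivity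
  have J0 : ∀ s, 0 ≤ J s := fun s => integral_nonneg_of_continuous hyL fun x _ => by
    have := S.v_pos x s
    positivity
  have hJℓ : ∀ s ∈ Icc 0 T, J s ≤ K * CF * ℓ s := by
    intro s hs
    simp only [J, ℓ]
    rw [← intervalIntegral.integral_const_mul]
    refine integral_mono_of_continuous hyL (by fun_prop) (by fun_prop) fun x hx => ?_
    have e1 := h.F_sq_le hx hs
    rw [← hCF] at e1
    have e2 := mul_le_mul (h.v_upper x hx s hs) e1 (sq_nonneg _) hK.le
    have e3 : 0 ≤ S.v x s * S.F x s ^ 2 := mul_nonneg (S.v_pos x s).le (sq_nonneg _)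
    have e4 := mul_le_of_le_one_left e3 (hη.sq_le_one x)
    linarith
  have hmain := gronwall_dissipation (T := T) (J := fun s => s * J s)
    (D := fun s => P.β / 4 * (s * N s)) (g := fun s => Cd * ℓ s)
    (b := fun s => K * Cd * (1 + ℓ s) + K * CF * ℓ s)
    (by fun_prop) (fun s hs => (hasDerivAt_id s).mul (hasDerivAt_effectiveFlux h hη hs))
    (by fun_prop) (by fun_prop) (by fun_prop)
    (fun s hs => mul_nonneg (by positivity) (mul_nonneg hs.1 (N0 s)))
    (fun s _ => mul_nonneg hCd0 (ℓ0 s)) (fun s _ => by have := ℓ0 s; positivity)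
    (fun s hs => by
      have hs' : s ∈ Icc 0 T := ⟨hs.1.le, hs.2.le⟩
      have e1 := mul_le_mul_of_nonneg_left (hCd L T S y y' η η' h h1 hη s hs') hs'.1
      have e2 := hJℓ s hs'
      have e3 := mul_le_mul_of_nonneg_right (hs'.2.trans h.T_le)
        (mul_nonneg hCd0 (by linarith [ℓ0 s] : 0 ≤ 1 + ℓ s))
      change _ ≤ -(P.β / 4 * (s * N s)) + Cd * ℓ s * (s * J s)
        + (K * Cd * (1 + ℓ s) + K * CF * ℓ s)
      change s * _ ≤ s * (-(P.β / 4) * N s + Cd * (1 + ℓ s) + Cd * ℓ s * J s) at e1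
      change 1 * J s + s * _ ≤ _
      linarith)
  have hlint : ∀ t ∈ Icc 0 T, ∫ s in (0 : ℝ)..t, ℓ s ≤ Cl := fun t ht =>
    (integral_le_integral_of_subinterval le_rfl ht.1 ht.2 cℓ fun s _ => ℓ0 s).trans
      (hCl L T S y h h1)
  have hb : ∫ s in (0 : ℝ)..T, (K * Cd * (1 + ℓ s) + K * CF * ℓ s)
      ≤ K * Cd * (K + Cl) + K * CF * Cl := by
    have e1 := hlint T ⟨hT.le, le_rfl⟩
    rw [integral_add_of_continuous (by fun_prop) (by fun_prop),
      intervalIntegral.integral_const_mul, intervalIntegral.integral_const_mul,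
      integral_add_of_continuous (by fun_prop) (by fun_prop), intervalIntegral.integral_const,
      smul_eq_mul, mul_one]
    refine add_le_add (mul_le_mul_of_nonneg_left ?_ (by positivity))
      (mul_le_mul_of_nonneg_left e1 (by positivity))
    linarith [h.T_le]
  have hall : ∀ t ∈ Icc 0 T, t * J t + ∫ s in (0 : ℝ)..t, P.β / 4 * (s * N s) ≤ M := by
    intro t ht
    refine (hmain t ht).trans ?_
    rw [hM]
    refine mul_le_mul (by simpa using hb) (Real.exp_le_exp.2 ?_) (Real.exp_pos _).le
      (by positivity)
    rw [intervalIntegral.integral_const_mul]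
    exact mul_le_mul_of_nonneg_left (hlint t ht) hCd0
  have hMβ : 0 ≤ M / (P.β / 4) := by positivity
  refine ⟨by positivity, fun t ht => ?_, ?_⟩
  · have e1 := hall t ht
    have e2 : 0 ≤ ∫ s in (0 : ℝ)..t, P.β / 4 * (s * N s) :=
      integral_nonneg_of_continuous ht.1 fun s hs =>
        mul_nonneg (by positivity) (mul_nonneg hs.1 (N0 s))
    have e3 : ∫ x in y'..L, S.F x t ^ 2 ≤ 2 * K * J t := by
      refine (hη.integral_le (by fun_prop) fun x => sq_nonneg _).trans ?_
      simp only [J]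
      rw [← intervalIntegral.integral_const_mul]
      refine integral_mono_of_continuous hyL (by fun_prop) (by fun_prop) fun x hx => ?_
      have i1 : 1 ≤ K * S.v x t := by
        have := mul_le_mul_of_nonneg_left (h.v_lower x hx t ht) hK.le
        rwa [mul_inv_cancel₀ hK.ne'] at this
      have := mul_le_mul_of_nonneg_right i1 (by positivity : 0 ≤ η x ^ 2 * S.F x t ^ 2)
      linarith
    have e4 := mul_le_mul_of_nonneg_left e3 ht.1
    have e5 := mul_le_mul_of_nonneg_left (by linarith : t * J t ≤ M)
      (by positivity : 0 ≤ 2 * K)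
    linarith
  · have e1 := hall T ⟨hT.le, le_rfl⟩
    have e2 : 0 ≤ T * J T := mul_nonneg hT.le (J0 T)
    rw [intervalIntegral.integral_const_mul] at e1
    have e3 : ∫ s in (0 : ℝ)..T, s * ∫ x in y'..L, S.ut x s ^ 2 ≤ ∫ s in (0 : ℝ)..T, s * N s := by
      refine integral_mono_of_continuous hT.le (continuous_id.mul
        (continuous_intervalIntegral_param (by fun_prop) _ _)) (by fun_prop) fun s hs => ?_
      exact mul_le_mul_of_nonneg_left (hη.integral_le (by fun_prop) fun x => sq_nonneg _) hs.1
    have e4 : ∫ s in (0 : ℝ)..T, s * N s ≤ M / (P.β / 4) := by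
      rw [le_div_iff₀ (by positivity)]; linarith
    have : 0 ≤ 2 * K * M := by positivity
    linarith

end Flow

end SphNS

namespace SphNS
namespace Flow

variable {P : FluidParams} {L T : ℝ} {S : Flow P L T} {K y y' : ℝ} {η η' : ℝ → ℝ}

/-! ### The second order estimate for the temperature -/

/-- The sum of squares whose supremum is integrable in time after multiplication by `t`. -/
noncomputable def msq (S : Flow P L T) (x t : ℝ) : ℝ :=
  S.F x t ^ 2 + (S.e x t - 1) ^ 2 + (S.v x t - 1) ^ 2 + S.u x t ^ 2

@[fun_prop] theorem continuous_msq (S : Flow P L T) {X : Type*} [TopologicalSpace X] {f g : X → ℝ}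
    (hf : Continuous f) (hg : Continuous g) : Continuous fun q => S.msq (f q) (g q) := by
  unfold msq; fun_prop

theorem msq_nonneg (S : Flow P L T) (x t : ℝ) : 0 ≤ S.msq x t := by
  unfold msq; positivity

/-- Sobolev's inequality for each of the functions in `msq`, except `v - 1`, which is bounded. -/
theorem exists_mul_msq_le (P : FluidParams) (K : ℝ) : ∃ C, 0 ≤ C ∧
    ∀ (L T : ℝ) (S : Flow P L T) (y : ℝ), S.Bounded K y → ∀ x ∈ Icc y L, ∀ t ∈ Icc 0 T,
    t * S.msq x t
      ≤ C * (1 + (∫ z in y..L, S.low z t) + t * ∫ z in y..L, S.ut z t ^ 2) := by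
  obtain ⟨CF, hCF⟩ : ∃ C, C = (2 * (P.β * K) ^ 2
    + 2 * (2 * P.β ^ 2 * P.m ^ 2 * K ^ 2 + 4 * (P.γ - 1) ^ 2 * K ^ 2)) := ⟨_, rfl⟩
  have CF0 : 0 ≤ CF := by rw [hCF]; positivity
  obtain ⟨M, hM⟩ : ∃ M, M = (K ^ P.m) ^ 2 := ⟨_, rfl⟩
  have M0 : 0 ≤ M := by rw [hM]; positivity
  refine ⟨4 * M + |K| * (4 * CF + 8 * (1 + M) + K ^ 2), by positivity, ?_⟩
  intro L T S y h x hx t ht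
  have hK := h.K_pos
  rw [abs_of_pos hK]
  have hyL := h.y_le_L
  obtain ⟨ℓ, hℓ⟩ : ∃ ℓ, ℓ = ∫ x in y..L, S.low x t := ⟨_, rfl⟩
  obtain ⟨N, hN⟩ : ∃ N, N = ∫ x in y..L, S.ut x t ^ 2 := ⟨_, rfl⟩
  have ℓ0 : 0 ≤ ℓ := hℓ ▸ integral_nonneg_of_continuous hyL fun x _ => S.low_nonneg x t
  have N0 : 0 ≤ N := hN ▸ integral_nonneg_of_continuous hyL fun x _ => by positivity
  have hmem : ∀ {z}, z ∈ Ioo y L → z ∈ Ioo 0 L := fun hz => ⟨h.y_nonneg.trans_lt hz.1, hz.2⟩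
  have inv : ∀ z ∈ Icc y L, ∀ q : ℝ, (q / S.rm z t) ^ 2 ≤ M * q ^ 2 := by
    intro z hz q
    have := mul_le_mul_of_nonneg_right (h.inv_rm_sq_le hz ht) (sq_nonneg q)
    rw [hM, div_pow]
    exact (by ring : q ^ 2 / S.rm z t ^ 2 = 1 / S.rm z t ^ 2 * q ^ 2).trans_le this
  have dom : ∀ {f : ℝ → ℝ} {c : ℝ}, Continuous f → (∀ z ∈ Icc y L, f z ≤ c * S.low z t) →
      ∫ z in y..L, f z ≤ c * ℓ := by
    intro f c hf hle
    rw [hℓ, ← intervalIntegral.integral_const_mul]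
    exact integral_mono_of_continuous hyL hf (by fun_prop) hle
  have hF : S.F x t ^ 2 ≤ 4 * (CF * ℓ + M * N) := by
    have h1 := sq_le_integral_sq_add_sq_deriv (f := fun x => S.F x t)
      (f' := fun x => S.ut x t / S.rm x t) h.y_le
      (by fun_prop) (by fun_prop) (fun z hz => S.F_dx (hmem hz) t) hx
    refine h1.trans (mul_le_mul_of_nonneg_left ?_ (by norm_num))
    rw [integral_add_of_continuous (by fun_prop) (by fun_prop)]
    refine add_le_add (dom (by fun_prop) fun z hz => by rw [hCF]; exact h.F_sq_le hz ht) ?_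
    rw [hN, ← intervalIntegral.integral_const_mul]
    exact integral_mono_of_continuous hyL (by fun_prop) (by fun_prop) fun z hz => inv z hz _
  have hθ : (S.e x t - 1) ^ 2 ≤ 4 * ((1 + M) * ℓ) := by
    have h1 := sq_le_integral_sq_add_sq_deriv (f := fun x => S.e x t - 1)
      (f' := fun x => S.ex x t) h.y_le
      (by fun_prop) (by fun_prop) (fun z hz => (S.e_dx z (hmem hz) t).sub_const 1) hx
    refine h1.trans (mul_le_mul_of_nonneg_left (dom (by fun_prop) fun z hz => ?_) (by norm_num))
    have e1 := inv z hz (S.B z t)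
    have e2 : S.B z t / S.rm z t = S.ex z t := by
      unfold B; rw [mul_div_cancel_left₀ _ (S.rm_pos z t).ne']
    rw [e2] at e1
    have e3 : 0 ≤ M * (S.A z t ^ 2 + S.u z t ^ 4 + S.u z t ^ 2 + (S.e z t - 1) ^ 2
      + (S.v z t - 1) ^ 2) + (S.A z t ^ 2 + S.B z t ^ 2 + S.u z t ^ 4 + S.u z t ^ 2
      + (S.v z t - 1) ^ 2) := by positivity
    unfold low
    linarith
  have hu : S.u x t ^ 2 ≤ 4 * ((1 + M) * ℓ) := by
    have h1 := sq_le_integral_sq_add_sq_deriv (f := fun x => S.u x t)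
      (f' := fun x => S.ux x t) h.y_le
      (by fun_prop) (by fun_prop) (fun z hz => S.u_dx z (hmem hz) t) hx
    refine h1.trans (mul_le_mul_of_nonneg_left (dom (by fun_prop) fun z hz => ?_) (by norm_num))
    have e1 := inv z hz (S.A z t)
    have e2 : S.A z t / S.rm z t = S.ux z t := by
      unfold A; rw [mul_div_cancel_left₀ _ (S.rm_pos z t).ne']
    rw [e2] at e1
    have e3 : 0 ≤ M * (S.B z t ^ 2 + S.u z t ^ 4 + S.u z t ^ 2 + (S.e z t - 1) ^ 2
      + (S.v z t - 1) ^ 2) + (S.A z t ^ 2 + S.B z t ^ 2 + S.u z t ^ 4 + (S.e z t - 1) ^ 2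
      + (S.v z t - 1) ^ 2) := by positivity
    unfold low
    linarith
  have hv := h.v_sub_sq_le hx ht
  have htK : t ≤ K := ht.2.trans h.T_le
  have hsum : S.msq x t ≤ (4 * CF + 8 * (1 + M) + K ^ 2) * (1 + ℓ) + 4 * M * N := by
    have e1 : 0 ≤ K ^ 2 * ℓ + 4 * CF + 8 * (1 + M) := by positivity
    unfold msq
    linarith
  have s1 := mul_le_mul_of_nonneg_left hsum ht.1
  have s2 := mul_le_mul_of_nonneg_right htK
    (by positivity : 0 ≤ (4 * CF + 8 * (1 + M) + K ^ 2) * (1 + ℓ))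
  have s3 : 0 ≤ K * (4 * CF + 8 * (1 + M) + K ^ 2) * (t * N) :=
    mul_nonneg (by positivity) (mul_nonneg ht.1 N0)
  have s4 : 0 ≤ 4 * M * (1 + ℓ) := by positivity
  rw [← hℓ, ← hN]
  clear hF hθ hu hsum hM hCF hℓ hN inv dom
  linarith

/-- The evolution of the weighted norm `½ ∫ η² H Dₓe` of the temperature gradient. -/
theorem hasDerivAt_temperatureGradient (h : S.Bounded K y) (hη : IsWeight K L y y' η η') {s : ℝ}
    (hs : s ∈ Ioo 0 T) :
    HasDerivAt (fun s => ∫ x in y..L,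
        1 / 2 * (η x ^ 2 * (P.κ * S.rm x s ^ 2 / S.v x s) * S.ex x s ^ 2))
      (∫ x in y..L,
        (-((η x * S.et x s) * (η x * S.et x s + (2 * (η' x * S.rm x s) * (P.κ / S.v x s * S.B x s)
          + η x * (S.p x s * S.W x s - S.Q x s))))
        + η x ^ 2 * (P.κ / S.v x s * (P.m * S.b x s - 1 / 2 * (S.W x s / S.v x s)) * S.B x s ^ 2)))
      s := by
  have cη := hη.cont
  have cη' := hη.cont'
  refine (hasDerivAt_integral_weighted_sq
    (p := fun x t => S.e x t) (pt := fun x t => S.et x t) (q := fun _ _ => 0) (qt := fun _ _ => 0)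
    (w := fun x t => η x ^ 2 * (P.κ * S.rm x t ^ 2 / S.v x t))
    (wt := fun x t => η x ^ 2 * (P.κ * S.rm x t ^ 2 * (2 * P.m * S.b x t) / S.v x t
      - P.κ * S.rm x t ^ 2 * S.W x t / S.v x t / S.v x t))
    (g := fun x t => S.ex x t)
    (S := fun x t => η x ^ 2 * S.H x t)
    (Sx := fun x t => 2 * η x * η' x * S.H x t
      + η x ^ 2 * (S.et x t + S.p x t * S.W x t - S.Q x t))
    h.y_le_L (by fun_prop) (by fun_prop) (by fun_prop) (by fun_prop) (by fun_prop) (by fun_prop)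
    (by fun_prop) (by fun_prop) (fun x t => by unfold H rm; ring) (fun x hx t => ?_)
    (fun x hx t => ?_) (fun x _ t ht => S.e_dt x t ht)
    (fun x _ t ht => hasDerivAt_const _ _) (fun x _ t ht => ?_) (fun t τ => ?_) (fun t τ => ?_)
    hs).congr_deriv ?_
  · have hx0 : x ∈ Ioo 0 L := ⟨h.y_nonneg.trans_lt hx.1, hx.2⟩
    exact (S.e_dx x hx0 t).congr_deriv (by ring)
  · have hx0 : x ∈ Ioo 0 L := ⟨h.y_nonneg.trans_lt hx.1, hx.2⟩
    refine (((hη.deriv x).pow 2).mul (S.H_dx hx0 t)).congr_deriv ?_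
    simp
  · have v0 := (S.v_pos x t).ne'
    have r0 := (S.r_pos x t).ne'
    refine ((((((S.r_dt x t ht).pow P.m).pow 2).const_mul P.κ).div (S.v_dt x t ht) v0).const_mul
      (η x ^ 2)).congr_deriv ?_
    obtain ⟨k, hk⟩ : ∃ k, P.m = k + 1 := ⟨P.m - 1, by have := P.one_le_m; omega⟩
    unfold rm b
    rw [hk]
    simp only [Nat.add_sub_cancel, pow_succ, Pi.pow_apply, Pi.mul_apply]
    field_simp
    push_cast
    ring
  · rcases hη.left with h0 | h0
    · simp [h0, S.H_left]
    · simp [h0]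
  · simp [S.H_right]
  · congr 1; ext x
    have v0 := (S.v_pos x s).ne'
    rw [S.H_eq]
    unfold B
    field_simp
    ring

/-- A pointwise bound for `t²` times the integrand in `hasDerivAt_temperatureGradient`. All remaining
terms are quadratic in `msq` or products of `msq` with squares of first order; one factor `t msq` is
replaced by its bound `G`. -/
theorem exists_temperatureGradient_pointwise_le (P : FluidParams) (K : ℝ) : ∃ C, 0 ≤ C ∧
    ∀ (L T : ℝ) (S : Flow P L T) (y y' : ℝ) (η η' : ℝ → ℝ), S.Bounded K y →
    IsWeight K L y y' η η' → ∀ x ∈ Icc y L, ∀ t ∈ Icc 0 T, ∀ G, 1 ≤ G → t * S.msq x t ≤ G →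
    t ^ 2 * (-((η x * S.et x t) * (η x * S.et x t
          + (2 * (η' x * S.rm x t) * (P.κ / S.v x t * S.B x t)
          + η x * (S.p x t * S.W x t - S.Q x t))))
        + η x ^ 2 * (P.κ / S.v x t * (P.m * S.b x t - 1 / 2 * (S.W x t / S.v x t)) * S.B x t ^ 2))
      ≤ -(1 / 2) * (t ^ 2 * (η x ^ 2 * S.et x t ^ 2)) + C * S.low x t + C * G * (t * S.msq x t)
        + C * G * (t ^ 2 * (1 / 2 * (η x ^ 2 * (P.κ * S.rm x t ^ 2 / S.v x t) * S.ex x t ^ 2))) := by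
  have hβ := P.β_pos
  have hκ := P.κ_pos
  have hμ := P.μ_pos
  have hn := P.n_pos
  -- bounds for `W²`, `p²`, `Q` and `b²` by `msq`
  obtain ⟨cπ, hcπ⟩ : ∃ C, C = 2 * (P.γ - 1) ^ 2 * K ^ 2 := ⟨_, rfl⟩
  have cπ0 : 0 ≤ cπ := by rw [hcπ]; positivity
  obtain ⟨cW, hcW⟩ : ∃ C, C = 2 * (K / P.β) ^ 2 * (1 + cπ) := ⟨_, rfl⟩
  have cW0 : 0 ≤ cW := by rw [hcW]; positivity
  obtain ⟨cQ, hcQ⟩ : ∃ C, C = (P.β * |K| + 2 * P.m * P.μ) * cW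
    + (2 * P.m * P.μ + 2 * P.m * P.μ * P.n * |K|) * K ^ 2 := ⟨_, rfl⟩
  have cQ0 : 0 ≤ cQ := by rw [hcQ]; positivity
  obtain ⟨c1, hc1⟩ : ∃ C, C = 4 * (K * K ^ P.m) ^ 2 * (P.κ * K) ^ 2 := ⟨_, rfl⟩
  have c10 : 0 ≤ c1 := by rw [hc1]; positivity
  obtain ⟨c2, hc2⟩ : ∃ C, C = 2 * (cπ * (|K| + 1) * cW + cQ ^ 2) := ⟨_, rfl⟩
  have c20 : 0 ≤ c2 := by rw [hc2]; positivity
  obtain ⟨c3, hc3⟩ : ∃ C, C = P.κ * |K| * (P.m + 1 / 2 * |K|) := ⟨_, rfl⟩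
  have c30 : 0 ≤ c3 := by rw [hc3]; positivity
  refine ⟨K ^ 2 * c1 + c2 + c3 * |K| + c3 * ((K ^ 2 + cW) * (2 * |K| / P.κ)), by positivity, ?_⟩
  intro L T S y y' η η' h hη x hx t ht G hG hGm
  have hK := h.K_pos
  have hKa : |K| = K := abs_of_pos hK
  rw [hKa] at hcQ hc2 hc3 ⊢
  have htK : t ≤ K := ht.2.trans h.T_le
  have m0 := S.msq_nonneg x t
  have l0 := S.low_nonneg x t
  have hη1 := hη.sq_le_one x
  have hη0 := sq_nonneg (η x)
  have hv := S.v_pos x t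
  have hW : S.W x t ^ 2 ≤ cW * S.msq x t := by
    have e1 := h.W_sq_le hx ht
    have e2 := h.π_sq_le hx ht
    rw [← hcπ] at e2
    have e3 : S.F x t ^ 2 + S.π x t ^ 2 ≤ (1 + cπ) * S.msq x t := by
      have : 0 ≤ cπ * (S.F x t ^ 2 + S.u x t ^ 2) + ((S.e x t - 1) ^ 2 + (S.v x t - 1) ^ 2
        + S.u x t ^ 2) := by positivity
      unfold msq; linarith
    rw [hcW]
    refine e1.trans ?_
    rw [mul_assoc (2 * (K / P.β) ^ 2)]
    exact mul_le_mul_of_nonneg_left e3 (by positivity)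
  have hb : S.b x t ^ 2 ≤ K ^ 2 * S.msq x t := by
    refine (h.b_sq_le hx ht).trans (mul_le_mul_of_nonneg_left ?_ (sq_nonneg _))
    unfold msq
    have : 0 ≤ S.F x t ^ 2 + (S.e x t - 1) ^ 2 + (S.v x t - 1) ^ 2 := by positivity
    linarith
  have hp : S.p x t ^ 2 ≤ cπ * (1 + S.msq x t) := by
    refine (h.p_sq_le hx ht).trans ?_
    rw [← hcπ]
    refine mul_le_mul_of_nonneg_left ?_ cπ0
    unfold msq
    have : 0 ≤ S.F x t ^ 2 + (S.v x t - 1) ^ 2 + S.u x t ^ 2 := by positivity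
    linarith
  have hQ : S.Q x t ≤ cQ * S.msq x t := by
    have e1 := h.Q_le hx ht
    have e2 := mul_le_mul_of_nonneg_left hW (by positivity : 0 ≤ P.β * K + 2 * P.m * P.μ)
    have e3 := mul_le_mul_of_nonneg_left hb
      (by positivity : 0 ≤ 2 * P.m * P.μ + 2 * P.m * P.μ * P.n * K)
    rw [hcQ]; linarith
  have hQ2 : S.Q x t ^ 2 ≤ cQ ^ 2 * S.msq x t ^ 2 := by
    rw [← mul_pow]; exact pow_le_pow_left₀ (S.Q_nonneg x t) hQ 2
  have hpW : S.p x t ^ 2 * S.W x t ^ 2 ≤ cπ * cW * (S.msq x t + S.msq x t ^ 2) := by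
    have := mul_le_mul hp hW (sq_nonneg _) (by positivity)
    linarith
  have hd0 : 0 ≤ P.κ / S.v x t := div_nonneg hκ.le hv.le
  have hdK := h.div_v_upper hx ht hκ.le
  have hB : S.B x t ^ 2 ≤ S.low x t := by
    have : 0 ≤ S.A x t ^ 2 + S.u x t ^ 4 + S.u x t ^ 2 + (S.e x t - 1) ^ 2
      + (S.v x t - 1) ^ 2 := by positivity
    unfold low; linarith
  have y1 : (2 * (η' x * S.rm x t) * (P.κ / S.v x t * S.B x t)) ^ 2 ≤ c1 * S.low x t := by
    have e1 := pow_le_pow_left₀ hd0 hdK 2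
    have e2 := mul_le_mul e1 hB (sq_nonneg _) (sq_nonneg _)
    have e3 := mul_le_mul (h.sq_cut_le hx ht hη) e2 (by positivity) (sq_nonneg _)
    rw [hc1]
    linarith
  have y2 : (η x * (S.p x t * S.W x t - S.Q x t)) ^ 2
      ≤ 2 * (cπ * cW * (S.msq x t + S.msq x t ^ 2) + cQ ^ 2 * S.msq x t ^ 2) := by
    rw [mul_pow]
    refine (mul_le_of_le_one_left (sq_nonneg _) hη1).trans ?_
    have e1 := sq_nonneg (S.p x t * S.W x t + S.Q x t)
    linarith
  have t2 : t ^ 2 ≤ K ^ 2 := pow_le_pow_left₀ ht.1 htK 2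
  -- the flux terms
  have f1 : t ^ 2 * -((η x * S.et x t) * (η x * S.et x t
          + (2 * (η' x * S.rm x t) * (P.κ / S.v x t * S.B x t)
          + η x * (S.p x t * S.W x t - S.Q x t))))
      ≤ -(1 / 2) * (t ^ 2 * (η x ^ 2 * S.et x t ^ 2)) + K ^ 2 * c1 * S.low x t
        + c2 * G * (t * S.msq x t) := by
    generalize 2 * (η' x * S.rm x t) * (P.κ / S.v x t * S.B x t) = Y1 at *
    generalize η x * (S.p x t * S.W x t - S.Q x t) = Y2 at *
    have e1 : -((η x * S.et x t) * (η x * S.et x t + (Y1 + Y2)))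
        ≤ -(1 / 2) * (η x ^ 2 * S.et x t ^ 2) + Y1 ^ 2 + Y2 ^ 2 := by
      linarith [sq_nonneg (η x * S.et x t + (Y1 + Y2)), sq_nonneg (Y1 - Y2)]
    have e2 := mul_le_mul_of_nonneg_left e1 (sq_nonneg t)
    have e3 := mul_le_mul_of_nonneg_left y2 (sq_nonneg t)
    have e4 := mul_le_mul t2 y1 (sq_nonneg _) (sq_nonneg _)
    -- `t² msq (1 + msq)` is at most a multiple of `G t msq`
    have e5 : t ^ 2 * S.msq x t ≤ K * (G * (t * S.msq x t)) := by
      have i1 := mul_nonneg ht.1 m0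
      have i2 := mul_le_mul_of_nonneg_right htK i1
      have i3 := mul_le_mul_of_nonneg_right hG i1
      have i4 := mul_le_mul_of_nonneg_left i3 hK.le
      linarith
    have e6 : t ^ 2 * S.msq x t ^ 2 ≤ G * (t * S.msq x t) := by
      have := mul_le_mul_of_nonneg_right hGm (mul_nonneg ht.1 m0)
      linarith
    have e7 := mul_le_mul_of_nonneg_left e5 (by positivity : 0 ≤ 2 * (cπ * cW))
    have e8 := mul_le_mul_of_nonneg_left e6 (by positivity : 0 ≤ 2 * (cπ * cW) + 2 * cQ ^ 2)
    have e9 : 0 ≤ G * (t * S.msq x t) := mul_nonneg (by linarith) (mul_nonneg ht.1 m0)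
    rw [hc2]
    clear hW hb hp hQ hQ2 hpW hB y1 y2 hcW hcQ hcπ hc1 hc2 hc3 e1 e5 e6 hGm
    linarith
  -- the terms coming from the coefficient
  have f2 : t ^ 2 * (η x ^ 2 * (P.κ / S.v x t * (P.m * S.b x t - 1 / 2 * (S.W x t / S.v x t))
        * S.B x t ^ 2))
      ≤ c3 * K * S.low x t + c3 * ((K ^ 2 + cW) * (2 * K / P.κ)) * G
        * (t ^ 2 * (1 / 2 * (η x ^ 2 * (P.κ * S.rm x t ^ 2 / S.v x t) * S.ex x t ^ 2))) := by
    have e1 : t ^ 2 * (P.κ / S.v x t * (P.m * S.b x t - 1 / 2 * (S.W x t / S.v x t)))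
        ≤ c3 * (t + t ^ 2 * ((K ^ 2 + cW) * G)) := by
      have i0 : ∀ q : ℝ, t ^ 2 * |q| ≤ 1 / 2 * (t + t ^ 2 * (t * q ^ 2)) := by
        intro q
        have : 0 ≤ t * (1 - t * |q|) ^ 2 := mul_nonneg ht.1 (sq_nonneg _)
        rw [← sq_abs q]; linarith
      have ib : t ^ 2 * |S.b x t| ≤ t + t ^ 2 * ((K ^ 2 + cW) * G) := by
        have j1 := i0 (S.b x t)
        have j2 := mul_le_mul_of_nonneg_left hb ht.1
        have j3 := mul_le_mul_of_nonneg_left hGm (sq_nonneg K)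
        have j4 : t * S.b x t ^ 2 ≤ (K ^ 2 + cW) * G := by
          have : 0 ≤ cW * G := by positivity
          linarith
        have j5 := mul_le_mul_of_nonneg_left j4 (sq_nonneg t)
        have j6 : 0 ≤ t ^ 2 * ((K ^ 2 + cW) * G) := by positivity
        linarith [ht.1]
      have iW : t ^ 2 * |S.W x t| ≤ t + t ^ 2 * ((K ^ 2 + cW) * G) := by
        have j1 := i0 (S.W x t)
        have j2 := mul_le_mul_of_nonneg_left hW ht.1
        have j3 := mul_le_mul_of_nonneg_left hGm cW0
        have j4 : t * S.W x t ^ 2 ≤ (K ^ 2 + cW) * G := by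
          have : 0 ≤ K ^ 2 * G := by positivity
          linarith
        have j5 := mul_le_mul_of_nonneg_left j4 (sq_nonneg t)
        have j6 : 0 ≤ t ^ 2 * ((K ^ 2 + cW) * G) := by positivity
        linarith [ht.1]
      have k1 : P.m * S.b x t - 1 / 2 * (S.W x t / S.v x t)
          ≤ P.m * |S.b x t| + 1 / 2 * K * |S.W x t| := by
        have j1 := mul_le_mul_of_nonneg_left (le_abs_self (S.b x t))
          (Nat.cast_nonneg P.m : (0 : ℝ) ≤ P.m)
        have j2 : -(S.W x t / S.v x t) ≤ K * |S.W x t| := by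
          refine (neg_le_abs _).trans ?_
          rw [abs_div, abs_of_pos hv, mul_comm]
          exact h.div_v_upper hx ht (abs_nonneg _)
        linarith
      have k2 : P.κ / S.v x t * (P.m * S.b x t - 1 / 2 * (S.W x t / S.v x t))
          ≤ P.κ * K * (P.m * |S.b x t| + 1 / 2 * K * |S.W x t|) :=
        (mul_le_mul_of_nonneg_left k1 hd0).trans
          (mul_le_mul_of_nonneg_right hdK (by positivity))
      have k3 := mul_le_mul_of_nonneg_left k2 (sq_nonneg t)
      have k4 := mul_le_mul_of_nonneg_left ib (by positivity : 0 ≤ P.κ * K * P.m)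
      have k5 := mul_le_mul_of_nonneg_left iW (by positivity : 0 ≤ P.κ * K * (1 / 2 * K))
      rw [hc3]
      clear hW hb hp hQ hQ2 hpW hB y1 y2 hcW hcQ hcπ hc1 hc2 hc3 f1 k1 k2 ib iW i0
      linarith
    have e2 := mul_le_mul_of_nonneg_right e1 (by positivity : 0 ≤ η x ^ 2 * S.B x t ^ 2)
    have e3 : η x ^ 2 * S.B x t ^ 2 ≤ S.low x t :=
      (mul_le_of_le_one_left (sq_nonneg _) hη1).trans hB
    have e4 : η x ^ 2 * S.B x t ^ 2 ≤ (2 * K / P.κ)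
        * (1 / 2 * (η x ^ 2 * (P.κ * S.rm x t ^ 2 / S.v x t) * S.ex x t ^ 2)) := by
      have i1 : (2 * K / P.κ) * (1 / 2 * (η x ^ 2 * (P.κ * S.rm x t ^ 2 / S.v x t) * S.ex x t ^ 2))
          = K / S.v x t * (η x ^ 2 * S.B x t ^ 2) := by
        unfold B; field_simp
      rw [i1]
      have i2 : 1 ≤ K / S.v x t := by rw [le_div_iff₀ hv, one_mul]; exact h.v_upper x hx t ht
      exact le_mul_of_one_le_left (by positivity) i2
    have e5 := mul_le_mul_of_nonneg_left e3 (mul_nonneg c30 ht.1)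
    have e6 := mul_le_mul_of_nonneg_right htK (mul_nonneg c30 l0)
    have e7 := mul_le_mul_of_nonneg_left e4
      (by positivity : 0 ≤ c3 * (t ^ 2 * ((K ^ 2 + cW) * G)))
    clear hW hb hp hQ hQ2 hpW hB y1 y2 hcW hcQ hcπ hc1 hc2 hc3 f1 e1 e3 e4
    linarith
  have g1 : 0 ≤ (c2 + c3 * ((K ^ 2 + cW) * (2 * K / P.κ))) * S.low x t := by positivity
  have g2 : 0 ≤ (K ^ 2 * c1 + c3 * K + c3 * ((K ^ 2 + cW) * (2 * K / P.κ))) * G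
    * (t * S.msq x t) := mul_nonneg (by positivity) (mul_nonneg ht.1 m0)
  have g3 : 0 ≤ (K ^ 2 * c1 + c2 + c3 * K) * G * (t ^ 2 * (1 / 2 * (η x ^ 2
      * (P.κ * S.rm x t ^ 2 / S.v x t) * S.ex x t ^ 2))) := by positivity
  clear hW hb hp hQ hQ2 hpW hB y1 y2 hcW hcQ hcπ hc1 hc2 hc3
  linarith

/-- The second order estimates for the temperature. -/
structure ThirdOrder (S : Flow P L T) (C y : ℝ) : Prop where
  nonneg : 0 ≤ C
  sup : ∀ t ∈ Icc 0 T, t ^ 2 * ∫ x in y..L, S.B x t ^ 2 ≤ C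
  int : ∫ s in (0 : ℝ)..T, s ^ 2 * ∫ x in y..L, S.et x s ^ 2 ≤ C

/-- Gronwall's inequality with weight `t²`. The rate `G` bounds the supremum of `t msq`; it is
integrable in time by the estimates of first and second order. -/
theorem exists_thirdOrder (P : FluidParams) (K C₁ C₂ : ℝ) : ∃ C, 0 ≤ C ∧
    ∀ (L T : ℝ) (S : Flow P L T) (y y' : ℝ) (η η' : ℝ → ℝ), S.Bounded K y → S.FirstOrder C₁ y →
    S.SecondOrder C₂ y → IsWeight K L y y' η η' → S.ThirdOrder C y' := by
  obtain ⟨Cm, hCm0, hCm⟩ := exists_mul_msq_le P K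
  obtain ⟨Cp, hCp0, hCp⟩ := exists_temperatureGradient_pointwise_le P K
  obtain ⟨Cl, hCl0, hCl⟩ := exists_integral_low_le P K C₁
  have hκ := P.κ_pos
  obtain ⟨Mm, hMm⟩ : ∃ M, M = |C₂| + |K| * |C₁| + |K| * (2 * |K|) := ⟨_, rfl⟩
  have Mm0 : 0 ≤ Mm := by rw [hMm]; positivity
  obtain ⟨IG, hIG⟩ : ∃ M, M = (Cm + 1) * (|K| + Cl + |C₂|) := ⟨_, rfl⟩
  have IG0 : 0 ≤ IG := by rw [hIG]; positivity
  obtain ⟨c, hc⟩ : ∃ c, c = Cp + P.κ * K ^ 2 := ⟨_, rfl⟩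
  have c0 : 0 ≤ c := by rw [hc]; positivity
  obtain ⟨M, hM⟩ : ∃ M, M = (c * Cl + Cp * Mm * IG) * Real.exp (Cp * IG) := ⟨_, rfl⟩
  have M0 : 0 ≤ M := by rw [hM]; positivity
  refine ⟨2 * |K| / P.κ * M + 2 * M, by positivity, ?_⟩
  intro L T S y y' η η' h h1 h2 hη
  have hK := h.K_pos
  have hKa : |K| = K := abs_of_pos hK
  have hC1a : |C₁| = C₁ := abs_of_nonneg h1.nonneg
  have hC2a : |C₂| = C₂ := abs_of_nonneg h2.nonneg
  rw [hKa, hC1a, hC2a] at hMm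
  rw [hKa, hC2a] at hIG
  rw [hKa]
  have hyL := h.y_le_L
  have hT := S.T_pos
  have cη := hη.cont
  have cη' := hη.cont'
  let J : ℝ → ℝ := fun s => ∫ x in y..L,
    1 / 2 * (η x ^ 2 * (P.κ * S.rm x s ^ 2 / S.v x s) * S.ex x s ^ 2)
  let ℓ : ℝ → ℝ := fun s => ∫ x in y..L, S.low x s
  let N : ℝ → ℝ := fun s => ∫ x in y..L, S.ut x s ^ 2
  let E : ℝ → ℝ := fun s => ∫ x in y..L, η x ^ 2 * S.et x s ^ 2
  let G : ℝ → ℝ := fun s => (Cm + 1) * (1 + ℓ s + s * N s)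
  have cJ : Continuous J := continuous_intervalIntegral_param
    (f := fun x s => 1 / 2 * (η x ^ 2 * (P.κ * S.rm x s ^ 2 / S.v x s) * S.ex x s ^ 2))
    (by fun_prop) y L
  have cℓ : Continuous ℓ := continuous_intervalIntegral_param
    (f := fun x s => S.low x s) (by fun_prop) y L
  have cN : Continuous N := continuous_intervalIntegral_param
    (f := fun x s => S.ut x s ^ 2) (by fun_prop) y L
  have cE : Continuous E := continuous_intervalIntegral_param
    (f := fun x s => η x ^ 2 * S.et x s ^ 2) (by fun_prop) y L
  have cG : Continuous G := by fun_prop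
  have ℓ0 : ∀ s, 0 ≤ ℓ s := fun s => integral_nonneg_of_continuous hyL fun x _ => S.low_nonneg x s
  have N0 : ∀ s, 0 ≤ N s := fun s => integral_nonneg_of_continuous hyL fun x _ => by positivity
  have E0 : ∀ s, 0 ≤ E s := fun s => integral_nonneg_of_continuous hyL fun x _ => by positivity
  have J0 : ∀ s, 0 ≤ J s := fun s => integral_nonneg_of_continuous hyL fun x _ => by
    have := S.v_pos x s
    positivity
  have G1 : ∀ s ∈ Icc 0 T, 1 ≤ G s := by
    intro s hs
    have := mul_nonneg hs.1 (N0 s)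
    have h3 : 1 ≤ 1 + ℓ s + s * N s := by linarith [ℓ0 s]
    have h4 := mul_le_mul_of_nonneg_left h3 hCm0
    simp only [G]; linarith
  have hGm : ∀ x ∈ Icc y L, ∀ s ∈ Icc 0 T, s * S.msq x s ≤ G s := by
    intro x hx s hs
    refine (hCm L T S y h x hx s hs).trans ?_
    have := mul_nonneg hs.1 (N0 s)
    change Cm * (1 + ℓ s + s * N s) ≤ G s
    simp only [G]
    linarith [ℓ0 s]
  have hJℓ : ∀ s ∈ Icc 0 T, 2 * (s * J s) ≤ P.κ * K ^ 2 * ℓ s := by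
    intro s hs
    have e : J s ≤ 1 / 2 * (P.κ * K) * ℓ s := by
      simp only [J, ℓ]
      rw [← intervalIntegral.integral_const_mul]
      refine integral_mono_of_continuous hyL (by fun_prop) (by fun_prop) fun x hx => ?_
      have i1 : 1 / 2 * (η x ^ 2 * (P.κ * S.rm x s ^ 2 / S.v x s) * S.ex x s ^ 2)
          = 1 / 2 * (η x ^ 2 * (P.κ / S.v x s * S.B x s ^ 2)) := by unfold B; ring
      have i2 : S.B x s ^ 2 ≤ S.low x s := by
        have : 0 ≤ S.A x s ^ 2 + S.u x s ^ 4 + S.u x s ^ 2 + (S.e x s - 1) ^ 2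
          + (S.v x s - 1) ^ 2 := by positivity
        unfold low; linarith
      have i3 := mul_le_mul (h.div_v_upper hx hs hκ.le) i2 (sq_nonneg _) (by positivity)
      have i4 := mul_le_of_le_one_left (mul_nonneg (div_nonneg hκ.le (S.v_pos x s).le)
        (sq_nonneg (S.B x s))) (hη.sq_le_one x)
      rw [i1]; linarith
    have e2 := mul_le_mul (hs.2.trans h.T_le) e (J0 s) hK.le
    linarith
  have hmsq : ∀ s ∈ Icc 0 T, s * ∫ x in y..L, S.msq x s ≤ Mm := by
    intro s hs
    have e1 := h2.sup s hs
    have e2 : ∫ x in y..L, ((S.e x s - 1) ^ 2 + (S.v x s - 1) ^ 2) ≤ C₁ := by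
      refine le_trans ?_ (h1.sup s hs)
      refine integral_mono_of_continuous hyL (by fun_prop) (by fun_prop) fun x hx => ?_
      have : 0 ≤ S.u x s ^ 4 := by positivity
      linarith
    have e3 : ∫ x in y..L, S.u x s ^ 2 ≤ 2 * K :=
      (S.integral_u_sq_le hs h.y_nonneg hyL le_rfl).trans
        (mul_le_mul_of_nonneg_left h.ent (by norm_num))
    have e4 : ∫ x in y..L, S.msq x s = (∫ x in y..L, S.F x s ^ 2)
        + (∫ x in y..L, ((S.e x s - 1) ^ 2 + (S.v x s - 1) ^ 2)) + ∫ x in y..L, S.u x s ^ 2 := by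
      rw [← integral_add_of_continuous (by fun_prop) (by fun_prop),
        ← integral_add_of_continuous (by fun_prop) (by fun_prop)]
      congr 1; ext x; unfold msq; ring
    rw [e4, hMm]
    have sK := hs.2.trans h.T_le
    have e5 := mul_le_mul_of_nonneg_left e2 hs.1
    have e6 := mul_le_mul_of_nonneg_left e3 hs.1
    have e7 := mul_le_mul_of_nonneg_right sK h1.nonneg
    have e8 := mul_le_mul_of_nonneg_right sK (by positivity : 0 ≤ 2 * K)
    linarith
  have hmain := gronwall_dissipation (T := T) (J := fun s => s ^ 2 * J s)
    (D := fun s => 1 / 2 * (s ^ 2 * E s)) (g := fun s => Cp * G s)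
    (b := fun s => c * ℓ s + Cp * Mm * G s)
    (by fun_prop) (fun s hs => ((hasDerivAt_id s).pow 2).mul
      (hasDerivAt_temperatureGradient h hη hs))
    (by fun_prop) (by fun_prop) (by fun_prop)
    (fun s hs => mul_nonneg (by positivity) (mul_nonneg (sq_nonneg _) (E0 s)))
    (fun s hs => mul_nonneg hCp0 (zero_le_one.trans (G1 s hs)))
    (fun s hs => by have := ℓ0 s; have := zero_le_one.trans (G1 s hs); positivity)
    (fun s hs => by
      have hs' : s ∈ Icc 0 T := ⟨hs.1.le, hs.2.le⟩
      have hpt := integral_mono_of_continuous hyL (by fun_prop) (by fun_prop)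
        fun x hx => hCp L T S y y' η η' h hη x hx s hs' (G s) (G1 s hs') (hGm x hx s hs')
      rw [integral_add_of_continuous (by fun_prop) (by fun_prop),
        integral_add_of_continuous (by fun_prop) (by fun_prop),
        integral_add_of_continuous (by fun_prop) (by fun_prop),
        intervalIntegral.integral_const_mul, intervalIntegral.integral_const_mul,
        intervalIntegral.integral_const_mul, intervalIntegral.integral_const_mul,
        intervalIntegral.integral_const_mul, intervalIntegral.integral_const_mul,
        intervalIntegral.integral_const_mul, intervalIntegral.integral_const_mul] at hpt
      have e2 := hJℓ s hs'
      have e3 := mul_le_mul_of_nonneg_left (hmsq s hs')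
        (mul_nonneg hCp0 (zero_le_one.trans (G1 s hs')))
      change s ^ 2 * _ ≤ -(1 / 2) * (s ^ 2 * E s) + Cp * ℓ s + Cp * G s * (s * _)
        + Cp * G s * (s ^ 2 * J s) at hpt
      change _ ≤ -(1 / 2 * (s ^ 2 * E s)) + Cp * G s * (s ^ 2 * J s)
        + (c * ℓ s + Cp * Mm * G s)
      rw [hc]
      change (2 : ℕ) * s ^ (2 - 1) * 1 * J s + s ^ 2 * _ ≤ _
      simp only [Nat.cast_ofNat, Nat.add_one_sub_one, pow_one, mul_one]
      linarith)
  have hlint : ∫ s in (0 : ℝ)..T, ℓ s ≤ Cl := hCl L T S y h h1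
  have hGT : ∫ s in (0 : ℝ)..T, G s ≤ IG := by
    simp only [G]
    rw [intervalIntegral.integral_const_mul, hIG,
      integral_add_of_continuous (by fun_prop) (by fun_prop),
      integral_add_of_continuous (by fun_prop) (by fun_prop), intervalIntegral.integral_const,
      smul_eq_mul, mul_one]
    refine mul_le_mul_of_nonneg_left ?_ (by positivity)
    have := h2.int
    have := h.T_le
    linarith
  have hGt : ∀ t ∈ Icc 0 T, ∫ s in (0 : ℝ)..t, G s ≤ IG := fun t ht =>
    (integral_le_integral_of_subinterval le_rfl ht.1 ht.2 cG fun s hs =>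
      zero_le_one.trans (G1 s hs)).trans hGT
  have hb : ∫ s in (0 : ℝ)..T, (c * ℓ s + Cp * Mm * G s) ≤ c * Cl + Cp * Mm * IG := by
    rw [integral_add_of_continuous (by fun_prop) (by fun_prop),
      intervalIntegral.integral_const_mul, intervalIntegral.integral_const_mul]
    exact add_le_add (mul_le_mul_of_nonneg_left hlint (by positivity))
      (mul_le_mul_of_nonneg_left hGT (by positivity))
  have hall : ∀ t ∈ Icc 0 T, t ^ 2 * J t + ∫ s in (0 : ℝ)..t, 1 / 2 * (s ^ 2 * E s) ≤ M := by
    intro t ht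
    refine (hmain t ht).trans ?_
    rw [hM]
    refine mul_le_mul (by simpa using hb) (Real.exp_le_exp.2 ?_) (Real.exp_pos _).le
      (by positivity)
    rw [intervalIntegral.integral_const_mul]
    exact mul_le_mul_of_nonneg_left (hGt t ht) hCp0
  have hMβ : 0 ≤ 2 * K / P.κ * M := by positivity
  refine ⟨by positivity, fun t ht => ?_, ?_⟩
  · have e1 := hall t ht
    have e2 : 0 ≤ ∫ s in (0 : ℝ)..t, 1 / 2 * (s ^ 2 * E s) :=
      integral_nonneg_of_continuous ht.1 fun s hs =>
        mul_nonneg (by positivity) (mul_nonneg (sq_nonneg _) (E0 s))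
    have e3 : ∫ x in y'..L, S.B x t ^ 2 ≤ 2 * K / P.κ * J t := by
      refine (hη.integral_le (by fun_prop) fun x => sq_nonneg _).trans ?_
      simp only [J]
      rw [← intervalIntegral.integral_const_mul]
      refine integral_mono_of_continuous hyL (by fun_prop) (by fun_prop) fun x hx => ?_
      have hv := S.v_pos x t
      have i1 : (2 * K / P.κ) * (1 / 2 * (η x ^ 2 * (P.κ * S.rm x t ^ 2 / S.v x t) * S.ex x t ^ 2))
          = K / S.v x t * (η x ^ 2 * S.B x t ^ 2) := by
        unfold B; field_simp
      rw [i1]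
      have i2 : 1 ≤ K / S.v x t := by rw [le_div_iff₀ hv, one_mul]; exact h.v_upper x hx t ht
      exact le_mul_of_one_le_left (by positivity) i2
    have e4 := mul_le_mul_of_nonneg_left e3 (sq_nonneg t)
    have e5 := mul_le_mul_of_nonneg_left (by linarith : t ^ 2 * J t ≤ M)
      (by positivity : 0 ≤ 2 * K / P.κ)
    linarith
  · have e1 := hall T ⟨hT.le, le_rfl⟩
    have e2 : 0 ≤ T ^ 2 * J T := mul_nonneg (sq_nonneg _) (J0 T)
    rw [intervalIntegral.integral_const_mul] at e1
    have e3 : ∫ s in (0 : ℝ)..T, s ^ 2 * ∫ x in y'..L, S.et x s ^ 2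
        ≤ ∫ s in (0 : ℝ)..T, s ^ 2 * E s := by
      refine integral_mono_of_continuous hT.le ((continuous_id.pow 2).mul
        (continuous_intervalIntegral_param (by fun_prop) _ _)) (by fun_prop) fun s hs => ?_
      exact mul_le_mul_of_nonneg_left (hη.integral_le (by fun_prop) fun x => sq_nonneg _)
        (sq_nonneg _)
    linarith

end Flow

end SphNS

namespace SphNS

/-! ### Cut-off functions and the pointwise bounds -/

/-- Without a cut-off the estimates hold up to the boundary point `0`. -/
theorem isWeight_one {K L : ℝ} (hK : 0 ≤ K) (hL : 1 ≤ L) :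
    IsWeight K L 0 0 (fun _ => 1) (fun _ => 0) where
  cont := continuous_const
  cont' := continuous_const
  deriv := fun x => hasDerivAt_const x 1
  nonneg := fun _ => zero_le_one
  le_one := fun _ => le_rfl
  left := Or.inl rfl
  eq_one := fun _ _ => rfl
  bound := fun _ => by simpa using hK
  far := fun _ _ => rfl
  le := le_rfl
  le' := by linarith

theorem exists_deriv_smoothTransition_le : ∃ M, 0 ≤ M ∧ ∀ x, |deriv Real.smoothTransition x| ≤ M := by
  have hc : Continuous (deriv Real.smoothTransition) :=
    (Real.smoothTransition.contDiff (n := 1)).continuous_deriv le_rfl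
  obtain ⟨M, hM⟩ := (isCompact_Icc (a := (0 : ℝ)) (b := 1)).exists_bound_of_continuousOn
    hc.continuousOn
  refine ⟨|M|, abs_nonneg _, fun x => ?_⟩
  rcases lt_or_ge x 0 with h0 | h0
  · have : Real.smoothTransition =ᶠ[nhds x] fun _ => 0 := by
      filter_upwards [Iio_mem_nhds h0] with z hz
      exact Real.smoothTransition.zero_of_nonpos (le_of_lt hz)
    rw [this.deriv_eq]; simp
  · rcases lt_or_ge 1 x with h1 | h1
    · have : Real.smoothTransition =ᶠ[nhds x] fun _ => 1 := by
        filter_upwards [Ioi_mem_nhds h1] with z hz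
        exact Real.smoothTransition.one_of_one_le (le_of_lt hz)
      rw [this.deriv_eq]; simp
    · exact (hM x ⟨h0, h1⟩).trans (le_abs_self _)

/-- A smooth transition from `0` at `y` to `1` at `y'`; its derivative is of order `(y' - y)⁻¹`. -/
theorem exists_isWeight : ∃ M, 0 ≤ M ∧ ∀ (K L y y' : ℝ), y < y' → y' ≤ 1 → y' + 1 / 2 ≤ L →
    M / (y' - y) ≤ K → ∃ η η', IsWeight K L y y' η η' := by
  obtain ⟨M, hM0, hM⟩ := exists_deriv_smoothTransition_le
  refine ⟨M, hM0, fun K L y y' h h1 hL hK => ?_⟩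
  have hd : 0 < y' - y := sub_pos.2 h
  have hs : ContDiff ℝ 1 Real.smoothTransition := Real.smoothTransition.contDiff
  have hc : Continuous (deriv Real.smoothTransition) := hs.continuous_deriv le_rfl
  refine ⟨fun x => Real.smoothTransition ((x - y) / (y' - y)),
    fun x => deriv Real.smoothTransition ((x - y) / (y' - y)) * (1 / (y' - y)), ?_⟩
  constructor
  · exact hs.continuous.comp (by fun_prop)
  · exact (hc.comp (by fun_prop)).mul continuous_const
  · intro x
    exact (((hs.differentiable one_ne_zero) _).hasDerivAt).comp x
      (((hasDerivAt_id x).sub_const y).div_const (y' - y))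
  · exact fun x => Real.smoothTransition.nonneg _
  · exact fun x => Real.smoothTransition.le_one _
  · right; simp
  · intro x hx
    exact Real.smoothTransition.one_of_one_le ((one_le_div hd).2 (by linarith [hx.1]))
  · intro x
    rw [abs_mul, abs_of_pos (by positivity : 0 < 1 / (y' - y))]
    refine le_trans ?_ hK
    rw [div_eq_mul_one_div M]
    exact mul_le_mul_of_nonneg_right (hM _) (by positivity)
  · intro x hx
    have h2 : 1 < (x - y) / (y' - y) := (one_lt_div hd).2 (by linarith)
    have : Real.smoothTransition =ᶠ[nhds ((x - y) / (y' - y))] fun _ => 1 := by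
      filter_upwards [Ioi_mem_nhds h2] with z hz
      exact Real.smoothTransition.one_of_one_le (le_of_lt hz)
    rw [this.deriv_eq]; simp
  · exact h.le
  · exact hL

/-- An interpolation inequality: the supremum of `f²` costs only half of a derivative. -/
theorem mul_sq_le_integral {f f' : ℝ → ℝ} {y L s : ℝ} (hs : 0 ≤ s) (hyL : y + 1 / 2 ≤ L)
    (hf : Continuous f) (hf' : Continuous f') (hd : ∀ x ∈ Ioo y L, HasDerivAt f (f' x) x) {x : ℝ}
    (hx : x ∈ Icc y L) :
    s * f x ^ 2 ≤ (2 * s + 1) * (∫ z in y..L, f z ^ 2) + s ^ 2 * ∫ z in y..L, f' z ^ 2 := by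
  obtain ⟨c, hyc, hcL, hxc⟩ := exists_half_interval hyL hx
  have h1 := abs_le_integral_add_integral_deriv (f := fun z => f z ^ 2)
    (f' := fun z => 2 * f z * f' z) (c := c) (by fun_prop) (by fun_prop)
    (fun z hz => ((hd z ⟨hyc.trans_lt hz.1, hz.2.trans_le hcL⟩).pow 2).congr_deriv (by simp)) hxc
  simp only [abs_pow, sq_abs] at h1
  have h2 := mul_le_mul_of_nonneg_left h1 hs
  have h3 : s * (∫ z in c..c + 1 / 2, |2 * f z * f' z|)
      ≤ ∫ z in c..c + 1 / 2, (f z ^ 2 + s ^ 2 * f' z ^ 2) := by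
    rw [← intervalIntegral.integral_const_mul]
    refine integral_mono_of_continuous (by linarith) (by fun_prop) (by fun_prop) fun z _ => ?_
    rw [abs_mul, abs_mul, abs_two]
    have := sq_nonneg (|f z| - s * |f' z|)
    rw [← sq_abs (f z), ← sq_abs (f' z)]
    linarith
  have sub : ∀ {g : ℝ → ℝ}, Continuous g → (∀ z, 0 ≤ g z) →
      ∫ z in c..c + 1 / 2, g z ≤ ∫ z in y..L, g z := fun hg g0 =>
    integral_le_integral_of_subinterval hyc (by linarith) hcL hg fun z _ => g0 z
  have h4 := h3.trans (sub (g := fun z => f z ^ 2 + s ^ 2 * f' z ^ 2) (by fun_prop)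
    fun z => by positivity)
  have h5 := sub (g := fun z => f z ^ 2) (by fun_prop) fun z => by positivity
  rw [integral_add_of_continuous (by fun_prop) (by fun_prop),
    intervalIntegral.integral_const_mul] at h4
  have h6 := mul_le_mul_of_nonneg_left h5 hs
  linarith

theorem sigma_nonneg {t : ℝ} (ht : 0 ≤ t) : 0 ≤ sigma t := le_min zero_le_one ht

theorem sigma_le_one (t : ℝ) : sigma t ≤ 1 := min_le_left _ _

theorem sigma_le (t : ℝ) : sigma t ≤ t := min_le_right _ _

theorem continuous_sigma : Continuous sigma := continuous_const.min continuous_id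

namespace Flow

variable {P : FluidParams} {L T : ℝ} {S : Flow P L T} {K y y' : ℝ}

/-- The estimates of all orders on `[y,L]`, in terms of `σ`. -/
structure Regular (S : Flow P L T) (C y : ℝ) : Prop where
  sup : ∀ t ∈ Icc 0 T, (∫ x in y..L, (S.u x t ^ 4 + (S.e x t - 1) ^ 2 + (S.v x t - 1) ^ 2))
    + sigma t * (∫ x in y..L, S.A x t ^ 2) + sigma t ^ 2 * (∫ x in y..L, S.B x t ^ 2) ≤ C
  int : (∫ s in (0 : ℝ)..T, ∫ x in y..L,
        (S.A x s ^ 2 + S.B x s ^ 2 + S.u x s ^ 2 * S.A x s ^ 2))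
    + (∫ s in (0 : ℝ)..T, sigma s * ∫ x in y..L, S.ut x s ^ 2)
    + (∫ s in (0 : ℝ)..T, sigma s ^ 2 * ∫ x in y..L, S.et x s ^ 2) ≤ C
  u_le : ∀ x ∈ Icc y L, ∀ t ∈ Icc 0 T, √(sigma t) * S.u x t ^ 2 ≤ C
  e_le : ∀ x ∈ Icc y L, ∀ t ∈ Icc 0 T, sigma t * (S.e x t - 1) ^ 2 ≤ C

theorem FirstOrder.mono {C C' : ℝ} (h : S.FirstOrder C y) (hy : y ≤ y') (hL : y' ≤ L)
    (hC : C ≤ C') : S.FirstOrder C' y' where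
  nonneg := h.nonneg.trans hC
  sup := fun t ht => (integral_le_integral_of_subinterval hy hL le_rfl (by fun_prop)
    fun x _ => by positivity).trans ((h.sup t ht).trans hC)
  int := by
    refine le_trans ?_ (h.int.trans hC)
    refine integral_mono_of_continuous S.T_pos.le (continuous_intervalIntegral_param
      (by fun_prop) _ _) (continuous_intervalIntegral_param (by fun_prop) _ _) fun s _ => ?_
    exact integral_le_integral_of_subinterval hy hL le_rfl (by fun_prop) fun x _ => by positivity

theorem SecondOrder.mono {C C' : ℝ} (h : S.SecondOrder C y) (hy : y ≤ y') (hL : y' ≤ L)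
    (hC : C ≤ C') : S.SecondOrder C' y' where
  nonneg := h.nonneg.trans hC
  sup := fun t ht => (mul_le_mul_of_nonneg_left (integral_le_integral_of_subinterval hy hL le_rfl
    (by fun_prop) fun x _ => by positivity) ht.1).trans ((h.sup t ht).trans hC)
  int := by
    refine le_trans ?_ (h.int.trans hC)
    refine integral_mono_of_continuous S.T_pos.le (continuous_id.mul
      (continuous_intervalIntegral_param (by fun_prop) _ _)) (continuous_id.mul
      (continuous_intervalIntegral_param (by fun_prop) _ _)) fun s hs => ?_
    exact mul_le_mul_of_nonneg_left (integral_le_integral_of_subinterval hy hL le_rfl (by fun_prop)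
      fun x _ => by positivity) hs.1

theorem ThirdOrder.mono {C C' : ℝ} (h : S.ThirdOrder C y) (hC : C ≤ C') : S.ThirdOrder C' y where
  nonneg := h.nonneg.trans hC
  sup := fun t ht => (h.sup t ht).trans hC
  int := h.int.trans hC

/-- The estimates on three nested regions; every step loses a part of the region. -/
theorem exists_orders (P : FluidParams) (K : ℝ) : ∃ C, 0 ≤ C ∧
    ∀ (L T : ℝ) (S : Flow P L T) (y₀ y₁ y₂ y₃ : ℝ) (η₁ η₁' η₂ η₂' η₃ η₃' : ℝ → ℝ),
    S.Bounded K y₀ → IsWeight K L y₀ y₁ η₁ η₁' → IsWeight K L y₁ y₂ η₂ η₂' →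
    IsWeight K L y₂ y₃ η₃ η₃' → S.FirstOrder C y₃ ∧ S.SecondOrder C y₃ ∧ S.ThirdOrder C y₃ := by
  obtain ⟨C₁, hC₁0, hC₁⟩ := exists_first_order_le P K
  obtain ⟨C₂, hC₂0, hC₂⟩ := exists_secondOrder P K C₁
  obtain ⟨C₃, hC₃0, hC₃⟩ := exists_thirdOrder P K C₁ C₂
  refine ⟨C₁ + C₂ + C₃, by positivity, ?_⟩
  intro L T S y₀ y₁ y₂ y₃ η₁ η₁' η₂ η₂' η₃ η₃' h w₁ w₂ w₃
  have f1 := hC₁ L T S y₀ y₁ η₁ η₁' h w₁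
  have F1 : S.FirstOrder C₁ y₁ := ⟨hC₁0, f1.1, f1.2⟩
  have h1 := h.mono w₁.le w₁.le'
  have F2 := hC₂ L T S y₁ y₂ η₂ η₂' h1 F1 w₂
  have h2 := h1.mono w₂.le w₂.le'
  have e2 : y₂ ≤ L := h2.y_le_L
  have e3 : y₃ ≤ L := by linarith [w₃.le']
  have F1' := F1.mono w₂.le e2 le_rfl
  have F3 := hC₃ L T S y₂ y₃ η₃ η₃' h2 F1' F2 w₃
  exact ⟨F1'.mono w₃.le e3 (by linarith), F2.mono w₃.le e3 (by linarith), F3.mono (by linarith)⟩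

/-- The gradient of `u` is recovered from `F`, and the pointwise bounds of `u` and `e` follow from
those of the gradients by interpolation. -/
theorem exists_regular (P : FluidParams) (K C : ℝ) : ∃ C', 0 ≤ C' ∧
    ∀ (L T : ℝ) (S : Flow P L T) (y : ℝ), S.Bounded K y → S.FirstOrder C y → S.SecondOrder C y →
    S.ThirdOrder C y → S.Regular C' y := by
  obtain ⟨cπ, hcπ⟩ : ∃ C, C = 2 * (P.γ - 1) ^ 2 * K ^ 2 := ⟨_, rfl⟩
  have cπ0 : 0 ≤ cπ := by rw [hcπ]; positivity
  obtain ⟨cW, hcW⟩ : ∃ C, C = 2 * (K / P.β) ^ 2 := ⟨_, rfl⟩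
  have cW0 : 0 ≤ cW := by rw [hcW]; positivity
  obtain ⟨CA, hCA⟩ : ∃ X, X = 2 * cW * |C| + |K| * (2 * cW * cπ * |C| + 2 * P.m ^ 2 * K ^ 4
    * (2 * |K|)) := ⟨_, rfl⟩
  have CA0 : 0 ≤ CA := by rw [hCA]; positivity
  obtain ⟨M, hM⟩ : ∃ M, M = (K ^ P.m) ^ 2 := ⟨_, rfl⟩
  have M0 : 0 ≤ M := by rw [hM]; positivity
  refine ⟨3 * |C| + CA + (3 * (2 * |K|) + M * CA) + (3 * |C| + M * |C|), by positivity, ?_⟩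
  intro L T S y h h1 h2 h3
  have hK := h.K_pos
  have hKa : |K| = K := abs_of_pos hK
  have hCa : |C| = C := abs_of_nonneg h1.nonneg
  have C0 := h1.nonneg
  rw [hKa, hCa] at hCA ⊢
  have hyL := h.y_le_L
  have hmem : ∀ {z}, z ∈ Ioo y L → z ∈ Ioo 0 L := fun hz => ⟨h.y_nonneg.trans_lt hz.1, hz.2⟩
  have cσ := continuous_sigma
  have hu2 : ∀ t ∈ Icc 0 T, ∫ x in y..L, S.u x t ^ 2 ≤ 2 * K := fun t ht =>
    (S.integral_u_sq_le ht h.y_nonneg hyL le_rfl).trans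
      (mul_le_mul_of_nonneg_left h.ent (by norm_num))
  have hθ2 : ∀ t ∈ Icc 0 T, ∫ x in y..L, (S.e x t - 1) ^ 2 ≤ C := fun t ht => by
    refine le_trans ?_ (h1.sup t ht)
    refine integral_mono_of_continuous hyL (by fun_prop) (by fun_prop) fun x _ => ?_
    have : 0 ≤ S.u x t ^ 4 + (S.v x t - 1) ^ 2 := by positivity
    linarith
  have hτ2 : ∀ t ∈ Icc 0 T, ∫ x in y..L, ((S.e x t - 1) ^ 2 + (S.v x t - 1) ^ 2) ≤ C :=
    fun t ht => by
      refine le_trans ?_ (h1.sup t ht)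
      refine integral_mono_of_continuous hyL (by fun_prop) (by fun_prop) fun x _ => ?_
      have : 0 ≤ S.u x t ^ 4 := by positivity
      linarith
  have hA : ∀ t ∈ Icc 0 T, sigma t * ∫ x in y..L, S.A x t ^ 2 ≤ CA := by
    intro t ht
    have i1 : ∫ x in y..L, S.A x t ^ 2 ≤ ∫ x in y..L, (2 * cW * S.F x t ^ 2
        + 2 * cW * cπ * ((S.e x t - 1) ^ 2 + (S.v x t - 1) ^ 2)
        + 2 * P.m ^ 2 * K ^ 4 * S.u x t ^ 2) := by
      refine integral_mono_of_continuous hyL (by fun_prop) (by fun_prop) fun x hx => ?_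
      have e1 := h.W_sq_le hx ht
      have e2 := h.π_sq_le hx ht
      rw [← hcπ] at e2
      rw [← hcW] at e1
      have e3 := mul_le_mul_of_nonneg_left e2 cW0
      have e4 := mul_le_mul_of_nonneg_left (h.vb_sq_le hx ht)
        (by positivity : 0 ≤ 2 * (P.m : ℝ) ^ 2)
      have e5 : S.A x t = S.W x t - P.m * S.v x t * S.b x t := by rw [S.W_eq_A]; ring
      rw [e5]
      linarith [sq_nonneg (S.W x t + P.m * S.v x t * S.b x t)]
    rw [integral_add_of_continuous (by fun_prop) (by fun_prop),
      integral_add_of_continuous (by fun_prop) (by fun_prop),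
      intervalIntegral.integral_const_mul, intervalIntegral.integral_const_mul,
      intervalIntegral.integral_const_mul] at i1
    have i0 : 0 ≤ ∫ x in y..L, S.A x t ^ 2 :=
      integral_nonneg_of_continuous hyL fun x _ => sq_nonneg _
    refine (mul_le_mul_of_nonneg_right (sigma_le t) i0).trans ?_
    have i2 := mul_le_mul_of_nonneg_left i1 ht.1
    have i3 := mul_le_mul_of_nonneg_left (h2.sup t ht) (by positivity : 0 ≤ 2 * cW)
    have i4 := mul_le_mul (ht.2.trans h.T_le) (mul_le_mul_of_nonneg_left (hτ2 t ht)
      (by positivity : 0 ≤ 2 * cW * cπ)) (mul_nonneg (by positivity)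
        (integral_nonneg_of_continuous hyL fun x _ => by positivity)) hK.le
    have i5 := mul_le_mul (ht.2.trans h.T_le) (mul_le_mul_of_nonneg_left (hu2 t ht)
      (by positivity : 0 ≤ 2 * (P.m : ℝ) ^ 2 * K ^ 4)) (mul_nonneg (by positivity)
        (integral_nonneg_of_continuous hyL fun x _ => by positivity)) hK.le
    rw [hCA]
    linarith
  have hB : ∀ t ∈ Icc 0 T, sigma t ^ 2 * ∫ x in y..L, S.B x t ^ 2 ≤ C := by
    intro t ht
    refine le_trans (mul_le_mul_of_nonneg_right (pow_le_pow_left₀ (sigma_nonneg ht.1)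
      (sigma_le t) 2) (integral_nonneg_of_continuous hyL fun x _ => sq_nonneg _)) (h3.sup t ht)
  have inv : ∀ t ∈ Icc 0 T, ∀ z ∈ Icc y L, ∀ q : ℝ, q ^ 2 ≤ M * (S.rm z t * q) ^ 2 := by
    intro t ht z hz q
    have := mul_le_mul_of_nonneg_right (h.inv_rm_sq_le hz ht) (sq_nonneg (S.rm z t * q))
    have r0 := (S.rm_pos z t).ne'
    rw [hM]
    refine le_trans (le_of_eq ?_) this
    field_simp
  constructor
  · intro t ht
    have := h1.sup t ht
    have := hA t ht
    have := hB t ht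
    have : 0 ≤ (3 * (2 * K) + M * CA) + (3 * C + M * C) := by positivity
    linarith
  · have := h1.int
    have e1 : ∫ s in (0 : ℝ)..T, sigma s * ∫ x in y..L, S.ut x s ^ 2 ≤ C := by
      refine le_trans ?_ h2.int
      refine integral_mono_of_continuous S.T_pos.le (cσ.mul
        (continuous_intervalIntegral_param (by fun_prop) _ _)) (continuous_id.mul
        (continuous_intervalIntegral_param (by fun_prop) _ _)) fun s hs => ?_
      exact mul_le_mul_of_nonneg_right (sigma_le s)
        (integral_nonneg_of_continuous hyL fun x _ => sq_nonneg _)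
    have e2 : ∫ s in (0 : ℝ)..T, sigma s ^ 2 * ∫ x in y..L, S.et x s ^ 2 ≤ C := by
      refine le_trans ?_ h3.int
      refine integral_mono_of_continuous S.T_pos.le ((cσ.pow 2).mul
        (continuous_intervalIntegral_param (by fun_prop) _ _)) ((continuous_id.pow 2).mul
        (continuous_intervalIntegral_param (by fun_prop) _ _)) fun s hs => ?_
      exact mul_le_mul_of_nonneg_right (pow_le_pow_left₀ (sigma_nonneg hs.1) (sigma_le s) 2)
        (integral_nonneg_of_continuous hyL fun x _ => sq_nonneg _)
    have : 0 ≤ CA + (3 * (2 * K) + M * CA) + (3 * C + M * C) := by positivity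
    linarith
  · intro x hx t ht
    have σ0 := sigma_nonneg ht.1
    have e1 := mul_sq_le_integral (f := fun x => S.u x t) (f' := fun x => S.ux x t)
      (Real.sqrt_nonneg (sigma t)) h.y_le (by fun_prop) (by fun_prop)
      (fun z hz => S.u_dx z (hmem hz) t) hx
    have hs1 : √(sigma t) ≤ 1 := Real.sqrt_le_one.2 (sigma_le_one t)
    have e2 : ∫ x in y..L, S.ux x t ^ 2 ≤ M * ∫ x in y..L, S.A x t ^ 2 := by
      rw [← intervalIntegral.integral_const_mul]
      exact integral_mono_of_continuous hyL (by fun_prop) (by fun_prop) fun z hz => inv t ht z hz _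
    rw [Real.sq_sqrt σ0] at e1
    have e3 := mul_le_mul_of_nonneg_left e2 σ0
    have e4 := mul_le_mul_of_nonneg_left (hA t ht) M0
    have e5 := mul_le_mul (by linarith : 2 * √(sigma t) + 1 ≤ 3) (hu2 t ht)
      (integral_nonneg_of_continuous hyL fun x _ => sq_nonneg _) (by norm_num)
    have : 0 ≤ 3 * C + CA + (3 * C + M * C) := by positivity
    linarith
  · intro x hx t ht
    have σ0 := sigma_nonneg ht.1
    have e1 := mul_sq_le_integral (f := fun x => S.e x t - 1) (f' := fun x => S.ex x t)
      σ0 h.y_le (by fun_prop) (by fun_prop)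
      (fun z hz => (S.e_dx z (hmem hz) t).sub_const 1) hx
    have hs1 := sigma_le_one t
    have e2 : ∫ x in y..L, S.ex x t ^ 2 ≤ M * ∫ x in y..L, S.B x t ^ 2 := by
      rw [← intervalIntegral.integral_const_mul]
      exact integral_mono_of_continuous hyL (by fun_prop) (by fun_prop) fun z hz => inv t ht z hz _
    have e3 := mul_le_mul_of_nonneg_left e2 (sq_nonneg (sigma t))
    have e4 := mul_le_mul_of_nonneg_left (hB t ht) M0
    have e5 := mul_le_mul (by linarith : 2 * sigma t + 1 ≤ 3) (hθ2 t ht)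
      (integral_nonneg_of_continuous hyL fun x _ => sq_nonneg _) (by norm_num)
    have : 0 ≤ 3 * C + CA + (3 * (2 * K) + M * CA) := by positivity
    linarith

end Flow

end SphNS

namespace SphNS

/-! ### Pointwise bounds of the specific volume -/

theorem integral_swap_of_continuous {f : ℝ → ℝ → ℝ} (hf : Continuous fun q : ℝ × ℝ => f q.1 q.2)
    {a b c d : ℝ} (hab : a ≤ b) (hcd : c ≤ d) :
    ∫ x in a..b, ∫ s in c..d, f x s = ∫ s in c..d, ∫ x in a..b, f x s := by
  simp only [intervalIntegral.integral_of_le hab, intervalIntegral.integral_of_le hcd]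
  refine integral_integral_swap ?_
  rw [Measure.prod_restrict]
  exact (hf.continuousOn.integrableOn_compact (isCompact_Icc.prod isCompact_Icc)).mono_set
    (prod_mono Ioc_subset_Icc_self Ioc_subset_Icc_self)

/-- Jensen's inequality for the left branch of `ψ`, from the tangent line at `s`. -/
theorem mul_le_integral_of_psi {v : ℝ → ℝ} (hv : Continuous v) (v0 : ∀ x, 0 < v x) {c d s : ℝ}
    (hcd : c ≤ d) (hs : 0 < s) (hs1 : s < 1)
    (h : ∫ x in c..d, psi (v x) ≤ (d - c) * psi s) : (d - c) * s ≤ ∫ x in c..d, v x := by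
  have cψ : Continuous fun x => psi (v x) :=
    (hv.sub continuous_const).sub (hv.log fun x => (v0 x).ne')
  have h1 : ∫ x in c..d, (psi s - psi (v x)) ≤ ∫ x in c..d, (1 / s - 1) * (v x - s) := by
    refine integral_mono_of_continuous hcd (by fun_prop) (by fun_prop) fun x _ => ?_
    have h2 := Real.log_le_sub_one_of_pos (div_pos (v0 x) hs)
    rw [Real.log_div (v0 x).ne' hs.ne'] at h2
    have h3 : (1 / s - 1) * (v x - s) = v x / s - 1 - v x + s := by field_simp; ring
    unfold psi
    rw [h3]; linarith
  rw [intervalIntegral.integral_const_mul, intervalIntegral.integral_sub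
    (by exact (continuous_const.intervalIntegrable _ _)) (cψ.intervalIntegrable _ _),
    intervalIntegral.integral_sub (hv.intervalIntegrable _ _)
    (continuous_const.intervalIntegrable _ _), intervalIntegral.integral_const,
    intervalIntegral.integral_const, smul_eq_mul, smul_eq_mul] at h1
  have h4 : 0 < 1 / s - 1 := by rw [sub_pos, lt_div_iff₀ hs]; linarith
  by_contra hcon
  push Not at hcon
  have := mul_neg_of_pos_of_neg h4 (sub_neg.2 hcon)
  linarith

namespace Flow

variable {P : FluidParams} {L T : ℝ} (S : Flow P L T)

/-- The time integral of the effective viscous flux, up to a term depending on time only. -/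
noncomputable def viscLog (x t : ℝ) : ℝ :=
  P.β * (Real.log (S.v x t) - Real.log (S.v x 0)) - ∫ s in (0 : ℝ)..t, S.p x s

/-- The part `v exp(-∫ p/β)` of the specific volume. -/
noncomputable def vX (x t : ℝ) : ℝ := S.v x 0 * Real.exp (S.viscLog x t / P.β)

@[fun_prop] theorem continuous_log_v {X : Type*} [TopologicalSpace X] {f g : X → ℝ}
    (hf : Continuous f) (hg : Continuous g) : Continuous fun z => Real.log (S.v (f z) (g z)) :=
  (S.continuous_v hf hg).log fun _ => (S.v_pos _ _).ne'

@[fun_prop] theorem continuous_viscLog {X : Type*} [TopologicalSpace X] {f g : X → ℝ}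
    (hf : Continuous f) (hg : Continuous g) : Continuous fun z => S.viscLog (f z) (g z) := by
  have := intervalIntegral.continuous_parametric_intervalIntegral_of_continuous
    (μ := volume) (f := fun (z : X) s => S.p (f z) s) (a₀ := 0) (by unfold Function.uncurry; fun_prop) hg
  unfold viscLog
  fun_prop

@[fun_prop] theorem continuous_vX {X : Type*} [TopologicalSpace X] {f g : X → ℝ}
    (hf : Continuous f) (hg : Continuous g) : Continuous fun z => S.vX (f z) (g z) := by
  unfold vX
  exact (by fun_prop : Continuous fun z => S.v (f z) 0).mul
    (Real.continuous_exp.comp ((S.continuous_viscLog hf hg).div_const _))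

theorem vX_pos (x t : ℝ) : 0 < S.vX x t := mul_pos (S.v_pos x 0) (Real.exp_pos _)

/-- The representation of the specific volume. -/
theorem v_eq (x t : ℝ) :
    S.v x t = S.vX x t * (1 + (P.γ - 1) / P.β * ∫ s in (0 : ℝ)..t, S.e x s / S.vX x s) := by
  have hβ := P.β_pos
  have cX : Continuous fun s => S.vX x s := by fun_prop
  have cE : Continuous fun s => S.e x s / S.vX x s :=
    Continuous.div (by fun_prop) cX fun s => (S.vX_pos x s).ne'
  have hX : ∀ s, S.v x s = S.vX x s * Real.exp ((∫ τ in (0 : ℝ)..s, S.p x τ) / P.β) := by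
    intro s
    have e1 : S.viscLog x s / P.β + (∫ τ in (0 : ℝ)..s, S.p x τ) / P.β
        = Real.log (S.v x s) - Real.log (S.v x 0) := by
      unfold viscLog; field_simp; ring
    unfold vX
    rw [mul_assoc, ← Real.exp_add, e1, Real.exp_sub, Real.exp_log (S.v_pos x s),
      Real.exp_log (S.v_pos x 0)]
    have := (S.v_pos x 0).ne'
    field_simp
  have hd : ∀ s, HasDerivAt (fun s => Real.exp ((∫ τ in (0 : ℝ)..s, S.p x τ) / P.β))
      ((P.γ - 1) / P.β * (S.e x s / S.vX x s)) s := by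
    intro s
    refine ((hasDerivAt_primitive (g := fun τ => S.p x τ) (by fun_prop) 0 s).div_const
      P.β).exp.congr_deriv ?_
    have h1 := hX s
    have h2 := (S.vX_pos x s).ne'
    have h3 := (Real.exp_pos ((∫ τ in (0 : ℝ)..s, S.p x τ) / P.β)).ne'
    unfold p at h1 h3 ⊢
    rw [h1]
    field_simp
  have hint := intervalIntegral.integral_eq_sub_of_hasDerivAt (a := 0) (b := t)
    (fun s _ => hd s) ((cE.const_mul _).intervalIntegrable _ _)
  rw [intervalIntegral.integral_const_mul] at hint
  rw [hint, hX t]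
  simp

variable {S}

/-- The momentum equation, integrated in space between two points and in time: the time integral of
the effective viscous flux hardly depends on the point. -/
theorem viscLog_sub_le {E H R c d : ℝ} (hE : S.entropy 0 ≤ E) (hc : 0 ≤ c) (hd : d ≤ L)
    (hdc : d ≤ c + 1 / 2) (hH : ∀ x ∈ Icc c d, ∀ t ∈ Icc 0 T, 1 ≤ H * S.rm x t ^ 2)
    (hR : ∀ x ∈ Icc c d, ∀ t ∈ Icc 0 T, 1 ≤ R * (S.r x t * S.rm x t))
    {x : ℝ} (hx : x ∈ Icc c d) {s t : ℝ} (hs : 0 ≤ s) (hst : s ≤ t) (ht : t ≤ T) :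
    -(2 * (E + H)) ≤ (S.viscLog x t - S.viscLog c t) - (S.viscLog x s - S.viscLog c s) ∧
    (S.viscLog x t - S.viscLog c t) - (S.viscLog x s - S.viscLog c s)
      ≤ 2 * (E + H) + 2 * P.m * E * R * (t - s) := by
  have hT := S.T_pos
  have hm := P.one_le_m_cast
  let D : ℝ → ℝ := fun t => ∫ z in c..x, S.u z t / S.rm z t
  let Φ : ℝ → ℝ := fun t => S.viscLog x t - S.viscLog c t - D t
  have cD : Continuous D := continuous_intervalIntegral_param
    (f := fun x t => S.u x t / S.rm x t) (by fun_prop) c x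
  have cΦ : Continuous Φ := by fun_prop
  have hsub : ∀ {z}, z ∈ Icc c x → z ∈ Icc c d := fun hz => ⟨hz.1, hz.2.trans hx.2⟩
  have hxL : x ≤ L := hx.2.trans hd
  have hu : ∀ t ∈ Icc 0 T, ∫ z in c..x, S.u z t ^ 2 ≤ 2 * E := fun t ht =>
    (S.integral_u_sq_le ht hc hx.1 hxL).trans (mul_le_mul_of_nonneg_left hE (by norm_num))
  have hH0 : 0 ≤ H := by
    have h1 := hH x hx 0 ⟨le_rfl, hT.le⟩
    have h2 : 0 < S.rm x 0 ^ 2 := pow_pos (S.rm_pos x 0) 2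
    by_contra hneg
    have := mul_neg_of_neg_of_pos (not_le.1 hneg) h2
    linarith
  have hD : ∀ t ∈ Icc 0 T, |D t| ≤ E + H := by
    intro t ht
    refine (intervalIntegral.abs_integral_le_integral_abs hx.1).trans ?_
    have h1 : ∫ z in c..x, |S.u z t / S.rm z t| ≤ ∫ z in c..x, (1 / 2 * S.u z t ^ 2 + 1 / 2 * H) := by
      refine integral_mono_of_continuous hx.1 (by fun_prop) (by fun_prop) fun z hz => ?_
      have r0 := S.rm_pos z t
      have e1 : (1 / S.rm z t) ^ 2 ≤ H := by
        rw [div_pow, one_pow, div_le_iff₀ (by positivity)]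
        exact hH z (hsub hz) t ht
      have e2 := sq_nonneg (|S.u z t| - 1 / S.rm z t)
      rw [abs_div, abs_of_pos r0, ← sq_abs (S.u z t), div_eq_mul_one_div |S.u z t|]
      linarith
    rw [integral_add_of_continuous (by fun_prop) (by fun_prop),
      intervalIntegral.integral_const_mul, intervalIntegral.integral_const, smul_eq_mul] at h1
    have h2 := hu t ht
    have h3 := mul_le_mul_of_nonneg_right (by linarith [hx.2] : x - c ≤ 1)
      (by positivity : 0 ≤ 1 / 2 * H)
    linarith
  -- the momentum equation, integrated over `[c,x]`
  have hFTC : ∀ t, ∫ z in c..x, S.ut z t / S.rm z t = S.F x t - S.F c t := fun t =>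
    intervalIntegral.integral_eq_sub_of_hasDerivAt_of_le hx.1
      (by fun_prop : Continuous fun z => S.F z t).continuousOn
      (fun z hz => S.F_dx ⟨hc.trans_lt hz.1, hz.2.trans_le hxL⟩ t)
      ((by fun_prop : Continuous fun z => S.ut z t / S.rm z t).intervalIntegrable _ _)
  -- `Dₜ(u/rᵐ)` differs from `Dₜu/rᵐ` only by `- m u²/(r rᵐ)`, so that the derivative of `Φ` is
  -- nonnegative and bounded by the kinetic energy
  have hΦ : ∀ τ ∈ Ioo 0 T, HasDerivAt Φ (∫ z in c..x, P.m * (S.b z τ * S.u z τ) / S.rm z τ) τ := by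
    intro τ hτ
    have hΛ : ∀ z, HasDerivAt (fun t => S.viscLog z t) (S.F z τ - (P.γ - 1)) τ := by
      intro z
      refine (((((S.v_dt z τ hτ).log (S.v_pos z τ).ne').sub_const _).const_mul P.β).sub
        (hasDerivAt_primitive (g := fun s => S.p z s) (by fun_prop) 0 τ)).congr_deriv ?_
      rw [S.p_eq]; unfold F; ring
    have hDd := hasDerivAt_integral_param (b := fun z t => S.u z t / S.rm z t)
      (bt := fun z t => S.ut z t / S.rm z t - P.m * (S.b z t * S.u z t) / S.rm z t) hx.1
      (by fun_prop) (by fun_prop) (fun z _ t ht => by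
        refine ((S.u_dt z t ht).div ((S.r_dt z t ht).pow P.m) (S.rm_pos z t).ne').congr_deriv ?_
        have r0 := (S.r_pos z t).ne'
        obtain ⟨k, hk⟩ : ∃ k, P.m = k + 1 := ⟨P.m - 1, by have := P.one_le_m; omega⟩
        unfold rm b
        rw [hk]
        simp only [Nat.add_sub_cancel, pow_succ, Pi.pow_apply]
        field_simp) hτ
    refine (((hΛ x).sub (hΛ c)).sub hDd).congr_deriv ?_
    rw [intervalIntegral.integral_sub
      ((by fun_prop : Continuous fun z => S.ut z τ / S.rm z τ).intervalIntegrable _ _)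
      ((by fun_prop : Continuous fun z => P.m * (S.b z τ * S.u z τ) / S.rm z τ).intervalIntegrable
        _ _), hFTC]
    ring
  have hdens : ∀ z t, P.m * (S.b z t * S.u z t) / S.rm z t
      = P.m * (1 / (S.r z t * S.rm z t)) * S.u z t ^ 2 := by
    intro z t
    have r0 := (S.r_pos z t).ne'
    have r1 := (S.rm_pos z t).ne'
    unfold b; field_simp
  have hΦ' : ∀ τ ∈ Icc 0 T, 0 ≤ (∫ z in c..x, P.m * (S.b z τ * S.u z τ) / S.rm z τ) ∧
      (∫ z in c..x, P.m * (S.b z τ * S.u z τ) / S.rm z τ) ≤ 2 * P.m * E * R := by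
    intro τ hτ
    constructor
    · refine integral_nonneg_of_continuous hx.1 fun z _ => ?_
      have := S.r_pos z τ
      have := S.rm_pos z τ
      rw [hdens]; positivity
    · have hR0 : 0 ≤ R := by
        have h1 := hR x hx τ hτ
        have h2 : 0 < S.r x τ * S.rm x τ := mul_pos (S.r_pos x τ) (S.rm_pos x τ)
        by_contra hneg
        have := mul_neg_of_neg_of_pos (not_le.1 hneg) h2
        linarith
      have h1 : (∫ z in c..x, P.m * (S.b z τ * S.u z τ) / S.rm z τ)
          ≤ ∫ z in c..x, P.m * R * S.u z τ ^ 2 := by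
        refine integral_mono_of_continuous hx.1 (by fun_prop) (by fun_prop) fun z hz => ?_
        rw [hdens]
        refine mul_le_mul_of_nonneg_right (mul_le_mul_of_nonneg_left ?_ (by positivity))
          (sq_nonneg _)
        rw [div_le_iff₀ (mul_pos (S.r_pos z τ) (S.rm_pos z τ))]
        exact hR z (hsub hz) τ hτ
      rw [intervalIntegral.integral_const_mul] at h1
      have := mul_le_mul_of_nonneg_left (hu τ hτ) (by positivity : 0 ≤ P.m * R)
      linarith
  have h0 : 0 ≤ Φ t - Φ s ∧ Φ t - Φ s ≤ 2 * P.m * E * R * (t - s) := by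
    have hs' : s ∈ Icc 0 T := ⟨hs, hst.trans ht⟩
    have ht' : t ∈ Icc 0 T := ⟨hs.trans hst, ht⟩
    have hdiff : DifferentiableOn ℝ Φ (interior (Icc 0 T)) := by
      rw [interior_Icc]
      exact fun τ hτ => (hΦ τ hτ).differentiableAt.differentiableWithinAt
    constructor
    · have := Convex.mul_sub_le_image_sub_of_le_deriv (convex_Icc 0 T) cΦ.continuousOn hdiff
        (C := 0) (fun τ hτ => by
          rw [interior_Icc] at hτ
          rw [(hΦ τ hτ).deriv]; exact (hΦ' τ ⟨hτ.1.le, hτ.2.le⟩).1) s hs' t ht' hst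
      linarith
    · exact Convex.image_sub_le_mul_sub_of_deriv_le (convex_Icc 0 T) cΦ.continuousOn hdiff
        (fun τ hτ => by
          rw [interior_Icc] at hτ
          rw [(hΦ τ hτ).deriv]; exact (hΦ' τ ⟨hτ.1.le, hτ.2.le⟩).2) s hs' t ht' hst
  have d1 := abs_le.1 (hD t ⟨hs.trans hst, ht⟩)
  have d2 := abs_le.1 (hD s ⟨hs, hst.trans ht⟩)
  simp only [Φ] at h0
  constructor <;> linarith [h0.1, h0.2, d1.1, d1.2, d2.1, d2.2]

/-- Bounds for the specific volume on an interval of length `1/2`, in terms of bounds `H` for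
`r⁻²ᵐ` and `R` for `r⁻ⁿ` there. -/
theorem exists_v_bounds_segment (P : FluidParams) {E V : ℝ} (hE1 : 1 ≤ E) (hV1 : 1 ≤ V) :
    ∃ C, 1 ≤ C ∧ ∀ (L T : ℝ) (S : Flow P L T), S.entropy 0 ≤ E →
    (∀ x ∈ Icc 0 L, V⁻¹ ≤ S.v x 0 ∧ S.v x 0 ≤ V) → ∀ c H R, 0 ≤ c → c + 1 / 2 ≤ L →
    (∀ x ∈ Icc c (c + 1 / 2), ∀ t ∈ Icc 0 T, 1 ≤ H * S.rm x t ^ 2) →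
    (∀ x ∈ Icc c (c + 1 / 2), ∀ t ∈ Icc 0 T, 1 ≤ R * (S.r x t * S.rm x t)) →
    0 ≤ H → 0 ≤ R → ∀ x ∈ Icc c (c + 1 / 2), ∀ t ∈ Icc 0 T,
    C⁻¹ * Real.exp (-(C * H)) * Real.exp (-(C * R * t)) * Real.exp (-(C * t * Real.exp (C * H)))
      ≤ S.v x t ∧
    S.v x t ≤ C * (1 + t) * (Real.exp (C * H) * Real.exp (C * R * t + C * t * Real.exp (C * H)))
      * Real.exp (C * H * (Real.exp (C * H) * Real.exp (C * R * t + C * t * Real.exp (C * H)))) := by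
  have hβ := P.β_pos
  have hγ := P.γ_sub_pos
  have hκ := P.κ_pos
  -- `η₀` is a lower bound for the integral of `v`: its mean is at least `s = exp(-1 - 2E/(γ - 1))`,
  -- because `ψ(s) ≥ 2E/(γ - 1)`
  obtain ⟨η₀, hη₀⟩ : ∃ z, z = 1 / 2 * Real.exp (-1 - 2 * (E / (P.γ - 1))) := ⟨_, rfl⟩
  have η0 : 0 < η₀ := by rw [hη₀]; positivity
  obtain ⟨g, hg⟩ : ∃ g, g = (P.γ - 1) / P.β := ⟨_, rfl⟩
  have g0 : 0 < g := by rw [hg]; positivity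
  -- `M₁` and `M₂` bound the integrals of `v` and `e` over an interval of length `1/2`
  obtain ⟨M₁, hM₁⟩ : ∃ M, M = 2 * (E / (P.γ - 1)) + 1 := ⟨_, rfl⟩
  have M₁0 : 0 < M₁ := by rw [hM₁]; positivity
  obtain ⟨M₂, hM₂⟩ : ∃ M, M = 2 * E + 1 := ⟨_, rfl⟩
  have M₂0 : 0 < M₂ := by rw [hM₂]; positivity
  obtain ⟨cφ, hcφ⟩ : ∃ z, z = Real.exp (2 * E / P.β) := ⟨_, rfl⟩
  have cφ0 : 0 < cφ := by rw [hcφ]; positivity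
  obtain ⟨cH, hcH⟩ : ∃ z, z = 2 / P.β := ⟨_, rfl⟩
  have cH0 : 0 < cH := by rw [hcH]; positivity
  obtain ⟨cR, hcR⟩ : ∃ z, z = 2 * P.m * E / P.β := ⟨_, rfl⟩
  have cR0 : 0 ≤ cR := by rw [hcR]; positivity
  obtain ⟨Gc, hGc⟩ : ∃ z, z = g * M₂ / η₀ := ⟨_, rfl⟩
  have Gc0 : 0 < Gc := by rw [hGc]; positivity
  obtain ⟨K₂, hK₂⟩ : ∃ z, z = 2 * M₁ * V ^ 2 * (1 + g * V ^ 2 / η₀) * cφ ^ 4 := ⟨_, rfl⟩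
  have K₂0 : 0 < K₂ := by rw [hK₂]; positivity
  obtain ⟨C, hC⟩ : ∃ C, C = 1 + V ^ 2 * cφ ^ 2 / η₀ + 4 * cH + 2 * cR + Gc * cφ + K₂ * (4 * M₂)
    + K₂ * (M₂ * (E / P.κ)) := ⟨_, rfl⟩
  have C1 : 1 ≤ C := by
    rw [hC]
    have : 0 ≤ V ^ 2 * cφ ^ 2 / η₀ + 4 * cH + 2 * cR + Gc * cφ + K₂ * (4 * M₂)
      + K₂ * (M₂ * (E / P.κ)) := by positivity
    linarith
  refine ⟨C, C1, ?_⟩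
  intro L T S hE hV c H R hc hcL hH hR H0 R0 x hx t ht
  have hcd : c ≤ c + 1 / 2 := by linarith
  have hV0 : 0 < V := by linarith
  have hT := S.T_pos
  obtain ⟨φ, hφ⟩ : ∃ φ, φ = Real.exp (2 * (E + H) / P.β) := ⟨_, rfl⟩
  have φ0 : 0 < φ := by rw [hφ]; positivity
  have φ1 : 1 ≤ φ := by rw [hφ]; exact Real.one_le_exp (by positivity)
  have hφ' : φ = cφ * Real.exp (cH * H) := by
    rw [hφ, hcφ, hcH, ← Real.exp_add]; congr 1; ring
  obtain ⟨c₁, hc₁⟩ : ∃ c, c = cR * R := ⟨_, rfl⟩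
  have c₁0 : 0 ≤ c₁ := by rw [hc₁]; positivity
  let Z : ℝ → ℝ := fun t => Real.exp (S.viscLog c t / P.β)
  -- the exponential factor compensates the growth allowed in `viscLog_sub_le`
  let q : ℝ → ℝ := fun t => Real.exp (-(c₁ * t)) / Z t
  have Z0 : ∀ t, 0 < Z t := fun t => Real.exp_pos _
  have cZ : Continuous Z := Real.continuous_exp.comp (by fun_prop)
  have cq : Continuous q := (Real.continuous_exp.comp (by fun_prop)).div cZ fun t => (Z0 t).ne'
  have q0 : ∀ t, 0 < q t := fun t => div_pos (Real.exp_pos _) (Z0 t)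
  -- `X / Z` is nearly independent of time
  have hXratio : ∀ z ∈ Icc c (c + 1 / 2), ∀ s τ, 0 ≤ s → s ≤ τ → τ ≤ T →
      S.vX z τ ≤ S.vX z s * (Z τ / Z s) * (φ * Real.exp (c₁ * (τ - s))) ∧
      S.vX z s * (Z τ / Z s) * φ⁻¹ ≤ S.vX z τ := by
    intro z hz s τ h0 h1 h2
    have h3 := viscLog_sub_le hE hc hcL le_rfl hH hR hz h0 h1 h2
    have h4 : S.vX z s * (Z τ / Z s)
        = S.v z 0 * Real.exp (S.viscLog z s / P.β + S.viscLog c τ / P.β - S.viscLog c s / P.β) := by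
      simp only [Z]; unfold vX
      rw [Real.exp_sub, Real.exp_add]; ring
    rw [h4, hφ, mul_assoc, mul_assoc, ← Real.exp_neg, ← Real.exp_add, ← Real.exp_add,
      ← Real.exp_add]
    unfold vX
    constructor
    · refine mul_le_mul_of_nonneg_left (Real.exp_le_exp.2 ?_) (S.v_pos z 0).le
      have e1 : S.viscLog z s / P.β + S.viscLog c τ / P.β - S.viscLog c s / P.β
          + (2 * (E + H) / P.β + c₁ * (τ - s))
          = (S.viscLog z s + S.viscLog c τ - S.viscLog c s + 2 * (E + H)
            + 2 * P.m * E * R * (τ - s)) / P.β := by rw [hc₁, hcR]; ring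
      rw [e1]
      exact div_le_div_of_nonneg_right (by linarith [h3.2]) hβ.le
    · refine mul_le_mul_of_nonneg_left (Real.exp_le_exp.2 ?_) (S.v_pos z 0).le
      have e1 : S.viscLog z s / P.β + S.viscLog c τ / P.β - S.viscLog c s / P.β
          + -(2 * (E + H) / P.β)
          = (S.viscLog z s + S.viscLog c τ - S.viscLog c s - 2 * (E + H)) / P.β := by ring
      rw [e1]
      exact div_le_div_of_nonneg_right (by linarith [h3.1]) hβ.le
  have hX0 : ∀ z, S.vX z 0 = S.v z 0 := by intro z; simp [vX, viscLog]
  have hZ0 : Z 0 = 1 := by simp [Z, viscLog]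
  have hXle : ∀ z ∈ Icc c (c + 1 / 2), ∀ τ ∈ Icc 0 T,
      S.vX z τ ≤ Z τ * (V * φ * Real.exp (c₁ * τ)) ∧ Z τ * (V⁻¹ * φ⁻¹) ≤ S.vX z τ := by
    intro z hz τ hτ
    have h1 := hXratio z hz 0 τ le_rfl hτ.1 hτ.2
    have h2 := hV z ⟨hc.trans hz.1, hz.2.trans hcL⟩
    rw [hX0, hZ0, sub_zero, div_one] at h1
    have zp := Z0 τ
    constructor
    · refine h1.1.trans ?_
      have := mul_le_mul_of_nonneg_right h2.2 (by positivity : 0 ≤ Z τ * (φ * Real.exp (c₁ * τ)))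
      linarith
    · refine le_trans ?_ h1.2
      have := mul_le_mul_of_nonneg_right h2.1 (by positivity : 0 ≤ Z τ * φ⁻¹)
      linarith
  -- the mean of `v` is bounded below
  have hsmall : ∀ τ ∈ Icc 0 T, η₀ ≤ ∫ z in c..c + 1 / 2, S.v z τ := by
    intro τ hτ
    have hγE : -1 - 2 * (E / (P.γ - 1)) < 0 := by
      have : 0 < E / (P.γ - 1) := by positivity
      linarith
    have h1 := mul_le_integral_of_psi (v := fun z => S.v z τ) (by fun_prop)
      (fun z => S.v_pos z τ) hcd (Real.exp_pos (-1 - 2 * (E / (P.γ - 1))))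
      ((Real.exp_lt_exp.2 hγE).trans_eq Real.exp_zero) (by
        have h2 : ∫ z in c..c + 1 / 2, psi (S.v z τ) ≤ E / (P.γ - 1) := by
          rw [le_div_iff₀ hγ, mul_comm]
          exact (S.integral_psi_v_le hτ hc hcd hcL).trans hE
        refine h2.trans ?_
        unfold psi
        rw [Real.log_exp]
        have := Real.exp_pos (-1 - 2 * (E / (P.γ - 1)))
        linarith)
    rw [hη₀]
    refine le_trans (le_of_eq ?_) h1
    ring
  -- a lower bound for `Z`: the representation of `v` is integrated over the interval, where the
  -- integral of `v` is bounded below and that of `e` above, and Gronwall's inequality applies to `q`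
  have hgron : ∀ τ ∈ Icc 0 T, q τ ≤ φ * V / η₀ * Real.exp (φ * Gc * τ) := by
    intro τ hτ
    have := gronwall_integral (A := φ * V / η₀) (φ := q) (g := fun _ => φ * Gc) cq
      continuous_const (T := T) (fun _ _ => by positivity) (fun t ht => by
        have hpt : ∀ z ∈ Icc c (c + 1 / 2), S.v z t
            ≤ φ / q t * (V + g * ∫ s in (0 : ℝ)..t, q s * S.e z s) := by
          intro z hz
          have cX : Continuous fun s => S.vX z s := by fun_prop
          have cE : Continuous fun s => S.e z s / S.vX z s :=
            Continuous.div (by fun_prop) cX fun s => (S.vX_pos z s).ne'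
          have hqt : φ / q t = Z t * (φ * Real.exp (c₁ * t)) := by
            simp only [q]
            have := (Z0 t).ne'
            rw [Real.exp_neg]
            field_simp
          have h1 : S.vX z t * ∫ s in (0 : ℝ)..t, S.e z s / S.vX z s
              ≤ φ / q t * ∫ s in (0 : ℝ)..t, q s * S.e z s := by
            rw [← intervalIntegral.integral_const_mul, ← intervalIntegral.integral_const_mul]
            refine integral_mono_of_continuous ht.1 (by fun_prop) (by fun_prop) fun s hs => ?_
            have h2 := (hXratio z hz s t hs.1 hs.2 ht.2).1
            have h3 := mul_le_mul_of_nonneg_right h2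
              (div_nonneg (S.e_pos z s).le (S.vX_pos z s).le)
            refine h3.trans (le_of_eq ?_)
            rw [hqt]
            simp only [q]
            have e1 := (S.vX_pos z s).ne'
            have e2 := (Z0 s).ne'
            rw [mul_sub, Real.exp_sub, Real.exp_neg]
            field_simp
          rw [S.v_eq z t, ← hg]
          have h4 := (hXle z hz t ht).1
          have h5 := mul_le_mul_of_nonneg_left h1 g0.le
          have h6 : φ / q t * V = Z t * (V * φ * Real.exp (c₁ * t)) := by rw [hqt]; ring
          rw [mul_add (φ / q t), h6]
          linarith
        have h1 := hsmall t ht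
        have h2 := integral_mono_of_continuous hcd (by fun_prop)
          (((intervalIntegral.continuous_parametric_intervalIntegral_of_continuous'
            (μ := volume) (f := fun z s => q s * S.e z s)
            (by unfold Function.uncurry; fun_prop) 0 t).const_mul g).const_add V |>.const_mul
            (φ / q t)) hpt
        rw [intervalIntegral.integral_const_mul, intervalIntegral.integral_add
          (continuous_const.intervalIntegrable _ _)
          ((intervalIntegral.continuous_parametric_intervalIntegral_of_continuous'
            (μ := volume) (f := fun z s => q s * S.e z s)
            (by unfold Function.uncurry; fun_prop) 0 t).const_mul g |>.intervalIntegrable _ _),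
          intervalIntegral.integral_const_mul, integral_swap_of_continuous (by fun_prop) hcd ht.1,
          intervalIntegral.integral_const, smul_eq_mul] at h2
        have h3 : ∫ s in (0 : ℝ)..t, ∫ z in c..c + 1 / 2, q s * S.e z s
            ≤ M₂ * ∫ s in (0 : ℝ)..t, q s := by
          rw [← intervalIntegral.integral_const_mul]
          refine integral_mono_of_continuous ht.1
            (continuous_intervalIntegral_param (by fun_prop) _ _) (by fun_prop) fun s hs => ?_
          rw [intervalIntegral.integral_const_mul, mul_comm M₂]
          refine mul_le_mul_of_nonneg_left ?_ (q0 s).le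
          have := S.integral_e_le ⟨hs.1, hs.2.trans ht.2⟩ hc hcd hcL
          rw [hM₂]
          linarith
        have h4 := h1.trans h2
        have h5 := q0 t
        have h6 : η₀ * q t ≤ φ * (V + g * (M₂ * ∫ s in (0 : ℝ)..t, q s)) := by
          have := mul_le_mul_of_nonneg_right h4 h5.le
          rw [div_mul_eq_mul_div, div_mul_cancel₀ _ h5.ne'] at this
          refine this.trans (mul_le_mul_of_nonneg_left ?_ φ0.le)
          have := mul_le_mul_of_nonneg_left h3 g0.le
          linarith
        rw [intervalIntegral.integral_const_mul, hGc]
        have h7 : φ * V / η₀ + φ * (g * M₂ / η₀) * ∫ s in (0 : ℝ)..t, q s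
            = φ * (V + g * (M₂ * ∫ s in (0 : ℝ)..t, q s)) / η₀ := by ring
        rw [h7, le_div_iff₀ η0]
        linarith) τ hτ
    rw [intervalIntegral.integral_const, smul_eq_mul, sub_zero, mul_comm τ] at this
    exact this
  have hZlow : ∀ τ ∈ Icc 0 T, (Z τ)⁻¹
      ≤ φ * V / η₀ * Real.exp (c₁ * τ) * Real.exp (φ * Gc * τ) := by
    intro τ hτ
    have h1 := mul_le_mul_of_nonneg_right (hgron τ hτ) (Real.exp_pos (c₁ * τ)).le
    have h2 : q τ * Real.exp (c₁ * τ) = (Z τ)⁻¹ := by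
      simp only [q]
      rw [Real.exp_neg]
      field_simp
    rw [h2] at h1
    linarith
  obtain ⟨k, hk⟩ : ∃ k, k = Real.exp (C * H) * Real.exp (C * R * t + C * t * Real.exp (C * H)) :=
    ⟨_, rfl⟩
  have hexpφ : ∀ τ, 0 ≤ τ → Real.exp (φ * Gc * τ) ≤ Real.exp (C * τ * Real.exp (C * H)) := by
    intro τ hτ
    refine Real.exp_le_exp.2 ?_
    have e1 : Real.exp (cH * H) ≤ Real.exp (C * H) := by
      refine Real.exp_le_exp.2 (mul_le_mul_of_nonneg_right ?_ H0)
      have : 0 ≤ 1 + V ^ 2 * cφ ^ 2 / η₀ + 3 * cH + 2 * cR + Gc * cφ + K₂ * (4 * M₂)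
        + K₂ * (M₂ * (E / P.κ)) := by positivity
      rw [hC]; linarith
    have e2 : Gc * cφ ≤ C := by
      have : 0 ≤ 1 + V ^ 2 * cφ ^ 2 / η₀ + 4 * cH + 2 * cR + K₂ * (4 * M₂)
        + K₂ * (M₂ * (E / P.κ)) := by positivity
      rw [hC]; linarith
    have e3 := mul_le_mul e2 e1 (Real.exp_pos _).le (by linarith)
    have e4 := mul_le_mul_of_nonneg_left e3 hτ
    rw [hφ']
    linarith
  have h4H : Real.exp (cH * H) ^ 4 ≤ Real.exp (C * H) := by
    rw [← Real.exp_nat_mul]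
    refine Real.exp_le_exp.2 ?_
    have : 4 * cH ≤ C := by
      have : 0 ≤ 1 + V ^ 2 * cφ ^ 2 / η₀ + 2 * cR + Gc * cφ + K₂ * (4 * M₂)
        + K₂ * (M₂ * (E / P.κ)) := by positivity
      rw [hC]; linarith
    have := mul_le_mul_of_nonneg_right this H0
    push_cast
    linarith
  have h2R : ∀ τ, 0 ≤ τ → 2 * (c₁ * τ) ≤ C * R * τ := by
    intro τ hτ
    have : 2 * cR ≤ C := by
      have : 0 ≤ 1 + V ^ 2 * cφ ^ 2 / η₀ + 4 * cH + Gc * cφ + K₂ * (4 * M₂)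
        + K₂ * (M₂ * (E / P.κ)) := by positivity
      rw [hC]; linarith
    have := mul_le_mul_of_nonneg_right (mul_le_mul_of_nonneg_right this R0) hτ
    rw [hc₁]; linarith
  have hXv : ∀ z τ, 0 ≤ τ → S.vX z τ ≤ S.v z τ := by
    intro z τ hτ
    rw [S.v_eq z τ]
    refine le_mul_of_one_le_right (S.vX_pos z τ).le (le_add_of_nonneg_right ?_)
    exact mul_nonneg (hg ▸ g0.le) (integral_nonneg_of_continuous hτ fun s _ =>
      div_nonneg (S.e_pos z s).le (S.vX_pos z s).le)
  constructor
  · refine le_trans ?_ (hXv x t ht.1)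
    refine le_trans ?_ (hXle x hx t ht).2
    have h1 := hZlow t ht
    have hz := Z0 t
    -- it suffices to compare the inverses
    rw [← inv_le_inv₀ (by positivity) (by positivity)]
    have hinv : (Z t * (V⁻¹ * φ⁻¹))⁻¹ = (Z t)⁻¹ * (V * φ) := by
      rw [mul_inv, mul_inv, inv_inv, inv_inv]
    rw [hinv]
    simp only [mul_inv, inv_inv, Real.exp_neg]
    have e1 : V * φ ^ 2 * V / η₀ ≤ C * Real.exp (C * H) := by
      have i1 : Real.exp (cH * H) ^ 2 ≤ Real.exp (C * H) := by
        refine le_trans ?_ h4H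
        exact pow_le_pow_right₀ (Real.one_le_exp (by positivity)) (by norm_num)
      have i2 : V ^ 2 * cφ ^ 2 / η₀ ≤ C := by
        have : 0 ≤ 1 + 4 * cH + 2 * cR + Gc * cφ + K₂ * (4 * M₂)
          + K₂ * (M₂ * (E / P.κ)) := by positivity
        rw [hC]; linarith
      have i3 := mul_le_mul i2 i1 (by positivity) (by linarith)
      rw [hφ']
      refine le_trans (le_of_eq ?_) i3
      ring
    have e2 : Real.exp (c₁ * t) ≤ Real.exp (C * R * t) :=
      Real.exp_le_exp.2 (by linarith [h2R t ht.1, mul_nonneg c₁0 ht.1])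
    have e3 := mul_le_mul (mul_le_mul e1 e2 (Real.exp_pos _).le (by positivity))
      (hexpφ t ht.1) (Real.exp_pos _).le (by positivity)
    refine le_trans ?_ e3
    have := mul_le_mul_of_nonneg_right h1 (by positivity : 0 ≤ V * φ)
    refine this.trans (le_of_eq ?_)
    ring
  · rw [← hk]
    have k1 : 1 ≤ k := by
      rw [hk]
      refine one_le_mul_of_one_le_of_one_le (Real.one_le_exp (by positivity))
        (Real.one_le_exp ?_)
      have := ht.1
      positivity
    -- an upper bound for `Z`, from `X ≤ v` and the upper bound for the integral of `v`
    have hZup : ∀ τ ∈ Icc 0 T, Z τ ≤ 2 * M₁ * V * φ := by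
      intro τ hτ
      have h1 : ∫ z in c..c + 1 / 2, Z τ * (V⁻¹ * φ⁻¹) ≤ ∫ z in c..c + 1 / 2, S.v z τ :=
        integral_mono_of_continuous hcd (by fun_prop) (by fun_prop) fun z hz =>
          ((hXle z hz τ hτ).2).trans (hXv z τ hτ.1)
      have h2 := S.integral_v_le hτ hc hcd hcL
      have h3 : S.entropy 0 / (P.γ - 1) ≤ E / (P.γ - 1) := div_le_div_of_nonneg_right hE hγ.le
      rw [intervalIntegral.integral_const, smul_eq_mul] at h1
      have h4 : Z τ * (V⁻¹ * φ⁻¹) ≤ 2 * M₁ := by rw [hM₁]; linarith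
      have h5 := mul_le_mul_of_nonneg_right h4 (by positivity : 0 ≤ V * φ)
      have h6 : Z τ * (V⁻¹ * φ⁻¹) * (V * φ) = Z τ := by field_simp
      linarith
    obtain ⟨K₁, hK₁⟩ : ∃ K, K = K₂ * k := ⟨_, rfl⟩
    have K₁0 : 0 < K₁ := by rw [hK₁]; positivity
    have hpt : ∀ z ∈ Icc c (c + 1 / 2), ∀ τ ∈ Icc 0 t,
        S.v z τ ≤ K₁ * (1 + ∫ s in (0 : ℝ)..τ, S.e z s) := by
      intro z hz τ hτ
      have hτ' : τ ∈ Icc 0 T := ⟨hτ.1, hτ.2.trans ht.2⟩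
      obtain ⟨ξ, hξ⟩ : ∃ ξ, ξ = Real.exp (c₁ * t) * Real.exp (φ * Gc * t) := ⟨_, rfl⟩
      have ξ0 : 0 < ξ := by rw [hξ]; positivity
      have hmono : ∀ s ∈ Icc 0 t, Real.exp (c₁ * s) * Real.exp (φ * Gc * s) ≤ ξ := by
        intro s hs
        rw [hξ]
        exact mul_le_mul (Real.exp_le_exp.2 (mul_le_mul_of_nonneg_left hs.2 c₁0))
          (Real.exp_le_exp.2 (mul_le_mul_of_nonneg_left hs.2 (by positivity)))
          (Real.exp_pos _).le (Real.exp_pos _).le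
      have cX : Continuous fun s => S.vX z s := by fun_prop
      have cE : Continuous fun s => S.e z s / S.vX z s :=
        Continuous.div (by fun_prop) cX fun s => (S.vX_pos z s).ne'
      have h1 : ∫ s in (0 : ℝ)..τ, S.e z s / S.vX z s
          ≤ (V ^ 2 * φ ^ 2 / η₀ * ξ) * ∫ s in (0 : ℝ)..τ, S.e z s := by
        rw [← intervalIntegral.integral_const_mul]
        refine integral_mono_of_continuous hτ.1 cE (by fun_prop) fun s hs => ?_
        have hs' : s ∈ Icc 0 t := ⟨hs.1, hs.2.trans hτ.2⟩
        have hsT : s ∈ Icc 0 T := ⟨hs.1, hs'.2.trans ht.2⟩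
        rw [div_eq_mul_inv, mul_comm]
        refine mul_le_mul_of_nonneg_right ?_ (S.e_pos z s).le
        have i1 : (S.vX z s)⁻¹ ≤ (Z s)⁻¹ * (V * φ) := by
          have := inv_anti₀ (by have := Z0 s; positivity) (hXle z hz s hsT).2
          rwa [mul_inv, mul_inv, inv_inv, inv_inv] at this
        have i2 := mul_le_mul_of_nonneg_right (hZlow s hsT) (by positivity : 0 ≤ V * φ)
        have i3 := mul_le_mul_of_nonneg_left (hmono s hs')
          (by positivity : 0 ≤ V ^ 2 * φ ^ 2 / η₀)
        refine i1.trans (i2.trans (le_trans (le_of_eq ?_) i3))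
        ring
      have h2 : S.vX z τ ≤ 2 * M₁ * V ^ 2 * φ ^ 2 * Real.exp (c₁ * t) := by
        refine (hXle z hz τ hτ').1.trans ?_
        have i1 := mul_le_mul (hZup τ hτ') (mul_le_mul_of_nonneg_left
          (Real.exp_le_exp.2 (mul_le_mul_of_nonneg_left hτ.2 c₁0))
          (by positivity : 0 ≤ V * φ)) (by positivity) (by positivity)
        exact i1.trans (le_of_eq (by ring))
      have I0 : 0 ≤ ∫ s in (0 : ℝ)..τ, S.e z s :=
        integral_nonneg_of_continuous hτ.1 fun s _ => (S.e_pos z s).le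
      have hφ2 : 1 ≤ φ ^ 2 := one_le_pow₀ φ1
      have hξ1 : 1 ≤ ξ := by
        rw [hξ]
        have := ht.1
        exact one_le_mul_of_one_le_of_one_le (Real.one_le_exp (by positivity))
          (Real.one_le_exp (by positivity))
      have h3 : 1 + g * ∫ s in (0 : ℝ)..τ, S.e z s / S.vX z s
          ≤ (1 + g * V ^ 2 / η₀) * (φ ^ 2 * ξ) * (1 + ∫ s in (0 : ℝ)..τ, S.e z s) := by
        have i1 := mul_le_mul_of_nonneg_left h1 g0.le
        have i2 : 1 ≤ φ ^ 2 * ξ := one_le_mul_of_one_le_of_one_le hφ2 hξ1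
        have i3 : 0 ≤ g * V ^ 2 / η₀ * (φ ^ 2 * ξ) := by positivity
        have i4 : 0 ≤ φ ^ 2 * ξ * ∫ s in (0 : ℝ)..τ, S.e z s := by positivity
        have i5 : g * ((V ^ 2 * φ ^ 2 / η₀ * ξ) * ∫ s in (0 : ℝ)..τ, S.e z s)
          = g * V ^ 2 / η₀ * (φ ^ 2 * ξ) * ∫ s in (0 : ℝ)..τ, S.e z s := by ring
        rw [i5] at i1
        linarith
      have h4 : Real.exp (c₁ * t) * ξ * φ ^ 4 ≤ cφ ^ 4 * k := by
        have i1 : Real.exp (c₁ * t) * ξ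
            ≤ Real.exp (C * R * t) * Real.exp (C * t * Real.exp (C * H)) := by
          rw [hξ, ← mul_assoc, ← Real.exp_add]
          exact mul_le_mul (Real.exp_le_exp.2 (by linarith [h2R t ht.1])) (hexpφ t ht.1)
            (Real.exp_pos _).le (Real.exp_pos _).le
        have i2 := mul_le_mul i1 h4H (by positivity) (by positivity)
        have i3 := mul_le_mul_of_nonneg_left i2 (by positivity : 0 ≤ cφ ^ 4)
        rw [hφ', hk, Real.exp_add]
        refine le_trans (le_of_eq ?_) (i3.trans (le_of_eq ?_)) <;> ring
      rw [S.v_eq z τ, ← hg, hK₁, hK₂]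
      have h5 := mul_le_mul h2 h3 (add_nonneg zero_le_one (mul_nonneg g0.le
        (integral_nonneg_of_continuous hτ.1 fun s _ =>
          div_nonneg (S.e_pos z s).le (S.vX_pos z s).le))) (by positivity)
      refine h5.trans ?_
      have h6 := mul_le_mul_of_nonneg_left h4
        (by positivity : 0 ≤ 2 * M₁ * V ^ 2 * (1 + g * V ^ 2 / η₀)
          * (1 + ∫ s in (0 : ℝ)..τ, S.e z s))
      refine le_trans (le_of_eq ?_) (h6.trans (le_of_eq ?_)) <;> ring
    -- the supremum `M` of `v` over the interval satisfies an integral inequality whose rate is the heat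
    -- production
    let M : ℝ → ℝ := fun τ => sSup ((fun z => S.v z τ) '' Icc c (c + 1 / 2))
    have cM : Continuous M := by
      refine IsCompact.continuous_sSup (f := fun τ z => S.v z τ) isCompact_Icc ?_
      change Continuous fun q : ℝ × ℝ => S.v q.2 q.1
      fun_prop
    have hbdd : ∀ τ, BddAbove ((fun z => S.v z τ) '' Icc c (c + 1 / 2)) := fun τ =>
      (isCompact_Icc.image (by fun_prop)).bddAbove
    have hvM : ∀ z ∈ Icc c (c + 1 / 2), ∀ τ, S.v z τ ≤ M τ := fun z hz τ =>
      le_csSup (hbdd τ) (mem_image_of_mem _ hz)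
    have M0 : ∀ τ, 0 < M τ := fun τ => (S.v_pos c τ).trans_le (hvM c ⟨le_rfl, hcd⟩ τ)
    have cHP := S.continuous_heatProd
    have he : ∀ z ∈ Icc c (c + 1 / 2), ∀ s ∈ Icc 0 T,
        S.e z s ≤ M₂ * (4 + M s * H * S.heatProd s) := by
      intro z hz s hs
      have hM0 := (M0 s).le
      have h1 := S.e_le (M := M s * H) hs hc hcL (by positivity) (fun w hw => by
        have i1 := mul_le_mul_of_nonneg_left (hH w hw s hs) hM0
        have i2 := hvM w hw s
        linarith) hz
      refine h1.trans (mul_le_mul_of_nonneg_right (by rw [hM₂]; linarith) ?_)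
      have := S.heatProd_nonneg s
      positivity
    have hMle := gronwall_integral (T := t) (A := K₁ * (1 + 4 * M₂ * t)) (φ := M)
      (g := fun s => K₁ * (M₂ * H) * S.heatProd s) cM (by fun_prop)
      (fun s _ => by have := S.heatProd_nonneg s; positivity) (fun τ hτ => by
        refine csSup_le ((nonempty_Icc.2 hcd).image _) ?_
        rintro _ ⟨z, hz, rfl⟩
        refine (hpt z hz τ hτ).trans ?_
        have h1 : ∫ s in (0 : ℝ)..τ, S.e z s
            ≤ ∫ s in (0 : ℝ)..τ, (4 * M₂ + M₂ * H * (S.heatProd s * M s)) := by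
          refine integral_mono_of_continuous hτ.1 (by fun_prop) (by fun_prop) fun s hs => ?_
          have := he z hz s ⟨hs.1, (hs.2.trans hτ.2).trans ht.2⟩
          linarith
        rw [integral_add_of_continuous (by fun_prop) (by fun_prop),
          intervalIntegral.integral_const, smul_eq_mul, intervalIntegral.integral_const_mul] at h1
        have h2 : ∫ s in (0 : ℝ)..τ, K₁ * (M₂ * H) * S.heatProd s * M s
            = K₁ * (M₂ * H * ∫ s in (0 : ℝ)..τ, S.heatProd s * M s) := by
          rw [← intervalIntegral.integral_const_mul, ← intervalIntegral.integral_const_mul]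
          congr 1; ext s; ring
        have h3 := mul_le_mul_of_nonneg_left hτ.2 (by positivity : 0 ≤ 4 * M₂)
        rw [h2, ← mul_add]
        exact mul_le_mul_of_nonneg_left (by linarith) K₁0.le) t ⟨ht.1, le_rfl⟩
    refine (hvM x hx t).trans (hMle.trans ?_)
    have ht0 := ht.1
    have hheat : ∫ s in (0 : ℝ)..t, S.heatProd s ≤ E / P.κ := by
      rw [le_div_iff₀ hκ, mul_comm]
      exact (S.integral_heatProd_le ht).trans hE
    refine mul_le_mul ?_ (Real.exp_le_exp.2 ?_) (Real.exp_pos _).le (by positivity)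
    · have i1 : K₂ * (4 * M₂) ≤ C := by
        have : 0 ≤ 1 + V ^ 2 * cφ ^ 2 / η₀ + 4 * cH + 2 * cR + Gc * cφ
          + K₂ * (M₂ * (E / P.κ)) := by positivity
        rw [hC]; linarith
      have i2 : 1 + 4 * M₂ * t ≤ 4 * M₂ * (1 + t) := by rw [hM₂]; linarith
      have i3 := mul_le_mul_of_nonneg_left i2 K₁0.le
      have i4 := mul_le_mul_of_nonneg_right i1 (by positivity : 0 ≤ (1 + t) * k)
      rw [hK₁] at i3 ⊢
      refine i3.trans (le_trans (le_of_eq ?_) (i4.trans (le_of_eq ?_))) <;> ring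
    · rw [intervalIntegral.integral_const_mul]
      have i1 : K₂ * (M₂ * (E / P.κ)) ≤ C := by
        have : 0 ≤ 1 + V ^ 2 * cφ ^ 2 / η₀ + 4 * cH + 2 * cR + Gc * cφ
          + K₂ * (4 * M₂) := by positivity
        rw [hC]; linarith
      have i2 := mul_le_mul_of_nonneg_left hheat (by positivity : 0 ≤ K₁ * (M₂ * H))
      have i3 := mul_le_mul_of_nonneg_right i1 (by positivity : 0 ≤ H * k)
      rw [hK₁] at i2 ⊢
      refine i2.trans (le_trans (le_of_eq ?_) (i3.trans (le_of_eq ?_))) <;> ring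

end Flow

end SphNS

namespace SphNS

/-! ### The explicit bounds of the specific volume -/

theorem exists_psi_eq {y : ℝ} (hy : 0 ≤ y) : ∃ s ∈ Ioc (0 : ℝ) 1, psi s = y := by
  have h0 : 0 < Real.exp (-(y + 1)) := Real.exp_pos _
  have h1 : Real.exp (-(y + 1)) ≤ 1 := Real.exp_le_one_iff.2 (by linarith)
  have hc : ContinuousOn psi (Icc (Real.exp (-(y + 1))) 1) := fun z hz => by
    have : z ≠ 0 := (h0.trans_le hz.1).ne'
    exact ((continuousAt_id.sub continuousAt_const).sub
      (Real.continuousAt_log this)).continuousWithinAt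
  have hmem : y ∈ Icc (psi 1) (psi (Real.exp (-(y + 1)))) := by
    unfold psi
    rw [Real.log_exp, Real.log_one]
    constructor <;> linarith
  obtain ⟨s, hs, hsy⟩ := intermediate_value_Icc' h1 hc hmem
  exact ⟨s, ⟨h0.trans_le hs.1, hs.2⟩, hsy⟩

theorem psiInvLeft_mem {y : ℝ} (hy : 0 ≤ y) : psiInvLeft y ∈ Ioc (0 : ℝ) 1 := by
  obtain ⟨s, hs, h⟩ := exists_psi_eq hy
  exact Function.invFunOn_mem ⟨s, hs, h⟩

theorem psi_psiInvLeft {y : ℝ} (hy : 0 ≤ y) : psi (psiInvLeft y) = y := by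
  obtain ⟨s, hs, h⟩ := exists_psi_eq hy
  exact Function.invFunOn_eq ⟨s, hs, h⟩

/-- The lower bound for `rⁿ` which enters the definition of `h`. -/
noncomputable def hBase (P : FluidParams) (C₀ z a : ℝ) : ℝ :=
  a ^ P.n + P.n * z * psiInvLeft (C₀ / z)

section

variable {P : FluidParams} {C₀ z a : ℝ}

theorem hBase_term_nonneg (hC : 0 < C₀) (hz : 0 ≤ z) : 0 ≤ P.n * z * psiInvLeft (C₀ / z) :=
  mul_nonneg (mul_nonneg P.n_pos.le hz) (psiInvLeft_mem (div_nonneg hC.le hz)).1.le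

theorem hBase_pos (hC : 0 < C₀) (hz : 0 ≤ z) (ha : 0 ≤ a) (h : 0 < z ∨ 0 < a) :
    0 < hBase P C₀ z a := by
  unfold hBase
  rcases h with h | h
  · have := mul_pos (mul_pos P.n_pos h) (psiInvLeft_mem (div_nonneg hC.le hz)).1
    positivity
  · have := hBase_term_nonneg (P := P) hC hz
    positivity

theorem hFun_eq : hFun P C₀ z a = hBase P C₀ z a ^ (-(2 * (P.m : ℝ)) / (P.n : ℝ)) := rfl

theorem hFun_pos (hC : 0 < C₀) (hz : 0 ≤ z) (ha : 0 ≤ a) (h : 0 < z ∨ 0 < a) :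
    0 < hFun P C₀ z a := Real.rpow_pos_of_pos (hBase_pos hC hz ha h) _

theorem hFun_le (hC : 0 < C₀) (hz : 0 < z) (ha : 0 ≤ a) : hFun P C₀ z a ≤ hFun P C₀ z 0 := by
  rw [hFun_eq, hFun_eq]
  have hm := P.one_le_m_cast
  have hn := P.n_pos
  refine Real.rpow_le_rpow_of_nonpos (hBase_pos hC hz.le le_rfl (Or.inl hz)) ?_ ?_
  · unfold hBase
    rw [zero_pow (by have := P.two_le_n; omega)]
    have := pow_nonneg ha P.n
    linarith
  · exact div_nonpos_of_nonpos_of_nonneg (by linarith) hn.le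

theorem hFun_rpow (hC : 0 < C₀) (hz : 0 ≤ z) (ha : 0 ≤ a) (h : 0 < z ∨ 0 < a) :
    hFun P C₀ z a ^ ((P.n : ℝ) / (2 * (P.m : ℝ))) = (hBase P C₀ z a)⁻¹ := by
  have hb := hBase_pos (P := P) hC hz ha h
  have hm : (P.m : ℝ) ≠ 0 := by linarith [P.one_le_m_cast]
  have hn := P.n_pos.ne'
  rw [hFun_eq, ← Real.rpow_mul hb.le]
  have : -(2 * (P.m : ℝ)) / (P.n : ℝ) * ((P.n : ℝ) / (2 * (P.m : ℝ))) = -1 := by field_simp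
  rw [this, Real.rpow_neg_one]

theorem rpow_le_one_add {h : ℝ} (hh : 0 ≤ h) : h ^ ((P.n : ℝ) / (2 * (P.m : ℝ))) ≤ 1 + h := by
  have hm := P.one_le_m_cast
  have h1 : (P.n : ℝ) / (2 * (P.m : ℝ)) ≤ 1 := by
    rw [P.n_cast, div_le_one (by linarith)]; linarith
  rcases le_or_gt h 1 with h2 | h2
  · have := Real.rpow_le_one hh h2 (div_nonneg P.n_pos.le (by linarith) :
      0 ≤ (P.n : ℝ) / (2 * (P.m : ℝ)))
    linarith
  · have := Real.rpow_le_rpow_of_exponent_le h2.le h1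
    rw [Real.rpow_one] at this
    linarith

end

/-- For bounded `h` and `t` the explicit bounds of the specific volume are bounded. -/
theorem exists_vUpper_vLower_le (P : FluidParams) {C₀ : ℝ} (hC : 0 < C₀) (T hb : ℝ) :
    ∃ V, 1 < V ∧ ∀ z a t, 0 ≤ z → 0 ≤ a → (0 < z ∨ 0 < a) → hFun P C₀ z a ≤ hb → 0 ≤ t → t ≤ T →
    V⁻¹ ≤ vLower P C₀ z t a ∧ vUpper P C₀ z t a ≤ V := by
  have hβ := P.β_pos
  let f := Real.exp (C₀ * hb)
  let U := C₀ * (1 + T) ^ 2 * f * Real.exp (C₀ * T * f + C₀ * (1 + T) * hb * f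
    * Real.exp (C₀ * T * f))
  let W := C₀ * (1 + T) * f * Real.exp (T * C₀ * f ^ 2) * Real.exp (P.m * C₀ * T / P.β * (1 + hb))
  refine ⟨2 + |U| + |W|, by linarith [abs_nonneg U, abs_nonneg W], ?_⟩
  intro z a t hz ha hza hh ht htT
  have h0 := hFun_pos (P := P) hC hz ha hza
  have hb0 : 0 < hb := h0.trans_le hh
  have hT : 0 ≤ T := ht.trans htT
  have hf : fFun P C₀ z a ≤ f := Real.exp_le_exp.2 (mul_le_mul_of_nonneg_left hh hC.le)
  have f0 : 0 < fFun P C₀ z a := Real.exp_pos _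
  have f0' : 0 < f := Real.exp_pos _
  constructor
  · have hW : (vLower P C₀ z t a)⁻¹ ≤ W := by
      have e : (vLower P C₀ z t a)⁻¹ = C₀ * (1 + t) * fFun P C₀ z a
          * Real.exp (t * C₀ * fFun P C₀ z a ^ 2) * Real.exp (P.m * C₀ * t / P.β
            * hFun P C₀ z a ^ ((P.n : ℝ) / (2 * (P.m : ℝ)))) := by
        unfold vLower GammaFun
        rw [neg_mul]
        simp only [mul_inv, inv_inv, Real.exp_neg]
      rw [e]
      have h1 : hFun P C₀ z a ^ ((P.n : ℝ) / (2 * (P.m : ℝ))) ≤ 1 + hb :=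
        (rpow_le_one_add h0.le).trans (by linarith)
      have h2 : 0 ≤ hFun P C₀ z a ^ ((P.n : ℝ) / (2 * (P.m : ℝ))) := Real.rpow_nonneg h0.le _
      simp only [W]
      gcongr
    have hpos : 0 < vLower P C₀ z t a := by
      unfold vLower GammaFun
      have : 0 < 1 + t := by linarith
      positivity
    refine inv_le_of_inv_le₀ hpos (hW.trans ?_)
    linarith [le_abs_self W, abs_nonneg U]
  · have hU : vUpper P C₀ z t a ≤ U := by
      unfold vUpper
      simp only [U]
      have := h0.le
      gcongr
    linarith [le_abs_self U, abs_nonneg W]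

/-- The bounds of the specific volume on an interval of length `1/2` imply the bounds in terms of
`h` once `C₀` is large. -/
theorem vLower_le_and_le_vUpper (P : FluidParams) {C C₀ z a t v : ℝ} (hC1 : 1 ≤ C)
    (hC0 : 4 * C + 2 * C * P.β ≤ C₀) (hz : 0 ≤ z) (ha : 0 < a) (ht : 0 ≤ t)
    (h : C⁻¹ * Real.exp (-(C * (4 * hFun P C₀ z a)))
        * Real.exp (-(C * (2 * hFun P C₀ z a ^ ((P.n : ℝ) / (2 * (P.m : ℝ)))) * t))
        * Real.exp (-(C * t * Real.exp (C * (4 * hFun P C₀ z a)))) ≤ v ∧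
      v ≤ C * (1 + t) * (Real.exp (C * (4 * hFun P C₀ z a))
          * Real.exp (C * (2 * hFun P C₀ z a ^ ((P.n : ℝ) / (2 * (P.m : ℝ)))) * t
            + C * t * Real.exp (C * (4 * hFun P C₀ z a))))
        * Real.exp (C * (4 * hFun P C₀ z a) * (Real.exp (C * (4 * hFun P C₀ z a))
          * Real.exp (C * (2 * hFun P C₀ z a ^ ((P.n : ℝ) / (2 * (P.m : ℝ)))) * t
            + C * t * Real.exp (C * (4 * hFun P C₀ z a)))))) :
    vLower P C₀ z t a ≤ v ∧ v ≤ vUpper P C₀ z t a := by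
  have hβ := P.β_pos
  have hm := P.one_le_m_cast
  have hCβ : 0 < C * P.β := by positivity
  have hC4 : 4 * C ≤ C₀ := by linarith
  have hC₀ : 0 < C₀ := by linarith
  have h0 := hFun_pos (P := P) hC₀ hz ha.le (Or.inr ha)
  have hle := rpow_le_one_add (P := P) h0.le
  have hr0 : 0 ≤ hFun P C₀ z a ^ ((P.n : ℝ) / (2 * (P.m : ℝ))) := Real.rpow_nonneg h0.le _
  unfold vLower vUpper fFun GammaFun
  generalize hFun P C₀ z a ^ ((P.n : ℝ) / (2 * (P.m : ℝ))) = h' at *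
  generalize hFun P C₀ z a = h₀ at *
  obtain ⟨f, hf⟩ : ∃ f, f = Real.exp (C₀ * h₀) := ⟨_, rfl⟩
  rw [← hf]
  have f1 : 1 ≤ f := by rw [hf]; exact Real.one_le_exp (by positivity)
  have hfe : Real.exp (C * (4 * h₀)) ≤ f := by
    rw [hf]
    refine Real.exp_le_exp.2 ?_
    have := mul_le_mul_of_nonneg_right hC4 h0.le
    linarith
  have hf1 : 1 + h₀ ≤ f := by
    rw [hf]
    have := Real.add_one_le_exp (C₀ * h₀)
    have : 1 * h₀ ≤ C₀ * h₀ := mul_le_mul_of_nonneg_right (by linarith) h0.le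
    linarith
  constructor
  · refine le_trans ?_ h.1
    have e1 : C₀⁻¹ * (1 + t)⁻¹ ≤ C⁻¹ := by
      rw [← mul_inv]
      refine inv_anti₀ (by linarith) ?_
      have : 0 ≤ C₀ * t := by positivity
      linarith
    have e2 : f⁻¹ ≤ Real.exp (-(C * (4 * h₀))) := by
      rw [Real.exp_neg]; exact inv_anti₀ (Real.exp_pos _) hfe
    have e3 : Real.exp (-(t * C₀ * f ^ 2)) ≤ Real.exp (-(C * t * Real.exp (C * (4 * h₀)))) := by
      refine Real.exp_le_exp.2 (neg_le_neg ?_)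
      have i1 : Real.exp (C * (4 * h₀)) ≤ f ^ 2 := hfe.trans (le_self_pow₀ f1 (by norm_num))
      have i2 := mul_le_mul (by linarith : C ≤ C₀) i1 (Real.exp_pos _).le hC₀.le
      have := mul_le_mul_of_nonneg_left i2 ht
      linarith
    have e4 : Real.exp (-(P.m * C₀ * t / P.β) * h') ≤ Real.exp (-(C * (2 * h') * t)) := by
      refine Real.exp_le_exp.2 ?_
      rw [neg_mul]
      refine neg_le_neg ?_
      have i1 : C * 2 ≤ P.m * C₀ / P.β := by
        rw [le_div_iff₀ hβ]
        have := mul_le_mul_of_nonneg_right hm hC₀.le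
        linarith
      have := mul_le_mul_of_nonneg_right i1 (mul_nonneg hr0 ht)
      refine le_trans (le_of_eq ?_) (this.trans (le_of_eq ?_)) <;> ring
    have p1 : 0 < (1 + t)⁻¹ := inv_pos.2 (by linarith)
    have := mul_le_mul (mul_le_mul (mul_le_mul e1 e2 (by positivity) (by positivity)) e3
      (Real.exp_pos _).le (by positivity)) e4 (Real.exp_pos _).le (by positivity)
    refine this.trans (le_of_eq ?_)
    ring
  · refine h.2.trans ?_
    obtain ⟨k, hk⟩ : ∃ k, k = Real.exp (C * (4 * h₀))
      * Real.exp (C * (2 * h') * t + C * t * Real.exp (C * (4 * h₀))) := ⟨_, rfl⟩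
    rw [← hk]
    have hkf : k ≤ f * Real.exp (C₀ * t * f) := by
      rw [hk]
      refine mul_le_mul hfe (Real.exp_le_exp.2 ?_) (Real.exp_pos _).le (by positivity)
      have i1 := mul_le_mul_of_nonneg_left (hle.trans hf1) (by positivity : 0 ≤ 2 * C * t)
      have i2 := mul_le_mul_of_nonneg_left hfe (by positivity : 0 ≤ C * t)
      have i3 := mul_le_mul_of_nonneg_right (by linarith : 3 * C ≤ C₀)
        (by positivity : 0 ≤ t * f)
      linarith
    have k0 : 0 ≤ k := by rw [hk]; positivity
    have e1 : C * (1 + t) * k ≤ C₀ * (1 + t) ^ 2 * (f * Real.exp (C₀ * t * f)) := by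
      refine mul_le_mul (mul_le_mul (by linarith) ?_ (by linarith) hC₀.le) hkf k0 (by positivity)
      exact le_self_pow₀ (by linarith) (by norm_num)
    have e2 : Real.exp (C * (4 * h₀) * k)
        ≤ Real.exp (C₀ * (1 + t) * h₀ * f * Real.exp (C₀ * t * f)) := by
      refine Real.exp_le_exp.2 ?_
      have i1 : C * (4 * h₀) ≤ C₀ * (1 + t) * h₀ := by
        have j1 := mul_le_mul_of_nonneg_right hC4 h0.le
        have j2 : 0 ≤ C₀ * t * h₀ := by positivity
        linarith
      have := mul_le_mul i1 hkf k0 (by positivity)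
      linarith
    rw [Real.exp_add]
    refine (mul_le_mul e1 e2 (Real.exp_pos _).le (by positivity)).trans (le_of_eq ?_)
    ring

namespace Flow

variable {P : FluidParams} {L T : ℝ} {S : Flow P L T}

/-- The basic information on a solution: the entropy bound, the bounds for the initial specific
volume, and the relation between `r` and `v`. -/
structure Basic (S : Flow P L T) (E V a : ℝ) : Prop where
  ent : S.entropy 0 ≤ E
  init_v : ∀ x ∈ Icc 0 L, V⁻¹ ≤ S.v x 0 ∧ S.v x 0 ≤ V
  init : ∫ x in (0 : ℝ)..L, (S.u x 0 ^ 4 + (S.e x 0 - 1) ^ 2) ≤ E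
  a_pos : 0 < a
  a_lt : a < 1
  r_pow : ∀ x ∈ Icc 0 L, ∀ t ∈ Icc 0 T, S.r x t ^ P.n = a ^ P.n + P.n * ∫ y in (0 : ℝ)..x, S.v y t

variable {E V a : ℝ}

/-- The lower bound for the radius at `x ≥ z/2`. By the entropy bound the integral of `ψ(v)` over
`[0,z/2]` is at most `C₀/2`, so that the mean of `v` there is at least `psiInvLeft (C₀/z)`. The loss
of one half of the interval leaves room for intervals of length `1/2` when `z` is close to `L`. -/
theorem Basic.hBase_le (h : S.Basic E V a) {C₀ z : ℝ} (hC : 0 < C₀)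
    (hE : 2 * (E / (P.γ - 1)) ≤ C₀) (hz : 0 ≤ z) {x t : ℝ} (hzx : z / 2 ≤ x) (hx : x ≤ L)
    (ht : t ∈ Icc 0 T) : 1 / 2 * hBase P C₀ z a ≤ S.r x t ^ P.n := by
  have hγ := P.γ_sub_pos
  have hn := P.n_pos
  have ha := pow_pos h.a_pos P.n
  have hx0 : 0 ≤ x := by linarith
  rw [h.r_pow x ⟨hx0, hx⟩ t ht]
  unfold hBase
  rcases hz.eq_or_lt with rfl | hz'
  · have : 0 ≤ ∫ y in (0 : ℝ)..x, S.v y t :=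
      integral_nonneg_of_continuous hx0 fun y _ => (S.v_pos y t).le
    have := mul_nonneg hn.le this
    simp only [mul_zero, zero_mul, add_zero]
    linarith
  · have hq : 0 < C₀ / z := div_pos hC hz'
    have hs := psiInvLeft_mem hq.le
    have hψ := psi_psiInvLeft hq.le
    have hs1 : psiInvLeft (C₀ / z) < 1 := by
      refine lt_of_le_of_ne hs.2 fun h1 => ?_
      rw [h1] at hψ
      unfold psi at hψ
      rw [Real.log_one] at hψ
      linarith
    have h1 := mul_le_integral_of_psi (v := fun y => S.v y t) (by fun_prop)
      (fun y => S.v_pos y t) (c := 0) (d := z / 2) (by linarith) hs.1 hs1 (by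
        rw [hψ]
        have h2 : ∫ y in (0 : ℝ)..z / 2, psi (S.v y t) ≤ E / (P.γ - 1) := by
          rw [le_div_iff₀ hγ, mul_comm]
          exact (S.integral_psi_v_le ht le_rfl (by linarith) (hzx.trans hx)).trans h.ent
        have h3 : (z / 2 - 0) * (C₀ / z) = C₀ / 2 := by field_simp; ring
        rw [h3]; linarith)
    have h2 : ∫ y in (0 : ℝ)..z / 2, S.v y t ≤ ∫ y in (0 : ℝ)..x, S.v y t :=
      integral_le_integral_of_subinterval le_rfl (by linarith) hzx (by fun_prop)
        fun y _ => (S.v_pos y t).le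
    have h3 := mul_le_mul_of_nonneg_left (h1.trans h2) hn.le
    linarith

/-- The lower bound for the radius, in the form of upper bounds for `r⁻²ᵐ` and `r⁻ⁿ`. -/
theorem Basic.one_le_hFun_mul (h : S.Basic E V a) {C₀ z : ℝ} (hC : 0 < C₀)
    (hE : 2 * (E / (P.γ - 1)) ≤ C₀) (hz : 0 ≤ z) {x t : ℝ} (hzx : z / 2 ≤ x) (hx : x ≤ L)
    (ht : t ∈ Icc 0 T) : 1 ≤ 4 * hFun P C₀ z a * S.rm x t ^ 2 ∧
      1 ≤ 2 * hFun P C₀ z a ^ ((P.n : ℝ) / (2 * (P.m : ℝ))) * (S.r x t * S.rm x t) := by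
  have hb := hBase_pos (P := P) hC hz h.a_pos.le (Or.inr h.a_pos)
  have hle := h.hBase_le hC hE hz hzx hx ht
  have hr := S.r_pos x t
  have hn := P.n_pos
  have hm := P.one_le_m_cast
  constructor
  · -- raise the lower bound for `rⁿ` to the power `2m/n ≤ 2`
    have e1 : S.rm x t ^ 2 = (S.r x t ^ P.n) ^ (2 * (P.m : ℝ) / P.n) := by
      rw [← Real.rpow_natCast (S.r x t) P.n, ← Real.rpow_mul hr.le]
      have : (P.n : ℝ) * (2 * (P.m : ℝ) / P.n) = ((P.m * 2 : ℕ) : ℝ) := by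
        push_cast; field_simp
      rw [this, Real.rpow_natCast, pow_mul]
      rfl
    have e2 := Real.rpow_le_rpow (by positivity) hle
      (by positivity : 0 ≤ 2 * (P.m : ℝ) / P.n)
    rw [Real.mul_rpow (by norm_num) hb.le, ← e1] at e2
    have e3 : (1 / 4 : ℝ) ≤ (1 / 2) ^ (2 * (P.m : ℝ) / P.n) := by
      have i1 : 2 * (P.m : ℝ) / P.n ≤ 2 := by
        rw [div_le_iff₀ hn, P.n_cast]; linarith
      have := Real.rpow_le_rpow_of_exponent_ge (by norm_num : (0 : ℝ) < 1 / 2) (by norm_num) i1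
      refine le_trans (by norm_num) this
    have e4 : hFun P C₀ z a * hBase P C₀ z a ^ (2 * (P.m : ℝ) / P.n) = 1 := by
      rw [hFun_eq, ← Real.rpow_add hb, neg_div, neg_add_cancel, Real.rpow_zero]
    have h0 := hFun_pos (P := P) hC hz h.a_pos.le (Or.inr h.a_pos)
    have e5 := mul_le_mul_of_nonneg_left e2 h0.le
    have e6 := mul_le_mul_of_nonneg_right e3 (zero_le_one.trans_eq e4.symm)
    rw [e4] at e6
    have e7 : hFun P C₀ z a * ((1 / 2) ^ (2 * (P.m : ℝ) / P.n)
        * hBase P C₀ z a ^ (2 * (P.m : ℝ) / P.n)) = (1 / 2) ^ (2 * (P.m : ℝ) / P.n)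
        * (hFun P C₀ z a * hBase P C₀ z a ^ (2 * (P.m : ℝ) / P.n)) := by ring
    rw [e7, e4] at e5
    linarith
  · have e1 : S.r x t * S.rm x t = S.r x t ^ P.n := by
      unfold rm; rw [P.n_eq, pow_succ]; ring
    rw [hFun_rpow hC hz h.a_pos.le (Or.inr h.a_pos), e1]
    have := mul_le_mul_of_nonneg_left hle (by positivity : 0 ≤ 2 * (hBase P C₀ z a)⁻¹)
    refine le_trans (le_of_eq ?_) this
    field_simp

/-- The explicit bounds of the specific volume. -/
theorem exists_v_bounds (P : FluidParams) {E V : ℝ} (hE1 : 1 ≤ E) (hV1 : 1 ≤ V) :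
    ∃ C, 1 ≤ C ∧ ∀ C₀, C ≤ C₀ → ∀ (L T : ℝ) (S : Flow P L T) (a : ℝ), S.Basic E V a →
    ∀ z, 0 ≤ z → ∀ x ∈ Icc z L, ∀ t ∈ Icc 0 T,
      vLower P C₀ z t a ≤ S.v x t ∧ S.v x t ≤ vUpper P C₀ z t a := by
  obtain ⟨C, hC1, hC⟩ := exists_v_bounds_segment P hE1 hV1
  have hβ := P.β_pos
  have hγ := P.γ_sub_pos
  have hEγ : 0 < E / (P.γ - 1) := by positivity
  have hCβ : 0 < C * P.β := by positivity
  refine ⟨4 * C + 2 * C * P.β + 2 * (E / (P.γ - 1)), by linarith, ?_⟩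
  intro C₀ hC₀ L T S a h z hz x hx t ht
  have hC₀' : 0 < C₀ := by linarith
  have hL := S.one_le_L
  obtain ⟨c, hyc, hcL, hxc⟩ := exists_half_interval (y := min z (L - 1 / 2)) (L := L) (x := x)
    (by linarith [min_le_right z (L - 1 / 2)]) ⟨(min_le_left _ _).trans hx.1, hx.2⟩
  have hzc : z / 2 ≤ c := by
    refine le_trans (le_min (by linarith) ?_) hyc
    linarith [hx.1, hx.2]
  have h0 := hFun_pos (P := P) hC₀' hz h.a_pos.le (Or.inr h.a_pos)
  refine vLower_le_and_le_vUpper P hC1 (by linarith) hz h.a_pos ht.1 ?_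
  exact hC L T S h.ent h.init_v c (4 * hFun P C₀ z a)
    (2 * hFun P C₀ z a ^ ((P.n : ℝ) / (2 * (P.m : ℝ)))) (by linarith) hcL
    (fun w hw τ hτ => (h.one_le_hFun_mul hC₀' (by linarith) hz (hzc.trans hw.1)
      (hw.2.trans hcL) hτ).1)
    (fun w hw τ hτ => (h.one_le_hFun_mul hC₀' (by linarith) hz (hzc.trans hw.1)
      (hw.2.trans hcL) hτ).2)
    (by positivity) (by have := Real.rpow_nonneg h0.le ((P.n : ℝ) / (2 * (P.m : ℝ))); positivity)
    x hxc t ht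

/-- The hypotheses of the energy estimates hold on `[y,L]`, with a constant depending on an upper
bound for `h(y,a)`. -/
theorem exists_bounded (P : FluidParams) {E V C₀ : ℝ} (hE1 : 1 ≤ E) (hC₀ : 0 < C₀)
    (hEC : 2 * (E / (P.γ - 1)) ≤ C₀) (T hb : ℝ) :
    ∃ K, 1 ≤ K ∧ ∀ (L : ℝ) (S : Flow P L T) (a : ℝ), S.Basic E V a →
    (∀ z, 0 ≤ z → ∀ x ∈ Icc z L, ∀ t ∈ Icc 0 T,
      vLower P C₀ z t a ≤ S.v x t ∧ S.v x t ≤ vUpper P C₀ z t a) →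
    ∀ y, 0 ≤ y → y + 1 / 2 ≤ L → hFun P C₀ y a ≤ hb → ∀ K', K ≤ K' → S.Bounded K' y := by
  obtain ⟨V', hV'1, hV'⟩ := exists_vUpper_vLower_le P hC₀ T hb
  have hγ := P.γ_sub_pos
  have hEγ : 0 < E / (P.γ - 1) := by positivity
  have hn := P.n_pos
  obtain ⟨M, hM⟩ : ∃ M, M = 1 + P.n * (2 * (E / (P.γ - 1)) + 2) := ⟨_, rfl⟩
  have M0 : 0 < M := by rw [hM]; positivity
  have M1 : 1 ≤ M := by rw [hM]; exact le_add_of_nonneg_right (by positivity)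
  refine ⟨V' + |T| + E + M + 2 * (1 + |hb|), by
    linarith [abs_nonneg T, abs_nonneg hb], ?_⟩
  intro L S a h hv y hy hyL hh K' hK'
  have n1 := abs_nonneg T
  have n2 := abs_nonneg hb
  have n3 := le_abs_self T
  have n4 := le_abs_self hb
  have h0 := hFun_pos (P := P) hC₀ hy h.a_pos.le (Or.inr h.a_pos)
  have hvb : ∀ x ∈ Icc y L, ∀ t ∈ Icc 0 T, V'⁻¹ ≤ S.v x t ∧ S.v x t ≤ V' := by
    intro x hx t ht
    have h1 := hv y hy x hx t ht
    have h2 := hV' y a t hy h.a_pos.le (Or.inr h.a_pos) hh ht.1 ht.2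
    exact ⟨h2.1.trans h1.1, h1.2.trans h2.2⟩
  have n0 : P.n ≠ 0 := by have := P.two_le_n; omega
  have K0 : 0 < K' := by linarith
  refine ⟨by linarith, by linarith, hy, hyL, fun x hx t ht => ?_, fun x hx t ht => ?_,
    fun x hx t ht => ?_, fun x hx hx1 t ht => ?_, by linarith [h.ent], by linarith [h.init]⟩
  · exact (inv_anti₀ (by linarith) (by linarith)).trans (hvb x hx t ht).1
  · linarith [(hvb x hx t ht).2]
  · have h1 := (h.one_le_hFun_mul hC₀ hEC hy (by linarith [hx.1]) hx.2 ht).2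
    have h2 := rpow_le_one_add (P := P) h0.le
    have e1 : S.r x t * S.rm x t = S.r x t ^ P.n := by
      unfold rm; rw [P.n_eq, pow_succ]; ring
    rw [e1] at h1
    have hr := S.r_pos x t
    have h3 : 1 ≤ K' * S.r x t ^ P.n := by
      refine h1.trans (mul_le_mul_of_nonneg_right ?_ (by positivity))
      linarith
    rcases le_or_gt 1 (S.r x t) with h4 | h4
    · refine le_trans ?_ h4
      exact inv_le_one_of_one_le₀ (by linarith)
    · rw [inv_le_iff_one_le_mul₀ K0, mul_comm]
      refine h3.trans (mul_le_mul_of_nonneg_left ?_ K0.le)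
      exact pow_le_of_le_one hr.le h4.le n0
  · have hx0 : 0 ≤ x := hy.trans hx.1
    have h1 := h.r_pow x ⟨hx0, hx.2⟩ t ht
    have h2 := S.integral_v_le ht le_rfl hx0 hx.2
    have h3 : S.entropy 0 / (P.γ - 1) ≤ E / (P.γ - 1) := div_le_div_of_nonneg_right h.ent hγ.le
    have h4 := mul_le_mul_of_nonneg_left (by linarith : ∫ y in (0 : ℝ)..x, S.v y t
      ≤ 2 * (E / (P.γ - 1)) + 2) hn.le
    have h5 : a ^ P.n ≤ 1 := pow_le_one₀ h.a_pos.le h.a_lt.le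
    have h6 : S.r x t ^ P.n ≤ M := by rw [h1, hM]; linarith
    have h7 : S.r x t ≤ M := by
      rcases le_or_gt (S.r x t) 1 with h8 | h8
      · exact h8.trans M1
      · exact (le_self_pow₀ h8.le n0).trans h6
    linarith

end Flow

end SphNS

namespace SphNS

/-! ### Positivity of the temperature -/

theorem hasDerivAt_max_pow (k : ℕ) (s : ℝ) :
    HasDerivAt (fun s : ℝ => max s 0 ^ (k + 2)) ((k + 2 : ℕ) * max s 0 ^ (k + 1)) s := by
  rcases lt_trichotomy s 0 with h | h | h
  · have : (fun s : ℝ => max s 0 ^ (k + 2)) =ᶠ[nhds s] fun _ => 0 := by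
      filter_upwards [Iio_mem_nhds h] with z hz
      rw [max_eq_right (le_of_lt hz), zero_pow (by omega)]
    rw [max_eq_right h.le, zero_pow (by omega), mul_zero]
    exact (hasDerivAt_const s 0).congr_of_eventuallyEq this
  · subst h
    have hO : (fun s : ℝ => max s 0 ^ (k + 2)) =O[nhds 0] fun s : ℝ => ‖s - 0‖ ^ (k + 2) := by
      refine Asymptotics.IsBigO.of_norm_le fun z => ?_
      rw [sub_zero, norm_pow, Real.norm_eq_abs, Real.norm_eq_abs]
      refine pow_le_pow_left₀ (abs_nonneg _) ?_ _
      rcases le_total z 0 with h | h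
      · simp [max_eq_right h]
      · rw [max_eq_left h]
    simpa using (hO.hasFDerivAt (by omega)).hasDerivAt
  · have : (fun s : ℝ => max s 0 ^ (k + 2)) =ᶠ[nhds s] fun s => s ^ (k + 2) := by
      filter_upwards [Ioi_mem_nhds h] with z hz
      rw [max_eq_left (le_of_lt hz)]
    rw [max_eq_left h.le]
    exact (hasDerivAt_pow (k + 2) s).congr_of_eventuallyEq this

namespace Flow

variable {P : FluidParams} {L T : ℝ} {S : Flow P L T} {K : ℝ}

/-- A minimum principle for the temperature, by a truncation argument. The compression work is
compared with a function `c` of time; where `e exp(∫ c)` is below its initial minimum `e₀`, diffusion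
and viscous heating can only increase it. -/
theorem le_e_of_work_le {c : ℝ → ℝ} (hc : Continuous c)
    (hw : ∀ x ∈ Icc 0 L, ∀ t ∈ Icc 0 T, (P.γ - 1) * (S.W x t / S.v x t) ≤ c t) {e₀ : ℝ}
    (he : ∀ x ∈ Icc 0 L, e₀ ≤ S.e x 0) {x t : ℝ} (hx : x ∈ Icc 0 L) (ht : t ∈ Icc 0 T) :
    e₀ ≤ S.e x t * Real.exp (∫ s in (0 : ℝ)..t, c s) := by
  have hL := S.L_pos
  have hT := S.T_pos
  have hκ := P.κ_pos
  let E : ℝ → ℝ := fun t => Real.exp (∫ s in (0 : ℝ)..t, c s)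
  have E0 : ∀ t, 0 < E t := fun t => Real.exp_pos _
  have hE : ∀ t, HasDerivAt E (E t * c t) t := fun t => (hasDerivAt_primitive hc 0 t).exp
  have cE : Continuous E := continuous_iff_continuousAt.2 fun t => (hE t).continuousAt
  -- the cube of the truncation is of class `C²`, and its integral does not increase
  let M : ℝ → ℝ → ℝ := fun x t => max (e₀ - S.e x t * E t) 0
  have M0 : ∀ x t, 0 ≤ M x t := fun x t => le_max_right _ _
  have cM : Continuous fun q : ℝ × ℝ => M q.1 q.2 := by
    have cE2 : Continuous fun q : ℝ × ℝ => E q.2 := cE.comp continuous_snd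
    exact (by fun_prop : Continuous fun q : ℝ × ℝ => e₀ - S.e q.1 q.2 * E q.2).max continuous_const
  have cMx : ∀ t, Continuous fun x => M x t := fun t =>
    cM.comp (continuous_id.prodMk continuous_const)
  let J : ℝ → ℝ := fun t => ∫ x in (0 : ℝ)..L, M x t ^ 3
  have cJ : Continuous J := continuous_intervalIntegral_param (f := fun x t => M x t ^ 3)
    (cM.pow 3) 0 L
  have hJ : ∀ τ ∈ Ioo 0 T, HasDerivAt J
      (∫ x in (0 : ℝ)..L, 3 * M x τ ^ 2 * -(S.et x τ * E τ + S.e x τ * (E τ * c τ))) τ := by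
    intro τ hτ
    have cE2 : Continuous fun q : ℝ × ℝ => E q.2 := cE.comp continuous_snd
    refine hasDerivAt_integral_param (bt := fun x t => 3 * M x t ^ 2
      * -(S.et x t * E t + S.e x t * (E t * c t))) hL.le (cM.pow 3)
      ((continuous_const.mul (cM.pow 2)).mul (by fun_prop)) (fun x _ t ht => ?_) hτ
    have h1 := ((S.e_dt x t ht).mul (hE t)).const_sub e₀
    have h2 := (hasDerivAt_max_pow 1 (e₀ - S.e x t * E t)).comp t h1
    refine h2.congr_deriv ?_
    simp only [M]
    push_cast
    ring
  have hJ' : ∀ τ ∈ Ioo 0 T,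
      (∫ x in (0 : ℝ)..L, 3 * M x τ ^ 2 * -(S.et x τ * E τ + S.e x τ * (E τ * c τ))) ≤ 0 := by
    intro τ hτ
    have hτ' : τ ∈ Icc 0 T := ⟨hτ.1.le, hτ.2.le⟩
    have cMτ := cMx τ
    have hz := integral_deriv_eq_zero (S := fun x => M x τ ^ 2 * S.H x τ)
      (S' := fun x => 2 * M x τ * -(S.ex x τ * E τ) * S.H x τ
        + M x τ ^ 2 * (S.et x τ + S.p x τ * S.W x τ - S.Q x τ)) hL.le
      (by fun_prop) (by fun_prop) (fun x hx => by
        have h1 := ((S.e_dx x hx τ).mul_const (E τ)).const_sub e₀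
        refine (((hasDerivAt_max_pow 0 (e₀ - S.e x τ * E τ)).comp x h1).mul
          (S.H_dx hx τ)).congr_deriv ?_
        norm_num [M]) (by simp [S.H_left, S.H_right])
    have hle := integral_mono_of_continuous (f := fun x => 3 * M x τ ^ 2
        * -(S.et x τ * E τ + S.e x τ * (E τ * c τ)))
      (g := fun x => (-3 * E τ) * (2 * M x τ * -(S.ex x τ * E τ) * S.H x τ
        + M x τ ^ 2 * (S.et x τ + S.p x τ * S.W x τ - S.Q x τ))) hL.le (by fun_prop)
      (by fun_prop) fun x hx => by
        have h1 : S.p x τ * S.W x τ ≤ S.e x τ * c τ := by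
          have := mul_le_mul_of_nonneg_left (hw x hx τ hτ') (S.e_pos x τ).le
          refine le_trans (le_of_eq ?_) this
          unfold p; ring
        have h2 := S.Q_nonneg x τ
        have h3 : 0 ≤ S.ex x τ * S.H x τ := by
          have hv := S.v_pos x τ
          have hr := S.r_pos x τ
          have : S.ex x τ * S.H x τ = P.κ * S.r x τ ^ (2 * P.m) / S.v x τ * S.ex x τ ^ 2 := by
            unfold H; ring
          rw [this]; positivity
        have hEτ := E0 τ
        have h4 := mul_nonneg (by have := M0 x τ; positivity : 0 ≤ 6 * E τ ^ 2 * M x τ) h3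
        have h5 := mul_nonneg (by positivity : 0 ≤ 3 * M x τ ^ 2 * E τ)
          (by linarith : 0 ≤ S.e x τ * c τ - S.p x τ * S.W x τ + S.Q x τ)
        linarith
    rw [intervalIntegral.integral_const_mul, hz, mul_zero] at hle
    exact hle
  have hJt : J t ≤ J 0 := by
    have := Convex.image_sub_le_mul_sub_of_deriv_le (convex_Icc 0 T) cJ.continuousOn
      (by rw [interior_Icc]; exact fun τ hτ => (hJ τ hτ).differentiableAt.differentiableWithinAt)
      (C := 0) (fun τ hτ => by
        rw [interior_Icc] at hτ
        rw [(hJ τ hτ).deriv]; exact hJ' τ hτ) 0 ⟨le_rfl, hT.le⟩ t ht ht.1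
    linarith
  have hJ0 : J 0 = 0 := by
    have h0 : EqOn (fun x => M x 0 ^ 3) (fun _ => (0 : ℝ)) (uIcc 0 L) := by
      intro x hx
      rw [uIcc_of_le hL.le] at hx
      have : e₀ - S.e x 0 * E 0 ≤ 0 := by
        have := he x hx
        simp only [E, intervalIntegral.integral_same, Real.exp_zero, mul_one]
        linarith
      simp [M, max_eq_right this]
    simp only [J]
    rw [intervalIntegral.integral_congr h0]; simp
  by_contra hcon
  push Not at hcon
  have hpos : 0 < J t := by
    refine intervalIntegral.integral_pos hL ?_ ?_ ?_
    · exact ((cMx t).pow 3).continuousOn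
    · exact fun z _ => pow_nonneg (M0 z t) 3
    · exact ⟨x, hx, pow_pos (lt_max_of_lt_left (sub_pos.2 hcon)) 3⟩
  linarith

/-- A pointwise bound for the effective viscous flux whose right-hand side is integrable in time by
the energy estimates. The term `1/√t` is the price of having only `∫ t (Dₜu)²` under control. -/
theorem exists_abs_F_le (P : FluidParams) (K : ℝ) : ∃ C, 0 ≤ C ∧
    ∀ (L T : ℝ) (S : Flow P L T) (y : ℝ), S.Bounded K y → ∀ x ∈ Icc y L, ∀ t ∈ Ioc 0 T,
    |S.F x t| ≤ 1 / √t + C * ((∫ z in y..L, S.low z t) + t * ∫ z in y..L, S.ut z t ^ 2) := by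
  obtain ⟨CF, hCF⟩ : ∃ C, C = (2 * (P.β * K) ^ 2
    + 2 * (2 * P.β ^ 2 * P.m ^ 2 * K ^ 2 + 4 * (P.γ - 1) ^ 2 * K ^ 2)) := ⟨_, rfl⟩
  have CF0 : 0 ≤ CF := by rw [hCF]; positivity
  obtain ⟨M, hM⟩ : ∃ M, M = (K ^ P.m) ^ 2 := ⟨_, rfl⟩
  have M0 : 0 ≤ M := by rw [hM]; positivity
  refine ⟨(2 * (1 + |K|) + 1) * CF + M, by positivity, ?_⟩
  intro L T S y h x hx t ht
  have hK := h.K_pos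
  have ht' : t ∈ Icc 0 T := ⟨ht.1.le, ht.2⟩
  have s0 : 0 < √t := Real.sqrt_pos.2 ht.1
  have hs2 : √t ^ 2 = t := Real.sq_sqrt ht.1.le
  have h1 := mul_sq_le_integral (f := fun x => S.F x t) (f' := fun x => S.ut x t / S.rm x t)
    s0.le h.y_le (by fun_prop) (by fun_prop)
    (fun z hz => S.F_dx ⟨h.y_nonneg.trans_lt hz.1, hz.2⟩ t) hx
  rw [hs2] at h1
  have h2 : ∫ z in y..L, S.F z t ^ 2 ≤ CF * ∫ z in y..L, S.low z t := by
    rw [← intervalIntegral.integral_const_mul, hCF]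
    exact integral_mono_of_continuous h.y_le_L (by fun_prop) (by fun_prop)
      fun z hz => h.F_sq_le hz ht'
  have h3 : ∫ z in y..L, (S.ut z t / S.rm z t) ^ 2 ≤ M * ∫ z in y..L, S.ut z t ^ 2 := by
    rw [← intervalIntegral.integral_const_mul, hM]
    refine integral_mono_of_continuous h.y_le_L (by fun_prop) (by fun_prop) fun z hz => ?_
    have := mul_le_mul_of_nonneg_right (h.inv_rm_sq_le hz ht') (sq_nonneg (S.ut z t))
    rw [div_pow]
    exact (by ring : S.ut z t ^ 2 / S.rm z t ^ 2 = 1 / S.rm z t ^ 2 * S.ut z t ^ 2).trans_le this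
  have l0 : 0 ≤ ∫ z in y..L, S.low z t :=
    integral_nonneg_of_continuous h.y_le_L fun z _ => S.low_nonneg z t
  have N0 : 0 ≤ ∫ z in y..L, S.ut z t ^ 2 :=
    integral_nonneg_of_continuous h.y_le_L fun z _ => sq_nonneg _
  have hsK : √t ≤ 1 + |K| := by
    rw [abs_of_pos hK]
    refine Real.sqrt_le_iff.2 ⟨by linarith, ?_⟩
    have := ht.2.trans h.T_le
    nlinarith
  have h4 : |S.F x t| ≤ 1 / √t + √t * S.F x t ^ 2 := by
    have e : 1 / √t + √t * S.F x t ^ 2 - |S.F x t|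
        = √t * (1 / √t - 1 / 2 * |S.F x t|) ^ 2 + 3 / 4 * (√t * |S.F x t| ^ 2) := by
      rw [← sq_abs (S.F x t)]; field_simp; ring
    have : 0 ≤ √t * (1 / √t - 1 / 2 * |S.F x t|) ^ 2 + 3 / 4 * (√t * |S.F x t| ^ 2) := by
      positivity
    linarith
  have h5 := mul_le_mul (by linarith : 2 * √t + 1 ≤ 2 * (1 + |K|) + 1) h2
    (integral_nonneg_of_continuous h.y_le_L fun z _ => sq_nonneg _) (by positivity)
  have h6 := mul_le_mul_of_nonneg_left h3 ht.1.le
  have h7 : 0 ≤ M * ∫ z in y..L, S.low z t := mul_nonneg M0 l0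
  have h8 : 0 ≤ (2 * (1 + |K|) + 1) * CF * (t * ∫ z in y..L, S.ut z t ^ 2) :=
    mul_nonneg (by positivity) (mul_nonneg ht.1.le N0)
  linarith

/-- The minimum principle with the supremum of the compression rate as comparison function. -/
theorem exists_le_e (P : FluidParams) (K C₁ C₂ : ℝ) : ∃ C, 0 ≤ C ∧
    ∀ (L T : ℝ) (S : Flow P L T), S.Bounded K 0 → S.FirstOrder C₁ 0 → S.SecondOrder C₂ 0 →
    ∀ e₀, (∀ x ∈ Icc 0 L, e₀ ≤ S.e x 0) → ∀ x ∈ Icc 0 L, ∀ t ∈ Icc 0 T,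
    e₀ ≤ S.e x t * Real.exp C := by
  obtain ⟨CF, hCF0, hCF⟩ := exists_abs_F_le P K
  obtain ⟨Cl, hCl0, hCl⟩ := exists_integral_low_le P K C₁
  have hγ := P.γ_sub_pos
  have hβ := P.β_pos
  have hκ := P.κ_pos
  obtain ⟨g, hg⟩ : ∃ g, g = (P.γ - 1) / P.β := ⟨_, rfl⟩
  have g0 : 0 < g := by rw [hg]; positivity
  obtain ⟨Ce, hCe⟩ : ∃ C, C = (P.γ - 1) * (|K| * ((2 * |K| + 1) * (4 + |K| * (|K| ^ P.m) ^ 2))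
    + 1) := ⟨_, rfl⟩
  have Ce0 : 0 ≤ Ce := by rw [hCe]; positivity
  refine ⟨g * (CF * (Cl + |C₂|) + Ce * (|K| + |K| / P.κ)) + g * (2 * (1 + |K|)), by positivity, ?_⟩
  intro L T S h h1 h2 e₀ he x hx t ht
  have hK := h.K_pos
  have hKa : |K| = K := abs_of_pos hK
  have hCa : |C₂| = C₂ := abs_of_nonneg h2.nonneg
  rw [hKa] at hCe
  rw [hKa, hCa]
  have hT := S.T_pos
  have hL := S.L_pos
  let ℓ : ℝ → ℝ := fun s => ∫ x in (0 : ℝ)..L, S.low x s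
  let N : ℝ → ℝ := fun s => ∫ x in (0 : ℝ)..L, S.ut x s ^ 2
  have cℓ : Continuous ℓ := continuous_intervalIntegral_param
    (f := fun x s => S.low x s) (by fun_prop) 0 L
  have cN : Continuous N := continuous_intervalIntegral_param
    (f := fun x s => S.ut x s ^ 2) (by fun_prop) 0 L
  have cV := S.continuous_heatProd
  let c : ℝ → ℝ := fun t => sSup ((fun x => (P.γ - 1) * |S.W x t / S.v x t|) '' Icc 0 L)
  have cc : Continuous c := by
    refine IsCompact.continuous_sSup (f := fun t x => (P.γ - 1) * |S.W x t / S.v x t|)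
      isCompact_Icc ?_
    change Continuous fun q : ℝ × ℝ => (P.γ - 1) * |S.W q.2 q.1 / S.v q.2 q.1|
    fun_prop
  have hwc : ∀ x ∈ Icc 0 L, ∀ t, (P.γ - 1) * |S.W x t / S.v x t| ≤ c t := fun x hx t =>
    le_csSup (isCompact_Icc.image (by fun_prop)).bddAbove (mem_image_of_mem _ hx)
  have hc0 : ∀ t, 0 ≤ c t := fun t =>
    le_trans (mul_nonneg hγ.le (abs_nonneg _)) (hwc 0 ⟨le_rfl, hL.le⟩ t)
  have hcle : ∀ s ∈ Ioo 0 T, c s ≤ g * (CF * (ℓ s + s * N s) + Ce * (1 + S.heatProd s))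
      + g * (1 / √s) := by
    intro s hs
    have hs' : s ∈ Icc 0 T := ⟨hs.1.le, hs.2.le⟩
    refine csSup_le ((nonempty_Icc.2 hL.le).image _) ?_
    rintro _ ⟨z, hz, rfl⟩
    have v0 := S.v_pos z s
    have e1 : S.W z s / S.v z s = (S.F z s + S.π z s) / P.β := by
      rw [S.W_eq_F]; field_simp
    have e2 : |S.π z s| ≤ Ce * (1 + S.heatProd s) := by
      have i1 : |S.π z s| ≤ (P.γ - 1) * (S.e z s / S.v z s + 1) := by
        have : S.π z s = (P.γ - 1) * (S.e z s / S.v z s - 1) := by unfold π; field_simp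
        have i0 : 0 < S.e z s / S.v z s := div_pos (S.e_pos z s) v0
        rw [this, abs_mul, abs_of_pos hγ]
        exact mul_le_mul_of_nonneg_left (abs_le.2 ⟨by linarith, by linarith⟩) hγ.le
      have i2 : S.e z s / S.v z s ≤ K * S.e z s := by
        have := h.div_v_upper hz hs' (S.e_pos z s).le
        linarith
      have i3 := mul_le_mul_of_nonneg_left (h.e_le_heatProd hz hs') hK.le
      have i4 := S.heatProd_nonneg s
      have i5 := mul_le_mul_of_nonneg_left (i2.trans i3) hγ.le
      have i6 : 0 ≤ (P.γ - 1) * S.heatProd s := by positivity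
      rw [hCe]
      linarith
    have e3 := hCF L T S 0 h z hz s ⟨hs.1, hs.2.le⟩
    have e4 : (P.γ - 1) * |S.W z s / S.v z s| ≤ g * (|S.F z s| + |S.π z s|) := by
      rw [e1, abs_div, abs_of_pos hβ, hg]
      have := mul_le_mul_of_nonneg_left (abs_add_le (S.F z s) (S.π z s))
        (by positivity : 0 ≤ (P.γ - 1) / P.β)
      refine le_trans (le_of_eq ?_) this
      ring
    refine e4.trans ?_
    have := mul_le_mul_of_nonneg_left (add_le_add e3 e2) g0.le
    refine this.trans (le_of_eq ?_)
    simp only [ℓ, N]; ring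
  have hcT : ∫ s in (0 : ℝ)..T, c s ≤ g * (CF * (Cl + C₂) + Ce * (K + K / P.κ))
      + g * (2 * (1 + K)) := by
    have cG : Continuous fun s => g * (CF * (ℓ s + s * N s) + Ce * (1 + S.heatProd s)) := by
      fun_prop
    -- `2√τ` is continuous up to `τ = 0` although its derivative `1/√τ` is not bounded
    have i1 := intervalIntegral.integral_le_sub_of_hasDeriv_right_of_le hT.le
      (g := fun τ => (∫ s in (0 : ℝ)..τ, g * (CF * (ℓ s + s * N s) + Ce * (1 + S.heatProd s)))
        + g * (2 * √τ))
      (g' := fun s => g * (CF * (ℓ s + s * N s) + Ce * (1 + S.heatProd s)) + g * (1 / √s))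
      (φ := c) (by
        refine ContinuousOn.add ?_ (by fun_prop)
        exact fun τ _ => (hasDerivAt_primitive cG 0 τ).continuousAt.continuousWithinAt)
      (fun τ hτ => by
        refine ((hasDerivAt_primitive cG 0 τ).add
          (((Real.hasDerivAt_sqrt hτ.1.ne').const_mul 2).const_mul g)).hasDerivWithinAt.congr_deriv
          ?_
        have : √τ ≠ 0 := (Real.sqrt_pos.2 hτ.1).ne'
        field_simp) cc.continuousOn.integrableOn_Icc hcle
    refine i1.trans ?_
    simp only [intervalIntegral.integral_same, Real.sqrt_zero, mul_zero, add_zero, sub_zero]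
    refine add_le_add ?_ (mul_le_mul_of_nonneg_left (mul_le_mul_of_nonneg_left ?_ (by norm_num))
      g0.le)
    · rw [intervalIntegral.integral_const_mul]
      refine mul_le_mul_of_nonneg_left ?_ g0.le
      rw [integral_add_of_continuous (by fun_prop) (by fun_prop),
        intervalIntegral.integral_const_mul, intervalIntegral.integral_const_mul,
        integral_add_of_continuous (by fun_prop) (by fun_prop),
        integral_add_of_continuous (by fun_prop) (by fun_prop), intervalIntegral.integral_const,
        smul_eq_mul]
      have j1 := hCl L T S 0 h h1
      have j2 := h2.int
      have j3 : ∫ s in (0 : ℝ)..T, S.heatProd s ≤ K / P.κ := by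
        rw [le_div_iff₀ hκ, mul_comm]
        exact (S.integral_heatProd_le ⟨hT.le, le_rfl⟩).trans h.ent
      have j4 := h.T_le
      refine add_le_add (mul_le_mul_of_nonneg_left (add_le_add j1 j2) hCF0)
        (mul_le_mul_of_nonneg_left (add_le_add (by linarith) j3) Ce0)
    · refine Real.sqrt_le_iff.2 ⟨by linarith, ?_⟩
      have := h.T_le
      nlinarith
  have hmin := le_e_of_work_le cc (fun z hz s _ =>
    (mul_le_mul_of_nonneg_left (le_abs_self _) hγ.le).trans (hwc z hz s)) he hx ht
  refine hmin.trans (mul_le_mul_of_nonneg_left (Real.exp_le_exp.2 ?_) (S.e_pos x t).le)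
  exact (integral_le_integral_of_subinterval le_rfl ht.1 ht.2 cc fun s _ => hc0 s).trans hcT

end Flow

end SphNS

namespace SphNS

/-! ### Mollified radial data -/

theorem lintegral_sq_le_of_isProbabilityMeasure {ν : Measure ℝ} [IsProbabilityMeasure ν]
    {w : ℝ → ℝ≥0∞} (hw : AEMeasurable w ν) : (∫⁻ ζ, w ζ ∂ν) ^ 2 ≤ ∫⁻ ζ, w ζ ^ 2 ∂ν := by
  have h := ENNReal.lintegral_mul_le_Lp_mul_Lq ν Real.HolderConjugate.two_two hw
    (aemeasurable_const (b := (1 : ℝ≥0∞)))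
  simp only [Pi.mul_apply, mul_one, ENNReal.one_rpow, lintegral_one, measure_univ] at h
  calc (∫⁻ ζ, w ζ ∂ν) ^ 2 ≤ ((∫⁻ ζ, w ζ ^ (2 : ℝ) ∂ν) ^ (1 / 2 : ℝ)) ^ 2 := by gcongr
    _ = ∫⁻ ζ, w ζ ^ 2 ∂ν := by
        rw [← ENNReal.rpow_natCast, ← ENNReal.rpow_mul]
        norm_num

namespace IsMollifier

variable {δ : ℝ} {j : ℝ → ℝ}

theorem hasCompactSupport (hj : IsMollifier δ j) : HasCompactSupport j :=
  isCompact_Icc.of_isClosed_subset (isClosed_tsupport j) hj.supp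

theorem continuous (hj : IsMollifier δ j) : Continuous j := hj.smooth.continuous

theorem integrable (hj : IsMollifier δ j) : Integrable j :=
  hj.continuous.integrable_of_hasCompactSupport hj.hasCompactSupport

theorem eq_zero_of_lt (hj : IsMollifier δ j) {ζ : ℝ} (h : δ < ζ) : j ζ = 0 :=
  image_eq_zero_of_notMem_tsupport fun hζ => h.not_ge (hj.supp hζ).2

theorem lintegral_eq_one (hj : IsMollifier δ j) : ∫⁻ ζ, ENNReal.ofReal (j ζ) = 1 := by
  rw [← ofReal_integral_eq_lintegral_ofReal hj.integrable (ae_of_all _ hj.nonneg), hj.mass,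
    ENNReal.ofReal_one]

/-- The average against a mollifier satisfies Jensen's inequality for `z ↦ z ^ 2`, also for
functions that are not integrable. -/
theorem lintegral_mul_sq_le (hj : IsMollifier δ j) {w : ℝ → ℝ≥0∞} (hw : AEMeasurable w) :
    (∫⁻ ζ, w ζ * ENNReal.ofReal (j ζ)) ^ 2 ≤ ∫⁻ ζ, w ζ ^ 2 * ENNReal.ofReal (j ζ) := by
  have hm : AEMeasurable fun ζ => ENNReal.ofReal (j ζ) :=
    hj.continuous.measurable.ennreal_ofReal.aemeasurable
  let ν : Measure ℝ := volume.withDensity fun ζ => ENNReal.ofReal (j ζ)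
  have : IsProbabilityMeasure ν := ⟨by simp [ν, hj.lintegral_eq_one]⟩
  have key : ∀ f : ℝ → ℝ≥0∞, AEMeasurable f →
      ∫⁻ ζ, f ζ ∂ν = ∫⁻ ζ, f ζ * ENNReal.ofReal (j ζ) := fun f hf => by
    rw [lintegral_withDensity_eq_lintegral_mul₀ hm hf]
    simp only [Pi.mul_apply, mul_comm]
  rw [← key w hw, ← key _ (hw.pow_const 2)]
  exact lintegral_sq_le_of_isProbabilityMeasure
    (hw.mono_ac (withDensity_absolutelyContinuous _ _))

theorem enorm_mollify_le (hj : IsMollifier δ j) (f : ℝ → ℝ) (r : ℝ) :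
    ‖mollify j f r‖ₑ ≤ ∫⁻ ζ, ‖f (r - ζ)‖ₑ * ENNReal.ofReal (j ζ) := by
  refine (enorm_integral_le_lintegral_enorm _).trans (le_of_eq (lintegral_congr fun ζ => ?_))
  rw [enorm_mul, Real.enorm_of_nonneg (hj.nonneg ζ)]

theorem aemeasurable_sub {f : ℝ → ℝ} (hf : AEMeasurable f) (r : ℝ) :
    AEMeasurable fun ζ => f (r - ζ) :=
  hf.comp_quasiMeasurePreserving
    (Measure.measurePreserving_sub_left volume r).quasiMeasurePreserving

theorem enorm_mollify_sq_le (hj : IsMollifier δ j) {f : ℝ → ℝ} (hf : AEMeasurable f) (r : ℝ) :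
    ‖mollify j f r‖ₑ ^ 2 ≤ ∫⁻ ζ, ‖f (r - ζ)‖ₑ ^ 2 * ENNReal.ofReal (j ζ) :=
  (pow_le_pow_left' (hj.enorm_mollify_le f r) 2).trans
    (hj.lintegral_mul_sq_le (aemeasurable_sub hf r).enorm)

theorem enorm_mollify_pow_four_le (hj : IsMollifier δ j) {f : ℝ → ℝ} (hf : AEMeasurable f)
    (r : ℝ) : ‖mollify j f r‖ₑ ^ 4 ≤ ∫⁻ ζ, ‖f (r - ζ)‖ₑ ^ 4 * ENNReal.ofReal (j ζ) := by
  have h := (pow_le_pow_left' (hj.enorm_mollify_sq_le hf r) 2).trans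
    (hj.lintegral_mul_sq_le ((aemeasurable_sub hf r).enorm.pow_const 2))
  simpa only [← pow_mul] using h

/-- For `r ≥ 2δ` a mollification with radius `δ` only sees radii `s = r - ζ ≥ r / 2`, so that the
weight `r ^ m` is comparable with `s ^ m`. -/
theorem lintegral_weight_le (hj : IsMollifier δ j) (m : ℕ) {f : ℝ → ℝ} (hf : AEMeasurable f)
    (hδ : 0 < δ) (q : ℕ) :
    ∫⁻ r in Ici (2 * δ), ENNReal.ofReal (r ^ m)
        * ∫⁻ ζ, ‖f (r - ζ)‖ₑ ^ q * ENNReal.ofReal (j ζ)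
      ≤ 2 ^ m * ∫⁻ s in Ici 0, ENNReal.ofReal (s ^ m) * ‖f s‖ₑ ^ q := by
  let H : ℝ → ℝ≥0∞ := (Ici 0).indicator fun s => ENNReal.ofReal (s ^ m) * ‖f s‖ₑ ^ q
  have hH : AEMeasurable H :=
    (((by fun_prop : Measurable fun s : ℝ => ENNReal.ofReal (s ^ m)).aemeasurable).mul
      (hf.enorm.pow_const q)).indicator measurableSet_Ici
  have hm : Measurable fun ζ => ENNReal.ofReal (j ζ) :=
    hj.continuous.measurable.ennreal_ofReal
  have hH2 : AEMeasurable (fun p : ℝ × ℝ => H (p.1 - p.2) * ENNReal.ofReal (j p.2))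
      (volume.prod volume) :=
    (hH.comp_quasiMeasurePreserving
      (quasiMeasurePreserving_sub_of_right_invariant volume volume)).mul
      (hm.comp measurable_snd).aemeasurable
  have step : ∀ r ∈ Ici (2 * δ), ENNReal.ofReal (r ^ m)
      * ∫⁻ ζ, ‖f (r - ζ)‖ₑ ^ q * ENNReal.ofReal (j ζ)
      ≤ 2 ^ m * ∫⁻ ζ, H (r - ζ) * ENNReal.ofReal (j ζ) := by
    intro r hr
    rw [← lintegral_const_mul' _ _ ENNReal.ofReal_ne_top,
      ← lintegral_const_mul' _ _ (by finiteness)]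
    refine lintegral_mono fun ζ => ?_
    rcases le_or_gt ζ δ with hζ | hζ
    · have hr' : 2 * δ ≤ r := hr
      have h0 : 0 ≤ r - ζ := by linarith
      have h1 : ENNReal.ofReal (r ^ m) ≤ 2 ^ m * ENNReal.ofReal ((r - ζ) ^ m) := by
        rw [ENNReal.ofReal_pow (by linarith), ENNReal.ofReal_pow h0, ← mul_pow]
        refine pow_le_pow_left' ?_ m
        rw [show (2 : ℝ≥0∞) = ENNReal.ofReal 2 by simp, ← ENNReal.ofReal_mul (by norm_num)]
        exact ENNReal.ofReal_le_ofReal (by linarith)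
      simp only [H, indicator_of_mem (show r - ζ ∈ Ici (0 : ℝ) from h0)]
      calc _ = ENNReal.ofReal (r ^ m) * (‖f (r - ζ)‖ₑ ^ q * ENNReal.ofReal (j ζ)) := rfl
        _ ≤ 2 ^ m * ENNReal.ofReal ((r - ζ) ^ m) * (‖f (r - ζ)‖ₑ ^ q * ENNReal.ofReal (j ζ)) := by
            gcongr
        _ = _ := by ring
    · simp [hj.eq_zero_of_lt hζ]
  calc _ ≤ ∫⁻ r in Ici (2 * δ), 2 ^ m * ∫⁻ ζ, H (r - ζ) * ENNReal.ofReal (j ζ) :=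
        setLIntegral_mono' measurableSet_Ici step
    _ ≤ ∫⁻ r, 2 ^ m * ∫⁻ ζ, H (r - ζ) * ENNReal.ofReal (j ζ) := setLIntegral_le_lintegral _ _
    _ = 2 ^ m * ∫⁻ r, ∫⁻ ζ, H (r - ζ) * ENNReal.ofReal (j ζ) :=
        lintegral_const_mul' _ _ (by finiteness)
    _ = 2 ^ m * ∫⁻ ζ, ∫⁻ r, H (r - ζ) * ENNReal.ofReal (j ζ) := by
        rw [lintegral_lintegral_swap hH2]
    _ = 2 ^ m * ∫⁻ ζ, (∫⁻ s, H s) * ENNReal.ofReal (j ζ) := by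
        congr 1
        refine lintegral_congr fun ζ => ?_
        rw [lintegral_mul_const' _ _ ENNReal.ofReal_ne_top, lintegral_sub_right_eq_self H ζ]
    _ = 2 ^ m * ∫⁻ s in Ici 0, ENNReal.ofReal (s ^ m) * ‖f s‖ₑ ^ q := by
        rw [lintegral_const_mul _ hm, hj.lintegral_eq_one, mul_one,
          lintegral_indicator measurableSet_Ici]

/-- A function whose square is integrable with the weight `s ^ m` can be averaged away from the
origin. -/
theorem integrable_mul (hj : IsMollifier δ j) (m : ℕ) {f : ℝ → ℝ} (hf : AEMeasurable f)
    (hδ : 0 < δ) (hfin : ∫⁻ s in Ici 0, ENNReal.ofReal (s ^ m) * ‖f s‖ₑ ^ 2 < ⊤) {r : ℝ}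
    (hr : 2 * δ ≤ r) : Integrable fun ζ => f (r - ζ) * j ζ := by
  obtain ⟨B, hB⟩ := hj.hasCompactSupport.exists_bound_of_continuous hj.continuous
  have hm : Measurable fun ζ => ENNReal.ofReal (j ζ) :=
    hj.continuous.measurable.ennreal_ofReal
  let H : ℝ → ℝ≥0∞ := (Ici 0).indicator fun s => ENNReal.ofReal (s ^ m) * ‖f s‖ₑ ^ 2
  have h2 : ENNReal.ofReal (δ ^ m) * ∫⁻ ζ, ‖f (r - ζ)‖ₑ ^ 2 * ENNReal.ofReal (j ζ) < ⊤ := by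
    refine lt_of_le_of_lt (b := ∫⁻ ζ, H (r - ζ) * ENNReal.ofReal B) ?_ ?_
    · rw [← lintegral_const_mul' _ _ ENNReal.ofReal_ne_top]
      refine lintegral_mono fun ζ => ?_
      rcases le_or_gt ζ δ with hζ | hζ
      · have h0 : δ ≤ r - ζ := by linarith
        simp only [H, indicator_of_mem (show r - ζ ∈ Ici (0 : ℝ) from hδ.le.trans h0)]
        rw [← mul_assoc]
        gcongr
        exact (le_abs_self _).trans (hB ζ)
      · simp [hj.eq_zero_of_lt hζ]
    · rw [lintegral_mul_const' _ _ ENNReal.ofReal_ne_top, lintegral_sub_left_eq_self H r,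
        lintegral_indicator measurableSet_Ici]
      exact ENNReal.mul_lt_top hfin ENNReal.ofReal_lt_top
  have h3 : ∫⁻ ζ, ‖f (r - ζ)‖ₑ ^ 2 * ENNReal.ofReal (j ζ) < ⊤ := by
    refine lt_of_le_of_ne le_top fun h => ?_
    rw [h, ENNReal.mul_top (by simp [pow_pos hδ m])] at h2
    exact lt_irrefl _ h2
  refine ⟨((aemeasurable_sub hf r).mul hj.continuous.measurable.aemeasurable).aestronglyMeasurable,
    ?_⟩
  have h4 := (hj.lintegral_mul_sq_le (aemeasurable_sub hf r).enorm).trans_lt h3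
  rw [hasFiniteIntegral_iff_enorm]
  have h5 : ∀ ζ, ‖f (r - ζ) * j ζ‖ₑ = ‖f (r - ζ)‖ₑ * ENNReal.ofReal (j ζ) := fun ζ => by
    rw [enorm_mul, Real.enorm_of_nonneg (hj.nonneg ζ)]
  simp only [h5]
  exact (ENNReal.pow_lt_top_iff (n := 2)).1 h4 |>.resolve_right (by norm_num)

theorem mollify_eq_indicator (hj : IsMollifier δ j) {f g : ℝ → ℝ} (c : ℝ) (hδ : 0 < δ)
    (hfg : ∀ s, 0 ≤ s → f s = g s) {r : ℝ} (hr : 2 * δ ≤ r)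
    (hint : Integrable fun ζ => (Ici 0).indicator (fun s => g s - c) (r - ζ) * j ζ) :
    mollify j f r - c = mollify j ((Ici 0).indicator fun s => g s - c) r := by
  have h : ∀ ζ, f (r - ζ) * j ζ
      = (Ici 0).indicator (fun s => g s - c) (r - ζ) * j ζ + c * j ζ := by
    intro ζ
    rcases le_or_gt ζ δ with hζ | hζ
    · have h0 : 0 ≤ r - ζ := by linarith
      rw [indicator_of_mem (show r - ζ ∈ Ici (0 : ℝ) from h0), hfg _ h0]
      ring
    · simp [hj.eq_zero_of_lt hζ]
  unfold mollify
  rw [integral_congr_ae (ae_of_all _ h), integral_add hint (hj.integrable.const_mul c),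
    integral_const_mul, hj.mass]
  ring

/-- Mollification does not increase the weighted second and fourth moments outside the ball of
radius `2δ` by more than the factor `2 ^ m`. -/
theorem lintegral_mollify_le (hj : IsMollifier δ j) (m : ℕ) {f g : ℝ → ℝ} (c : ℝ) (hδ : 0 < δ)
    (hfg : ∀ s, 0 ≤ s → f s = g s) (hg : AEMeasurable g (volume.restrict (Ici 0)))
    (hfin : ∫⁻ s in Ici 0, ENNReal.ofReal (s ^ m) * ‖g s - c‖ₑ ^ 2 < ⊤) {q : ℕ}
    (hq : q = 2 ∨ q = 4) :
    ∫⁻ r in Ici (2 * δ), ENNReal.ofReal (r ^ m) * ‖mollify j f r - c‖ₑ ^ q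
      ≤ 2 ^ m * ∫⁻ s in Ici 0, ENNReal.ofReal (s ^ m) * ‖g s - c‖ₑ ^ q := by
  let f' : ℝ → ℝ := (Ici 0).indicator fun s => g s - c
  have hf' : AEMeasurable f' := (aemeasurable_indicator_iff measurableSet_Ici).2
    (hg.sub aemeasurable_const)
  have heq : ∀ p : ℕ, ∫⁻ s in Ici 0, ENNReal.ofReal (s ^ m) * ‖f' s‖ₑ ^ p
      = ∫⁻ s in Ici 0, ENNReal.ofReal (s ^ m) * ‖g s - c‖ₑ ^ p := fun p =>
    setLIntegral_congr_fun measurableSet_Ici fun s hs => by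
      simp only [f', indicator_of_mem hs]
  rw [← heq] at hfin ⊢
  refine le_trans (setLIntegral_mono' measurableSet_Ici fun r hr => ?_)
    (hj.lintegral_weight_le m hf' hδ q)
  rw [hj.mollify_eq_indicator c hδ hfg hr (hj.integrable_mul m hf' hδ hfin hr)]
  gcongr
  rcases hq with rfl | rfl
  · exact hj.enorm_mollify_sq_le hf' r
  · exact hj.enorm_mollify_pow_four_le hf' r

theorem integrable_mul_of_indicator (hj : IsMollifier δ j) {f g : ℝ → ℝ} (c : ℝ) (hδ : 0 < δ)
    (hfg : ∀ s, 0 ≤ s → f s = g s) {r : ℝ} (hr : 2 * δ ≤ r)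
    (hint : Integrable fun ζ => (Ici 0).indicator (fun s => g s - c) (r - ζ) * j ζ) :
    Integrable fun ζ => f (r - ζ) * j ζ := by
  refine (hint.add (hj.integrable.const_mul c)).congr (ae_of_all _ fun ζ => ?_)
  rcases le_or_gt ζ δ with hζ | hζ
  · have h0 : 0 ≤ r - ζ := by linarith
    simp only [Pi.add_apply, indicator_of_mem (show r - ζ ∈ Ici (0 : ℝ) from h0), hfg _ h0]
    ring
  · simp [hj.eq_zero_of_lt hζ]

theorem mollify_mem_Icc (hj : IsMollifier δ j) {f : ℝ → ℝ} {c r : ℝ} (hr : 2 * δ ≤ r)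
    (hδ : 0 < δ) (hint : Integrable fun ζ => f (r - ζ) * j ζ) :
    ((∀ s, 0 ≤ s → c ≤ f s) → c ≤ mollify j f r) ∧
      ((∀ s, 0 ≤ s → f s ≤ c) → mollify j f r ≤ c) := by
  have hc : ∫ ζ, c * j ζ = c := by rw [integral_const_mul, hj.mass, mul_one]
  constructor
  · intro hf
    rw [← hc]
    refine integral_mono (hj.integrable.const_mul c) hint fun ζ => ?_
    rcases le_or_gt ζ δ with hζ | hζ
    · exact mul_le_mul_of_nonneg_right (hf _ (by linarith)) (hj.nonneg ζ)
    · simp [hj.eq_zero_of_lt hζ]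
  · intro hf
    rw [← hc]
    refine integral_mono hint (hj.integrable.const_mul c) fun ζ => ?_
    rcases le_or_gt ζ δ with hζ | hζ
    · exact mul_le_mul_of_nonneg_right (hf _ (by linarith)) (hj.nonneg ζ)
    · simp [hj.eq_zero_of_lt hζ]

theorem continuous_mollify (hj : IsMollifier δ j) {f : ℝ → ℝ} (hf : LocallyIntegrable f) :
    Continuous (mollify j f) := by
  have h := hj.hasCompactSupport.continuous_convolution_left (ContinuousLinearMap.mul ℝ ℝ)
    hj.continuous hf
  refine h.congr fun r => ?_
  simp only [convolution, ContinuousLinearMap.mul_apply', mollify, mul_comm]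

end IsMollifier

end SphNS

namespace SphNS

/-! ### Lagrangian coordinates of the initial data -/

section InitPath

variable {m : ℕ} {a c C : ℝ} {ρ : ℝ → ℝ}

theorem hasDerivWithinAt_mass (hρ : ContinuousOn ρ (Ici a)) {r : ℝ} (hr : r ∈ Ici a) :
    HasDerivWithinAt (fun r => ∫ s in a..r, ρ s * s ^ m) (ρ r * r ^ m) (Ici a) r := by
  have hc : Continuous fun s => ρ (max a s) * s ^ m :=
    (hρ.comp_continuous (by fun_prop) fun s => le_max_left a s).mul (by fun_prop)
  have h := (hasDerivAt_primitive hc a r).hasDerivWithinAt (s := Ici a)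
  rw [max_eq_right (show a ≤ r from hr)] at h
  refine h.congr (fun z hz => ?_) ?_
  all_goals
    refine intervalIntegral.integral_congr fun s hs => ?_
    simp only [mem_Ici] at *
    rw [uIcc_of_le (by assumption)] at hs
    simp only [max_eq_right hs.1]

theorem mul_sub_le_mass (ha : 0 < a) (hc : 0 < c) (hρ : ContinuousOn ρ (Ici a))
    (hl : ∀ r ∈ Ici a, c ≤ ρ r) {r r' : ℝ} (hr : r ∈ Ici a) (hr' : r ≤ r') :
    c * a ^ m * (r' - r) ≤ (∫ s in a..r', ρ s * s ^ m) - ∫ s in a..r, ρ s * s ^ m := by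
  have hr0 : a ≤ r := hr
  have hcon : ∀ b d, a ≤ b → a ≤ d → IntervalIntegrable (fun s => ρ s * s ^ m) volume b d :=
    fun b d hb hd => ((hρ.mono fun s hs => (le_min hb hd).trans hs.1).mul
      (by fun_prop)).intervalIntegrable
  rw [intervalIntegral.integral_interval_sub_left (hcon _ _ le_rfl (hr0.trans hr'))
    (hcon _ _ le_rfl hr)]
  have h : ∫ _ in r..r', c * a ^ m = c * a ^ m * (r' - r) := by
    rw [intervalIntegral.integral_const, smul_eq_mul, mul_comm]
  rw [← h]
  refine intervalIntegral.integral_mono_on hr' intervalIntegrable_const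
    (hcon _ _ hr (hr0.trans hr')) fun s hs => ?_
  have hs' : a ≤ s := hr0.trans hs.1
  exact mul_le_mul (hl s hs') (pow_le_pow_left₀ ha.le hs' m) (by positivity)
    (hc.le.trans (hl s hs'))

theorem injOn_mass (ha : 0 < a) (hc : 0 < c) (hρ : ContinuousOn ρ (Ici a))
    (hl : ∀ r ∈ Ici a, c ≤ ρ r) : InjOn (fun r => ∫ s in a..r, ρ s * s ^ m) (Ici a) := by
  refine StrictMonoOn.injOn fun r hr r' _ h => ?_
  have h1 := mul_sub_le_mass (m := m) ha hc hρ hl hr h.le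
  have h2 : 0 < c * a ^ m * (r' - r) := mul_pos (by positivity) (sub_pos.2 h)
  exact sub_pos.1 (h2.trans_le h1)

theorem Ici_subset_image_mass (ha : 0 < a) (hc : 0 < c) (hρ : ContinuousOn ρ (Ici a))
    (hl : ∀ r ∈ Ici a, c ≤ ρ r) :
    Ici 0 ⊆ (fun r => ∫ s in a..r, ρ s * s ^ m) '' Ici a := by
  intro x hx
  have hx0 : 0 ≤ x := hx
  have hca : 0 < c * a ^ m := by positivity
  have hR : a ≤ a + x / (c * a ^ m) := by
    have := div_nonneg hx0 hca.le
    linarith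
  have hcont : ContinuousOn (fun r => ∫ s in a..r, ρ s * s ^ m) (Icc a (a + x / (c * a ^ m))) :=
    fun r hr => ((hasDerivWithinAt_mass hρ hr.1).continuousWithinAt).mono Icc_subset_Ici_self
  have h1 := mul_sub_le_mass (m := m) ha hc hρ hl self_mem_Ici hR
  rw [intervalIntegral.integral_same, sub_zero, add_sub_cancel_left, mul_div_cancel₀ _ hca.ne'] at h1
  obtain ⟨r, hr, hrx⟩ := intermediate_value_Icc hR hcont (show x ∈ Icc _ _ from
    ⟨by simpa using hx0, h1⟩)
  exact ⟨r, hr.1, hrx⟩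

theorem initPath_mem (ha : 0 < a) (hc : 0 < c) (hρ : ContinuousOn ρ (Ici a))
    (hl : ∀ r ∈ Ici a, c ≤ ρ r) {x : ℝ} (hx : 0 ≤ x) : initPath m a ρ x ∈ Ici a :=
  Function.invFunOn_mem (Ici_subset_image_mass ha hc hρ hl hx)

/-- Lagrangian integrals of Eulerian functions, by the change of variables `x = ∫_a^r ρ s^m ds`. -/
theorem lintegral_initPath_le (ha : 0 < a) (hc : 0 < c) (hρ : ContinuousOn ρ (Ici a))
    (hl : ∀ r ∈ Ici a, c ≤ ρ r) (hu : ∀ r ∈ Ici a, ρ r ≤ C) (L : ℝ) (g : ℝ → ℝ≥0∞) :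
    ∫⁻ x in Icc 0 L, g (initPath m a ρ x)
      ≤ ENNReal.ofReal C * ∫⁻ r in Ici a, ENNReal.ofReal (r ^ m) * g r := by
  have hinj := injOn_mass (m := m) ha hc hρ hl
  calc _ ≤ ∫⁻ x in (fun r => ∫ s in a..r, ρ s * s ^ m) '' Ici a, g (initPath m a ρ x) :=
        lintegral_mono_set (Icc_subset_Ici_self.trans (Ici_subset_image_mass ha hc hρ hl))
    _ = ∫⁻ r in Ici a, ENNReal.ofReal |ρ r * r ^ m|
          * g (initPath m a ρ (∫ s in a..r, ρ s * s ^ m)) :=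
        lintegral_image_eq_lintegral_abs_deriv_mul measurableSet_Ici
          (fun r hr => hasDerivWithinAt_mass hρ hr) hinj _
    _ ≤ ∫⁻ r in Ici a, ENNReal.ofReal C * (ENNReal.ofReal (r ^ m) * g r) := by
        refine setLIntegral_mono' measurableSet_Ici fun r hr => ?_
        have hr0 : 0 ≤ r := ha.le.trans hr
        have hpath : initPath m a ρ (∫ s in a..r, ρ s * s ^ m) = r :=
          hinj.leftInvOn_invFunOn hr
        have hρ0 := hc.le.trans (hl r hr)
        rw [hpath, abs_of_nonneg (by positivity), ENNReal.ofReal_mul hρ0, mul_assoc]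
        gcongr
        exact hu r hr
    _ = _ := lintegral_const_mul' _ _ ENNReal.ofReal_ne_top

end InitPath

/-! ### Bounds of the approximate initial data -/

theorem entG_nonneg {ζ : ℝ} (h : 0 < ζ) : 0 ≤ entG ζ := by
  have h1 := mul_le_mul_of_nonneg_left (Real.one_sub_inv_le_log_of_pos h) h.le
  rw [mul_sub, mul_inv_cancel₀ h.ne'] at h1
  unfold entG
  linarith

theorem ofReal_pow_mul_enorm_pow {s : ℝ} (hs : 0 ≤ s) (m : ℕ) (g : ℝ) {q : ℕ} (hq : Even q) :
    ENNReal.ofReal (s ^ m) * ‖g‖ₑ ^ q = ENNReal.ofReal (s ^ m * g ^ q) := by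
  rw [ENNReal.ofReal_mul (by positivity), ← hq.pow_abs g, ENNReal.ofReal_pow (abs_nonneg g),
    ← Real.enorm_eq_ofReal_abs]

namespace AdmissibleData

variable {P : FluidParams} {K : ℝ} {ρ₀ u₀ e₀ : ℝ → ℝ}

theorem one_le (h : AdmissibleData P K ρ₀ u₀ e₀) (hK : 0 < K) : 1 ≤ K := by
  have h1 := (h.ρ_lower 0 le_rfl).trans (h.ρ_upper 0 le_rfl)
  by_contra hlt
  push Not at hlt
  have := (one_lt_inv₀ hK).2 hlt
  linarith

/-- All terms of the energy of the Cauchy data are nonnegative, hence each of them is bounded. The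
factor `2K` compensates the density in the kinetic energy. -/
theorem moments_le (h : AdmissibleData P K ρ₀ u₀ e₀) (hK : 0 < K) (g : ℝ → ℝ) {q : ℕ}
    (hq : Even q) (hg : ∀ s, 0 ≤ s → g s ^ q ≤ 2 * K * (1 / 2 * ρ₀ s * u₀ s ^ 2)
      + ((ρ₀ s - 1) ^ 2 + ((u₀ s) ^ 2) ^ 2 + (e₀ s - 1) ^ 2)) :
    ∫⁻ s in Ici 0, ENNReal.ofReal (s ^ P.m) * ‖g s‖ₑ ^ q ≤ ENNReal.ofReal (2 * K * K) := by
  have hK1 := h.one_le hK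
  calc _ ≤ ∫⁻ r in Ici (0 : ℝ), ENNReal.ofReal (2 * K) * ENNReal.ofReal
          ((ρ₀ r * (1 / 2 * (u₀ r) ^ 2 + psi (e₀ r)) + (P.γ - 1) * entG (ρ₀ r)
            + ((ρ₀ r - 1) ^ 2 + ((u₀ r) ^ 2) ^ 2 + (e₀ r - 1) ^ 2)) * r ^ P.m) := by
        refine setLIntegral_mono' measurableSet_Ici fun s hs => ?_
        have hs0 : 0 ≤ s := hs
        rw [ofReal_pow_mul_enorm_pow hs0 _ _ hq, ← ENNReal.ofReal_mul (by positivity)]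
        refine ENNReal.ofReal_le_ofReal ?_
        have hρ : 0 < ρ₀ s := (inv_pos.2 hK).trans_le (h.ρ_lower s hs0)
        have he : 0 < e₀ s := (inv_pos.2 hK).trans_le (h.e_lower s hs0)
        have h1 := mul_nonneg hρ.le (Flow.psi_nonneg he)
        have h2 := mul_nonneg P.γ_sub_pos.le (entG_nonneg hρ)
        have h3 : 0 ≤ (ρ₀ s - 1) ^ 2 + ((u₀ s) ^ 2) ^ 2 + (e₀ s - 1) ^ 2 := by positivity
        have h4 := mul_le_mul_of_nonneg_right (show (1 : ℝ) ≤ 2 * K by linarith) h3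
        have h5 := mul_nonneg (show 0 ≤ 2 * K by linarith) (add_nonneg h1 h2)
        have h6 := mul_le_mul_of_nonneg_left (hg s hs0) (pow_nonneg hs0 P.m)
        refine h6.trans ?_
        rw [mul_comm, ← mul_assoc (2 * K) _ (s ^ P.m)]
        refine mul_le_mul_of_nonneg_right ?_ (pow_nonneg hs0 P.m)
        linarith
    _ = ENNReal.ofReal (2 * K) * _ := lintegral_const_mul' _ _ ENNReal.ofReal_ne_top
    _ ≤ ENNReal.ofReal (2 * K) * ENNReal.ofReal K := by gcongr; exact h.energy
    _ = _ := (ENNReal.ofReal_mul (by positivity)).symm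

end AdmissibleData

theorem evenExt_of_nonneg (f : ℝ → ℝ) {s : ℝ} (hs : 0 ≤ s) : evenExt f s = f s := if_pos hs

theorem oddExt_of_nonneg (f : ℝ → ℝ) {s : ℝ} (hs : 0 ≤ s) : oddExt f s = f s := if_pos hs

/-- A convex combination of a number and `1` stays between bounds that enclose both. -/
theorem sub_one_mul_add_one_mem {K z θ : ℝ} (hK : 1 ≤ K) (hθ : θ ∈ Icc (0 : ℝ) 1) :
    (K⁻¹ ≤ z → K⁻¹ ≤ (z - 1) * θ + 1) ∧ (z ≤ K → (z - 1) * θ + 1 ≤ K) := by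
  have hK1 : K⁻¹ ≤ 1 := inv_le_one_of_one_le₀ hK
  constructor
  · intro hz
    have h1 := mul_le_mul_of_nonneg_right (sub_le_sub_right hz 1) hθ.1
    have h2 := mul_le_mul_of_nonneg_left hθ.2 (show 0 ≤ 1 - K⁻¹ by linarith)
    linarith
  · intro hz
    have h1 := mul_le_mul_of_nonneg_right (sub_le_sub_right hz 1) hθ.1
    have h2 := mul_le_mul_of_nonneg_left hθ.2 (show 0 ≤ K - 1 by linarith)
    linarith

namespace DataTuple.Admissible

variable {P : FluidParams} {K a : ℝ} {D : DataTuple}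

theorem aemeasurable_sub_one {f : ℝ → ℝ} (hf : AEMeasurable f (volume.restrict (Ici 0))) :
    AEMeasurable (fun s => f s - 1) (volume.restrict (Ici 0)) := hf.sub aemeasurable_const

theorem moment_ρ_le (h : D.Admissible P K a) (hK : 0 < K) :
    ∫⁻ s in Ici 0, ENNReal.ofReal (s ^ P.m) * ‖D.ρ₀ s - 1‖ₑ ^ 2 ≤ ENNReal.ofReal (2 * K * K) :=
  h.cauchy.moments_le hK (fun s => D.ρ₀ s - 1) even_two fun s hs => by
    have hρ : 0 < D.ρ₀ s := (inv_pos.2 hK).trans_le (h.cauchy.ρ_lower s hs)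
    have : 0 ≤ 2 * K * (1 / 2 * D.ρ₀ s * D.u₀ s ^ 2) + ((D.u₀ s ^ 2) ^ 2 + (D.e₀ s - 1) ^ 2) := by
      positivity
    linarith

theorem moment_e_le (h : D.Admissible P K a) (hK : 0 < K) :
    ∫⁻ s in Ici 0, ENNReal.ofReal (s ^ P.m) * ‖D.e₀ s - 1‖ₑ ^ 2 ≤ ENNReal.ofReal (2 * K * K) :=
  h.cauchy.moments_le hK (fun s => D.e₀ s - 1) even_two fun s hs => by
    have hρ : 0 < D.ρ₀ s := (inv_pos.2 hK).trans_le (h.cauchy.ρ_lower s hs)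
    have : 0 ≤ 2 * K * (1 / 2 * D.ρ₀ s * D.u₀ s ^ 2) + ((D.ρ₀ s - 1) ^ 2 + (D.u₀ s ^ 2) ^ 2) := by
      positivity
    linarith

theorem moment_u_le (h : D.Admissible P K a) (hK : 0 < K) {q : ℕ} (hq : q = 2 ∨ q = 4) :
    ∫⁻ s in Ici 0, ENNReal.ofReal (s ^ P.m) * ‖D.u₀ s - 0‖ₑ ^ q ≤ ENNReal.ofReal (2 * K * K) :=
  h.cauchy.moments_le hK (fun s => D.u₀ s - 0) (by rcases hq with rfl | rfl <;> decide)
    fun s hs => by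
      have hρ : K⁻¹ ≤ D.ρ₀ s := h.cauchy.ρ_lower s hs
      have hρ0 : 0 < D.ρ₀ s := (inv_pos.2 hK).trans_le hρ
      rw [sub_zero]
      rcases hq with rfl | rfl
      · have h1 := mul_le_mul_of_nonneg_left hρ hK.le
        rw [mul_inv_cancel₀ hK.ne'] at h1
        have h2 := mul_le_mul_of_nonneg_right h1 (sq_nonneg (D.u₀ s))
        have : 0 ≤ (D.ρ₀ s - 1) ^ 2 + (D.u₀ s ^ 2) ^ 2 + (D.e₀ s - 1) ^ 2 := by positivity
        linarith
      · have : 0 ≤ 2 * K * (1 / 2 * D.ρ₀ s * D.u₀ s ^ 2)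
            + ((D.ρ₀ s - 1) ^ 2 + (D.e₀ s - 1) ^ 2) := by positivity
        have h4 : D.u₀ s ^ 4 = (D.u₀ s ^ 2) ^ 2 := by ring
        linarith

/-- Averages of the even extension of data with finite weighted second moment are well defined
outside the ball of radius `a`. -/
theorem integrable_evenExt (h : D.Admissible P K a) (ha : 0 < a) {f : ℝ → ℝ}
    (hf : AEMeasurable f (volume.restrict (Ici 0)))
    (hm : ∫⁻ s in Ici 0, ENNReal.ofReal (s ^ P.m) * ‖f s - 1‖ₑ ^ 2 < ⊤) {r : ℝ} (hr : a ≤ r) :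
    Integrable fun ζ => evenExt f (r - ζ) * D.j ζ := by
  have hr' : 2 * (a / 2) ≤ r := by linarith
  refine h.mollifier.integrable_mul_of_indicator 1 (half_pos ha)
    (fun s => evenExt_of_nonneg f) hr' ?_
  refine h.mollifier.integrable_mul P.m ((aemeasurable_indicator_iff measurableSet_Ici).2
    (aemeasurable_sub_one hf)) (half_pos ha) ?_ hr'
  rw [setLIntegral_congr_fun (g := fun s => ENNReal.ofReal (s ^ P.m) * ‖f s - 1‖ₑ ^ 2)
    measurableSet_Ici fun s hs => by simp only [indicator_of_mem hs]]
  exact hm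

theorem extData_ρ_mem (h : D.Admissible P K a) (hK : 0 < K) (ha : 0 < a) {r : ℝ}
    (hr : r ∈ Ici a) : K⁻¹ ≤ extData a D.j D.χin D.ρ₀ r ∧ extData a D.j D.χin D.ρ₀ r ≤ K := by
  have hm := fun c => h.mollifier.mollify_mem_Icc (f := evenExt D.ρ₀) (c := c) (r := r)
    (by linarith [show a ≤ r from hr]) (half_pos ha) (h.integrable_evenExt ha h.cauchy.meas_ρ
      ((h.moment_ρ_le hK).trans_lt ENNReal.ofReal_lt_top) hr)
  have hc := fun z => sub_one_mul_add_one_mem (z := z) (h.cauchy.one_le hK)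
    (h.inner.range (r / a))
  exact ⟨(hc _).1 ((hm _).1 fun s hs => by
      rw [evenExt_of_nonneg _ hs]; exact h.cauchy.ρ_lower s hs),
    (hc _).2 ((hm _).2 fun s hs => by rw [evenExt_of_nonneg _ hs]; exact h.cauchy.ρ_upper s hs)⟩

theorem le_extData_e (h : D.Admissible P K a) (hK : 0 < K) (ha : 0 < a) {r : ℝ}
    (hr : r ∈ Ici a) : K⁻¹ ≤ extData a D.j D.χin D.e₀ r :=
  (sub_one_mul_add_one_mem (h.cauchy.one_le hK) (h.inner.range (r / a))).1
    ((h.mollifier.mollify_mem_Icc (by linarith [show a ≤ r from hr]) (half_pos ha)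
      (h.integrable_evenExt ha h.cauchy.meas_e
        ((h.moment_e_le hK).trans_lt ENNReal.ofReal_lt_top) hr)).1 fun s hs => by
          rw [evenExt_of_nonneg _ hs]; exact h.cauchy.e_lower s hs)

theorem continuousOn_extData_ρ (h : D.Admissible P K a) (hK : 0 < K) (ha : 0 < a) :
    ContinuousOn (extData a D.j D.χin D.ρ₀) (Ici a) := by
  let g : ℝ → ℝ := (Ici 0).indicator D.ρ₀
  have hg : LocallyIntegrable g := by
    refine (locallyIntegrable_const K).mono
      ((aemeasurable_indicator_iff measurableSet_Ici).2 h.cauchy.meas_ρ).aestronglyMeasurable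
      (ae_of_all _ fun s => ?_)
    by_cases hs : s ∈ Ici (0 : ℝ)
    · simp only [g, indicator_of_mem hs]
      have h1 := h.cauchy.ρ_lower s hs
      have h2 := h.cauchy.ρ_upper s hs
      have h3 : 0 ≤ K⁻¹ := (inv_pos.2 hK).le
      rw [Real.norm_of_nonneg (h3.trans h1)]
      exact h2.trans (le_abs_self K)
    · simp only [g, indicator_of_notMem hs, norm_zero]
      exact norm_nonneg _
  have hcon : Continuous fun r => (mollify D.j g r - 1) * D.χin (r / a) + 1 :=
    (((h.mollifier.continuous_mollify hg).sub continuous_const).mul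
      (h.inner.smooth.continuous.comp (continuous_id.div_const a))).add continuous_const
  refine hcon.continuousOn.congr fun r hr => ?_
  have hr' : 2 * (a / 2) ≤ r := by linarith [show a ≤ r from hr]
  unfold extData
  congr 3
  unfold mollify
  refine integral_congr_ae (ae_of_all _ fun ζ => ?_)
  rcases le_or_gt ζ (a / 2) with hζ | hζ
  · have h0 : 0 ≤ r - ζ := by linarith
    simp only [g, evenExt_of_nonneg _ h0, indicator_of_mem (show r - ζ ∈ Ici (0 : ℝ) from h0)]
  · simp [h.mollifier.eq_zero_of_lt hζ]

theorem path_mem (h : D.Admissible P K a) (hK : 0 < K) (ha : 0 < a) {x : ℝ} (hx : 0 ≤ x) :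
    D.path P a x ∈ Ici a :=
  initPath_mem ha (inv_pos.2 hK) (h.continuousOn_extData_ρ hK ha)
    (fun _ hr => (h.extData_ρ_mem hK ha hr).1) hx

/-- Weighted moments of the Cauchy data control the Lagrangian moments of their mollifications. -/
theorem lintegral_path_le (h : D.Admissible P K a) (hK : 0 < K) (ha : 0 < a) (L : ℝ)
    {f g : ℝ → ℝ} (c : ℝ) (hfg : ∀ s, 0 ≤ s → f s = g s)
    (hg : AEMeasurable g (volume.restrict (Ici 0))) {q : ℕ} (hq : q = 2 ∨ q = 4)
    (h2 : ∫⁻ s in Ici 0, ENNReal.ofReal (s ^ P.m) * ‖g s - c‖ₑ ^ 2 ≤ ENNReal.ofReal (2 * K * K))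
    (hm : ∫⁻ s in Ici 0, ENNReal.ofReal (s ^ P.m) * ‖g s - c‖ₑ ^ q
      ≤ ENNReal.ofReal (2 * K * K)) :
    ∫⁻ x in Icc 0 L, ‖mollify D.j f (D.path P a x) - c‖ₑ ^ q
      ≤ ENNReal.ofReal (K * (2 ^ P.m * (2 * K * K))) := by
  refine (lintegral_initPath_le ha (inv_pos.2 hK) (h.continuousOn_extData_ρ hK ha)
    (fun _ hr => (h.extData_ρ_mem hK ha hr).1) (fun _ hr => (h.extData_ρ_mem hK ha hr).2) L
    fun r => ‖mollify D.j f r - c‖ₑ ^ q).trans ?_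
  have h3 := h.mollifier.lintegral_mollify_le P.m c (half_pos ha) hfg hg
    (h2.trans_lt ENNReal.ofReal_lt_top) hq
  rw [show 2 * (a / 2) = a by ring] at h3
  rw [ENNReal.ofReal_mul hK.le, ENNReal.ofReal_mul (by positivity : (0 : ℝ) ≤ 2 ^ P.m),
    ENNReal.ofReal_pow (by norm_num), ENNReal.ofReal_ofNat]
  gcongr
  exact h3.trans (by gcongr)

variable {k : ℕ}

theorem phi_mem (h : D.Admissible P K a) (r : ℝ) : D.phi P a k r ∈ Icc (0 : ℝ) 1 :=
  h.outer.range _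

/-- The cut-off density is a convex combination of the mollified density and `1`. -/
theorem vInit_mem (h : D.Admissible P K a) (hK : 0 < K) (ha : 0 < a) {x : ℝ} (hx : 0 ≤ x) :
    K⁻¹ ≤ D.vInit P a k x ∧ D.vInit P a k x ≤ K := by
  have h1 := h.extData_ρ_mem hK ha (h.path_mem hK ha hx)
  have hc := sub_one_mul_add_one_mem (z := extData a D.j D.χin D.ρ₀ (D.path P a x))
    (h.cauchy.one_le hK) (h.phi_mem (k := k) (D.path P a x))
  have h2 := hc.1 h1.1
  have h3 := hc.2 h1.2
  have h4 := (inv_pos.2 hK).trans_le h2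
  unfold DataTuple.vInit
  exact ⟨inv_anti₀ h4 h3, by simpa using inv_anti₀ (inv_pos.2 hK) h2⟩

theorem le_eInit (h : D.Admissible P K a) (hK : 0 < K) (ha : 0 < a) {x : ℝ} (hx : 0 ≤ x) :
    K⁻¹ ≤ D.eInit P a k x :=
  (sub_one_mul_add_one_mem (h.cauchy.one_le hK) (h.phi_mem (k := k) (D.path P a x))).1
    (h.le_extData_e hK ha (h.path_mem hK ha hx))

theorem enorm_le_of_cutoff {z g θ : ℝ} (hθ : θ ∈ Icc (0 : ℝ) 1) (h : ‖z‖ₑ ≤ ‖g‖ₑ) :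
    ‖z * θ‖ₑ ≤ ‖g‖ₑ := by
  rw [enorm_mul]
  refine (mul_le_of_le_one_right' ?_).trans h
  rw [Real.enorm_of_nonneg hθ.1]
  exact ENNReal.ofReal_le_one.2 hθ.2

theorem lintegral_uInit_le (h : D.Admissible P K a) (hK : 0 < K) (ha : 0 < a) (L : ℝ) {q : ℕ}
    (hq : q = 2 ∨ q = 4) :
    ∫⁻ x in Icc 0 L, ‖D.uInit P a k x‖ₑ ^ q ≤ ENNReal.ofReal (K * (2 ^ P.m * (2 * K * K))) := by
  refine le_trans (lintegral_mono fun x => pow_le_pow_left' ?_ q) (h.lintegral_path_le hK ha L 0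
    (fun s hs => oddExt_of_nonneg D.u₀ hs) h.cauchy.meas_u hq (h.moment_u_le hK (Or.inl rfl))
    (h.moment_u_le hK hq))
  rw [sub_zero]
  exact enorm_le_of_cutoff (h.phi_mem _) (enorm_le_of_cutoff (h.inner.range _) le_rfl)

theorem lintegral_eInit_le (h : D.Admissible P K a) (hK : 0 < K) (ha : 0 < a) (L : ℝ) :
    ∫⁻ x in Icc 0 L, ‖D.eInit P a k x - 1‖ₑ ^ 2
      ≤ ENNReal.ofReal (K * (2 ^ P.m * (2 * K * K))) := by
  refine le_trans (lintegral_mono fun x => pow_le_pow_left' ?_ 2) (h.lintegral_path_le hK ha L 1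
    (fun s hs => evenExt_of_nonneg D.e₀ hs) h.cauchy.meas_e (Or.inl rfl) (h.moment_e_le hK)
    (h.moment_e_le hK))
  unfold DataTuple.eInit extData
  rw [add_sub_cancel_right, add_sub_cancel_right]
  exact enorm_le_of_cutoff (h.phi_mem _) (enorm_le_of_cutoff (h.inner.range _) le_rfl)

theorem lintegral_vInit_le (h : D.Admissible P K a) (hK : 0 < K) (ha : 0 < a) (L : ℝ) :
    ∫⁻ x in Icc 0 L, ‖D.vInit P a k x - 1‖ₑ ^ 2
      ≤ ENNReal.ofReal (K ^ 2 * (K * (2 ^ P.m * (2 * K * K)))) := by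
  have h1 := h.lintegral_path_le hK ha L 1
    (fun s hs => evenExt_of_nonneg D.ρ₀ hs) h.cauchy.meas_ρ (Or.inl rfl) (h.moment_ρ_le hK)
    (h.moment_ρ_le hK)
  rw [ENNReal.ofReal_mul (by positivity)]
  refine le_trans ?_ (mul_le_mul_right h1 _)
  rw [← lintegral_const_mul' _ _ ENNReal.ofReal_ne_top]
  refine setLIntegral_mono' measurableSet_Icc fun x hx => ?_
  have hv := h.vInit_mem (k := k) hK ha hx.1
  have hv0 : 0 < D.vInit P a k x := (inv_pos.2 hK).trans_le hv.1
  -- `v - 1 = -v (ρ - 1)` for `v = 1 / ρ`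
  have heq : D.vInit P a k x - 1 = -(D.vInit P a k x
      * ((mollify D.j (evenExt D.ρ₀) (D.path P a x) - 1) * D.χin (D.path P a x / a)
        * D.phi P a k (D.path P a x))) := by
    have h2 : D.vInit P a k x * ((extData a D.j D.χin D.ρ₀ (D.path P a x) - 1)
        * D.phi P a k (D.path P a x) + 1) = 1 := by
      refine inv_mul_cancel₀ fun h0 => ?_
      rw [DataTuple.vInit, h0, inv_zero] at hv0
      exact lt_irrefl _ hv0
    unfold extData at h2
    linarith
  rw [heq, enorm_neg, enorm_mul, mul_pow, ENNReal.ofReal_pow hK.le,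
    Real.enorm_of_nonneg hv0.le]
  gcongr
  · exact hv.2
  · exact enorm_le_of_cutoff (h.phi_mem _) (enorm_le_of_cutoff (h.inner.range _) le_rfl)

end DataTuple.Admissible

end SphNS

namespace SphNS

/-! ### From classical solutions to flows -/

theorem lintegral_Icc_eq_ofReal_integral {f F : ℝ → ℝ} {c d : ℝ} (hcd : c ≤ d)
    (hF : Continuous F) (h0 : ∀ x ∈ Icc c d, 0 ≤ F x) (hfF : ∀ x ∈ Icc c d, f x = F x) :
    ∫⁻ x in Icc c d, ENNReal.ofReal (f x) = ENNReal.ofReal (∫ x in c..d, F x) := by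
  rw [setLIntegral_congr_fun (g := fun x => ENNReal.ofReal (F x)) measurableSet_Icc
    fun x hx => by simp only [hfF x hx], intervalIntegral.integral_of_le hcd,
    ← integral_Icc_eq_integral_Ioc, ofReal_integral_eq_lintegral_ofReal]
  · exact hF.continuousOn.integrableOn_compact isCompact_Icc
  · exact (ae_restrict_iff' measurableSet_Icc).2 (ae_of_all _ h0)

theorem lintegral_lintegral_Icc_eq_ofReal_integral {f F : ℝ → ℝ → ℝ} {c d T : ℝ} (hcd : c ≤ d)
    (hT : 0 ≤ T) (hF : Continuous fun q : ℝ × ℝ => F q.1 q.2)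
    (h0 : ∀ x ∈ Icc c d, ∀ t ∈ Icc 0 T, 0 ≤ F x t)
    (hfF : ∀ x ∈ Icc c d, ∀ t ∈ Icc 0 T, f x t = F x t) :
    ∫⁻ t in Icc 0 T, ∫⁻ x in Icc c d, ENNReal.ofReal (f x t)
      = ENNReal.ofReal (∫ t in (0 : ℝ)..T, ∫ x in c..d, F x t) := by
  have hFt : ∀ t, Continuous fun x => F x t := fun t =>
    hF.comp (continuous_id.prodMk continuous_const)
  rw [← lintegral_Icc_eq_ofReal_integral (f := fun t => ∫ x in c..d, F x t) hT
    (continuous_intervalIntegral_param hF c d) (fun t ht => ?_) (fun t _ => rfl)]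
  · exact setLIntegral_congr_fun measurableSet_Icc fun t ht =>
      lintegral_Icc_eq_ofReal_integral hcd (hFt t) (fun x hx => h0 x hx t ht)
        fun x hx => hfF x hx t ht
  · exact intervalIntegral.integral_nonneg hcd fun x hx => h0 x hx t ht

theorem integral_pow_le_of_lintegral_le {g F : ℝ → ℝ} {L N : ℝ} (hL : 0 ≤ L) (hN : 0 ≤ N)
    (hF : Continuous F) (hg : ∀ x ∈ Icc 0 L, F x = g x) {q : ℕ} (hq : Even q)
    (h : ∫⁻ x in Icc 0 L, ‖g x‖ₑ ^ q ≤ ENNReal.ofReal N) :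
    ∫ x in (0 : ℝ)..L, F x ^ q ≤ N := by
  rw [← ENNReal.ofReal_le_ofReal_iff hN, ← lintegral_Icc_eq_ofReal_integral
    (f := fun x => g x ^ q) (F := fun x => F x ^ q) hL (hF.pow q) (fun x _ => hq.pow_nonneg _)
    fun x hx => by rw [hg x hx]]
  refine le_trans (le_of_eq (lintegral_congr fun x => ?_)) h
  simpa using (ofReal_pow_mul_enorm_pow zero_le_one 0 (g x) hq).symm

namespace Flow

variable {P : FluidParams} {L T : ℝ}

/-- The fields of the flow `S` restrict on `[0,L] × [0,T]` to `v`, `u`, `e`, to the radius of the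
particles and to the derivatives that occur in the equations. -/
def Extends (S : Flow P L T) (a : ℝ) (v u e : ℝ → ℝ → ℝ) : Prop :=
  ∀ x ∈ Icc 0 L, ∀ t ∈ Icc 0 T,
    S.r x t = radius P a v x t ∧ S.v x t = v x t ∧ S.u x t = u x t ∧ S.e x t = e x t ∧
    S.W x t = Dx L (flux P a v u) x t ∧ S.ux x t = Dx L u x t ∧ S.ex x t = Dx L e x t ∧
    S.ut x t = Dt T u x t ∧ S.et x t = Dt T e x t

/-- The initial entropy and the initial fourth-order energy are bounded by weighted moments of the
Cauchy data, because `v` and `e` are bounded below and `ψ(ζ) ≤ (ζ - 1)²/ζ`. -/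
theorem exists_basic (P : FluidParams) {K : ℝ} (hK : 0 < K) : ∃ E V, 1 ≤ E ∧ 1 ≤ V ∧
    ∀ a ∈ Ioo (0 : ℝ) 1, ∀ (k : ℕ) (T : ℝ) (D : DataTuple), D.Admissible P K a →
    ∀ v u e : ℝ → ℝ → ℝ,
    IsClassicalSolution P a k T (D.vInit P a k) (D.uInit P a k) (D.eInit P a k) v u e →
    ∀ S : Flow P k T, S.Extends a v u e → S.Basic E V a := by
  have hγ := P.γ_sub_pos
  obtain ⟨N, hN⟩ : ∃ N, N = K * (2 ^ P.m * (2 * K * K)) := ⟨_, rfl⟩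
  have N0 : 0 ≤ N := by rw [hN]; positivity
  have e1 : 0 ≤ K * N := by positivity
  have e2 : 0 ≤ (P.γ - 1) * (K * (K ^ 2 * N)) := by positivity
  refine ⟨1 + 2 * N + K * N + (P.γ - 1) * (K * (K ^ 2 * N)), max 1 K, by linarith,
    le_max_left _ _, ?_⟩
  intro a ha k T D hD v u e h S hS
  have hK1 := hD.cauchy.one_le hK
  have hL := S.L_pos
  have hT := S.T_pos
  have h0T : (0 : ℝ) ∈ Icc 0 T := ⟨le_rfl, hT.le⟩
  have hv : ∀ x ∈ Icc 0 (k : ℝ), S.v x 0 = D.vInit P a k x := fun x hx =>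
    (hS x hx 0 h0T).2.1.trans (h.init x hx).1
  have hu : ∀ x ∈ Icc 0 (k : ℝ), S.u x 0 = D.uInit P a k x := fun x hx =>
    (hS x hx 0 h0T).2.2.1.trans (h.init x hx).2.1
  have he : ∀ x ∈ Icc 0 (k : ℝ), S.e x 0 = D.eInit P a k x := fun x hx =>
    (hS x hx 0 h0T).2.2.2.1.trans (h.init x hx).2.2
  have iu : ∀ q, q = 2 ∨ q = 4 → ∫ x in (0 : ℝ)..k, S.u x 0 ^ q ≤ N := fun q hq =>
    integral_pow_le_of_lintegral_le hL.le N0 (by fun_prop) hu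
      (by rcases hq with rfl | rfl <;> decide) (hN ▸ hD.lintegral_uInit_le hK ha.1 k hq)
  have iu2 := iu 2 (Or.inl rfl)
  have iu4 := iu 4 (Or.inr rfl)
  have ie : ∫ x in (0 : ℝ)..k, (S.e x 0 - 1) ^ 2 ≤ N :=
    integral_pow_le_of_lintegral_le hL.le N0 (by fun_prop) (fun x hx => by rw [he x hx])
      even_two (hN ▸ hD.lintegral_eInit_le hK ha.1 k)
  have iv : ∫ x in (0 : ℝ)..k, (S.v x 0 - 1) ^ 2 ≤ K ^ 2 * N :=
    integral_pow_le_of_lintegral_le hL.le (by positivity) (by fun_prop)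
      (fun x hx => by rw [hv x hx]) even_two (hN ▸ hD.lintegral_vInit_le hK ha.1 k)
  have hpsi : ∀ z : ℝ, K⁻¹ ≤ z → psi z ≤ K * (z - 1) ^ 2 := fun z hz => by
    have hz0 := (inv_pos.2 hK).trans_le hz
    refine (psi_le_sq_sub_one_div hz0).trans ?_
    rw [div_eq_mul_inv, mul_comm]
    exact mul_le_mul_of_nonneg_right (by simpa using inv_anti₀ (inv_pos.2 hK) hz) (sq_nonneg _)
  refine ⟨?_, fun x hx => ?_, ?_, ha.1, ha.2, fun x hx t ht => ?_⟩
  · have h1 : S.entropy 0 ≤ ∫ x in (0 : ℝ)..k, (1 / 2 * S.u x 0 ^ 2 + K * (S.e x 0 - 1) ^ 2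
        + (P.γ - 1) * (K * (S.v x 0 - 1) ^ 2)) := by
      refine integral_mono_of_continuous hL.le (by fun_prop) (by fun_prop) fun x hx => ?_
      have hx' : x ∈ Icc 0 (k : ℝ) := ⟨hx.1, hx.2⟩
      have hv' := hpsi _ ((hD.vInit_mem (k := k) hK ha.1 hx'.1).1.trans_eq (hv x hx').symm)
      have he' := hpsi _ ((hD.le_eInit (k := k) hK ha.1 hx'.1).trans_eq (he x hx').symm)
      have := mul_le_mul_of_nonneg_left hv' hγ.le
      linarith
    rw [integral_add_of_continuous (by fun_prop) (by fun_prop),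
      integral_add_of_continuous (by fun_prop) (by fun_prop)] at h1
    simp only [intervalIntegral.integral_const_mul] at h1
    have h2 := mul_le_mul_of_nonneg_left ie hK.le
    have h3 := mul_le_mul_of_nonneg_left (mul_le_mul_of_nonneg_left iv hK.le) hγ.le
    linarith
  · rw [hv x hx, max_eq_right hK1]
    exact hD.vInit_mem hK ha.1 hx.1
  · rw [integral_add_of_continuous (by fun_prop) (by fun_prop)]
    linarith
  · have heq : ∫ y in (0 : ℝ)..x, v y t = ∫ y in (0 : ℝ)..x, S.v y t := by
      refine intervalIntegral.integral_congr fun y hy => ?_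
      rw [uIcc_of_le hx.1] at hy
      exact ((hS y ⟨hy.1, hy.2.trans hx.2⟩ t ht).2.1).symm
    have hpos : 0 ≤ ∫ y in (0 : ℝ)..x, S.v y t :=
      integral_nonneg_of_continuous hx.1 fun y _ => (S.v_pos y t).le
    rw [(hS x hx t ht).1, radius_pow, heq]
    rw [heq]
    have := mul_nonneg P.n_pos.le hpos
    have := pow_pos ha.1 P.n
    linarith

variable {S : Flow P L T} {a : ℝ} {v u e : ℝ → ℝ → ℝ}

theorem Extends.entropyFunctional_le (hS : S.Extends a v u e) {E : ℝ} (hE : S.entropy 0 ≤ E) :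
    entropyFunctional P a L T v u e ≤ ENNReal.ofReal (3 * E) := by
  have hL := S.L_pos
  have hT := S.T_pos
  have hTT : T ∈ Icc 0 T := ⟨hT.le, le_rfl⟩
  have hE0 : 0 ≤ E := (S.entropy_nonneg 0).trans hE
  rw [show 3 * E = E + E + E by ring, ENNReal.ofReal_add (by positivity) hE0,
    ENNReal.ofReal_add hE0 hE0]
  refine add_le_add (add_le_add (iSup₂_le fun t ht => ?_) ?_) ?_
  · rw [lintegral_Icc_eq_ofReal_integral (F := fun x =>
      1 / 2 * S.u x t ^ 2 + psi (S.e x t) + (P.γ - 1) * psi (S.v x t)) hL.le (by fun_prop) (fun x _ => S.entropy_density_nonneg x t)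
      fun x hx => by
        obtain ⟨-, h1, h2, h3, -⟩ := hS x hx t ht
        rw [h1, h2, h3]]
    exact ENNReal.ofReal_le_ofReal ((S.entropy_le ht).trans hE)
  · rw [lintegral_lintegral_Icc_eq_ofReal_integral (F := fun x t =>
      S.B x t ^ 2 / (S.v x t * S.e x t ^ 2)) hL.le hT.le (by fun_prop)
      (fun x _ t _ => div_nonneg (sq_nonneg _)
        (mul_nonneg (S.v_pos x t).le (sq_nonneg _))) fun x hx t ht => by
        obtain ⟨h0, h1, h2, h3, -, -, h6, -⟩ := hS x hx t ht
        simp only [B, rm, h0, h1, h3, h6]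
        ring, ← ENNReal.ofReal_mul P.κ_pos.le]
    exact ENNReal.ofReal_le_ofReal ((S.integral_heatProd_le hTT).trans hE)
  · rw [lintegral_lintegral_Icc_eq_ofReal_integral (F := fun x t => S.Q x t / S.e x t) hL.le hT.le
      (by fun_prop) (fun x _ t _ => div_nonneg (S.Q_nonneg x t) (S.e_pos x t).le)
      fun x hx t ht => by
        obtain ⟨h0, h1, h2, h3, h4, -⟩ := hS x hx t ht
        rw [Q_eq, b, ← h0, ← h1, ← h2, ← h3, ← h4]
        ring]
    exact ENNReal.ofReal_le_ofReal ((S.integral_viscProd_le hTT).trans hE)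

theorem Regular.mono {C y y' : ℝ} (h : S.Regular C y) (hy : y ≤ y') (hL : y' ≤ L) :
    S.Regular C y' where
  sup := fun t ht => by
    have key : ∀ f : ℝ → ℝ, Continuous f → (∀ x, 0 ≤ f x) →
        ∫ x in y'..L, f x ≤ ∫ x in y..L, f x := fun f hf h0 =>
      integral_le_integral_of_subinterval hy hL le_rfl hf fun x _ => h0 x
    have h1 := key (fun x => S.u x t ^ 4 + (S.e x t - 1) ^ 2 + (S.v x t - 1) ^ 2) (by fun_prop)
      fun x => by positivity
    have h2 := mul_le_mul_of_nonneg_left (key (fun x => S.A x t ^ 2) (by fun_prop)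
      fun x => sq_nonneg _) (sigma_nonneg ht.1)
    have h3 := mul_le_mul_of_nonneg_left (key (fun x => S.B x t ^ 2) (by fun_prop)
      fun x => sq_nonneg _) (sq_nonneg (sigma t))
    linarith [h.sup t ht]
  int := by
    have cσ := continuous_sigma
    refine le_trans (add_le_add (add_le_add ?_ ?_) ?_) h.int
    · refine integral_mono_of_continuous S.T_pos.le (continuous_intervalIntegral_param
        (by fun_prop) _ _) (continuous_intervalIntegral_param (by fun_prop) _ _) fun s _ => ?_
      exact integral_le_integral_of_subinterval hy hL le_rfl (by fun_prop) fun x _ => by positivity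
    · refine integral_mono_of_continuous S.T_pos.le (cσ.mul (continuous_intervalIntegral_param
        (by fun_prop) _ _)) (cσ.mul (continuous_intervalIntegral_param (by fun_prop) _ _))
        fun s hs => mul_le_mul_of_nonneg_left ?_ (sigma_nonneg hs.1)
      exact integral_le_integral_of_subinterval hy hL le_rfl (by fun_prop) fun x _ => by positivity
    · refine integral_mono_of_continuous S.T_pos.le ((cσ.pow 2).mul
        (continuous_intervalIntegral_param (by fun_prop) _ _)) ((cσ.pow 2).mul
        (continuous_intervalIntegral_param (by fun_prop) _ _))
        fun s hs => mul_le_mul_of_nonneg_left ?_ (sq_nonneg _)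
      exact integral_le_integral_of_subinterval hy hL le_rfl (by fun_prop) fun x _ => by positivity
  u_le := fun x hx t ht => h.u_le x ⟨hy.trans hx.1, hx.2⟩ t ht
  e_le := fun x hx t ht => h.e_le x ⟨hy.trans hx.1, hx.2⟩ t ht

theorem Extends.regFunctional_le (hS : S.Extends a v u e) {C y : ℝ} (hC : 0 ≤ C) (hy : 0 ≤ y)
    (hyL : y ≤ L) (h : S.Regular C y) :
    regFunctional P a L T y v u e ≤ ENNReal.ofReal (2 * C) := by
  have hT := S.T_pos
  have cσ := continuous_sigma
  have hS' : ∀ x ∈ Icc y L, ∀ t ∈ Icc 0 T, _ := fun x hx => hS x ⟨hy.trans hx.1, hx.2⟩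
  rw [two_mul, ENNReal.ofReal_add hC hC]
  refine add_le_add (iSup₂_le fun t ht => ?_) ?_
  · have hσ := sigma_nonneg ht.1
    rw [lintegral_Icc_eq_ofReal_integral (F := fun x => (S.u x t ^ 4 + (S.e x t - 1) ^ 2
      + (S.v x t - 1) ^ 2) + sigma t * S.A x t ^ 2 + sigma t ^ 2 * S.B x t ^ 2) hyL (by fun_prop)
      (fun x _ => by positivity) fun x hx => by
        obtain ⟨h0, h1, h2, h3, -, h5, h6, -⟩ := hS' x hx t ht
        rw [A, B, rm, ← h0, ← h1, ← h2, ← h3, ← h5, ← h6, mul_pow (_ * _), mul_pow √_,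
          Real.sq_sqrt hσ]
        ring]
    refine ENNReal.ofReal_le_ofReal (le_trans (le_of_eq ?_) (h.sup t ht))
    rw [integral_add_of_continuous (by fun_prop) (by fun_prop),
      integral_add_of_continuous (by fun_prop) (by fun_prop),
      intervalIntegral.integral_const_mul, intervalIntegral.integral_const_mul]
  · rw [lintegral_lintegral_Icc_eq_ofReal_integral (F := fun x t =>
      (S.A x t ^ 2 + S.B x t ^ 2 + S.u x t ^ 2 * S.A x t ^ 2) + sigma t * S.ut x t ^ 2
      + sigma t ^ 2 * S.et x t ^ 2) hyL hT.le (by fun_prop)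
      (fun x _ t ht => by have := sigma_nonneg ht.1; positivity) fun x hx t ht => by
        obtain ⟨h0, h1, h2, h3, -, h5, h6, h7, h8⟩ := hS' x hx t ht
        rw [A, B, rm, ← h0, ← h2, ← h5, ← h6, ← h7, ← h8, mul_pow √_,
          Real.sq_sqrt (sigma_nonneg ht.1)]
        ring]
    refine ENNReal.ofReal_le_ofReal (le_trans (le_of_eq ?_) h.int)
    have hx : ∀ t, ∫ x in y..L, ((S.A x t ^ 2 + S.B x t ^ 2 + S.u x t ^ 2 * S.A x t ^ 2)
        + sigma t * S.ut x t ^ 2 + sigma t ^ 2 * S.et x t ^ 2)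
        = (∫ x in y..L, (S.A x t ^ 2 + S.B x t ^ 2 + S.u x t ^ 2 * S.A x t ^ 2))
          + sigma t * (∫ x in y..L, S.ut x t ^ 2) + sigma t ^ 2 * ∫ x in y..L, S.et x t ^ 2 := by
      intro t
      rw [integral_add_of_continuous (by fun_prop) (by fun_prop),
        integral_add_of_continuous (by fun_prop) (by fun_prop),
        intervalIntegral.integral_const_mul, intervalIntegral.integral_const_mul]
    simp only [hx]
    have c1 := continuous_intervalIntegral_param
      (f := fun x t => S.A x t ^ 2 + S.B x t ^ 2 + S.u x t ^ 2 * S.A x t ^ 2) (by fun_prop) y L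
    have c2 : Continuous fun t => sigma t * ∫ x in y..L, S.ut x t ^ 2 :=
      cσ.mul (continuous_intervalIntegral_param (f := fun x t => S.ut x t ^ 2) (by fun_prop) y L)
    have c3 : Continuous fun t => sigma t ^ 2 * ∫ x in y..L, S.et x t ^ 2 :=
      (cσ.pow 2).mul
        (continuous_intervalIntegral_param (f := fun x t => S.et x t ^ 2) (by fun_prop) y L)
    have c12 : Continuous fun t =>
        (∫ x in y..L, (S.A x t ^ 2 + S.B x t ^ 2 + S.u x t ^ 2 * S.A x t ^ 2))
          + sigma t * ∫ x in y..L, S.ut x t ^ 2 := c1.add c2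
    rw [integral_add_of_continuous c12 c3, integral_add_of_continuous c1 c2]

theorem le_one_add_of_sq_le {z C : ℝ} (h : z ^ 2 ≤ C) : z ≤ 1 + C := by
  nlinarith [sq_nonneg (z - 1)]

theorem Regular.u_e_le {C y : ℝ} (h : S.Regular C y) {x t : ℝ} (hx : x ∈ Icc y L)
    (ht : t ∈ Icc 0 T) : sigma t ^ (1 / 4 : ℝ) * |S.u x t| ≤ 1 + C
      ∧ sigma t ^ (1 / 2 : ℝ) * S.e x t ≤ 2 + C := by
  have hσ := sigma_nonneg ht.1
  constructor
  · refine le_one_add_of_sq_le ?_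
    rw [mul_pow, sq_abs, ← Real.rpow_natCast (sigma t ^ (1 / 4 : ℝ)), ← Real.rpow_mul hσ]
    have := h.u_le x hx t ht
    rw [Real.sqrt_eq_rpow] at this
    norm_num at this ⊢
    exact this
  · have h1 : √(sigma t) * (S.e x t - 1) ≤ 1 + C := by
      refine le_one_add_of_sq_le ?_
      rw [mul_pow, Real.sq_sqrt hσ]
      exact h.e_le x hx t ht
    have h2 : √(sigma t) ≤ 1 := Real.sqrt_le_one.2 (sigma_le_one t)
    rw [← Real.sqrt_eq_rpow]
    linarith

end Flow

end SphNS

namespace SphNS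
namespace Flow

/-! ### Choice of the constants -/

/-- The estimates that hold for every flow issuing from admissible data. -/
structure Controlled {P : FluidParams} {L T : ℝ} (S : Flow P L T) (E V C₀ a : ℝ) : Prop where
  basic : S.Basic E V a
  v_bounds : ∀ z, 0 ≤ z → ∀ x ∈ Icc z L, ∀ t ∈ Icc 0 T,
    vLower P C₀ z t a ≤ S.v x t ∧ S.v x t ≤ vUpper P C₀ z t a

variable {P : FluidParams} {E V C₀ : ℝ}

/-- The function `h(z,a)` decreases in `a`, so that `h(z,0)` gives a bound independent of `a`. -/
theorem exists_v_bounds_of_pos (P : FluidParams) {E V C₀ : ℝ} (hC : 0 < C₀) (T : ℝ) {z : ℝ}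
    (hz : 0 < z) :
    ∃ C, 1 < C ∧ ∀ (L : ℝ) (S : Flow P L T) (a : ℝ), S.Controlled E V C₀ a →
    ∀ x ∈ Icc z L, ∀ t ∈ Icc 0 T, C⁻¹ ≤ S.v x t ∧ S.v x t ≤ C := by
  obtain ⟨C, hC1, h⟩ := exists_vUpper_vLower_le P hC T (hFun P C₀ z 0)
  refine ⟨C, hC1, fun L S a hS x hx t ht => ?_⟩
  have ha := hS.basic.a_pos
  have h1 := h z a t hz.le ha.le (Or.inl hz) (hFun_le hC hz ha.le) ht.1 ht.2
  have h2 := hS.v_bounds z hz.le x hx t ht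
  exact ⟨h1.1.trans h2.1, h2.2.trans h1.2⟩

theorem exists_v_bounds_zero (P : FluidParams) {E V C₀ : ℝ} (hC : 0 < C₀) (T : ℝ) {a : ℝ}
    (ha : 0 < a) :
    ∃ C, 1 < C ∧ ∀ (L : ℝ) (S : Flow P L T), S.Controlled E V C₀ a →
    ∀ x ∈ Icc 0 L, ∀ t ∈ Icc 0 T, C⁻¹ ≤ S.v x t ∧ S.v x t ≤ C := by
  obtain ⟨C, hC1, h⟩ := exists_vUpper_vLower_le P hC T (hFun P C₀ 0 a)
  refine ⟨C, hC1, fun L S hS x hx t ht => ?_⟩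
  have h1 := h 0 a t le_rfl ha.le (Or.inr ha) le_rfl ht.1 ht.2
  have h2 := hS.v_bounds 0 le_rfl x hx t ht
  exact ⟨h1.1.trans h2.1, h2.2.trans h1.2⟩

/-- Away from the inner boundary the regularity estimates follow from a chain of three cut-offs,
none of which sees the inner radius. -/
theorem exists_regular_of_pos (P : FluidParams) {E V C₀ : ℝ} (hE1 : 1 ≤ E) (hC : 0 < C₀)
    (hEC : 2 * (E / (P.γ - 1)) ≤ C₀) (T : ℝ) {ε : ℝ} (hε : ε ∈ Ioc (0 : ℝ) 1) :
    ∃ C, 0 ≤ C ∧ ∀ (L : ℝ) (S : Flow P L T) (a : ℝ), S.Controlled E V C₀ a →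
    S.Regular C ε := by
  obtain ⟨hε0, hε1⟩ := hε
  obtain ⟨K, hK1, hK⟩ := exists_bounded P (V := V) hE1 hC hEC T (hFun P C₀ (ε / 16) 0)
  obtain ⟨M, hM0, hM⟩ := exists_isWeight
  obtain ⟨K', hK'⟩ : ∃ K', K' = K + M / (ε / 16) := ⟨_, rfl⟩
  obtain ⟨C, hC0, horders⟩ := exists_orders P K'
  obtain ⟨C', hC'0, hreg⟩ := exists_regular P K' C
  refine ⟨C', hC'0, fun L S a hS => ?_⟩
  have hL := S.one_le_L
  have ha := hS.basic.a_pos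
  have hMε : 0 ≤ M / (ε / 16) := by positivity
  have hKK' : K ≤ K' := by linarith
  have hB : ∀ y, ε / 16 ≤ y → y ≤ 1 / 2 → S.Bounded K' y := fun y hy hy1 =>
    (hK L S a hS.basic hS.v_bounds (ε / 16) (by positivity) (by linarith)
      (hFun_le hC (by positivity) ha.le) K' hKK').mono hy (by linarith)
  have hw : ∀ y y', y + ε / 16 ≤ y' → y' ≤ 1 / 2 → ∃ η η', IsWeight K' L y y' η η' := by
    intro y y' h h1
    refine hM K' L y y' (by linarith) (by linarith) (by linarith) ?_
    have : M / (y' - y) ≤ M / (ε / 16) :=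
      div_le_div_of_nonneg_left hM0 (by positivity) (by linarith)
    linarith
  -- `h(y,0)` is finite for `y > 0`, hence the chain starts at `ε/16` instead of `0`; it stops at
  -- `ε/2 ≤ 1/2`, so that an interval of length `1/2` remains even for `L = 1`
  obtain ⟨η₁, η₁', w₁⟩ := hw (ε / 16) (ε / 8) (by linarith) (by linarith)
  obtain ⟨η₂, η₂', w₂⟩ := hw (ε / 8) (ε / 4) (by linarith) (by linarith)
  obtain ⟨η₃, η₃', w₃⟩ := hw (ε / 4) (ε / 2) (by linarith) (by linarith)
  obtain ⟨h1, h2, h3⟩ := horders L T S _ _ _ _ _ _ _ _ _ _ (hB _ le_rfl (by linarith)) w₁ w₂ w₃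
  exact (hreg L T S _ (hB _ (by linarith) (by linarith)) h1 h2 h3).mono (by linarith)
    (by linarith)

/-- For a fixed inner radius no cut-off is needed, and the temperature is bounded below. -/
theorem exists_regular_zero (P : FluidParams) {E V C₀ : ℝ} (hE1 : 1 ≤ E) (hC : 0 < C₀)
    (hEC : 2 * (E / (P.γ - 1)) ≤ C₀) (T : ℝ) (a : ℝ) :
    ∃ C, 0 ≤ C ∧ ∀ (L : ℝ) (S : Flow P L T), S.Controlled E V C₀ a →
    S.Regular C 0 ∧ ∀ e₀, (∀ x ∈ Icc 0 L, e₀ ≤ S.e x 0) →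
      ∀ x ∈ Icc 0 L, ∀ t ∈ Icc 0 T, e₀ ≤ S.e x t * Real.exp C := by
  obtain ⟨K, hK1, hK⟩ := exists_bounded P (V := V) hE1 hC hEC T (hFun P C₀ 0 a)
  obtain ⟨C, hC0, horders⟩ := exists_orders P K
  obtain ⟨C', hC'0, hreg⟩ := exists_regular P K C
  obtain ⟨Ce, hCe0, he⟩ := exists_le_e P K C C
  refine ⟨C' + Ce, by positivity, fun L S hS => ?_⟩
  have hL := S.one_le_L
  have hB := hK L S a hS.basic hS.v_bounds 0 le_rfl (by linarith) le_rfl K le_rfl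
  have w := isWeight_one (zero_le_one.trans hK1) hL
  obtain ⟨h1, h2, h3⟩ := horders L T S _ _ _ _ _ _ _ _ _ _ hB w w w
  have hR := hreg L T S 0 hB h1 h2 h3
  refine ⟨⟨fun t ht => (hR.sup t ht).trans (by linarith), hR.int.trans (by linarith),
    fun x hx t ht => (hR.u_le x hx t ht).trans (by linarith),
    fun x hx t ht => (hR.e_le x hx t ht).trans (by linarith)⟩, fun e₀ h0 x hx t ht => ?_⟩
  refine (he L T S hB h1 h2 e₀ h0 x hx t ht).trans ?_
  refine mul_le_mul_of_nonneg_left (Real.exp_le_exp.2 (by linarith)) (S.e_pos x t).le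

end Flow
end SphNS

theorem mainTheorem3 (P : SphNS.FluidParams) (Cstar : ℝ) (hCstar : 0 < Cstar) :
    ∃ (C₀ : ℝ) (CT : ℝ → ℝ) (Ca Cε : ℝ → ℝ → ℝ),
      1 < C₀ ∧ (∀ T, 1 < CT T) ∧ (∀ T a, 1 < Ca T a) ∧ (∀ T ε, 1 < Cε T ε) ∧
      ∀ (a : ℝ), a ∈ Set.Ioo (0 : ℝ) 1 →
      ∀ (k : ℕ), 1 ≤ k →
      ∀ (T : ℝ), 0 < T →
      ∀ (D : SphNS.DataTuple), D.Admissible P Cstar a →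
      ∀ (v u e : ℝ → ℝ → ℝ),
        SphNS.IsClassicalSolution P a k T (D.vInit P a k) (D.uInit P a k) (D.eInit P a k) v u e →
        -- entropy estimate
        SphNS.entropyFunctional P a k T v u e ≤ ENNReal.ofReal C₀ ∧
        -- pointwise bounds of the specific volume
        ((∀ ε : ℝ, 0 ≤ ε → ∀ x ∈ Set.Icc ε (k : ℝ), ∀ t ∈ Set.Icc (0 : ℝ) T,
            SphNS.vLower P C₀ ε t a ≤ v x t ∧ v x t ≤ SphNS.vUpper P C₀ ε t a) ∧
          (∀ x ∈ Set.Icc (1 : ℝ) k, ∀ t ∈ Set.Icc (0 : ℝ) T,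
            (CT T)⁻¹ ≤ v x t ∧ v x t ≤ CT T) ∧
          (∀ ε : ℝ, 0 < ε → ∀ x ∈ Set.Icc ε (k : ℝ), ∀ t ∈ Set.Icc (0 : ℝ) T,
            (Cε T ε)⁻¹ ≤ v x t ∧ v x t ≤ Cε T ε) ∧
          (∀ x ∈ Set.Icc (0 : ℝ) k, ∀ t ∈ Set.Icc (0 : ℝ) T,
            (Ca T a)⁻¹ ≤ v x t ∧ v x t ≤ Ca T a)) ∧
        -- estimates up to the inner boundary
        (SphNS.regFunctional P a k T 0 v u e ≤ ENNReal.ofReal (Ca T a) ∧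
          (∀ x ∈ Set.Icc (0 : ℝ) k, ∀ t ∈ Set.Icc (0 : ℝ) T,
            ((Ca T a)⁻¹ ≤ v x t ∧ v x t ≤ Ca T a) ∧
            SphNS.sigma t ^ (1 / 4 : ℝ) * |u x t| ≤ Ca T a ∧
            (Ca T a)⁻¹ ≤ e x t ∧
            SphNS.sigma t ^ (1 / 2 : ℝ) * e x t ≤ Ca T a)) ∧
        -- estimates away from the inner boundary, uniform in the inner radius
        (∀ ε ∈ Set.Ioc (0 : ℝ) 1,
          SphNS.regFunctional P a k T ε v u e ≤ ENNReal.ofReal (Cε T ε) ∧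
          (∀ x ∈ Set.Icc ε (k : ℝ), ∀ t ∈ Set.Icc (0 : ℝ) T,
            ((Cε T ε)⁻¹ ≤ v x t ∧ v x t ≤ Cε T ε) ∧
            SphNS.sigma t ^ (1 / 4 : ℝ) * |u x t| + SphNS.sigma t ^ (1 / 2 : ℝ) * e x t
              ≤ Cε T ε)) := by

  obtain ⟨E, V, hE1, hV1, hbasic⟩ := SphNS.Flow.exists_basic P hCstar
  obtain ⟨C₁, hC₁1, hv⟩ := SphNS.Flow.exists_v_bounds P hE1 hV1
  have hγ := P.γ_sub_pos
  have hEγ : 0 ≤ 2 * (E / (P.γ - 1)) := by positivity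
  obtain ⟨C₀, hC₀⟩ : ∃ C₀, C₀ = C₁ + 3 * E + 2 * (E / (P.γ - 1)) := ⟨_, rfl⟩
  have hC₀1 : 1 < C₀ := by linarith
  have hC₀0 : 0 < C₀ := zero_lt_one.trans hC₀1
  have hEC : 2 * (E / (P.γ - 1)) ≤ C₀ := by linarith
  -- constants for the region `x ≥ ε`, for the region `x ≥ 1` and for a fixed inner radius
  have hε : ∀ T ε : ℝ, ∃ C, 1 < C ∧
      (0 < ε → ∀ (L : ℝ) (S : SphNS.Flow P L T) (a : ℝ), S.Controlled E V C₀ a →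
        (∀ x ∈ Icc ε L, ∀ t ∈ Icc 0 T, C⁻¹ ≤ S.v x t ∧ S.v x t ≤ C) ∧
        (ε ≤ 1 → ∃ C', 0 ≤ C' ∧ 3 + 2 * C' ≤ C ∧ S.Regular C' ε)) := by
    intro T ε
    by_cases h0 : 0 < ε
    · obtain ⟨C, hC1, hC⟩ := SphNS.Flow.exists_v_bounds_of_pos P (E := E) (V := V) hC₀0 T h0
      by_cases h1 : ε ≤ 1
      · obtain ⟨C', hC'0, hC'⟩ :=
          SphNS.Flow.exists_regular_of_pos P (V := V) hE1 hC₀0 hEC T ⟨h0, h1⟩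
        refine ⟨C + (3 + 2 * C'), by linarith, fun _ L S a hS =>
          ⟨fun x hx t ht => ?_, fun _ => ⟨C', hC'0, by linarith, hC' L S a hS⟩⟩⟩
        obtain ⟨h2, h3⟩ := hC L S a hS x hx t ht
        exact ⟨(inv_anti₀ (by linarith) (by linarith)).trans h2, h3.trans (by linarith)⟩
      · exact ⟨C, hC1, fun _ L S a hS => ⟨hC L S a hS, fun h => absurd h h1⟩⟩
    · exact ⟨2, one_lt_two, fun h => absurd h h0⟩
  have hT : ∀ T : ℝ, ∃ C, 1 < C ∧ ∀ (L : ℝ) (S : SphNS.Flow P L T) (a : ℝ),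
      S.Controlled E V C₀ a → ∀ x ∈ Icc 1 L, ∀ t ∈ Icc 0 T, C⁻¹ ≤ S.v x t ∧ S.v x t ≤ C :=
    fun T => SphNS.Flow.exists_v_bounds_of_pos P hC₀0 T one_pos
  have ha : ∀ T a : ℝ, ∃ C, 1 < C ∧ (0 < a → ∀ (L : ℝ) (S : SphNS.Flow P L T),
      S.Controlled E V C₀ a →
        (∀ x ∈ Icc 0 L, ∀ t ∈ Icc 0 T, C⁻¹ ≤ S.v x t ∧ S.v x t ≤ C) ∧
        (∃ C', 0 ≤ C' ∧ 3 + 2 * C' ≤ C ∧ S.Regular C' 0) ∧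
        ((∀ x ∈ Icc 0 L, Cstar⁻¹ ≤ S.e x 0) → ∀ x ∈ Icc 0 L, ∀ t ∈ Icc 0 T, C⁻¹ ≤ S.e x t)) := by
    intro T a
    by_cases h0 : 0 < a
    · obtain ⟨C, hC1, hC⟩ := SphNS.Flow.exists_v_bounds_zero P (E := E) (V := V) hC₀0 T h0
      obtain ⟨C', hC'0, hC'⟩ := SphNS.Flow.exists_regular_zero P (V := V) hE1 hC₀0 hEC T a
      have hpos : 0 < Cstar * Real.exp C' := mul_pos hCstar (Real.exp_pos _)
      refine ⟨C + (3 + 2 * C') + Cstar * Real.exp C', by linarith, fun _ L S hS =>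
        ⟨fun x hx t ht => ?_, ⟨C', hC'0, by linarith, (hC' L S hS).1⟩, fun he x hx t ht => ?_⟩⟩
      · obtain ⟨h2, h3⟩ := hC L S hS x hx t ht
        exact ⟨(inv_anti₀ (by linarith) (by linarith)).trans h2, h3.trans (by linarith)⟩
      · refine (inv_anti₀ hpos (by linarith)).trans ?_
        rw [mul_inv, ← div_eq_mul_inv, div_le_iff₀ (Real.exp_pos _)]
        exact (hC' L S hS).2 _ he x hx t ht
    · exact ⟨2, one_lt_two, fun h => absurd h h0⟩
  choose CT hCT1 hCT using hT
  choose Ca hCa1 hCa using ha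
  choose Cε hCε1 hCε using hε
  refine ⟨C₀, CT, Ca, Cε, hC₀1, hCT1, hCa1, hCε1, ?_⟩
  intro a haI k hk T hT D hD v u e h
  have hk1 : (1 : ℝ) ≤ k := by exact_mod_cast hk
  obtain ⟨S, hS⟩ := h.exists_flow haI.1 hk1 hT
  have hB := hbasic a haI k T D hD v u e h S hS
  have hS₀ : S.Controlled E V C₀ a := ⟨hB, hv C₀ (by linarith) k T S a hB⟩
  have hSv : ∀ x ∈ Icc (0 : ℝ) k, ∀ t ∈ Icc (0 : ℝ) T, S.v x t = v x t := fun x hx t ht =>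
    (hS x hx t ht).2.1
  have hSu : ∀ x ∈ Icc (0 : ℝ) k, ∀ t ∈ Icc (0 : ℝ) T, S.u x t = u x t := fun x hx t ht =>
    (hS x hx t ht).2.2.1
  have hSe : ∀ x ∈ Icc (0 : ℝ) k, ∀ t ∈ Icc (0 : ℝ) T, S.e x t = e x t := fun x hx t ht =>
    (hS x hx t ht).2.2.2.1
  have hmem : ∀ {y x : ℝ}, 0 ≤ y → x ∈ Icc y (k : ℝ) → x ∈ Icc (0 : ℝ) k := fun hy hx =>
    ⟨hy.trans hx.1, hx.2⟩
  have hva : ∀ x ∈ Icc (0 : ℝ) k, ∀ t ∈ Icc (0 : ℝ) T, (Ca T a)⁻¹ ≤ v x t ∧ v x t ≤ Ca T a :=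
    fun x hx t ht => hSv x hx t ht ▸ (hCa T a haI.1 k S hS₀).1 x hx t ht
  have hvε : ∀ ε : ℝ, 0 < ε → ∀ x ∈ Icc ε (k : ℝ), ∀ t ∈ Icc (0 : ℝ) T,
      (Cε T ε)⁻¹ ≤ v x t ∧ v x t ≤ Cε T ε := fun ε hε x hx t ht =>
    hSv x (hmem hε.le hx) t ht ▸ (hCε T ε hε k S a hS₀).1 x hx t ht
  refine ⟨?_, ⟨?_, ?_, hvε, hva⟩, ⟨?_, ?_⟩, ?_⟩
  · exact (SphNS.Flow.Extends.entropyFunctional_le hS hB.ent).trans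
      (ENNReal.ofReal_le_ofReal (by linarith))
  · exact fun ε hε x hx t ht => hSv x (hmem hε hx) t ht ▸ hS₀.v_bounds ε hε x hx t ht
  · exact fun x hx t ht => hSv x (hmem zero_le_one hx) t ht ▸ hCT T k S a hS₀ x hx t ht
  · obtain ⟨C', hC'0, hC', hR⟩ := (hCa T a haI.1 k S hS₀).2.1
    exact (SphNS.Flow.Extends.regFunctional_le hS hC'0 le_rfl S.L_pos.le hR).trans
      (ENNReal.ofReal_le_ofReal (by linarith))
  · intro x hx t ht
    obtain ⟨C', hC'0, hC', hR⟩ := (hCa T a haI.1 k S hS₀).2.1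
    obtain ⟨h1, h2⟩ := hR.u_e_le hx ht
    rw [hSu x hx t ht] at h1
    rw [hSe x hx t ht] at h2
    refine ⟨hva x hx t ht, by linarith, ?_, by linarith⟩
    rw [← hSe x hx t ht]
    refine (hCa T a haI.1 k S hS₀).2.2 (fun z hz => ?_) x hx t ht
    rw [hSe z hz 0 ⟨le_rfl, hT.le⟩, (h.init z hz).2.2]
    exact hD.le_eInit hCstar haI.1 hz.1
  · intro ε hε
    obtain ⟨C', hC'0, hC', hR⟩ := (hCε T ε hε.1 k S a hS₀).2 hε.2
    refine ⟨(SphNS.Flow.Extends.regFunctional_le hS hC'0 hε.1.le (hε.2.trans hk1) hR).trans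
      (ENNReal.ofReal_le_ofReal (by linarith)), fun x hx t ht => ⟨hvε ε hε.1 x hx t ht, ?_⟩⟩
    obtain ⟨h1, h2⟩ := hR.u_e_le hx ht
    rw [hSu x (hmem hε.1.le hx) t ht] at h1
    rw [hSe x (hmem hε.1.le hx) t ht] at h2
    linarith
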